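/- **Theorem 6.** The following problem is in \textsc{N2ExpTime}: given a HyperLTL$^1(\mathbf F,\mathbf G,\mathbf X^*)$ sentence $\varphi$ with quantifier prefix of the form $\exists^*\forall\exists^*$, is $\varphi$ satisfiable? Here a trace over a finite set $\mathrm{AP}$ of atomic propositions is a map $t\colon\mathbb N\to 2^{\mathrm{AP}}$. HyperLTL$^1(\mathbf F,\mathbf G,\mathbf X^*)$ formulas are generated by $$\varphi ::= \exists\pi.\,\varphi \mid \forall\pi.\,\varphi \mid \psi,\qquad \psi ::= \neg\psi \mid \psi\vee\psi \mid \psi\wedge\psi \mid \mathbf X^n\psi' \mid \mathbf F\,\psi' \mid \mathbf G\,\psi' \mid \psi',\qquad \psi' ::= a_\pi \mid \neg\psi' \mid \psi'\vee\psi' \mid \psi'\wedge\psi',$$ where $a$ ranges over atomic propositions, $\pi$ over trace variables and $n$ over the natural numbers ($\mathbf X^n$ is the $n$-fold iteration of $\mathbf X$). A sentence is a formula without free trace variables. The prefix $\exists^*\forall\exists^*$ consists of any number (possibly zero) of existential quantifiers, exactly one universal quantifier, and any number (possibly zero) of existential quantifiers. Trace quantifiers range over a set $T$ of traces; $a_\pi$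 holds if $a$ belongs to the first valuation of the trace assigned to $\pi$; the temporal operators advance all assigned traces synchronously, with their usual meaning. The sentence $\varphi$ is satisfiable if it holds in some nonempty set $T$ of traces over the set $\mathrm{AP}$ of the atomic propositions occurring in $\varphi$. The size of the input is measured by the number of distinct subformulas: a formula is presented as a word over a fixed finite alphabet that lists its subformulas line by line, each line giving an operator and the labels of the lines of its operands, with all labels and all names of propositions and variables written in binary. \textsc{N2ExpTime} is the class of languages decided by a nondeterministic Turing machine all of whose runs on inputs of length $n$ have at most $2^{2^{p(n)}}$ steps, for some polynomial $p$. -/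

import Mathlib

namespace HyperLTL

/-! ## Syntax

Atomic propositions and trace variables are named by natural numbers. -/

/-- Quantifier-free HyperLTL formulas. The usual derived operators (conjunction, "eventually" `F`
and "always" `G`) are constructors of their own. -/
inductive QF : Type
  | atom (a x : ℕ) : QF
  | neg (ψ : QF) : QF
  | or (ψ₁ ψ₂ : QF) : QF
  | and (ψ₁ ψ₂ : QF) : QF
  | next (ψ : QF) : QF
  | until (ψ₁ ψ₂ : QF) : QF
  | ev (ψ : QF) : QF
  | alw (ψ : QF) : QF

/-- HyperLTL formulas (in prenex normal form). -/
inductive Formula : Type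
  | ex (x : ℕ) (φ : Formula) : Formula
  | all (x : ℕ) (φ : Formula) : Formula
  | qf (ψ : QF) : Formula

/-- Trace variables of a quantifier-free formula. -/
def QF.vars : QF → Finset ℕ
  | .atom _ x => {x}
  | .neg ψ => ψ.vars
  | .or ψ₁ ψ₂ => ψ₁.vars ∪ ψ₂.vars
  | .and ψ₁ ψ₂ => ψ₁.vars ∪ ψ₂.vars
  | .next ψ => ψ.vars
  | .until ψ₁ ψ₂ => ψ₁.vars ∪ ψ₂.vars
  | .ev ψ => ψ.vars
  | .alw ψ => ψ.vars

/-- Atomic propositions of a quantifier-free formula. -/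
def QF.props : QF → Finset ℕ
  | .atom a _ => {a}
  | .neg ψ => ψ.props
  | .or ψ₁ ψ₂ => ψ₁.props ∪ ψ₂.props
  | .and ψ₁ ψ₂ => ψ₁.props ∪ ψ₂.props
  | .next ψ => ψ.props
  | .until ψ₁ ψ₂ => ψ₁.props ∪ ψ₂.props
  | .ev ψ => ψ.props
  | .alw ψ => ψ.props

/-- Free trace variables of a formula. -/
def Formula.freeVars : Formula → Finset ℕ
  | .ex x φ => φ.freeVars.erase x
  | .all x φ => φ.freeVars.erase x
  | .qf ψ => ψ.vars

/-- A sentence is a formula without free trace variables. -/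
def Formula.IsSentence (φ : Formula) : Prop := φ.freeVars = ∅

/-- The quantifier-free part of a formula. -/
def Formula.matrix : Formula → QF
  | .ex _ φ => φ.matrix
  | .all _ φ => φ.matrix
  | .qf ψ => ψ

/-- Atomic propositions of a formula. -/
def Formula.props (φ : Formula) : Finset ℕ := φ.matrix.props

/-! ## Semantics -/

/-- A trace: an infinite sequence of valuations (sets of atomic propositions). -/
abbrev Trace : Type := ℕ → Set ℕ

/-- A trace assignment: a partial map from trace variables to traces. -/
abbrev Assignment : Type := ℕ → Option Trace

/-- The assignment with empty domain. -/
def Assignment.empty : Assignment := fun _ => none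

/-- The assignment of all suffixes from position `j` on. -/
def Assignment.suffix (ρ : Assignment) (j : ℕ) : Assignment :=
  fun x => (ρ x).map fun t i => t (i + j)

/-- The assignment that maps `x` to `t` and coincides with `ρ` elsewhere. -/
def Assignment.set (ρ : Assignment) (x : ℕ) (t : Trace) : Assignment :=
  Function.update ρ x (some t)

/-- Satisfaction of quantifier-free formulas. -/
def QF.Sat : QF → Assignment → Prop
  | .atom a x, ρ => ∃ t : Trace, ρ x = some t ∧ a ∈ t 0
  | .neg ψ, ρ => ¬ ψ.Sat ρ
  | .or ψ₁ ψ₂, ρ => ψ₁.Sat ρ ∨ ψ₂.Sat ρ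
  | .and ψ₁ ψ₂, ρ => ψ₁.Sat ρ ∧ ψ₂.Sat ρ
  | .next ψ, ρ => ψ.Sat (ρ.suffix 1)
  | .until ψ₁ ψ₂, ρ => ∃ j, ψ₂.Sat (ρ.suffix j) ∧ ∀ j' < j, ψ₁.Sat (ρ.suffix j')
  | .ev ψ, ρ => ∃ j, ψ.Sat (ρ.suffix j)
  | .alw ψ, ρ => ∀ j, ψ.Sat (ρ.suffix j)

/-- `φ.Sat T ρ` is `(T, ρ) ⊨ φ`: quantifiers range over the set `T` of traces. -/
def Formula.Sat (T : Set Trace) : Formula → Assignment → Prop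
  | .ex x φ, ρ => ∃ t ∈ T, φ.Sat T (ρ.set x t)
  | .all x φ, ρ => ∀ t ∈ T, φ.Sat T (ρ.set x t)
  | .qf ψ, ρ => ψ.Sat ρ

/-- A sentence is satisfiable if it has a nonempty model. The traces are traces over the finite set
of those atomic propositions that occur in the sentence. -/
def Formula.Satisfiable (φ : Formula) : Prop :=
  ∃ T : Set Trace, T.Nonempty ∧ (∀ t ∈ T, ∀ j, t j ⊆ (φ.props : Set ℕ)) ∧
    φ.Sat T Assignment.empty

/-! ## The fragment -/

/-- Boolean combinations of atoms: `ψ' ::= a_π | ¬ψ' | ψ' ∨ ψ' | ψ' ∧ ψ'`. -/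
inductive QF.IsBoolean : QF → Prop
  | atom (a x : ℕ) : QF.IsBoolean (.atom a x)
  | neg {ψ : QF} : ψ.IsBoolean → QF.IsBoolean (.neg ψ)
  | or {ψ₁ ψ₂ : QF} : ψ₁.IsBoolean → ψ₂.IsBoolean → QF.IsBoolean (.or ψ₁ ψ₂)
  | and {ψ₁ ψ₂ : QF} : ψ₁.IsBoolean → ψ₂.IsBoolean → QF.IsBoolean (.and ψ₁ ψ₂)

/-- Quantifier-free part of HyperLTL¹(F,G,X*):
`ψ ::= ¬ψ | ψ ∨ ψ | ψ ∧ ψ | Xⁿ ψ' | F ψ' | G ψ' | ψ'` with `ψ'` a Boolean combination of atoms. -/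
inductive QF.IsFGX : QF → Prop
  | neg {ψ : QF} : ψ.IsFGX → QF.IsFGX (.neg ψ)
  | or {ψ₁ ψ₂ : QF} : ψ₁.IsFGX → ψ₂.IsFGX → QF.IsFGX (.or ψ₁ ψ₂)
  | and {ψ₁ ψ₂ : QF} : ψ₁.IsFGX → ψ₂.IsFGX → QF.IsFGX (.and ψ₁ ψ₂)
  | next (n : ℕ) {ψ : QF} : ψ.IsBoolean → QF.IsFGX (QF.next^[n] ψ)
  | ev {ψ : QF} : ψ.IsBoolean → QF.IsFGX (.ev ψ)
  | alw {ψ : QF} : ψ.IsBoolean → QF.IsFGX (.alw ψ)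
  | bool {ψ : QF} : ψ.IsBoolean → QF.IsFGX ψ

/-- HyperLTL¹(F,G,X*) formulas (with arbitrary quantifiers). -/
def Formula.IsFGX (φ : Formula) : Prop := φ.matrix.IsFGX

/-- Formulas with quantifier prefix `∃*`. -/
inductive Formula.IsE : Formula → Prop
  | qf (ψ : QF) : Formula.IsE (.qf ψ)
  | ex (x : ℕ) {φ : Formula} : φ.IsE → Formula.IsE (.ex x φ)

/-- Formulas with quantifier prefix `∃*∀∃*`. -/
inductive Formula.IsEAE : Formula → Prop
  | all (x : ℕ) {φ : Formula} : φ.IsE → Formula.IsEAE (.all x φ)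
  | ex (x : ℕ) {φ : Formula} : φ.IsEAE → Formula.IsEAE (.ex x φ)

/-! ## Formulas as words

The size of a formula is its number of distinct subformulas, hence a formula is presented to a
machine as a list of lines `ℓ := op`, each of which builds a formula from formulas built by earlier
lines, referred to by their labels. All numbers are written in binary. -/

/-- The right-hand side of a line: `i`, `j` are labels, `x` is a trace variable. -/
inductive Op : Type
  | atom (a x : ℕ) : Op
  | neg (i : ℕ) : Op
  | or (i j : ℕ) : Op
  | and (i j : ℕ) : Op
  | next (i : ℕ) : Op
  | until (i j : ℕ) : Op
  | ev (i : ℕ) : Op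
  | alw (i : ℕ) : Op
  | ex (x i : ℕ) : Op
  | all (x i : ℕ) : Op

/-- The formula, if it is quantifier-free. -/
def Formula.toQF : Formula → Option QF
  | .qf ψ => some ψ
  | _ => none

/-- The formula built by a right-hand side, given the formulas that the labels stand for. -/
def Op.eval (env : ℕ → Option Formula) : Op → Option Formula
  | .atom a x => some (.qf (.atom a x))
  | .neg i => do
      let ψ ← (env i).bind Formula.toQF
      return .qf (.neg ψ)
  | .or i j => do
      let ψ₁ ← (env i).bind Formula.toQF
      let ψ₂ ← (env j).bind Formula.toQF
      return .qf (.or ψ₁ ψ₂)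
  | .and i j => do
      let ψ₁ ← (env i).bind Formula.toQF
      let ψ₂ ← (env j).bind Formula.toQF
      return .qf (.and ψ₁ ψ₂)
  | .next i => do
      let ψ ← (env i).bind Formula.toQF
      return .qf (.next ψ)
  | .until i j => do
      let ψ₁ ← (env i).bind Formula.toQF
      let ψ₂ ← (env j).bind Formula.toQF
      return .qf (.until ψ₁ ψ₂)
  | .ev i => do
      let ψ ← (env i).bind Formula.toQF
      return .qf (.ev ψ)
  | .alw i => do
      let ψ ← (env i).bind Formula.toQF
      return .qf (.alw ψ)
  | .ex x i => do
      let φ ← env i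
      return .ex x φ
  | .all x i => do
      let φ ← env i
      return .all x φ

/-- `Denotes env C φ`: if the labels stand for the formulas given by `env`, then every line of the
list `C` builds a formula, and the last line builds `φ`. -/
inductive Denotes : (ℕ → Option Formula) → List (ℕ × Op) → Formula → Prop
  | last {env : ℕ → Option Formula} {l : ℕ} {o : Op} {φ : Formula} :
      o.eval env = some φ → Denotes env [(l, o)] φ
  | cons {env : ℕ → Option Formula} {l : ℕ} {o : Op} {C : List (ℕ × Op)} {χ φ : Formula} :
      o.eval env = some χ → Denotes (Function.update env l (some χ)) C φ →
        Denotes env ((l, o) :: C) φ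

/-- The alphabet in which formulas are written. -/
inductive Letter : Type
  | zero | one | sep
  | atom | neg | or | and | next | until | ev | alw | ex | all

/-- A number in binary (least significant bit first), followed by a separator. -/
def encNat (n : ℕ) : List Letter :=
  n.bits.map (fun b => if b then Letter.one else Letter.zero) ++ [Letter.sep]

/-- A right-hand side as a word. -/
def Op.enc : Op → List Letter
  | .atom a x => Letter.atom :: (encNat a ++ encNat x)
  | .neg i => Letter.neg :: encNat i
  | .or i j => Letter.or :: (encNat i ++ encNat j)
  | .and i j => Letter.and :: (encNat i ++ encNat j)
  | .next i => Letter.next :: encNat i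
  | .until i j => Letter.until :: (encNat i ++ encNat j)
  | .ev i => Letter.ev :: encNat i
  | .alw i => Letter.alw :: encNat i
  | .ex x i => Letter.ex :: (encNat x ++ encNat i)
  | .all x i => Letter.all :: (encNat x ++ encNat i)

/-- A list of lines as a word. -/
def encLines (C : List (ℕ × Op)) : List Letter :=
  C.flatMap fun line => encNat line.1 ++ line.2.enc

/-- The word `w` presents the formula `φ`. -/
def Presents (w : List Letter) (φ : Formula) : Prop :=
  ∃ C : List (ℕ × Op), w = encLines C ∧ Denotes (fun _ => none) C φ

/-- The decision problem: given a HyperLTL¹(F,G,X*) sentence with quantifier prefix `∃*∀∃*`, is it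
satisfiable? -/
def satEAE : Language Letter :=
  {w | ∃ φ : Formula, Presents w φ ∧ φ.IsSentence ∧ φ.IsEAE ∧ φ.IsFGX ∧ φ.Satisfiable}

end HyperLTL

namespace Complexity

/-- Nondeterministic Turing machines with input alphabet `A` and `extra + 1` two-way infinite
tapes. The blank symbol is `default`. In one step, a machine in state `q` whose heads read the
symbols `s` chooses an element of `δ q s`: the new state and, for every tape, the symbol to be
written and the direction of the head (`none` for "stay"). -/
structure NTM (A : Type) where
  extra : ℕ
  State : Type
  Symb : Type
  [finiteState : Finite State]
  [finiteSymb : Finite Symb]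
  [inhabitedSymb : Inhabited Symb]
  input : A ↪ Symb
  input_ne_blank : ∀ a, input a ≠ default
  start : State
  accept : Set State
  δ : State → (Fin (extra + 1) → Symb) → Set (State × (Fin (extra + 1) → Symb × Option Turing.Dir))

attribute [instance] NTM.finiteState NTM.finiteSymb NTM.inhabitedSymb

namespace NTM

variable {A : Type}

/-- Configurations. -/
structure Cfg (M : NTM A) where
  state : M.State
  tape : Fin (M.extra + 1) → Turing.Tape M.Symb

/-- The effect of one step on one tape: write, then move. -/
def act {G : Type} [Inhabited G] (a : G × Option Turing.Dir) (t : Turing.Tape G) : Turing.Tape G :=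
  match a.2 with
  | none => t.write a.1
  | some d => (t.write a.1).move d

/-- The initial configuration: the input is written on the first tape with the head on its first
letter, and all other tapes are blank. -/
def init (M : NTM A) (w : List A) : M.Cfg where
  state := M.start
  tape := fun i => if i = 0 then Turing.Tape.mk₁ (w.map M.input) else Turing.Tape.mk₁ []

/-- `c'` is a successor configuration of `c`. -/
def Step (M : NTM A) (c c' : M.Cfg) : Prop :=
  ∃ a ∈ M.δ c.state (fun i => (c.tape i).head),
    c' = ⟨a.1, fun i => act (a.2 i) (c.tape i)⟩

/-- There is a run of exactly `n` steps from `c` to `c'`. -/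
def StepsIn (M : NTM A) : ℕ → M.Cfg → M.Cfg → Prop
  | 0, c, c' => c = c'
  | n + 1, c, c' => ∃ d, M.Step c d ∧ M.StepsIn n d c'

/-- `M` accepts `w` if some run on `w` halts in an accepting state. -/
def Accepts (M : NTM A) (w : List A) : Prop :=
  ∃ n c, M.StepsIn n (M.init w) c ∧ c.state ∈ M.accept ∧ ∀ c', ¬ M.Step c c'

/-- `M` decides `L` in time `t`: no run on an input of length `n` makes more than `t n` steps, and
`M` accepts exactly the words in `L`. -/
def DecidesInTime (M : NTM A) (L : Language A) (t : ℕ → ℕ) : Prop :=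
  (∀ w n c, M.StepsIn n (M.init w) c → n ≤ t w.length) ∧ ∀ w, w ∈ L ↔ M.Accepts w

end NTM

/-- The class N2ExpTime: languages decided by a nondeterministic Turing machine in time
`2 ^ (2 ^ p n)` for some polynomial `p`. -/
def N2ExpTime (A : Type) : Set (Language A) :=
  {L | ∃ (M : NTM A) (p : Polynomial ℕ), M.DecidesInTime L fun n => 2 ^ (2 ^ p.eval n)}

end Complexity

/-!
The proof shows that satisfiability is decided by small certificates, and that a machine can guess
and check such certificates.

*Certificates.* Call every quantifier of the sentence a slot. Replacing the existential quantifiers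
by witnesses, a model is a set `T` of traces with a fixed trace for every slot in front of the
universal quantifier, and for every `t ∈ T` a trace in `T` for every slot behind it. So every `t`
comes with a sequence of valuations of all slots. A formula of the fragment cannot see the order of
this sequence beyond the nesting depth `n` of `X`: its truth only depends on the first valuations
and on the set of all valuations that occur (`QF.sat_iff_fsat`). A `Cert` records this information
for a set of types, together with the types of the witnesses. Every model yields a certificate
(`exists_cert`), and identifying the traces with the same information leaves doubly exponentially
many types (`exists_small_cert`). Conversely, a certificate yields a model (`Cert.exists_model`): the
types unfold into trees, whose nodes become traces. The first positions of the traces are given.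
Every valuation required by some node extends along the edges to the whole tree, since witnesses must
fit in both directions, and to the other trees, since all types agree on the slots in front of the
universal quantifier; this fills one further position of all traces. Running through the countably
many requirements in turn gives every trace exactly the valuations of its type. The order of the
further positions does not matter, which is why this succeeds for `F` and `G` without nesting.

*Presentations.* The sentence is given by a list of lines and may be exponentially longer than this
list, so everything is expressed in terms of lines (`satisfiable_iff`). The conditions on the division
of the word into lines (`ParseRel.IsParse`), on the formula (`Rel.IsWellFormed`) and on the certificate
(`Rel.IsCertificate`) are first-order conditions on finitely many relations between numbers below
`N = 2 ^ 2 ^ (l + 2) ^ 2`, where `l` is the length of the word: positions, lines, types and valuations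
are all numbered. They are sound (`satisfiable_of_rel`) and complete (`exists_rel_of_satisfiable`), and
`mem_satEAE_iff` states them as one formula `Cond.total`.

*Machines.* By `TapeProgram.mem_N2ExpTime`, a language is in N2ExpTime if membership is expressed by
the existence of relations on the numbers below `N` that satisfy a fixed first-order formula. The
machine computes `N` in unary, guesses the relations as tables of `N ^ 3` bits, and evaluates the
formula by exhaustive search. The time is a polynomial in `N`. Such machines are assembled from small
programs with two exits (`TapeProgram.Prog`), whose running time and outcomes are computed along the
way.
-/

/-! ### Tape programs -/

namespace TapeProgram

open Turing (Dir Tape)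
open Function (update)

/-- What one step does to each tape: the symbol written and the move made afterwards. -/
abbrev Action (ι Γ : Type) : Type := ι → Γ × Option Dir

/-- The contents of a family of two-way infinite tapes, in absolute coordinates, together with the
positions of the heads. -/
structure Mem (ι Γ : Type) where
  cell : ι → ℤ → Γ
  pos : ι → ℤ

/-- The displacement of a head. -/
def shift : Option Dir → ℤ
  | none => 0
  | some .left => -1
  | some .right => 1

namespace Mem

variable {ι Γ : Type}

/-- The scanned symbols. -/
def heads (m : Mem ι Γ) : ι → Γ := fun i => m.cell i (m.pos i)

/-- The effect of one step. -/
def act (m : Mem ι Γ) (α : Action ι Γ) : Mem ι Γ :=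
  ⟨fun i => update (m.cell i) (m.pos i) (α i).1, fun i => m.pos i + shift (α i).2⟩

end Mem

/-- A nondeterministic program on a family of tapes: a finite control with one entry and two exits,
labelled by `true` and `false`. -/
structure Prog (ι Γ : Type) where
  St : Type
  finite : Finite St
  start : St
  δ : St → (ι → Γ) → Set ((St ⊕ Bool) × Action ι Γ)

namespace Prog

variable {ι Γ : Type}

/-- From state `q` and memory `m`, every run leaves the program within `t` steps. -/
def Halts (F : Prog ι Γ) : ℕ → F.St → Mem ι Γ → Prop
  | 0, _, _ => False
  | t + 1, q, m => ∀ a ∈ F.δ q m.heads, ∀ q', a.1 = .inl q' → F.Halts t q' (m.act a.2)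

/-- From state `q` and memory `m`, some run leaves the program through the given exit with the given
memory. -/
inductive Reach (F : Prog ι Γ) : F.St → Mem ι Γ → Bool → Mem ι Γ → Prop
  | exit {q : F.St} {m : Mem ι Γ} {b : Bool} {α : Action ι Γ} :
      ((.inr b, α) : (F.St ⊕ Bool) × Action ι Γ) ∈ F.δ q m.heads → Reach F q m b (m.act α)
  | step {q q' : F.St} {m m' : Mem ι Γ} {b : Bool} {α : Action ι Γ} :
      ((.inl q', α) : (F.St ⊕ Bool) × Action ι Γ) ∈ F.δ q m.heads →
      Reach F q' (m.act α) b m' → Reach F q m b m'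

/-- Started on `m`, the program makes at most `t` steps, and `P` holds of exactly the possible
outcomes. -/
structure Runs (F : Prog ι Γ) (m : Mem ι Γ) (t : ℕ) (P : Bool → Mem ι Γ → Prop) : Prop where
  halts : F.Halts t F.start m
  reach : ∀ b m', F.Reach F.start m b m' ↔ P b m'

/-- Started on `m`, the program makes at most `t` steps, and the only outcome is exit `b` with
memory `m'`. -/
abbrev Det (F : Prog ι Γ) (m : Mem ι Γ) (t : ℕ) (b : Bool) (m' : Mem ι Γ) : Prop :=
  F.Runs m t fun b' m'' => b' = b ∧ m'' = m'

theorem Halts.mono {F : Prog ι Γ} {t t' : ℕ} (h : t ≤ t') {q : F.St} {m : Mem ι Γ}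
    (H : F.Halts t q m) : F.Halts t' q m := by
  induction t generalizing t' q m with
  | zero => exact H.elim
  | succ t ih =>
    obtain ⟨s, rfl⟩ : ∃ s, t' = s + 1 := ⟨t' - 1, by omega⟩
    exact fun a ha q' hq => ih (by omega) (H a ha q' hq)

theorem Runs.mono {F : Prog ι Γ} {m : Mem ι Γ} {t t' : ℕ} {P : Bool → Mem ι Γ → Prop}
    (H : F.Runs m t P) (h : t ≤ t') : F.Runs m t' P := ⟨H.halts.mono h, H.reach⟩

/-- `K` simulates `F` via `e`, except that the exit `b` of `F` leads to `tgt b`. -/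
def Embeds (F K : Prog ι Γ) (e : F.St → K.St) (tgt : Bool → K.St ⊕ Bool) : Prop :=
  ∀ q h, K.δ (e q) h =
    (fun a => (Sum.elim (fun q' => .inl (e q')) tgt a.1, a.2)) '' F.δ q h

theorem Embeds.halts {F K : Prog ι Γ} {e : F.St → K.St} {tgt : Bool → K.St ⊕ Bool}
    (E : F.Embeds K e tgt) {t t' : ℕ} {q : F.St} {m : Mem ι Γ} (H : F.Halts t q m)
    (H' : ∀ b m', F.Reach q m b m' → ∀ q', tgt b = .inl q' → K.Halts t' q' m') :
    K.Halts (t + t') (e q) m := by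
  induction t generalizing q m with
  | zero => exact H.elim
  | succ t ih =>
    rw [Nat.succ_add]
    intro a ha q' hq
    rw [E] at ha
    obtain ⟨⟨x, α⟩, hx, rfl⟩ := ha
    rcases x with q₁ | b
    · obtain rfl : e q₁ = q' := by simpa using hq
      exact ih (H _ hx _ rfl) fun b m' hr => H' b m' (.step hx hr)
    · exact (H' b _ (.exit hx) q' (by simpa using hq)).mono (by omega)

theorem Embeds.reach {F K : Prog ι Γ} {e : F.St → K.St} {tgt : Bool → K.St ⊕ Bool}
    (E : F.Embeds K e tgt) {q : F.St} {m : Mem ι Γ} {b : Bool} {m' : Mem ι Γ} :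
    K.Reach (e q) m b m' ↔ ∃ b₀ m₀, F.Reach q m b₀ m₀ ∧
      Sum.elim (fun q' => K.Reach q' m₀ b m') (fun b₁ => b = b₁ ∧ m' = m₀) (tgt b₀) := by
  constructor
  · intro h
    generalize hq : e q = k at h
    induction h generalizing q with
    | @exit k m b α hα =>
      subst hq
      rw [E] at hα
      obtain ⟨⟨x, β⟩, hx, hxe⟩ := hα
      rcases x with q₁ | b₀
      · simp at hxe
      · simp only [Sum.elim_inr, Prod.mk.injEq] at hxe
        obtain ⟨h1, rfl⟩ := hxe
        exact ⟨b₀, _, .exit hx, by simp [h1]⟩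
    | @step k k' m m' b α hα hr ih =>
      subst hq
      rw [E] at hα
      obtain ⟨⟨x, β⟩, hx, hxe⟩ := hα
      rcases x with q₁ | b₀
      · simp only [Sum.elim_inl, Prod.mk.injEq, Sum.inl.injEq] at hxe
        obtain ⟨h1, rfl⟩ := hxe
        obtain ⟨b₀, m₀, h2, h3⟩ := ih h1
        exact ⟨b₀, m₀, .step hx h2, h3⟩
      · simp only [Sum.elim_inr, Prod.mk.injEq] at hxe
        obtain ⟨h1, rfl⟩ := hxe
        exact ⟨b₀, _, .exit hx, by simpa [h1] using hr⟩
  · rintro ⟨b₀, m₀, h, h'⟩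
    induction h with
    | @exit q m b₀ α hα =>
      have key : (tgt b₀, α) ∈ K.δ (e q) m.heads := by
        rw [E]; exact ⟨_, hα, by simp⟩
      rcases htg : tgt b₀ with q' | b₁
      · rw [htg] at key h'
        exact .step key h'
      · rw [htg] at key h'
        obtain ⟨rfl, rfl⟩ := h'
        exact .exit key
    | @step q q' m m₀ b₀ α hα hr ih =>
      have key : (.inl (e q'), α) ∈ K.δ (e q) m.heads := by
        rw [E]; exact ⟨_, hα, by simp⟩
      exact .step key (ih h')

/-- The program that makes one step. -/
def one (g : (ι → Γ) → Set (Bool × Action ι Γ)) : Prog ι Γ where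
  St := Unit
  finite := inferInstance
  start := ()
  δ _ h := (fun x => (.inr x.1, x.2)) '' g h

theorem runs_one (g : (ι → Γ) → Set (Bool × Action ι Γ)) (m : Mem ι Γ) :
    (one g).Runs m 1 fun b m' => ∃ α, (b, α) ∈ g m.heads ∧ m' = m.act α := by
  refine ⟨?_, fun b m' => ⟨fun h => ?_, ?_⟩⟩
  · rintro a ⟨x, -, rfl⟩ q' hq
    cases hq
  · cases h with
    | exit h =>
      obtain ⟨⟨x, α⟩, hx, hxe⟩ := h
      cases hxe
      exact ⟨_, hx, rfl⟩
    | step h =>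
      obtain ⟨⟨x, α⟩, hx, hxe⟩ := h
      cases hxe
  · rintro ⟨α, h, rfl⟩
    exact .exit ⟨_, h, rfl⟩

/-- Run `F`, then `G` or `H`, depending on the exit of `F`. -/
def branch (F G H : Prog ι Γ) : Prog ι Γ where
  St := F.St ⊕ G.St ⊕ H.St
  finite := by
    have := F.finite
    have := G.finite
    have := H.finite
    infer_instance
  start := .inl F.start
  δ q h := match q with
    | .inl q => (fun a => (Sum.elim (fun q' => .inl (.inl q'))
        (fun b => .inl (.inr (if b then .inl G.start else .inr H.start))) a.1, a.2)) '' F.δ q h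
    | .inr (.inl q) => (fun a => (Sum.elim (fun q' => .inl (.inr (.inl q'))) .inr a.1, a.2)) '' G.δ q h
    | .inr (.inr q) => (fun a => (Sum.elim (fun q' => .inl (.inr (.inr q'))) .inr a.1, a.2)) '' H.δ q h

theorem Runs.branch {F G H : Prog ι Γ} {m : Mem ι Γ} {t t' : ℕ} {P : Bool → Mem ι Γ → Prop}
    {Q : Mem ι Γ → Bool → Mem ι Γ → Prop} (hF : F.Runs m t P)
    (hG : ∀ m', P true m' → G.Runs m' t' (Q m')) (hH : ∀ m', P false m' → H.Runs m' t' (Q m')) :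
    (branch F G H).Runs m (t + t') fun b m'' => ∃ b₀ m', P b₀ m' ∧ Q m' b m'' := by
  have EF : F.Embeds (F.branch G H) .inl
    (fun b => .inl (.inr (if b then .inl G.start else .inr H.start))) := fun _ _ => rfl
  have EG : G.Embeds (F.branch G H) (fun q => .inr (.inl q)) .inr := fun _ _ => rfl
  have EH : H.Embeds (F.branch G H) (fun q => .inr (.inr q)) .inr := fun _ _ => rfl
  refine ⟨EF.halts hF.halts ?_, fun b m'' => ?_⟩
  · rintro (_ | _) m' hr q' hq
    · cases hq
      exact EH.halts (t' := 0) (hH m' ((hF.reach _ _).1 hr)).halts (by simp)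
    · cases hq
      exact EG.halts (t' := 0) (hG m' ((hF.reach _ _).1 hr)).halts (by simp)
  · refine EF.reach.trans (exists_congr fun b₀ => exists_congr fun m' => ?_)
    rw [hF.reach]
    refine and_congr_right fun hP => ?_
    rcases b₀ with _ | _
    · simp only [Bool.false_eq_true, if_false]
      refine EH.reach.trans ?_
      simp only [(hH m' hP).reach, Sum.elim_inr]
      exact ⟨by rintro ⟨_, _, h, rfl, rfl⟩; exact h, fun h => ⟨_, _, h, rfl, rfl⟩⟩
    · simp only [if_true]
      refine EG.reach.trans ?_
      simp only [(hG m' hP).reach, Sum.elim_inr]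
      exact ⟨by rintro ⟨_, _, h, rfl, rfl⟩; exact h, fun h => ⟨_, _, h, rfl, rfl⟩⟩

/-- Run `F`, then `G`. -/
def seq (F G : Prog ι Γ) : Prog ι Γ := branch F G G

theorem Runs.congr {F : Prog ι Γ} {m : Mem ι Γ} {t : ℕ} {P Q : Bool → Mem ι Γ → Prop}
    (H : F.Runs m t P) (h : ∀ b m', P b m' ↔ Q b m') : F.Runs m t Q :=
  ⟨H.halts, fun b m' => (H.reach b m').trans (h b m')⟩

theorem Det.branch_runs {F G H : Prog ι Γ} {m m' : Mem ι Γ} {t t' : ℕ} {b : Bool}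
    {P : Bool → Mem ι Γ → Prop} (hF : F.Det m t b m')
    (h : (if b then G else H).Runs m' t' P) : (branch F G H).Runs m (t + t') P := by
  refine (Runs.branch (Q := fun _ => P) hF ?_ ?_).congr ?_
  · rintro _ ⟨rfl, rfl⟩; exact h
  · rintro _ ⟨rfl, rfl⟩; exact h
  · exact fun b' m'' => ⟨by rintro ⟨_, _, _, h⟩; exact h, fun h => ⟨_, _, ⟨rfl, rfl⟩, h⟩⟩

theorem Det.seq_runs {F G : Prog ι Γ} {m m' : Mem ι Γ} {t t' : ℕ} {b : Bool}
    {P : Bool → Mem ι Γ → Prop} (hF : F.Det m t b m') (h : G.Runs m' t' P) :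
    (seq F G).Runs m (t + t') P :=
  hF.branch_runs (by simpa using h)

/-- Run `F` again and again, until it leaves through the exit `false`. -/
def loop (F : Prog ι Γ) : Prog ι Γ where
  St := F.St
  finite := F.finite
  start := F.start
  δ q h := (fun a => (Sum.elim .inl (fun b => if b then .inl F.start else .inr true) a.1, a.2)) ''
    F.δ q h

theorem Runs.loop {F : Prog ι Γ} {m : Mem ι Γ} {t t' : ℕ} {P : Bool → Mem ι Γ → Prop}
    {Q : Mem ι Γ → Bool → Mem ι Γ → Prop} (hF : F.Runs m t P)
    (h : ∀ m', P true m' → (loop F).Runs m' t' (Q m')) :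
    (loop F).Runs m (t + t') fun b m'' =>
      (∃ m', P true m' ∧ Q m' b m'') ∨ (b = true ∧ P false m'') := by
  have EF : F.Embeds F.loop id (fun b => if b then .inl F.start else .inr true) := fun _ _ => rfl
  refine ⟨EF.halts hF.halts ?_, fun b m'' => EF.reach.trans ?_⟩
  · rintro (_ | _) m' hr q' hq
    · cases hq
    · cases hq
      exact (h m' ((hF.reach _ _).1 hr)).halts
  · have hF' : ∀ b m', F.Reach F.loop.start m b m' ↔ P b m' := hF.reach
    rw [Bool.exists_bool, or_comm]
    simp only [hF', if_true, Bool.false_eq_true, if_false, Sum.elim_inr]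
    refine or_congr (exists_congr fun m' => and_congr_right fun hP => (h m' hP).reach b m'') ?_
    exact ⟨by rintro ⟨m', h, rfl, rfl⟩; exact ⟨rfl, h⟩, by rintro ⟨rfl, h⟩; exact ⟨_, h, rfl, rfl⟩⟩

/-- A loop whose body runs deterministically through the memories `m 0`, …, `m k`. -/
theorem Det.loop {F : Prog ι Γ} {t k : ℕ} (m : ℕ → Mem ι Γ) {m' : Mem ι Γ}
    (hF : ∀ i < k, F.Det (m i) t true (m (i + 1))) (hk : F.Det (m k) t false m') :
    F.loop.Det (m 0) ((k + 1) * t) true m' := by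
  suffices h : ∀ j i, i + j = k → F.loop.Det (m i) ((j + 1) * t) true m' from h k 0 (by omega)
  intro j
  induction j with
  | zero =>
    rintro i rfl
    refine ((Runs.loop (t' := 0) (Q := fun _ _ _ => False) hk ?_).congr ?_).mono (by omega)
    · simp
    · simp
  | succ j ih =>
    intro i hi
    refine ((Runs.loop (t' := (j + 1) * t) (Q := fun _ b m'' => b = true ∧ m'' = m')
      (hF i (by omega)) ?_).congr ?_).mono (by rw [add_mul (j + 1), one_mul, add_comm])
    · rintro _ ⟨-, rfl⟩
      exact ih (i + 1) (by omega)
    · simp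

end Prog

end TapeProgram

/-! ### From tape programs to Turing machines -/

namespace TapeProgram

open Turing (Dir Tape)
open Function (update)

namespace Prog

variable {A ι Γ : Type} [Inhabited Γ]

/-- The Turing machine that runs the program and accepts on leaving it through the exit `true`. -/
def toNTM [Finite Γ] (F : Prog ι Γ) {k : ℕ} (e : Fin (k + 1) ≃ ι) (inp : A ↪ Γ) (hinp : ∀ a, inp a ≠ default) :
    Complexity.NTM A where
  extra := k
  State := F.St ⊕ Bool
  Symb := Γ
  finiteState := by have := F.finite; infer_instance
  input := inp
  input_ne_blank := hinp
  start := .inl F.start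
  accept := {.inr true}
  δ q s := match q with
    | .inl q => (fun a => (a.1, fun i => a.2 (e i))) '' F.δ q fun j => s (e.symm j)
    | .inr _ => ∅

/-- The initial memory: the first tape holds the input from cell `1` on, and is scanned there. -/
def initMem [DecidableEq ι] (i₀ : ι) (inp : A → Γ) (w : List A) : Mem ι Γ where
  cell i j := if i = i₀ ∧ 1 ≤ j then (w.map inp).getI (j - 1).toNat else default
  pos i := if i = i₀ then 1 else 0

/-- The tapes `T` have the contents `m`. -/
def Represents {k : ℕ} (e : Fin (k + 1) ≃ ι) (T : Fin (k + 1) → Tape Γ) (m : Mem ι Γ) : Prop :=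
  ∀ i j, (T i).nth j = m.cell (e i) (m.pos (e i) + j)

theorem Represents.heads {k : ℕ} {e : Fin (k + 1) ≃ ι} {T : Fin (k + 1) → Tape Γ} {m : Mem ι Γ}
    (h : Represents e T m) : (fun j => (T (e.symm j)).head) = m.heads := by
  funext j
  have := h (e.symm j) 0
  simpa [Mem.heads] using this

theorem Represents.act {k : ℕ} {e : Fin (k + 1) ≃ ι} {T : Fin (k + 1) → Tape Γ} {m : Mem ι Γ}
    (h : Represents e T m) (α : Action ι Γ) :
    Represents e (fun i => Complexity.NTM.act (α (e i)) (T i)) (m.act α) := by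
  intro i j
  have key : ∀ j, ((T i).write (α (e i)).1).nth j =
      update (m.cell (e i)) (m.pos (e i)) (α (e i)).1 (m.pos (e i) + j) := by
    intro j
    rw [Tape.write_nth]
    by_cases hj : j = 0
    · simp [hj]
    · simp [hj, Function.update_of_ne, h i j]
  unfold Complexity.NTM.act Mem.act
  rcases hd : (α (e i)).2 with _ | _ | _
  · simp only [hd, shift, key]
    congr 1; ring
  · simp only [hd, shift, Tape.move_left_nth, key]
    congr 1; ring
  · simp only [hd, shift, Tape.move_right_nth, key]
    congr 1; ring

theorem represents_init [Finite Γ] [DecidableEq ι] (F : Prog ι Γ) {k : ℕ} (e : Fin (k + 1) ≃ ι) (inp : A ↪ Γ)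
    (hinp : ∀ a, inp a ≠ default) (w : List A) :
    Represents e ((F.toNTM e inp hinp).init w).tape (initMem (e 0) inp w) := by
  have key : ∀ (l : List Γ) (j : ℤ), (Tape.mk₁ l).nth j = if 0 ≤ j then l.getI j.toNat else default := by
    intro l j
    rcases j with j | j
    · have : (Tape.mk₁ l).nth ((j : ℕ) : ℤ) = l.getI j := by
        rw [Tape.mk₁, Tape.mk₂, Tape.mk'_nth_nat, Turing.ListBlank.nth_mk]
      simpa using this
    · change Turing.ListBlank.nth (Turing.ListBlank.mk []) j = _
      rw [Turing.ListBlank.nth_mk]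
      simp [List.getI_nil]
  intro i j
  simp only [Complexity.NTM.init, initMem, EmbeddingLike.apply_eq_iff_eq]
  by_cases hi : i = 0
  · subst hi
    simp only [if_true, true_and]
    refine (key _ _).trans ?_
    have : (1 ≤ 1 + j) ↔ 0 ≤ j := by omega
    simp only [this, add_sub_cancel_left]
    rfl
  · simp only [hi, if_false, false_and]
    have h := key [] j
    rw [List.getI_nil, ite_self] at h
    refine Eq.trans ?_ h
    exact congrArg (fun T : Tape Γ => T.nth j) (if_neg hi)

section

variable [Finite Γ] (F : Prog ι Γ) {k : ℕ} (e : Fin (k + 1) ≃ ι) (inp : A ↪ Γ)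
  (hinp : ∀ a, inp a ≠ default)

theorem toNTM_steps_le {t n : ℕ} {q : F.St} {T : Fin (k + 1) → Tape Γ} {m : Mem ι Γ}
    {c : (F.toNTM e inp hinp).Cfg} (H : F.Halts t q m) (hT : Represents e T m)
    (hs : (F.toNTM e inp hinp).StepsIn n ⟨.inl q, T⟩ c) : n ≤ t := by
  induction n generalizing t q T m with
  | zero => omega
  | succ n ih =>
    obtain ⟨d, ⟨a, ha, rfl⟩, hd⟩ := hs
    obtain ⟨t, rfl⟩ : ∃ s, t = s + 1 := by
      cases t with
      | zero => exact H.elim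
      | succ t => exact ⟨t, rfl⟩
    obtain ⟨⟨x, α⟩, hx, rfl⟩ := ha
    rw [hT.heads] at hx
    rcases x with q' | b
    · have := ih (H _ hx _ rfl) (hT.act α) hd
      omega
    · cases n with
      | zero => omega
      | succ n =>
        obtain ⟨_, ⟨_, h, _⟩, _⟩ := hd
        exact h.elim

theorem toNTM_reach {n : ℕ} {q : F.St} {b : Bool} {T T' : Fin (k + 1) → Tape Γ} {m : Mem ι Γ}
    (hT : Represents e T m)
    (hs : (F.toNTM e inp hinp).StepsIn n ⟨.inl q, T⟩ ⟨.inr b, T'⟩) : ∃ m', F.Reach q m b m' := by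
  induction n generalizing q T m with
  | zero => cases hs
  | succ n ih =>
    obtain ⟨d, ⟨a, ha, rfl⟩, hd⟩ := hs
    obtain ⟨⟨x, α⟩, hx, rfl⟩ := ha
    rw [hT.heads] at hx
    rcases x with q' | b'
    · obtain ⟨m', hm'⟩ := ih (hT.act α) hd
      exact ⟨m', .step hx hm'⟩
    · cases n with
      | zero => cases hd; exact ⟨_, .exit hx⟩
      | succ n =>
        obtain ⟨_, ⟨_, h, _⟩, _⟩ := hd
        exact h.elim

theorem toNTM_steps_of_reach {q : F.St} {b : Bool} {T : Fin (k + 1) → Tape Γ} {m m' : Mem ι Γ}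
    (hT : Represents e T m) (hr : F.Reach q m b m') :
    ∃ n T', (F.toNTM e inp hinp).StepsIn n ⟨.inl q, T⟩ ⟨.inr b, T'⟩ := by
  induction hr generalizing T with
  | @exit q m b α h =>
    rw [← hT.heads] at h
    exact ⟨1, _, _, ⟨_, ⟨_, h, rfl⟩, rfl⟩, rfl⟩
  | @step q q' m m' b α h hr ih =>
    obtain ⟨n, T', hn⟩ := ih (hT.act α)
    rw [← hT.heads] at h
    exact ⟨n + 1, T', _, ⟨_, ⟨_, h, rfl⟩, rfl⟩, hn⟩

/-- The Turing machine decides a language in the time of the program, if the words in the language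
are those on which the program may leave through the exit `true`. -/
theorem toNTM_decides [DecidableEq ι] {L : Language A} {t : ℕ → ℕ} {P : List A → Bool → Mem ι Γ → Prop}
    (H : ∀ w, F.Runs (initMem (e 0) inp w) (t w.length) (P w)) (hL : ∀ w, w ∈ L ↔ ∃ m, P w true m) :
    (F.toNTM e inp hinp).DecidesInTime L t := by
  refine ⟨fun w n c hs => toNTM_steps_le F e inp hinp (H w).halts
    (represents_init F e inp hinp w) hs, fun w => (hL w).trans ⟨?_, ?_⟩⟩
  · rintro ⟨m, hm⟩
    obtain ⟨n, T', hn⟩ := toNTM_steps_of_reach F e inp hinp (represents_init F e inp hinp w)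
      (((H w).reach _ _).2 hm)
    refine ⟨n, _, hn, rfl, ?_⟩
    rintro c' ⟨_, h, _⟩
    exact h.elim
  · rintro ⟨n, ⟨q, T'⟩, hn, rfl, -⟩
    obtain ⟨m', hm'⟩ := toNTM_reach F e inp hinp (represents_init F e inp hinp w) hn
    exact ⟨m', ((H w).reach _ _).1 hm'⟩

end

end Prog

end TapeProgram

/-! ### Moving the heads -/

namespace TapeProgram

open Turing (Dir Tape)
open Function (update)

/-- Tape symbols: the blank, a mark for the origin, a mark for the end of a counter, guessed bits
and input letters. -/
inductive Sym (A : Type) : Type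
  | blank
  | mark
  | fence
  | bit (b : Bool)
  | letter (a : A)

instance {A : Type} : Inhabited (Sym A) := ⟨.blank⟩

instance {A : Type} [Finite A] : Finite (Sym A) := by
  let f : Option (Option (Option (Bool ⊕ A))) → Sym A := fun x => match x with
    | none => .blank
    | some none => .mark
    | some (some none) => .fence
    | some (some (some (.inl b))) => .bit b
    | some (some (some (.inr a))) => .letter a
  refine Finite.of_surjective f fun x => ?_
  rcases x with _ | _ | _ | b | a
  · exact ⟨none, rfl⟩
  · exact ⟨some none, rfl⟩
  · exact ⟨some (some none), rfl⟩
  · exact ⟨some (some (some (.inl b))), rfl⟩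
  · exact ⟨some (some (some (.inr a))), rfl⟩

namespace Prog

variable {ι A : Type}

open scoped Classical in
/-- The displacement that moves the tapes in `ls` to the left and those in `rs` to the right. -/
noncomputable def vec (ls rs : Set ι) : ι → ℤ :=
  fun i => if i ∈ ls then -1 else if i ∈ rs then 1 else 0

open scoped Classical in
/-- Leave the scanned symbols unchanged, move `ls` to the left and `rs` to the right. -/
noncomputable def moveAct {Γ : Type} (ls rs : Set ι) (h : ι → Γ) : Action ι Γ :=
  fun i => (h i, if i ∈ ls then some .left else if i ∈ rs then some .right else none)

theorem act_moveAct {Γ : Type} (ls rs : Set ι) (m : Mem ι Γ) :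
    m.act (moveAct ls rs m.heads) = ⟨m.cell, m.pos + vec ls rs⟩ := by
  unfold Mem.act
  congr 1
  · funext i; simp [moveAct, Mem.heads]
  · funext i
    simp only [moveAct, vec, Pi.add_apply]
    split_ifs <;> rfl

theorem vec_empty : vec (∅ : Set ι) ∅ = 0 := by
  funext i; simp [vec]

open scoped Classical in
/-- If the scanned symbols satisfy `c`, then move and leave through `true`, else leave through
`false`. -/
noncomputable def test {Γ : Type} (c : (ι → Γ) → Prop) (ls rs : Set ι) : Prog ι Γ :=
  one fun h => {if c h then (true, moveAct ls rs h) else (false, moveAct ∅ ∅ h)}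

theorem det_test_pos {Γ : Type} {c : (ι → Γ) → Prop} (ls rs : Set ι) {C : ι → ℤ → Γ} {p : ι → ℤ}
    (h : c fun i => C i (p i)) : (test c ls rs).Det ⟨C, p⟩ 1 true ⟨C, p + vec ls rs⟩ := by
  refine (runs_one _ _).congr fun b m' => ?_
  have h' : c (Mem.heads ⟨C, p⟩) := h
  simp [h', act_moveAct]

theorem det_test_neg {Γ : Type} {c : (ι → Γ) → Prop} (ls rs : Set ι) {C : ι → ℤ → Γ} {p : ι → ℤ}
    (h : ¬ c fun i => C i (p i)) : (test c ls rs).Det ⟨C, p⟩ 1 false ⟨C, p⟩ := by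
  refine (runs_one _ _).congr fun b m' => ?_
  have h' : ¬ c (Mem.heads ⟨C, p⟩) := h
  simp [h', act_moveAct, vec_empty]

/-- Move and leave through `true`. -/
noncomputable def move {Γ : Type} (ls rs : Set ι) : Prog ι Γ := test (fun _ => True) ls rs

theorem det_move {Γ : Type} (ls rs : Set ι) (C : ι → ℤ → Γ) (p : ι → ℤ) :
    (move ls rs).Det ⟨C, p⟩ 1 true ⟨C, p + vec ls rs⟩ := det_test_pos ls rs trivial

/-- Leave through the given exit. -/
noncomputable def ret {Γ : Type} (b : Bool) : Prog ι Γ := test (fun _ => b = true) ∅ ∅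

theorem det_ret {Γ : Type} (b : Bool) (C : ι → ℤ → Γ) (p : ι → ℤ) :
    (ret b).Det ⟨C, p⟩ 1 b ⟨C, p⟩ := by
  cases b
  · exact det_test_neg (c := fun _ => false = true) ∅ ∅ (by simp)
  · have h := det_test_pos (c := fun _ : ι → Γ => true = true) (C := C) (p := p) ∅ ∅ rfl
    rwa [vec_empty, add_zero] at h

theorem Det.to {Γ : Type} {F : Prog ι Γ} {C : ι → ℤ → Γ} {p p' : ι → ℤ} {m : Mem ι Γ} {t : ℕ} {b : Bool}
    (H : F.Det m t b ⟨C, p⟩) (h : p = p') : F.Det m t b ⟨C, p'⟩ := h ▸ H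

/-- Move until tape `x` scans the origin. -/
noncomputable def walk (x : ι) (ls rs : Set ι) : Prog ι (Sym A) :=
  loop (test (fun h => h x ≠ .mark) ls rs)

/-- On tape `x` of `C`, the mark for the origin is at cell `0` and nowhere to the right of it. -/
def Origin (C : ι → ℤ → Sym A) (x : ι) : Prop := ∀ j : ℕ, C x j = .mark ↔ j = 0

theorem det_walk {x : ι} {ls : Set ι} (rs : Set ι) {C : ι → ℤ → Sym A} {p : ι → ℤ} {k : ℕ}
    (hx : x ∈ ls) (hC : Origin C x) (hp : p x = k) :
    (walk x ls rs).Det ⟨C, p⟩ (k + 1) true ⟨C, p + (k : ℤ) • vec ls rs⟩ := by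
  have hv : vec ls rs x = -1 := by simp [vec, hx]
  have hpos : ∀ i ≤ k, (p + (i : ℤ) • vec ls rs) x = ((k - i : ℕ) : ℤ) := by
    intro i hi
    simp only [Pi.add_apply, Pi.smul_apply, hv, hp, smul_eq_mul]
    omega
  have := Det.loop (F := test (fun h => h x ≠ .mark) ls rs) (t := 1) (k := k)
    (fun i => ⟨C, p + (i : ℤ) • vec ls rs⟩) (m' := ⟨C, p + (k : ℤ) • vec ls rs⟩)
    (fun i hi => by
      refine (det_test_pos ls rs ?_).to ?_
      · simp only [hpos i hi.le]
        rw [Ne, hC]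
        omega
      · push_cast
        rw [add_smul, one_smul, add_assoc])
    (det_test_neg ls rs (by simp only [hpos k le_rfl]; rw [not_not, hC]; omega))
  have e : p + ((0 : ℕ) : ℤ) • vec ls rs = p := by module
  rwa [e, mul_one] at this

/-- The program `F` moves the heads by `v` within `t` steps, whenever the heads in `Z` are at the
positions given by `q`. -/
def Adds (C : ι → ℤ → Sym A) (F : Prog ι (Sym A)) (v : ι → ℤ) (t : ℕ) (Z : Set ι) (q : ι → ℤ) :
    Prop :=
  ∀ p, (∀ i ∈ Z, p i = q i) → F.Det ⟨C, p⟩ t true ⟨C, p + v⟩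

theorem adds_move (C : ι → ℤ → Sym A) (ls rs : Set ι) (q : ι → ℤ) :
    Adds C (move ls rs) (vec ls rs) 1 ∅ q := fun p _ => det_move ls rs C p

/-- Run the body once for every cell of the counter `b`. -/
noncomputable def sweep (b : ι) (F : Prog ι (Sym A)) : Prog ι (Sym A) :=
  seq (loop (branch (test (fun h => h b ≠ .fence) ∅ {b}) F (ret false))) (walk b {b} ∅)

theorem Adds.sweep {C : ι → ℤ → Sym A} {F : Prog ι (Sym A)} {v : ι → ℤ} {t : ℕ} {Z : Set ι}
    {q : ι → ℤ} {b : ι} {N : ℕ} (H : Adds C F v t Z q) (hb : b ∉ Z) (hvb : v b = 0)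
    (hv : ∀ i ∈ Z, v i = 0) (hq : q b = 0) (hC : Origin C b)
    (hN : ∀ j : ℕ, j ≤ N → (C b j = .fence ↔ j = N)) :
    Adds C (sweep b F) ((N : ℤ) • v) ((N + 1) * (t + 2) + (N + 1)) (insert b Z) q := by
  intro p hp
  have hpb : p b = 0 := by rw [hp b (by simp), hq]
  have hvecb : vec ∅ {b} b = 1 := by simp [vec]
  have hveco : ∀ i, i ≠ b → vec ∅ {b} i = 0 := by intro i h; simp [vec, h]
  set m : ℕ → Mem ι (Sym A) := fun i => ⟨C, p + (i : ℤ) • vec ∅ {b} + (i : ℤ) • v⟩ with hm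
  have hbi : ∀ i : ℕ, (p + (i : ℤ) • vec ∅ {b} + (i : ℤ) • v) b = i := by
    intro i; simp [hpb, hvb, hvecb]
  have h1 : (loop (branch (test (fun h => h b ≠ .fence) ∅ {b}) F (ret false))).Det (m 0)
      ((N + 1) * (1 + (t + 1))) true (m N) := by
    refine Det.loop m (fun i hi => ?_) ?_
    · refine (Det.branch_runs (det_test_pos ∅ {b} ?_) (t' := t + 1) ?_)
      · simp only [hbi]; rw [Ne, hN i hi.le]; omega
      · simp only [if_true]
        refine Det.to ((H _ ?_).mono (Nat.le_succ t)) ?_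
        · intro j hj
          have : j ≠ b := fun h => hb (h ▸ hj)
          simp [hveco j this, hv j hj, hp j (by simp [hj])]
        · push_cast; module
    · refine (Det.branch_runs (det_test_neg ∅ {b} ?_) (t' := t + 1) ?_)
      · simp only [hbi]; rw [not_not, hN N le_rfl]
      · exact (det_ret false _ _).mono (by omega)
  have h2 := det_walk (x := b) (ls := {b}) ∅ (C := C) (p := p + (N : ℤ) • vec ∅ {b} + (N : ℤ) • v)
    (k := N) (by simp) hC (hbi N)
  have h3 := Det.seq_runs h1 h2
  have e0 : m 0 = ⟨C, p⟩ := by simp [hm]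
  have e1 : p + (N : ℤ) • vec ∅ {b} + (N : ℤ) • v + (N : ℤ) • vec {b} ∅ = p + (N : ℤ) • v := by
    have : vec {b} ∅ = - vec (∅ : Set ι) {b} := by
      funext i; simp [vec]; split_ifs <;> rfl
    rw [this]; module
  rw [e0, e1] at h3
  exact h3.mono (le_of_eq (by ring))

/-- Run the body as many times as the position of tape `x` says; `a` is an auxiliary counter. -/
noncomputable def tally (x a : ι) (F : Prog ι (Sym A)) : Prog ι (Sym A) :=
  seq (loop (branch (test (fun h => h x ≠ .mark) {x} {a}) F (ret false))) (walk a {a} {x})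

theorem Adds.tally {C : ι → ℤ → Sym A} {F : Prog ι (Sym A)} {v : ι → ℤ} {t : ℕ} {Z : Set ι}
    {q : ι → ℤ} {x a : ι} {k : ℕ} (H : Adds C F v t Z q) (hxa : x ≠ a) (hx : x ∉ Z) (ha : a ∉ Z)
    (hvx : v x = 0) (hva : v a = 0) (hv : ∀ i ∈ Z, v i = 0) (hqx : q x = k) (hqa : q a = 0)
    (hCx : Origin C x) (hCa : Origin C a) :
    Adds C (tally x a F) ((k : ℤ) • v) ((k + 1) * (t + 2) + (k + 1)) (insert x (insert a Z)) q := by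
  intro p hp
  have hpx : p x = k := by rw [hp x (by simp), hqx]
  have hpa : p a = 0 := by rw [hp a (by simp), hqa]
  have hvecx : vec {x} {a} x = -1 := by simp [vec]
  have hveca : vec {x} {a} a = 1 := by simp [vec, hxa.symm]
  have hveco : ∀ i, i ≠ x → i ≠ a → vec {x} {a} i = 0 := by intro i h h'; simp [vec, h, h']
  set m : ℕ → Mem ι (Sym A) := fun i => ⟨C, p + (i : ℤ) • vec {x} {a} + (i : ℤ) • v⟩ with hm
  have hxi : ∀ i : ℕ, i ≤ k → (p + (i : ℤ) • vec {x} {a} + (i : ℤ) • v) x = ((k - i : ℕ) : ℤ) := by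
    intro i hi; simp [hpx, hvx, hvecx]; omega
  have hai : ∀ i : ℕ, (p + (i : ℤ) • vec {x} {a} + (i : ℤ) • v) a = i := by
    intro i; simp [hpa, hva, hveca]
  have h1 : (loop (branch (test (fun h => h x ≠ .mark) {x} {a}) F (ret false))).Det (m 0)
      ((k + 1) * (1 + (t + 1))) true (m k) := by
    refine Det.loop m (fun i hi => ?_) ?_
    · refine (Det.branch_runs (det_test_pos {x} {a} ?_) (t' := t + 1) ?_)
      · simp only [hxi i hi.le]; rw [Ne, hCx]; omega
      · simp only [if_true]
        refine Det.to ((H _ ?_).mono (Nat.le_succ t)) ?_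
        · intro j hj
          have h1 : j ≠ x := fun h => hx (h ▸ hj)
          have h2 : j ≠ a := fun h => ha (h ▸ hj)
          simp [hveco j h1 h2, hv j hj, hp j (by simp [hj])]
        · push_cast; module
    · refine (Det.branch_runs (det_test_neg {x} {a} ?_) (t' := t + 1) ?_)
      · simp only [hxi k le_rfl]; rw [not_not, hCx]; omega
      · exact (det_ret false _ _).mono (by omega)
  have h2 := det_walk (x := a) (ls := {a}) {x} (C := C)
    (p := p + (k : ℤ) • vec {x} {a} + (k : ℤ) • v) (k := k) (by simp) hCa (hai k)
  have h3 := Det.seq_runs h1 h2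
  have e0 : m 0 = ⟨C, p⟩ := by simp [hm]
  have e1 : p + (k : ℤ) • vec {x} {a} + (k : ℤ) • v + (k : ℤ) • vec {a} {x} = p + (k : ℤ) • v := by
    have : vec {a} {x} = - vec {x} {a} := by
      funext i
      by_cases h1 : i = x
      · subst h1; simp [vec, hxa]
      · by_cases h2 : i = a <;> simp [vec, h1, h2, hxa.symm]
    rw [this]; module
  rw [e0, e1] at h3
  exact h3.mono (le_of_eq (by ring))

end Prog

end TapeProgram

/-! ### Bounded first-order formulas and their evaluation -/

namespace TapeProgram

open Turing (Dir Tape)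
open Function (update)

/-- First-order formulas over an initial segment of the natural numbers, with the order, the
successor relation, the letters of a word, and `R` ternary relation symbols. Variables are the
elements of `Fin D`. -/
inductive Fml (A : Type) (D R : ℕ) : Type
  | lt (x y : Fin D) : Fml A D R
  | succ (x y : Fin D) : Fml A D R
  | letter (a : A) (x : Fin D) : Fml A D R
  | rel (r : Fin R) (x y z : Fin D) : Fml A D R
  | neg (φ : Fml A D R) : Fml A D R
  | and (φ ψ : Fml A D R) : Fml A D R
  | ex (x : Fin D) (φ : Fml A D R) : Fml A D R

namespace Fml

variable {A : Type} {D R : ℕ}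

/-- Satisfaction; quantifiers range over the numbers below `N`. -/
def Sat (N : ℕ) (w : List A) (G : Fin R → ℕ → ℕ → ℕ → Prop) : Fml A D R → (Fin D → ℕ) → Prop
  | lt x y, v => v x < v y
  | succ x y, v => v y = v x + 1
  | letter a x, v => w[v x]? = some a
  | rel r x y z, v => G r (v x) (v y) (v z)
  | neg φ, v => ¬ φ.Sat N w G v
  | and φ ψ, v => φ.Sat N w G v ∧ ψ.Sat N w G v
  | ex x φ, v => ∃ i < N, φ.Sat N w G (update v x i)

/-- No quantifier binds a variable of `s` or one that is already bound, and the two variables of an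
atom `succ` are distinct. -/
def ok : List (Fin D) → Fml A D R → Bool
  | _, lt _ _ => true
  | _, succ x y => decide (x ≠ y)
  | _, letter _ _ => true
  | _, rel _ _ _ _ => true
  | s, neg φ => φ.ok s
  | s, and φ ψ => φ.ok s && ψ.ok s
  | s, ex x φ => !s.contains x && φ.ok (x :: s)

/-- Only the restriction of the relations to the numbers below `N` matters. -/
theorem sat_congr {N : ℕ} {w : List A} {G G' : Fin R → ℕ → ℕ → ℕ → Prop}
    (h : ∀ r, ∀ i < N, ∀ j < N, ∀ k < N, G r i j k ↔ G' r i j k) (φ : Fml A D R) {v : Fin D → ℕ}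
    (hv : ∀ x, v x < N) : φ.Sat N w G v ↔ φ.Sat N w G' v := by
  induction φ generalizing v with
  | lt | succ | letter => rfl
  | rel r x y z => exact h r _ (hv x) _ (hv y) _ (hv z)
  | neg φ ih => exact not_congr (ih hv)
  | and φ ψ ih1 ih2 => exact and_congr (ih1 hv) (ih2 hv)
  | ex x φ ih =>
    refine exists_congr fun i => and_congr_right fun hi => ih fun y => ?_
    by_cases hy : y = x
    · subst hy; simpa using hi
    · simpa [hy] using hv y

end Fml

/-- Auxiliary counters. -/
inductive Reg : Type
  | aux | b₁ | b₂ | b₃ | cnt | c₁ | c₂ | c₃ | c₄ | c₅ | c₆ | c₇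
  deriving DecidableEq

instance : Fintype Reg :=
  ⟨{.aux, .b₁, .b₂, .b₃, .cnt, .c₁, .c₂, .c₃, .c₄, .c₅, .c₆, .c₇}, by intro c; cases c <;> decide⟩

/-- The tapes: the input, one tape for every guessed relation, one counter for every variable, and
auxiliary counters. -/
inductive Tp (D R : ℕ) : Type
  | inp
  | rel (r : Fin R)
  | var (x : Fin D)
  | reg (c : Reg)
  deriving DecidableEq

instance {D R : ℕ} : Finite (Tp D R) := by
  let f : Option (Fin R ⊕ Fin D ⊕ Reg) → Tp D R := fun x => match x with
    | none => .inp
    | some (.inl r) => .rel r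
    | some (.inr (.inl x)) => .var x
    | some (.inr (.inr c)) => .reg c
  refine Finite.of_surjective f fun x => ?_
  rcases x with _ | r | x | c
  · exact ⟨none, rfl⟩
  · exact ⟨some (.inl r), rfl⟩
  · exact ⟨some (.inr (.inl x)), rfl⟩
  · exact ⟨some (.inr (.inr c)), rfl⟩

namespace Prog

variable {A : Type} {D R : ℕ}

open Tp Reg

/-- The truth value of a proposition. -/
noncomputable def truth (P : Prop) : Bool := @decide P (Classical.propDecidable P)

theorem truth_true {P : Prop} (h : P) : truth P = true := by simpa [truth] using h

theorem truth_false {P : Prop} (h : ¬ P) : truth P = false := by simpa [truth] using h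

@[simp]
theorem truth_True : truth True = true := truth_true trivial

@[simp]
theorem truth_False : truth False = false := truth_false not_false

/-- The counters with an end mark. -/
def Bounded : Set (Tp D R) := {i | (∃ x, i = var x) ∨ i = reg b₁ ∨ i = reg b₂ ∨ i = reg b₃}

/-- The contents of the tapes during the evaluation of a formula: the word `w` is on the input tape
from cell `1` on, the relation tapes hold `g` from cell `1` on, and the counters end at `N`. -/
structure Layout (C : Tp D R → ℤ → Sym A) (N : ℕ) (w : List A) (g : Fin R → ℕ → Bool) : Prop where
  origin : ∀ i, Origin C i
  inp : ∀ (k : ℕ) a, C .inp (k + 1) = .letter a ↔ w[k]? = some a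
  fence : ∀ i ∈ Bounded, ∀ j : ℕ, j ≤ N → (C i j = .fence ↔ j = N)
  rel : ∀ r, ∀ k < N ^ 3, C (.rel r) (k + 1) = .bit (g r k)

/-- The positions of the heads that represent a valuation of the variables. -/
def posOf (v : Fin D → ℕ) : Tp D R → ℤ
  | var x => v x
  | _ => 0

/-- Test the symbol scanned on tape `T`, and return the head of `T` to the origin. -/
noncomputable def peek (T : Tp D R) (s : Sym A → Prop) : Prog (Tp D R) (Sym A) :=
  branch (test (fun h => s (h T)) ∅ ∅) (seq (walk T {T} ∅) (ret true)) (seq (walk T {T} ∅) (ret false))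

theorem det_peek {T : Tp D R} (s : Sym A → Prop) {C : Tp D R → ℤ → Sym A} {p : Tp D R → ℤ} {k : ℕ}
    (hC : Origin C T) (hp : p T = k) :
    (peek T s).Det ⟨C, p⟩ (k + 3) (truth (s (C T k))) ⟨C, p + (k : ℤ) • vec {T} ∅⟩ := by
  have h1 := fun b => (det_walk (x := T) (ls := {T}) ∅ (by simp) hC hp).seq_runs
    (det_ret b C (p + (k : ℤ) • vec {T} ∅))
  by_cases h : s (C T k)
  · have h2 := det_test_pos (c := fun h => s (h T)) (C := C) (p := p) ∅ ∅ (by simpa [hp] using h)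
    rw [vec_empty, add_zero] at h2
    rw [truth_true h]
    exact (h2.branch_runs (h1 true)).mono (by omega)
  · have h2 := det_test_neg (c := fun h => s (h T)) (C := C) (p := p) ∅ ∅ (by simpa [hp] using h)
    rw [truth_false h]
    exact (h2.branch_runs (h1 false)).mono (by omega)

/-- Move the heads of `x` and `y` back until one of them scans the origin, test the symbols scanned
then, and move the heads forth again. -/
noncomputable def meet (x y : Fin D) (s : Sym A → Sym A → Prop) : Prog (Tp D R) (Sym A) :=
  seq (loop (test (fun h => h (var x) ≠ .mark ∧ h (var y) ≠ .mark) {var x, var y} {reg aux}))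
    (branch (test (fun h => s (h (var x)) (h (var y))) ∅ ∅)
      (seq (walk (reg aux) {reg aux} {var x, var y}) (ret true))
      (seq (walk (reg aux) {reg aux} {var x, var y}) (ret false)))

theorem det_meet {x y : Fin D} (s : Sym A → Sym A → Prop)
    {C : Tp D R → ℤ → Sym A} {p : Tp D R → ℤ} {k l : ℕ} (hC : ∀ i, Origin C i)
    (hx : p (var x) = k) (hy : p (var y) = l) (ha : p (reg aux) = 0) :
    (meet x y s).Det ⟨C, p⟩ (2 * k + 4)
      (truth (s (C (var x) ((k - min k l : ℕ))) (C (var y) ((l - min k l : ℕ))))) ⟨C, p⟩ := by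
  set u : Tp D R → ℤ := vec {var x, var y} {reg aux} with hu
  have hux : u (var x) = -1 := by simp [hu, vec]
  have huy : u (var y) = -1 := by simp [hu, vec]
  have hua : u (reg aux) = 1 := by simp [hu, vec]
  set n := min k l with hn
  have px : ∀ i ≤ n, (p + (i : ℤ) • u) (var x) = ((k - i : ℕ) : ℤ) := by
    intro i hi; simp only [Pi.add_apply, Pi.smul_apply, hux, hx, smul_eq_mul]; omega
  have py : ∀ i ≤ n, (p + (i : ℤ) • u) (var y) = ((l - i : ℕ) : ℤ) := by
    intro i hi; simp only [Pi.add_apply, Pi.smul_apply, huy, hy, smul_eq_mul]; omega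
  have pa : (p + (n : ℤ) • u) (reg aux) = n := by
    simp only [Pi.add_apply, Pi.smul_apply, hua, ha, smul_eq_mul]; omega
  have h1 := Det.loop (F := test (fun h => h (var x) ≠ .mark ∧ h (var y) ≠ .mark)
      {var x, var y} {reg aux}) (t := 1) (k := n) (fun i => ⟨C, p + (i : ℤ) • u⟩)
      (m' := ⟨C, p + (n : ℤ) • u⟩)
    (fun i hi => by
      refine (det_test_pos _ _ ?_).to ?_
      · simp only [px i hi.le, py i hi.le]
        rw [Ne, hC, Ne, hC]
        omega
      · push_cast
        rw [add_smul, one_smul, add_assoc])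
    (det_test_neg _ _ (by
      simp only [px n le_rfl, py n le_rfl]
      rw [Ne, hC, Ne, hC]
      omega))
  have e0 : p + ((0 : ℕ) : ℤ) • u = p := by module
  rw [e0, mul_one] at h1
  have e1 : p + (n : ℤ) • u + (n : ℤ) • vec {reg aux} {var x, var y} = p := by
    have : vec {reg aux} {var x, var y} = - u := by
      funext i
      by_cases h1 : i = var x
      · subst h1; simp [hu, vec]
      · by_cases h2 : i = var y
        · subst h2; simp [hu, vec]
        · by_cases h3 : i = reg aux
          · subst h3; simp [hu, vec]
          · simp [hu, vec, h1, h2, h3]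
    rw [this]; module
  have h2 := fun b => Det.to ((det_walk (x := reg aux) (ls := {reg aux}) {var x, var y} (by simp)
    (hC _) pa).seq_runs (det_ret b C _)) e1
  by_cases h : s (C (var x) ((k - n : ℕ))) (C (var y) ((l - n : ℕ)))
  · have h3 := det_test_pos (c := fun h => s (h (var x)) (h (var y))) (C := C)
      (p := p + (n : ℤ) • u) ∅ ∅ (by simpa only [px n le_rfl, py n le_rfl] using h)
    rw [vec_empty, add_zero] at h3
    rw [truth_true h]
    exact (h1.seq_runs (h3.branch_runs (h2 true))).mono (by omega)
  · have h3 := det_test_neg (c := fun h => s (h (var x)) (h (var y))) (C := C)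
      (p := p + (n : ℤ) • u) ∅ ∅ (by simpa only [px n le_rfl, py n le_rfl] using h)
    rw [truth_false h]
    exact (h1.seq_runs (h3.branch_runs (h2 false))).mono (by omega)

/-- Run the body for the values `0`, `1`, … of `x`, until it succeeds or the values are exhausted;
succeed if the body did. -/
noncomputable def search (x : Fin D) (F : Prog (Tp D R) (Sym A)) : Prog (Tp D R) (Sym A) :=
  seq (loop (branch (test (fun h => h (var x) = .fence) ∅ ∅) (ret false)
      (branch F (ret false) (move ∅ {var x}))))
    (peek (var x) fun s => s ≠ .fence)

theorem posOf_update (v : Fin D → ℕ) (x : Fin D) (i : ℕ) (hx : v x = 0) :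
    (posOf (update v x i) : Tp D R → ℤ) = posOf v + (i : ℤ) • vec ∅ {var x} := by
  funext j
  rcases j with _ | r | y | c
  · simp [posOf, vec]
  · simp [posOf, vec]
  · by_cases h : y = x
    · subst h; simp [posOf, vec, hx]
    · simp [posOf, vec, h]
  · simp [posOf, vec]

theorem det_search {x : Fin D} {F : Prog (Tp D R) (Sym A)} {C : Tp D R → ℤ → Sym A} {N t : ℕ}
    {v : Fin D → ℕ} {P : (Fin D → ℕ) → Prop} (hC : Origin C (var x))
    (hN : ∀ j : ℕ, j ≤ N → (C (var x) j = .fence ↔ j = N)) (hx : v x = 0)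
    (hF : ∀ i < N, F.Det ⟨C, posOf (update v x i)⟩ t (truth (P (update v x i)))
      ⟨C, posOf (update v x i)⟩) :
    (search x F).Det ⟨C, posOf v⟩ ((N + 1) * (t + 2) + (N + 3))
      (truth (∃ i < N, P (update v x i))) ⟨C, posOf v⟩ := by
  classical
  have ex : ∃ i, i = N ∨ P (update v x i) := ⟨N, .inl rfl⟩
  set k := Nat.find ex with hk
  have hkN : k ≤ N := Nat.find_le (.inl rfl)
  have hk1 : k = N ∨ P (update v x k) := Nat.find_spec ex
  have hk2 : ∀ i < k, ¬ P (update v x i) := fun i hi h => Nat.find_min ex hi (.inr h)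
  have hpos : ∀ i : ℕ, (posOf (update v x i) : Tp D R → ℤ) (var x) = i := by
    intro i; simp [posOf]
  have h1 := Det.loop (F := branch (test (fun h => h (var x) = .fence) ∅ ∅) (ret false)
      (branch F (ret false) (move ∅ {var x}))) (t := 1 + (t + 1)) (k := k)
      (fun i => ⟨C, posOf (update v x i)⟩) (m' := ⟨C, posOf (update v x k)⟩)
    (fun i hi => by
      refine (det_test_neg ∅ ∅ ?_).branch_runs ?_
      · simp only [hpos]
        rw [hN i (by omega)]; omega
      · rw [if_neg (by simp)]
        have h := hF i (by omega)
        rw [truth_false (hk2 i hi)] at h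
        refine h.branch_runs ?_
        rw [if_neg (by simp)]
        refine (det_move _ _ _ _).to ?_
        rw [posOf_update v x _ hx, posOf_update v x _ hx]
        push_cast
        module)
    (by
      by_cases hkN' : k = N
      · refine Det.branch_runs (m' := ⟨C, posOf (update v x k)⟩) (b := true)
          ((det_test_pos ∅ ∅ ?_).to ?_) ?_
        · simp only [hpos]
          rw [hN k hkN]; exact hkN'
        · rw [vec_empty, add_zero]
        · rw [if_pos rfl]
          exact (det_ret false _ _).mono (by omega)
      · refine (det_test_neg ∅ ∅ ?_).branch_runs ?_
        · simp only [hpos]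
          rw [hN k hkN]; exact hkN'
        · rw [if_neg (by simp)]
          have h := hF k (by omega)
          rw [truth_true (hk1.resolve_left hkN')] at h
          refine h.branch_runs ?_
          rw [if_pos rfl]
          exact det_ret false _ _)
  have e0 : update v x 0 = v := by rw [← hx]; simp
  simp only [e0] at h1
  have h2 := (det_peek (T := var x) (fun s => s ≠ .fence) hC (hpos k)).to (p' := posOf v) (by
    have : vec {(var x : Tp D R)} ∅ = - vec ∅ {var x} := by
      funext i; simp [vec]; split_ifs <;> rfl
    rw [posOf_update v x _ hx, this]; module)
  have e2 : (C (var x) k ≠ .fence) ↔ ∃ i < N, P (update v x i) := by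
    rw [Ne, hN k hkN]
    constructor
    · exact fun h => ⟨k, by omega, hk1.resolve_left h⟩
    · rintro ⟨i, hi, hP⟩ h
      exact hk2 i (by omega) hP
  have h3 := h1.seq_runs h2
  simp only [e2] at h3
  refine h3.mono ?_
  have : (k + 1) * (1 + (t + 1)) ≤ (N + 1) * (t + 2) := Nat.mul_le_mul (by omega) (by omega)
  omega

/-- Test a letter of the input. -/
noncomputable def evalLetter (a : A) (x : Fin D) : Prog (Tp D R) (Sym A) :=
  seq (tally (var x) (reg aux) (move ∅ {inp})) (seq (move ∅ {inp}) (peek inp fun s => s = .letter a))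

theorem det_evalLetter (a : A) (x : Fin D) {C : Tp D R → ℤ → Sym A} {N : ℕ} {w : List A}
    {g : Fin R → ℕ → Bool} (H : Layout C N w g) (v : Fin D → ℕ) (hv : ∀ x, v x < N) :
    (evalLetter a x).Det ⟨C, posOf v⟩ (5 * N + 5) (truth (w[v x]? = some a)) ⟨C, posOf v⟩ := by
  have h1 := (adds_move C ∅ {inp} (posOf v)).tally (x := var x) (a := reg aux) (k := v x) (by simp)
    (by simp) (by simp) (by simp [vec]) (by simp [vec]) (by simp) (by simp [posOf]) (by simp [posOf])
    (H.origin _) (H.origin _) (posOf v) (fun _ _ => rfl)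
  have h2 := h1.seq_runs ((det_move ∅ {inp} _ _).seq_runs
    ((det_peek (T := inp) (k := v x + 1) (fun s => s = Sym.letter a) (H.origin _)
      (by simp [posOf, vec])).to (p' := posOf v) (by
        have : vec {(inp : Tp D R)} ∅ = - vec ∅ {inp} := by
          funext i; simp [vec]; split_ifs <;> rfl
        rw [this]; push_cast; module)))
  have := hv x
  have e := H.inp (v x) a
  push_cast at h2
  simp only [e] at h2
  exact h2.mono (by omega)

/-- Test an entry of a guessed relation. The entry at `(i, j, k)` is in cell
`i * N ^ 2 + j * N + k + 1` of the tape. -/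
noncomputable def evalRel (r : Fin R) (x y z : Fin D) : Prog (Tp D R) (Sym A) :=
  seq (tally (var x) (reg aux) (sweep (reg b₂) (sweep (reg b₁) (move ∅ {.rel r}))))
    (seq (tally (var y) (reg aux) (sweep (reg b₁) (move ∅ {.rel r})))
      (seq (tally (var z) (reg aux) (move ∅ {.rel r}))
        (seq (move ∅ {.rel r}) (peek (.rel r) fun s => s = .bit true))))

/-- The position of the entry at `(i, j, k)`. -/
def index (N i j k : ℕ) : ℕ := (i * N + j) * N + k

theorem index_lt {N i j k : ℕ} (hi : i < N) (hj : j < N) (hk : k < N) : index N i j k < N ^ 3 := by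
  unfold index
  have h1 : i * N + j + 1 ≤ N * N := by nlinarith
  calc (i * N + j) * N + k < (i * N + j + 1) * N := by nlinarith
    _ ≤ N * N * N := Nat.mul_le_mul_right _ h1
    _ = N ^ 3 := by ring

/-- The time of a loop with at most `N` repetitions of a body of time `t`. -/
def loopTime (N t : ℕ) : ℕ := (N + 1) * (t + 2) + (N + 1)

theorem det_evalRel (r : Fin R) (x y z : Fin D) {C : Tp D R → ℤ → Sym A} {N : ℕ} {w : List A}
    {g : Fin R → ℕ → Bool} (H : Layout C N w g) (v : Fin D → ℕ) (hv : ∀ x, v x < N) :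
    (evalRel r x y z).Det ⟨C, posOf v⟩
      (loopTime N (loopTime N (loopTime N 1)) + loopTime N (loopTime N 1) + loopTime N 1 + N ^ 3 + 5)
      (truth (g r (index N (v x) (v y) (v z)) = true)) ⟨C, posOf v⟩ := by
  set u : Tp D R → ℤ := vec ∅ {.rel r} with hu
  set q : Tp D R → ℤ := posOf v with hq
  have hub : ∀ i, i ≠ .rel r → u i = 0 := by intro i hi; simp [hu, vec, hi]
  have hur : u (.rel r) = 1 := by simp [hu, vec]
  have s1 := (adds_move C ∅ {.rel r} q).sweep (b := reg b₁) (N := N) (by simp) (hub _ (by simp))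
    (by simp) (by simp [hq, posOf]) (H.origin _) (H.fence _ (by simp [Bounded]))
  have s2 := s1.sweep (b := reg b₂) (N := N) (by simp) (by simp [← hu, hub]) (by simp [← hu, hub])
    (by simp [hq, posOf]) (H.origin _) (H.fence _ (by simp [Bounded]))
  have t1 := s2.tally (x := var x) (a := reg aux) (k := v x) (by simp) (by simp) (by simp)
    (by simp [← hu, hub]) (by simp [← hu, hub]) (by simp [← hu, hub]) (by simp [hq, posOf])
    (by simp [hq, posOf]) (H.origin _) (H.origin _)
  have t2 := s1.tally (x := var y) (a := reg aux) (k := v y) (by simp) (by simp) (by simp)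
    (by simp [← hu, hub]) (by simp [← hu, hub]) (by simp [← hu, hub]) (by simp [hq, posOf])
    (by simp [hq, posOf]) (H.origin _) (H.origin _)
  have t3 := (adds_move C ∅ {.rel r} q).tally (x := var z) (a := reg aux) (k := v z) (by simp)
    (by simp) (by simp) (by simp [← hu, hub]) (by simp [← hu, hub]) (by simp)
    (by simp [hq, posOf]) (by simp [hq, posOf]) (H.origin _) (H.origin _)
  have e1 := t1 q fun _ _ => rfl
  have e2 := t2 (q + (v x : ℤ) • (N : ℤ) • (N : ℤ) • u) (by simp [hub])
  have e3 := t3 (q + (v x : ℤ) • (N : ℤ) • (N : ℤ) • u + (v y : ℤ) • (N : ℤ) • u) (by simp [hub])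
  have e5 := (det_peek (T := .rel r) (p := q + (v x : ℤ) • (N : ℤ) • (N : ℤ) • u +
    (v y : ℤ) • (N : ℤ) • u + (v z : ℤ) • u + u)
    (k := index N (v x) (v y) (v z) + 1) (fun s => s = Sym.bit true) (H.origin (.rel r))
      (by simp [hq, posOf, hur, index]; ring)).to (p' := q) (by
        have : vec {(.rel r : Tp D R)} ∅ = - u := by
          funext i; simp [hu, vec]; split_ifs <;> rfl
        rw [this]; simp only [index]; push_cast; module)
  have h := e1.seq_runs (e2.seq_runs (e3.seq_runs ((det_move ∅ {.rel r} _ _).seq_runs e5)))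
  have hi := index_lt (hv x) (hv y) (hv z)
  have e := H.rel r _ hi
  push_cast at h
  simp only [e, Sym.bit.injEq] at h
  refine h.mono ?_
  have hm : ∀ t, ∀ y, (v y + 1) * (t + 2) + (v y + 1) ≤ loopTime N t := by
    intro t y
    have := hv y
    exact Nat.add_le_add (Nat.mul_le_mul_right _ (by omega)) (by omega)
  have a1 := hm (loopTime N (loopTime N 1)) x
  have a2 := hm (loopTime N 1) y
  have a3 := hm 1 z
  change (v x + 1) * (loopTime N (loopTime N 1) + 2) + (v x + 1) +
    ((v y + 1) * (loopTime N 1 + 2) + (v y + 1) +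
      ((v z + 1) * (1 + 2) + (v z + 1) + (1 + (index N (v x) (v y) (v z) + 1 + 3)))) ≤ _
  omega

/-- The program that evaluates a formula. -/
noncomputable def eval : Fml A D R → Prog (Tp D R) (Sym A)
  | .lt x y => meet x y fun _ s => s ≠ .mark
  | .succ x y => seq (move ∅ {var x})
      (branch (meet x y fun s s' => s = .mark ∧ s' = .mark)
        (seq (move {var x} ∅) (ret true)) (seq (move {var x} ∅) (ret false)))
  | .letter a x => evalLetter a x
  | .rel r x y z => evalRel r x y z
  | .neg φ => branch (eval φ) (ret false) (ret true)
  | .and φ ψ => branch (eval φ) (eval ψ) (ret false)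
  | .ex x φ => search x (eval φ)

/-- A bound for the time that the evaluation of a formula takes. -/
def cost (N : ℕ) : Fml A D R → ℕ
  | .lt _ _ => 2 * N + 4
  | .succ _ _ => 2 * N + 9
  | .letter _ _ => 5 * N + 5
  | .rel _ _ _ _ =>
    loopTime N (loopTime N (loopTime N 1)) + loopTime N (loopTime N 1) + loopTime N 1 + N ^ 3 + 5
  | .neg φ => cost N φ + 1
  | .and φ ψ => cost N φ + (cost N ψ + 1)
  | .ex _ φ => (N + 1) * (cost N φ + 2) + (N + 3)

/-- The program evaluates the formula and returns all heads to where they were. A quantifier uses the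
counter of its variable from `0` on, so variables outside `s` must be `0`. -/
theorem det_eval {C : Tp D R → ℤ → Sym A} {N : ℕ} {w : List A} {g : Fin R → ℕ → Bool}
    (H : Layout C N w g) (φ : Fml A D R) {s : List (Fin D)} (hφ : φ.ok s) (v : Fin D → ℕ)
    (hv : ∀ x, v x < N) (hs : ∀ x, x ∉ s → v x = 0) :
    (eval φ).Det ⟨C, posOf v⟩ (cost N φ)
      (truth (φ.Sat N w (fun r i j k => g r (index N i j k) = true) v)) ⟨C, posOf v⟩ := by
  induction φ generalizing s v with
  | lt x y =>
    have h := det_meet (x := x) (y := y) (fun _ s => s ≠ .mark) (p := posOf v) (k := v x) (l := v y) H.origin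
      (by simp [posOf]) (by simp [posOf]) (by simp [posOf])
    have e : (C (var y) ((v y - min (v x) (v y) : ℕ) : ℤ) ≠ .mark) ↔ v x < v y := by
      rw [Ne, H.origin]; omega
    rw [e] at h
    have := hv x
    exact h.mono (by simp only [cost]; omega)
  | succ x y =>
    have hxy : x ≠ y := by simpa [Fml.ok] using hφ
    have h := det_meet (x := x) (y := y) (fun s s' => s = .mark ∧ s' = .mark) (p := posOf v + vec ∅ {var x})
      (k := v x + 1) (l := v y) H.origin
      (by simp [posOf, vec]) (by simp [posOf, vec, hxy.symm]) (by simp [posOf, vec])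
    have e : (C (var x) ((v x + 1 - min (v x + 1) (v y) : ℕ) : ℤ) = .mark ∧
        C (var y) ((v y - min (v x + 1) (v y) : ℕ) : ℤ) = .mark) ↔ v y = v x + 1 := by
      rw [H.origin, H.origin]; omega
    simp only [e] at h
    have := hv x
    have h2 := fun b => Det.to (p' := posOf v) ((det_move {var x} ∅ C (posOf v + vec ∅ {var x})).seq_runs
      (det_ret b C _)) (by
        have : vec {(var x : Tp D R)} ∅ = - vec ∅ {var x} := by
          funext i; simp [vec]; split_ifs <;> rfl
        rw [this]; module)
    refine Runs.mono ((det_move ∅ {var x} C (posOf v)).seq_runs (h.branch_runs (t' := 2) ?_)) ?_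
      (t := 1 + (2 * (v x + 1) + 4 + 2))
    · by_cases hd : v y = v x + 1
      · simpa [Fml.Sat, hd] using h2 true
      · simpa [Fml.Sat, hd] using h2 false
    · simp only [cost]; omega
  | letter a x => exact det_evalLetter a x H v hv
  | rel r x y z => exact det_evalRel r x y z H v hv
  | neg φ ih =>
    refine (ih hφ v hv hs).branch_runs ?_
    by_cases hd : φ.Sat N w (fun r i j k => g r (index N i j k) = true) v
    · simpa [Fml.Sat, hd] using det_ret false C (posOf v)
    · simpa [Fml.Sat, hd] using det_ret true C (posOf v)
  | and φ ψ ih1 ih2 =>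
    simp only [Fml.ok, Bool.and_eq_true] at hφ
    refine (ih1 hφ.1 v hv hs).branch_runs ?_
    by_cases hd : φ.Sat N w (fun r i j k => g r (index N i j k) = true) v
    · simpa [Fml.Sat, hd] using (ih2 hφ.2 v hv hs).mono (Nat.le_succ _)
    · simpa [Fml.Sat, hd] using (det_ret false C (posOf v)).mono (by omega)
  | ex x φ ih =>
    simp only [Fml.ok, Bool.and_eq_true, Bool.not_eq_true', List.contains_eq_mem,
      decide_eq_false_iff_not] at hφ
    refine det_search (P := φ.Sat N w (fun r i j k => g r (index N i j k) = true))
      (H.origin _) (H.fence _ (by simp [Bounded])) (hs x hφ.1) fun i hi => ?_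
    refine ih hφ.2 _ (fun y => ?_) fun y hy => ?_
    · by_cases hy : y = x
      · subst hy; simpa using hi
      · simpa [hy] using hv y
    · simp only [List.mem_cons, not_or] at hy
      simpa [hy.1] using hs y hy.2

end Prog

end TapeProgram

/-! ### Counting to a double exponential and guessing -/

namespace TapeProgram

open Turing (Dir Tape)
open Function (update)

namespace Prog

variable {A : Type} {D R : ℕ}

open Tp Reg

section Arithmetic

variable {ι : Type} {C : ι → ℤ → Sym A}

/-- Double the counter `y`; `d` and `d'` are auxiliary counters. -/
noncomputable def double (y d d' : ι) : Prog ι (Sym A) :=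
  seq (walk y {y} {d, d'}) (seq (walk d {d} {y}) (walk d' {d'} {y}))

theorem det_double {y d d' : ι} (h₁ : y ≠ d) (h₂ : y ≠ d') (h₃ : d ≠ d') (hC : ∀ i, Origin C i)
    {p : ι → ℤ} {k : ℕ} (hy : p y = k) (hd : p d = 0) (hd' : p d' = 0) :
    (double y d d').Det ⟨C, p⟩ (3 * (k + 1)) true ⟨C, p + (k : ℤ) • vec ∅ {y}⟩ := by
  have e1 := det_walk (x := y) (ls := {y}) {d, d'} (by simp) (hC y) hy
  have e2 := det_walk (x := d) (ls := {d}) {y} (p := p + (k : ℤ) • vec {y} {d, d'}) (k := k)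
    (by simp) (hC d) (by simp [vec, h₁.symm, hd])
  have e3 := det_walk (x := d') (ls := {d'}) {y}
    (p := p + (k : ℤ) • vec {y} {d, d'} + (k : ℤ) • vec {d} {y}) (k := k)
    (by simp) (hC d') (by simp [vec, h₂.symm, h₃.symm, hd'])
  refine Det.to ((e1.seq_runs (e2.seq_runs e3)).mono (by omega)) ?_
  have : vec {y} {d, d'} + vec {d} {y} + vec {d'} {y} = vec ∅ {y} := by
    funext i
    by_cases hi : i = y
    · subst hi; simp [vec, h₁, h₂]
    · by_cases hi' : i = d
      · subst hi'; simp [vec, hi, h₃]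
      · by_cases hi'' : i = d'
        · subst hi''; simp [vec, hi, hi']
        · simp [vec, hi, hi', hi'']
  rw [← this]; module

/-- Set the counter `y` to `2 ^ x`, and `x` to `0`; `d` and `d'` are auxiliary counters. -/
noncomputable def power (x y d d' : ι) : Prog ι (Sym A) :=
  seq (move ∅ {y})
    (loop (branch (test (fun h => h x ≠ .mark) {x} ∅) (double y d d') (ret false)))

theorem det_power {x y d d' : ι} (h₁ : y ≠ d) (h₂ : y ≠ d') (h₃ : d ≠ d') (h₄ : x ≠ y) (h₅ : x ≠ d)
    (h₆ : x ≠ d') (hC : ∀ i, Origin C i) {p : ι → ℤ} {a : ℕ} (hx : p x = a) (hy : p y = 0)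
    (hd : p d = 0) (hd' : p d' = 0) :
    (power x y d d').Det ⟨C, p⟩ (1 + (a + 1) * (1 + 3 * (2 ^ a + 1))) true
      ⟨C, p + (a : ℤ) • vec {x} ∅ + ((2 ^ a : ℕ) : ℤ) • vec ∅ {y}⟩ := by
  set m : ℕ → Mem ι (Sym A) :=
    fun i => ⟨C, p + (i : ℤ) • vec {x} ∅ + ((2 ^ i : ℕ) : ℤ) • vec ∅ {y}⟩ with hm
  have hxi : ∀ i ≤ a,
      (p + (i : ℤ) • vec {x} ∅ + ((2 ^ i : ℕ) : ℤ) • vec ∅ {y}) x = ((a - i : ℕ) : ℤ) := by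
    intro i hi
    have h1 : vec {x} ∅ x = -1 := by simp [vec]
    have h2 : vec ∅ {y} x = 0 := by simp [vec, h₄]
    simp only [Pi.add_apply, Pi.smul_apply, smul_eq_mul, hx, h1, h2]
    omega
  have e : (loop (branch (test (fun h => h x ≠ .mark) {x} ∅) (double y d d') (ret false))).Det (m 0)
      ((a + 1) * (1 + 3 * (2 ^ a + 1))) true (m a) := by
    refine Det.loop m (fun i hi => ?_) ?_
    · refine (det_test_pos {x} ∅ ?_).branch_runs (t' := 3 * (2 ^ a + 1)) ?_
      · simp only [hxi i hi.le]; rw [Ne, hC]; omega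
      · rw [if_pos rfl]
        refine Det.to ((det_double h₁ h₂ h₃ hC (k := 2 ^ i) ?_ ?_ ?_).mono ?_) ?_
        · simp [vec, hy, h₄.symm]
        · simp [vec, hd, h₅.symm, h₁.symm]
        · simp [vec, hd', h₆.symm, h₂.symm]
        · have := Nat.pow_le_pow_right (n := 2) (by omega) hi.le
          omega
        · push_cast; rw [pow_succ]; module
    · refine (det_test_neg {x} ∅ ?_).branch_runs (t' := 3 * (2 ^ a + 1)) ?_
      · simp only [hxi a le_rfl]; rw [not_not, hC]; omega
      · exact (det_ret false _ _).mono (Nat.mul_pos (by omega) (by positivity))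
  have e0 : m 0 = ⟨C, p + vec ∅ {y}⟩ := by simp [hm]
  rw [e0] at e
  exact (det_move ∅ {y} C p).seq_runs e

end Arithmetic

/-- The positions in which only the auxiliary counters have moved. -/
def regPos (f : Reg → ℕ) : Tp D R → ℤ
  | reg c => f c
  | _ => 0

/-- The contents of the tapes after the origins have been marked. -/
def marked (w : List A) : Tp D R → ℤ → Sym A
  | inp, j => if j = 0 then .mark else if 1 ≤ j then (w.map Sym.letter).getI (j - 1).toNat else .blank
  | _, j => if j = 0 then .mark else .blank

theorem getI_map_letter (w : List A) (k : ℕ) :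
    (w.map Sym.letter).getI k = (w[k]?).elim Sym.blank Sym.letter := by
  rw [← List.getD_default_eq_getI, List.getD_eq_getElem?_getD, List.getElem?_map]
  cases w[k]? <;> rfl

theorem marked_inp (w : List A) (k : ℕ) :
    marked w (inp : Tp D R) ((k : ℤ) + 1) = (w[k]?).elim Sym.blank Sym.letter := by
  have h1 : ((k : ℤ) + 1 ≠ 0) := by omega
  simp [marked, h1, getI_map_letter]

theorem origin_marked (w : List A) (i : Tp D R) : Origin (marked w) i := by
  intro j
  rcases j with _ | j
  · cases i <;> simp [marked]
  · have h : ((j : ℤ) + 1 ≠ 0) := by omega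
    rcases i with _ | r | x | c
    · push_cast
      rw [marked_inp w j]
      cases w[j]? <;> simp
    all_goals simp [marked, h]

/-- Mark the origins. -/
noncomputable def markOrigins : Prog (Tp D R) (Sym A) :=
  seq (one fun h => {(true, fun i => if i = inp then (h i, some .left) else (.mark, none))})
    (one fun h => {(true, fun i => if i = inp then (.mark, none) else (h i, none))})

theorem det_markOrigins (w : List A) :
    (markOrigins (D := D) (R := R)).Det (initMem inp Sym.letter w) 2 true ⟨marked w, 0⟩ := by
  have h1 : ∀ (f : (Tp D R → Sym A) → Action (Tp D R) (Sym A)) m,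
      (one fun h => {(true, f h)}).Det m 1 true (m.act (f m.heads)) := fun f m =>
    (runs_one (fun h => {(true, f h)}) m).congr fun b m' => by simp [and_comm]
  have h2 := (h1 (fun h i => if i = inp then (h i, some .left) else (.mark, none))
    (initMem inp Sym.letter w)).seq_runs (h1 (fun h i => if i = inp then (.mark, none) else (h i, none)) _)
  refine h2.congr fun b m' => and_congr_right fun _ => ?_
  apply Eq.congr_right
  unfold Mem.act initMem
  simp only [Mem.mk.injEq]
  constructor
  · funext i j
    rcases i with _ | r | x | c
    · by_cases hj : j = 0
      · subst hj; simp [marked, shift, Mem.heads, update]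
      · by_cases hj' : j = 1
        · subst hj'; simp [marked, shift, Mem.heads, update]
        · simp [marked, shift, Mem.heads, update, hj, hj']; rfl
    all_goals
      by_cases hj : j = 0
      · subst hj; simp [marked, shift, Mem.heads, update]
      · simp [marked, shift, update, hj]; rfl
  · funext i
    rcases i with _ | r | x | c <;> simp [shift]

/-- Copy the length of the input, plus two, to the counters `c₁` and `c₂`. -/
noncomputable def measure : Prog (Tp D R) (Sym A) :=
  seq (move ∅ {inp, reg c₁, reg c₂})
    (seq (loop (test (fun h => h inp ≠ .blank) ∅ {inp, reg c₁, reg c₂}))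
      (seq (walk inp {inp} ∅) (move ∅ {reg c₁, reg c₂})))

theorem det_measure (w : List A) :
    (measure (D := D) (R := R)).Det ⟨marked w, 0⟩ (2 * w.length + 5) true
      ⟨marked w, regPos fun c => match c with
        | c₁ => w.length + 2
        | c₂ => w.length + 2
        | _ => 0⟩ := by
  set n := w.length with hn
  set u : Tp D R → ℤ := vec ∅ {inp, reg c₁, reg c₂} with hu
  have hui : u inp = 1 := by simp [hu, vec]
  have hpos : ∀ i : ℕ, ((0 : Tp D R → ℤ) + u + (i : ℤ) • u) inp = (i : ℤ) + 1 := by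
    intro i; simp [hui]; ring
  have h1 := Det.loop (F := test (fun h => h inp ≠ .blank) ∅ {inp, reg c₁, reg c₂}) (t := 1)
    (k := n) (fun i => ⟨marked w, 0 + u + (i : ℤ) • u⟩) (m' := ⟨marked w, 0 + u + (n : ℤ) • u⟩)
    (fun i hi => by
      refine (det_test_pos _ _ ?_).to ?_
      · simp only [hpos, marked_inp w i]
        rw [List.getElem?_eq_getElem (by omega)]
        simp
      · push_cast; module)
    (det_test_neg _ _ (by
      simp only [hpos, marked_inp w n]
      rw [List.getElem?_eq_none (by omega)]
      simp))
  have e0 : (0 : Tp D R → ℤ) + u + ((0 : ℕ) : ℤ) • u = 0 + u := by module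
  rw [e0] at h1
  have h2 := det_walk (x := (inp : Tp D R)) (ls := {inp}) ∅ (C := marked w)
    (p := 0 + u + (n : ℤ) • u) (k := n + 1) (by simp) (origin_marked w _) (by rw [hpos]; simp)
  refine Det.to (((det_move _ _ _ _).seq_runs (h1.seq_runs (h2.seq_runs
    (det_move ∅ {reg c₁, reg c₂} _ _)))).mono (by omega)) ?_
  funext i
  rcases i with _ | r | x | c
  · simp [regPos, hu, vec]; ring
  · simp [regPos, hu, vec]
  · simp [regPos, hu, vec]
  · cases c <;> simp [regPos, hu, vec] <;> ring

/-- Set all counters in `Bounded` to `2 ^ 2 ^ ((n + 2) ^ 2)`, where `n` is the length of the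
input. -/
noncomputable def count : Prog (Tp D R) (Sym A) :=
  seq measure (seq (tally (reg c₁) (reg aux) (tally (reg c₂) (reg c₃) (move ∅ {reg c₄})))
    (seq (walk (reg c₁) {reg c₁, reg c₂} ∅) (seq (power (reg c₄) (reg c₅) (reg c₆) (reg c₇))
      (seq (power (reg c₅) (reg c₄) (reg c₆) (reg c₇)) (walk (reg c₄) {reg c₄} Bounded)))))

/-- A bound for the running time of `count`. -/
def countTime (N : ℕ) : ℕ :=
  (2 * N + 5) + (loopTime N (loopTime N 1) + ((N + 1) + ((1 + (N + 1) * (1 + 3 * (N + 1))) +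
    ((1 + (N + 1) * (1 + 3 * (N + 1))) + (N + 1)))))

theorem loopTime_mono {N N' t t' : ℕ} (h : N ≤ N') (h' : t ≤ t') : loopTime N t ≤ loopTime N' t' :=
  Nat.add_le_add (Nat.mul_le_mul (by omega) (by omega)) (by omega)

theorem det_count (w : List A) {N : ℕ} (hN : N = 2 ^ 2 ^ (w.length + 2) ^ 2) :
    (count (D := D) (R := R)).Det ⟨marked w, 0⟩ (countTime N) true
      ⟨marked w, (N : ℤ) • vec ∅ Bounded⟩ := by
  set n := w.length with hn
  set q := (n + 2) ^ 2 with hq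
  have h1 := det_measure (D := D) (R := R) w
  set p₁ : Tp D R → ℤ := regPos fun c => match c with
        | c₁ => w.length + 2
        | c₂ => w.length + 2
        | _ => 0 with hp₁
  have hC : ∀ i : Tp D R, Origin (marked w) i := origin_marked w
  have h2 := (((adds_move (marked w) ∅ {(reg c₄ : Tp D R)} p₁).tally (x := reg c₂) (a := reg c₃)
    (k := n + 2) (by simp) (by simp) (by simp) (by simp [vec]) (by simp [vec]) (by simp)
    (by simp [hp₁, regPos, hn]) (by simp [hp₁, regPos]) (hC _) (hC _)).tally (x := reg c₁)
    (a := reg aux) (k := n + 2) (by simp) (by simp) (by simp) (by simp [vec]) (by simp [vec])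
    (by simp [vec]) (by simp [hp₁, regPos, hn]) (by simp [hp₁, regPos]) (hC _) (hC _)) p₁
    (fun _ _ => rfl)
  set p₂ : Tp D R → ℤ := regPos fun c => match c with
        | c₁ => n + 2
        | c₂ => n + 2
        | c₄ => q
        | _ => 0 with hp₂
  have e2 : p₁ + ((n + 2 : ℕ) : ℤ) • ((n + 2 : ℕ) : ℤ) • vec ∅ {(reg c₄ : Tp D R)} = p₂ := by
    funext i
    rcases i with _ | r | x | c
    · simp [hp₁, hp₂, regPos, vec]
    · simp [hp₁, hp₂, regPos, vec]
    · simp [hp₁, hp₂, regPos, vec]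
    · cases c <;> simp [hp₁, hp₂, regPos, vec, hn, hq]
      ring
  have h3 := det_walk (x := (reg c₁ : Tp D R)) (ls := {reg c₁, reg c₂}) ∅ (C := marked w)
    (p := p₂) (k := n + 2) (by simp) (hC _) (by simp [hp₂, regPos])
  set p₃ : Tp D R → ℤ := regPos fun c => match c with
        | c₄ => q
        | _ => 0 with hp₃
  have e3 : p₂ + ((n + 2 : ℕ) : ℤ) • vec {reg c₁, reg c₂} ∅ = p₃ := by
    funext i
    rcases i with _ | r | x | c
    · simp [hp₃, hp₂, regPos, vec]
    · simp [hp₃, hp₂, regPos, vec]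
    · simp [hp₃, hp₂, regPos, vec]
    · cases c <;> simp [hp₃, hp₂, regPos, vec]
  have h4 := det_power (x := (reg c₄ : Tp D R)) (y := reg c₅) (d := reg c₆) (d' := reg c₇)
    (by simp) (by simp) (by simp) (by simp) (by simp) (by simp) hC (p := p₃) (a := q)
    (by simp [hp₃, regPos]) (by simp [hp₃, regPos]) (by simp [hp₃, regPos]) (by simp [hp₃, regPos])
  set p₄ : Tp D R → ℤ := regPos fun c => match c with
        | c₅ => 2 ^ q
        | _ => 0 with hp₄
  have e4 : p₃ + (q : ℤ) • vec {reg c₄} ∅ + ((2 ^ q : ℕ) : ℤ) • vec ∅ {reg c₅} = p₄ := by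
    funext i
    rcases i with _ | r | x | c
    · simp [hp₃, hp₄, regPos, vec]
    · simp [hp₃, hp₄, regPos, vec]
    · simp [hp₃, hp₄, regPos, vec]
    · cases c <;> simp [hp₃, hp₄, regPos, vec]
  have h5 := det_power (x := (reg c₅ : Tp D R)) (y := reg c₄) (d := reg c₆) (d' := reg c₇)
    (by simp) (by simp) (by simp) (by simp) (by simp) (by simp) hC (p := p₄) (a := 2 ^ q)
    (by simp [hp₄, regPos]) (by simp [hp₄, regPos]) (by simp [hp₄, regPos]) (by simp [hp₄, regPos])
  set p₅ : Tp D R → ℤ := regPos fun c => match c with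
        | c₄ => N
        | _ => 0 with hp₅
  have e5 : p₄ + ((2 ^ q : ℕ) : ℤ) • vec {reg c₅} ∅ + ((2 ^ 2 ^ q : ℕ) : ℤ) • vec ∅ {reg c₄} = p₅ := by
    funext i
    rcases i with _ | r | x | c
    · simp [hp₅, hp₄, regPos, vec]
    · simp [hp₅, hp₄, regPos, vec]
    · simp [hp₅, hp₄, regPos, vec]
    · cases c <;> simp [hp₅, hp₄, regPos, vec, hN]
  have h6 := det_walk (x := (reg c₄ : Tp D R)) (ls := {reg c₄}) Bounded (C := marked w)
    (p := p₅) (k := N) (by simp) (hC _) (by simp [hp₅, regPos])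
  have e6 : p₅ + (N : ℤ) • vec {reg c₄} Bounded = (N : ℤ) • vec ∅ Bounded := by
    funext i
    rcases i with _ | r | x | c
    · simp [hp₅, regPos, vec]
    · simp [hp₅, regPos, vec]
    · simp [hp₅, regPos, vec]
    · cases c <;> simp [hp₅, regPos, vec, Bounded]
  have a1 : q < 2 ^ q := Nat.lt_two_pow_self
  have a2 : 2 ^ q < N := by rw [hN]; exact Nat.lt_two_pow_self
  have a3 : n + 2 ≤ q := by rw [hq]; nlinarith
  refine ((h1.seq_runs ((h2.to e2).seq_runs ((h3.to e3).seq_runs ((h4.to e4).seq_runs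
    ((h5.to e5).seq_runs (h6.to e6))))))).mono ?_
  refine Nat.add_le_add (by omega) (Nat.add_le_add ?_ (Nat.add_le_add (by omega)
    (Nat.add_le_add ?_ (Nat.add_le_add ?_ le_rfl))))
  · exact loopTime_mono (by omega) (loopTime_mono (by omega) le_rfl)
  · exact Nat.add_le_add le_rfl (Nat.mul_le_mul (by omega) (by omega))
  · rw [← hN]
    exact Nat.add_le_add le_rfl (Nat.mul_le_mul (by omega) (by omega))

open scoped Classical in
/-- The contents of the tapes after the ends of the counters have been marked. -/
noncomputable def bounded (w : List A) (N : ℕ) : Tp D R → ℤ → Sym A :=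
  fun i j => if i ∈ Bounded ∧ j = N then .fence else marked w i j

theorem origin_bounded (w : List A) {N : ℕ} (hN : 0 < N) (i : Tp D R) :
    Origin (bounded w N) i := by
  intro j
  unfold bounded
  split_ifs with h
  · obtain ⟨-, h⟩ := h
    simp; omega
  · exact origin_marked w i j

theorem bounded_fence (w : List A) {N : ℕ} {i : Tp D R} (hi : i ∈ Bounded) (j : ℕ) :
    bounded w N i j = .fence ↔ j = N := by
  by_cases hj : (j : ℤ) = N
  · simp [bounded, hi, hj]; exact_mod_cast hj
  · have : marked w i j ≠ .fence := by
      rcases i with _ | r | x | c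
      · simp [Bounded] at hi
      all_goals simp only [marked]; split_ifs <;> simp
    have h' : j ≠ N := by exact_mod_cast hj
    simp [bounded, hj, this, h']

open scoped Classical in
/-- Mark the ends of the counters in `Bounded` and return their heads to the origin. -/
noncomputable def markEnds : Prog (Tp D R) (Sym A) :=
  seq (one fun h => {(true, fun i => if i ∈ Bounded then (.fence, none) else (h i, none))})
    (walk (reg b₁) Bounded ∅)

theorem det_markEnds (w : List A) {N : ℕ} (hN : 0 < N) :
    (markEnds (D := D) (R := R)).Det ⟨marked w, (N : ℤ) • vec ∅ Bounded⟩ (N + 2) true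
      ⟨bounded w N, 0⟩ := by
  classical
  have hb : (reg b₁ : Tp D R) ∈ Bounded := by simp [Bounded]
  have h1 : (one fun h : Tp D R → Sym A =>
      {(true, fun i => if i ∈ Bounded then (.fence, none) else (h i, none))}).Det
      ⟨marked w, (N : ℤ) • vec ∅ Bounded⟩ 1 true ⟨bounded w N, (N : ℤ) • vec ∅ Bounded⟩ := by
    refine (runs_one _ _).congr fun b m' => ?_
    simp only [Set.mem_singleton_iff, Prod.mk.injEq]
    constructor
    · rintro ⟨_, ⟨rfl, rfl⟩, rfl⟩
      refine ⟨rfl, ?_⟩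
      unfold Mem.act
      simp only [Mem.mk.injEq]
      constructor
      · funext i j
        by_cases hi : i ∈ Bounded
        · by_cases hj : j = N
          · subst hj; simp [vec, hi, bounded]
          · simp [vec, hi, bounded, hj]
        · by_cases hj : j = 0
          · subst hj; simp [vec, hi, bounded, Mem.heads]
          · simp [vec, hi, bounded, hj]
      · funext i
        by_cases hi : i ∈ Bounded <;> simp [hi, shift]
    · rintro ⟨rfl, rfl⟩
      refine ⟨_, ⟨rfl, rfl⟩, ?_⟩
      unfold Mem.act
      simp only [Mem.mk.injEq]
      constructor
      · funext i j
        by_cases hi : i ∈ Bounded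
        · by_cases hj : j = N
          · subst hj; simp [vec, hi, bounded]
          · simp [vec, hi, bounded, hj]
        · by_cases hj : j = 0
          · subst hj; simp [vec, hi, bounded, Mem.heads]
          · simp [vec, hi, bounded, hj]
      · funext i
        by_cases hi : i ∈ Bounded <;> simp [hi, shift]
  have h2 := det_walk (x := (reg b₁ : Tp D R)) (ls := Bounded) ∅ (C := bounded w N)
    (p := (N : ℤ) • vec ∅ Bounded) (k := N) hb (origin_bounded w hN _) (by simp [vec, hb])
  refine Det.to ((h1.seq_runs h2).mono (by omega)) ?_
  funext i
  by_cases hi : i ∈ Bounded <;> simp [hi, vec]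

/-- The relation tapes. -/
def rels : Set (Tp D R) := Set.range .rel

/-- While the counter `cnt` is not exhausted, write an arbitrary bit on each relation tape. -/
noncomputable def guessBit : Prog (Tp D R) (Sym A) :=
  one fun h => {x | (h (reg cnt) ≠ .mark ∧ ∃ g : Fin R → Bool, x = (true, fun i => match i with
      | .rel r => (.bit (g r), some .right)
      | reg cnt => (h (reg cnt), some .left)
      | reg aux => (h (reg aux), some .right)
      | i => (h i, none))) ∨ (h (reg cnt) = .mark ∧ x = (false, moveAct ∅ ∅ h))}

/-- The contents `C`, except that on the relation tapes the cells from `s + 1` to `M` are given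
by `g`. -/
def overwrite (C : Tp D R → ℤ → Sym A) (s M : ℕ) (g : Fin R → ℕ → Bool) : Tp D R → ℤ → Sym A
  | .rel r, j => if s < j ∧ j ≤ M then .bit (g r (j - 1).toNat) else C (.rel r) j
  | i, j => C i j

theorem runs_guess_loop (C : Tp D R → ℤ → Sym A) (p : Tp D R → ℤ) (M k s : ℕ) (hs : s + k = M)
    (hC : ∀ j : ℕ, C (reg cnt) j = .mark ↔ j = 0) (hp : p (reg cnt) = k)
    (hr : ∀ r, p (.rel r) = (s : ℤ) + 1) :
    (loop (guessBit (A := A) (D := D) (R := R))).Runs ⟨C, p⟩ (k + 1) fun b m =>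
      b = true ∧ ∃ g, m = ⟨overwrite C s M g, p + (k : ℤ) • vec {reg cnt} ({reg aux} ∪ rels)⟩ := by
  induction k generalizing C p s with
  | zero =>
    have hsM : s = M := by omega
    subst hsM
    have e : ∀ g, overwrite C s s g = C := by
      intro g; funext i j
      rcases i with _ | r | _ | _ <;> simp only [overwrite]
      rw [if_neg (by omega)]
    have h0 : C (reg cnt) (p (reg cnt)) = .mark := by rw [hp, hC]
    refine ((Runs.loop (t' := 0) (Q := fun _ _ _ => False) (runs_one _ _) ?_).congr ?_).mono (by omega)
    · rintro m' ⟨α, hα, -⟩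
      simp [Mem.heads, h0] at hα
    · intro b m'
      have e2 := act_moveAct ∅ ∅ (⟨C, p⟩ : Mem (Tp D R) (Sym A))
      simp only [vec_empty, add_zero] at e2
      simp [Mem.heads, h0, e] at e2 ⊢
      simp [e2]
  | succ k ih =>
    have h0 : C (reg cnt) (p (reg cnt)) ≠ .mark := by rw [hp, Ne, hC]; omega
    have hact : ∀ g : Fin R → Bool, (⟨C, p⟩ : Mem (Tp D R) (Sym A)).act (fun i => match i with
      | .rel r => (.bit (g r), some .right)
      | reg cnt => (C (reg cnt) (p (reg cnt)), some .left)
      | reg aux => (C (reg aux) (p (reg aux)), some .right)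
      | i => (C i (p i), none)) =
        ⟨overwrite C s (s + 1) fun r _ => g r, p + vec {reg cnt} ({reg aux} ∪ rels)⟩ := by
      intro g
      unfold Mem.act
      simp only [Mem.mk.injEq]
      constructor
      · funext i j
        rcases i with _ | r | x | c
        · simp [overwrite]
        · by_cases hj : j = (s : ℤ) + 1
          · subst hj; simp [overwrite, hr]
          · have : ¬ ((s : ℤ) < j ∧ j ≤ s + 1) := by omega
            simp [overwrite, hr, hj, this]
        · simp [overwrite]
        · cases c <;> simp [overwrite]
      · funext i
        rcases i with _ | r | x | c
        · simp [shift, vec, rels]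
        · simp [shift, vec, rels]
        · simp [shift, vec, rels]
        · cases c <;> simp [shift, vec, rels]
    have h1 := runs_one (fun h : Tp D R → Sym A =>
      {x | (h (reg cnt) ≠ .mark ∧ ∃ g : Fin R → Bool, x = (true, fun i => match i with
      | .rel r => (.bit (g r), some .right)
      | reg cnt => (h (reg cnt), some .left)
      | reg aux => (h (reg aux), some .right)
      | i => (h i, none))) ∨ (h (reg cnt) = .mark ∧ x = (false, moveAct ∅ ∅ h))}) ⟨C, p⟩
    have h2 := h1.congr (Q := fun b m' => b = true ∧ ∃ g : Fin R → Bool, m' =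
        ⟨overwrite C s (s + 1) fun r _ => g r, p + vec {reg cnt} ({reg aux} ∪ rels)⟩) (by
      intro b m'
      simp only [Mem.heads, Set.mem_ofPred_eq, Prod.mk.injEq, h0, ne_eq, not_false_eq_true, true_and,
        false_and, or_false]
      constructor
      · rintro ⟨_, ⟨g, rfl, rfl⟩, rfl⟩
        exact ⟨rfl, g, hact g⟩
      · rintro ⟨rfl, g, rfl⟩
        exact ⟨_, ⟨g, rfl, rfl⟩, (hact g).symm⟩)
    refine ((Runs.loop (F := guessBit) (t' := k + 1) (Q := fun m' b m => b = true ∧ ∃ g, m =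
      ⟨overwrite m'.cell (s + 1) M g, p + vec {reg cnt} ({reg aux} ∪ rels) +
        (k : ℤ) • vec {reg cnt} ({reg aux} ∪ rels)⟩) h2 ?_).congr ?_).mono (by omega)
    · rintro _ ⟨-, g, rfl⟩
      refine ih _ _ (s + 1) (by omega) ?_ ?_ ?_
      · intro j; simpa [overwrite] using hC j
      · simp [vec, hp]
      · intro r; simp [vec, hr, rels]
    · intro b m
      simp only [Bool.false_eq_true, false_and, and_false, or_false, true_and]
      have e : ∀ (g : Fin R → Bool) (g' : Fin R → ℕ → Bool),
          overwrite (overwrite C s (s + 1) fun r _ => g r) (s + 1) M g' =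
          overwrite C s M fun r j => if j = s then g r else g' r j := by
        intro g g'
        funext i j
        rcases i with _ | r | x | c <;> simp only [overwrite]
        by_cases h1 : j = (s : ℤ) + 1
        · subst h1
          rw [if_neg (by push_cast; omega), if_pos (by push_cast; omega), if_pos (by omega)]
          simp
        · have h2 : (j - 1).toNat ≠ s ∨ j ≤ 0 := by omega
          by_cases h3 : (s : ℤ) < j ∧ j ≤ M
          · have h4 : (j - 1).toNat ≠ s := by omega
            rw [if_pos (by push_cast; omega), if_pos h3, if_neg h4]
          · rw [if_neg (by push_cast; omega), if_neg (by push_cast; omega), if_neg h3]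
      have e' : p + ((k + 1 : ℕ) : ℤ) • vec {reg cnt} ({reg aux} ∪ rels) =
          p + vec {reg cnt} ({reg aux} ∪ rels) + (k : ℤ) • vec {reg cnt} ({reg aux} ∪ rels) := by
        push_cast; module
      rw [e']
      constructor
      · rintro ⟨_, ⟨g, rfl⟩, rfl, g', rfl⟩
        exact ⟨rfl, _, by rw [e]⟩
      · rintro ⟨rfl, g, rfl⟩
        refine ⟨_, ⟨fun r => g r s, rfl⟩, rfl, g, ?_⟩
        rw [e]
        congr 2
        funext r j
        split_ifs with h
        · rw [h]
        · rfl

/-- Guess the relations. -/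
noncomputable def guess : Prog (Tp D R) (Sym A) :=
  seq (sweep (reg b₃) (sweep (reg b₂) (sweep (reg b₁) (move ∅ {reg cnt}))))
    (seq (move ∅ rels) (seq (loop guessBit) (seq (walk (reg aux) ({reg aux} ∪ rels) ∅) (move rels ∅))))

/-- A bound for the running time of `guess`. -/
def guessTime (N : ℕ) : ℕ :=
  loopTime N (loopTime N (loopTime N 1)) + (1 + (N ^ 3 + 1 + (N ^ 3 + 1 + 1)))

theorem runs_guess (w : List A) {N : ℕ} (hN : 0 < N) :
    (guess (A := A) (D := D) (R := R)).Runs ⟨bounded w N, 0⟩ (guessTime N) fun b m =>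
      b = true ∧ ∃ g, m = ⟨overwrite (bounded w N) 0 (N ^ 3) g, 0⟩ := by
  have hC := origin_bounded (D := D) (R := R) w hN
  have hst : ∀ i ∈ (Bounded : Set (Tp D R)), ∀ j : ℕ, j ≤ N → (bounded w N i j = .fence ↔ j = N) :=
    fun i hi j _ => bounded_fence w hi j
  have h1 := ((((adds_move (bounded w N) ∅ {(reg cnt : Tp D R)} 0).sweep (b := reg b₁) (N := N)
    (by simp) (by simp [vec]) (by simp) (by simp) (hC _) (hst _ (by simp [Bounded]))).sweep
    (b := reg b₂) (N := N) (by simp) (by simp [vec]) (by simp [vec]) (by simp) (hC _)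
    (hst _ (by simp [Bounded]))).sweep (b := reg b₃) (N := N) (by simp) (by simp [vec])
    (by simp [vec]) (by simp) (hC _) (hst _ (by simp [Bounded]))) 0 (fun _ _ => rfl)
  have e1 : (0 : Tp D R → ℤ) + (N : ℤ) • (N : ℤ) • (N : ℤ) • vec ∅ {reg cnt} =
      ((N ^ 3 : ℕ) : ℤ) • vec ∅ {reg cnt} := by push_cast; module
  set M := N ^ 3 with hM
  set p : Tp D R → ℤ := (M : ℤ) • vec ∅ {reg cnt} + vec ∅ rels with hp
  set u : Tp D R → ℤ := vec {reg cnt} ({reg aux} ∪ rels) with hu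
  have h2 := det_move ∅ rels (bounded w N) ((M : ℤ) • vec ∅ {(reg cnt : Tp D R)})
  have h3 := runs_guess_loop (bounded w N) p M M 0 (by omega) (hC _) (by simp [hp, vec, rels])
    (by intro r; simp [hp, vec, rels])
  have h4 : ∀ g, (seq (walk (reg aux) ({reg aux} ∪ rels) ∅) (move rels ∅)).Det
      ⟨overwrite (bounded w N) 0 M g, p + (M : ℤ) • u⟩ (M + 1 + 1) true
      ⟨overwrite (bounded w N) 0 M g, 0⟩ := by
    intro g
    refine Det.to ((det_walk (k := M) _ (by simp) ?_ ?_).seq_runs (det_move _ _ _ _)) ?_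
    · intro j; simpa [overwrite] using hC (reg aux) j
    · simp [hp, hu, vec, rels]
    · funext i
      rcases i with _ | r | x | c
      · simp [hp, hu, vec, rels]
      · simp [hp, hu, vec, rels]
      · simp [hp, hu, vec, rels]
      · cases c <;> simp [hp, hu, vec, rels]
  refine (h1.to e1).seq_runs (h2.seq_runs ?_)
  have h5 : ∀ m', (true = true ∧ ∃ g, m' = (⟨overwrite (bounded w N) 0 M g, p + (M : ℤ) • u⟩ :
      Mem (Tp D R) (Sym A))) → (seq (walk (reg aux) ({reg aux} ∪ rels) ∅) (move rels ∅)).Runs m'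
      (M + 1 + 1) fun b m => b = true ∧ m = ⟨m'.cell, 0⟩ := by
    rintro _ ⟨-, g, rfl⟩
    exact h4 g
  refine (Runs.branch h3 h5 (fun m' h => by simp at h)).congr ?_
  intro b m
  constructor
  · rintro ⟨_, _, ⟨-, g, rfl⟩, rfl, rfl⟩
    exact ⟨rfl, g, rfl⟩
  · rintro ⟨rfl, g, rfl⟩
    exact ⟨true, _, ⟨rfl, g, rfl⟩, rfl, rfl⟩

theorem layout_overwrite (w : List A) {N : ℕ} (hN : 0 < N) (g : Fin R → ℕ → Bool) :
    Layout (overwrite (bounded w N) 0 (N ^ 3) g : Tp D R → ℤ → Sym A) N w g where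
  origin i j := by
    have h := origin_bounded w hN i j
    rcases i with _ | r | x | c <;> simp only [overwrite]
    · exact h
    · split_ifs with h'
      · simp; omega
      · exact h
    · exact h
    · exact h
  inp k a := by
    have : bounded w N (inp : Tp D R) ((k : ℤ) + 1) = marked w (inp : Tp D R) ((k : ℤ) + 1) := by
      simp [bounded, Bounded]
    simp only [overwrite]
    rw [this, marked_inp w k]
    cases w[k]? <;> simp
  fence i hi j hj := by
    rcases i with _ | r | x | c
    · simp [Bounded] at hi
    · simp [Bounded] at hi
    · exact bounded_fence w hi j
    · exact bounded_fence w hi j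
  rel r k hk := by
    simp only [overwrite]
    rw [if_pos ⟨by omega, by exact_mod_cast hk⟩]
    simp

/-- The program that guesses the relations and evaluates the formula. -/
noncomputable def check (φ : Fml A D R) : Prog (Tp D R) (Sym A) :=
  seq markOrigins (seq count (seq markEnds (seq guess (eval φ))))

/-- The outcomes of the program correspond to the structures that can be guessed. -/
theorem runs_check {φ : Fml A D R} (hφ : φ.ok []) (w : List A) {N : ℕ}
    (hN : N = 2 ^ 2 ^ (w.length + 2) ^ 2) :
    (check φ).Runs (initMem inp Sym.letter w)
      (2 + (countTime N + ((N + 2) + (guessTime N + cost N φ)))) fun b m => ∃ g : Fin R → ℕ → Bool,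
        b = truth (φ.Sat N w (fun r i j k => g r (index N i j k) = true) fun _ => 0) ∧
        m = ⟨overwrite (bounded w N) 0 (N ^ 3) g, 0⟩ := by
  have hN0 : 0 < N := by rw [hN]; positivity
  have e0 : (posOf (fun _ => 0) : Tp D R → ℤ) = 0 := by
    funext i; rcases i with _ | r | x | c <;> rfl
  refine (det_markOrigins w).seq_runs ((det_count w hN).seq_runs ((det_markEnds w hN0).seq_runs ?_))
  have h1 : ∀ g, (eval φ).Det ⟨overwrite (bounded w N) 0 (N ^ 3) g, 0⟩ (cost N φ)
      (truth (φ.Sat N w (fun r i j k => g r (index N i j k) = true) fun _ => 0))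
      ⟨overwrite (bounded w N) 0 (N ^ 3) g, 0⟩ := by
    intro g
    have := det_eval (layout_overwrite (D := D) w hN0 g) φ hφ (fun _ => 0) (fun _ => hN0) (fun _ _ => rfl)
    rwa [e0] at this
  have h2 : ∀ m', (true = true ∧ ∃ g, m' = (⟨overwrite (bounded w N) 0 (N ^ 3) g, 0⟩ :
      Mem (Tp D R) (Sym A))) → (eval φ).Runs m' (cost N φ) fun b m => ∃ g : Fin R → ℕ → Bool,
        m' = ⟨overwrite (bounded w N) 0 (N ^ 3) g, 0⟩ ∧
        b = truth (φ.Sat N w (fun r i j k => g r (index N i j k) = true) fun _ => 0) ∧ m = m' := by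
    rintro _ ⟨-, g, rfl⟩
    refine (h1 g).congr fun b m => ⟨fun h => ⟨g, rfl, h⟩, ?_⟩
    rintro ⟨g', h, rfl, rfl⟩
    refine ⟨?_, rfl⟩
    congr 1
    refine propext (Fml.sat_congr (fun r i hi j hj k hk => ?_) φ (fun _ => hN0))
    have hlt := index_lt hi hj hk
    have h3 := (layout_overwrite (D := D) w hN0 g).rel r _ hlt
    have h4 := (layout_overwrite (D := D) w hN0 g').rel r _ hlt
    rw [Mem.mk.injEq] at h
    rw [← h.1, h3] at h4
    simp only [Sym.bit.injEq] at h4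
    rw [h4]
  refine (Runs.branch (runs_guess w hN0) h2 (fun m' h => by simp at h)).congr ?_
  intro b m
  constructor
  · rintro ⟨_, _, ⟨-, -⟩, g, rfl, rfl, rfl⟩
    exact ⟨g, rfl, rfl⟩
  · rintro ⟨g, rfl, rfl⟩
    exact ⟨true, _, ⟨rfl, g, rfl⟩, g, rfl, rfl, rfl⟩

/-! ### Time bounds -/

/-- The function is bounded by a power of its argument. -/
def PowerBounded (f : ℕ → ℕ) : Prop := ∃ c, ∀ N, 2 ≤ N → f N ≤ N ^ c

theorem powerBounded_id : PowerBounded fun N => N := ⟨1, fun N _ => by simp⟩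

theorem powerBounded_const (a : ℕ) : PowerBounded fun _ => a :=
  ⟨a, fun _ hN => (Nat.lt_pow_self hN).le⟩

theorem PowerBounded.mul {f g : ℕ → ℕ} (hf : PowerBounded f) (hg : PowerBounded g) :
    PowerBounded fun N => f N * g N := by
  obtain ⟨c, hc⟩ := hf
  obtain ⟨d, hd⟩ := hg
  exact ⟨c + d, fun N hN => by rw [pow_add]; exact Nat.mul_le_mul (hc N hN) (hd N hN)⟩

theorem PowerBounded.add {f g : ℕ → ℕ} (hf : PowerBounded f) (hg : PowerBounded g) :
    PowerBounded fun N => f N + g N := by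
  obtain ⟨c, hc⟩ := hf
  obtain ⟨d, hd⟩ := hg
  refine ⟨c + d + 1, fun N hN => ?_⟩
  have h1 : N ^ c ≤ N ^ (c + d) := Nat.pow_le_pow_right (by omega) (by omega)
  have h2 : N ^ d ≤ N ^ (c + d) := Nat.pow_le_pow_right (by omega) (by omega)
  have h3 : N ^ (c + d) * 2 ≤ N ^ (c + d) * N := Nat.mul_le_mul_left _ hN
  rw [pow_succ]
  have h4 := hc N hN
  have h5 := hd N hN
  change f N + g N ≤ _
  omega

theorem PowerBounded.cube : PowerBounded fun N => N ^ 3 := ⟨3, fun _ _ => le_rfl⟩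

theorem PowerBounded.loopTime {f : ℕ → ℕ} (hf : PowerBounded f) :
    PowerBounded fun N => loopTime N (f N) :=
  ((powerBounded_id.add (powerBounded_const 1)).mul (hf.add (powerBounded_const 2))).add
    (powerBounded_id.add (powerBounded_const 1))

theorem powerBounded_cost (φ : Fml A D R) : PowerBounded fun N => cost N φ := by
  have hid := powerBounded_id
  have hc := powerBounded_const
  induction φ with
  | lt x y => exact ((hc 2).mul hid).add (hc 4)
  | succ x y => exact ((hc 2).mul hid).add (hc 9)
  | letter a x => exact ((hc 5).mul hid).add (hc 5)
  | rel r x y z =>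
    have h1 := (hc 1).loopTime
    exact (((h1.loopTime.loopTime.add h1.loopTime).add h1).add .cube).add (hc 5)
  | neg φ ih => exact ih.add (hc 1)
  | and φ ψ ih1 ih2 => exact ih1.add (ih2.add (hc 1))
  | ex x φ ih => exact ((hid.add (hc 1)).mul (ih.add (hc 2))).add (hid.add (hc 3))

theorem powerBounded_check (φ : Fml A D R) : PowerBounded fun N =>
    2 + (countTime N + ((N + 2) + (guessTime N + cost N φ))) := by
  have hid := powerBounded_id
  have hc := powerBounded_const
  have h1 := (hc 1).loopTime
  have h2 : PowerBounded fun N => 1 + (N + 1) * (1 + 3 * (N + 1)) :=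
    (hc 1).add ((hid.add (hc 1)).mul ((hc 1).add ((hc 3).mul (hid.add (hc 1)))))
  have h3 : PowerBounded countTime :=
    (((hc 2).mul hid).add (hc 5)).add (h1.loopTime.add ((hid.add (hc 1)).add
      (h2.add (h2.add (hid.add (hc 1))))))
  have h4 : PowerBounded guessTime :=
    h1.loopTime.loopTime.add ((hc 1).add ((PowerBounded.cube.add (hc 1)).add
      ((PowerBounded.cube.add (hc 1)).add (hc 1))))
  exact (hc 2).add (h3.add ((hid.add (hc 2)).add (h4.add (powerBounded_cost φ))))

end Prog

open Prog

/-- A language is in N2ExpTime if membership of `w` can be expressed by a fixed first-order formula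
with guessed relations over the numbers below `2 ^ 2 ^ ((|w| + 2) ^ 2)`. -/
theorem mem_N2ExpTime {A : Type} [Finite A] {D R : ℕ} {L : Language A} (φ : Fml A D R)
    (hφ : φ.ok [] = true)
    (h : ∀ w, w ∈ L ↔ ∃ G, φ.Sat (2 ^ 2 ^ (w.length + 2) ^ 2) w G fun _ => 0) :
    L ∈ Complexity.N2ExpTime A := by
  obtain ⟨c, hc⟩ := powerBounded_check φ
  obtain ⟨k, e₀, he₀⟩ : ∃ (k : ℕ) (e : Fin (k + 1) ≃ Tp D R), e 0 = .inp := by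
    obtain ⟨n, ⟨e⟩⟩ := Finite.exists_equiv_fin (Tp D R)
    obtain _ | k := n
    · exact (e .inp).elim0
    · exact ⟨k, (Equiv.swap 0 (e .inp)).trans e.symm, by simp⟩
  let p : Polynomial ℕ := (Polynomial.X + Polynomial.C 2) ^ 2 + Polynomial.C c
  refine ⟨(check φ).toNTM e₀ ⟨Sym.letter, fun a b h => by simpa using h⟩ (fun a => by
    change Sym.letter a ≠ Sym.blank; simp), p, ?_⟩
  refine toNTM_decides _ e₀ _ _ (P := fun w b m => ∃ g : Fin R → ℕ → Bool,
    b = truth (φ.Sat (2 ^ 2 ^ (w.length + 2) ^ 2) w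
      (fun r i j k => g r (index (2 ^ 2 ^ (w.length + 2) ^ 2) i j k) = true) fun _ => 0) ∧
        m = ⟨overwrite (bounded w (2 ^ 2 ^ (w.length + 2) ^ 2)) 0
          ((2 ^ 2 ^ (w.length + 2) ^ 2) ^ 3) g, 0⟩) (fun w => ?_) (fun w => ?_)
  · rw [he₀]
    refine (runs_check hφ w rfl).mono ((hc _ ?_).trans ?_)
    · calc 2 = 2 ^ 1 := by norm_num
        _ ≤ _ := Nat.pow_le_pow_right (by omega) Nat.one_le_two_pow
    · rw [← pow_mul]
      refine Nat.pow_le_pow_right (by omega) ?_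
      have : p.eval w.length = (w.length + 2) ^ 2 + c := by simp [p]
      rw [this, pow_add]
      exact Nat.mul_le_mul_left _ Nat.lt_two_pow_self.le
  · rw [h w]
    set N := 2 ^ 2 ^ (w.length + 2) ^ 2 with hN
    have hN0 : 0 < N := by rw [hN]; positivity
    constructor
    · classical
      rintro ⟨G, hG⟩
      refine ⟨_, fun r x => decide (G r (x / N / N) (x / N % N) (x % N)), ?_, rfl⟩
      rw [truth_true]
      refine (Fml.sat_congr (fun r i hi j hj k hk => ?_) φ (fun _ => hN0)).1 hG
      have e1 : index N i j k % N = k := by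
        simp [index, Nat.add_mod, Nat.mod_eq_of_lt hk]
      have e2 : index N i j k / N = i * N + j := by
        rw [index, Nat.add_comm, Nat.add_mul_div_right _ _ hN0, Nat.div_eq_of_lt hk, zero_add]
      have e3 : (i * N + j) / N = i := by
        rw [Nat.add_comm, Nat.add_mul_div_right _ _ hN0, Nat.div_eq_of_lt hj, zero_add]
      have e4 : (i * N + j) % N = j := by
        simp [Nat.add_mod, Nat.mod_eq_of_lt hj]
      simp [e1, e2, e3, e4]
    · rintro ⟨_, g, hg, -⟩
      refine ⟨fun r i j k => g r (index N i j k) = true, ?_⟩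
      by_contra hn
      rw [truth_false hn] at hg
      simp at hg

end TapeProgram

/-! ### The fragment evaluated on sets of valuations -/

namespace HyperLTL

open Function (update)

/-- A valuation of the atomic propositions for every quantifier ("slot") of a formula. -/
abbrev Val : Type := ℕ → Set ℕ

namespace QF

/-- Truth of a Boolean formula under a valuation; `bind` maps a trace variable to the slot that
binds it. Temporal formulas are given an arbitrary truth value. -/
def BSat (bind : ℕ → Option ℕ) : QF → Val → Prop
  | atom a x, z => ∃ s, bind x = some s ∧ a ∈ z s
  | neg ψ, z => ¬ ψ.BSat bind z
  | or ψ₁ ψ₂, z => ψ₁.BSat bind z ∨ ψ₂.BSat bind z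
  | and ψ₁ ψ₂, z => ψ₁.BSat bind z ∧ ψ₂.BSat bind z
  | _, _ => False

/-- Truth at position `i` of a formula of the fragment, if `P` gives the valuations at the first
positions and `Q` is the set of all valuations that occur. -/
def FSat (bind : ℕ → Option ℕ) : QF → (ℕ → Val) → Set Val → ℕ → Prop
  | atom a x, P, _, i => ∃ s, bind x = some s ∧ a ∈ P i s
  | neg ψ, P, Q, i => ¬ ψ.FSat bind P Q i
  | or ψ₁ ψ₂, P, Q, i => ψ₁.FSat bind P Q i ∨ ψ₂.FSat bind P Q i
  | and ψ₁ ψ₂, P, Q, i => ψ₁.FSat bind P Q i ∧ ψ₂.FSat bind P Q i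
  | next ψ, P, Q, i => ψ.FSat bind P Q (i + 1)
  | .until _ _, _, _, _ => False
  | ev ψ, _, Q, _ => ∃ z ∈ Q, ψ.BSat bind z
  | alw ψ, _, Q, _ => ∀ z ∈ Q, ψ.BSat bind z

/-- The nesting depth of `X`, not counting the operands of the other temporal operators. -/
def depth : QF → ℕ
  | neg ψ => ψ.depth
  | or ψ₁ ψ₂ => max ψ₁.depth ψ₂.depth
  | and ψ₁ ψ₂ => max ψ₁.depth ψ₂.depth
  | next ψ => ψ.depth + 1
  | _ => 0

theorem bsat_congr {bind : ℕ → Option ℕ} {z z' : Val} (h : ∀ x s, bind x = some s → z s = z' s)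
    (ψ : QF) : ψ.BSat bind z ↔ ψ.BSat bind z' := by
  induction ψ with
  | atom a x => exact exists_congr fun s => and_congr_right fun hs => by rw [h x s hs]
  | neg ψ ih => exact not_congr ih
  | or ψ₁ ψ₂ ih1 ih2 => exact or_congr ih1 ih2
  | and ψ₁ ψ₂ ih1 ih2 => exact and_congr ih1 ih2
  | _ => rfl

theorem fsat_congr {bind : ℕ → Option ℕ} {P P' : ℕ → Val} {Q Q' : Set Val} {n : ℕ}
    (hP : ∀ i < n, ∀ x s, bind x = some s → P i s = P' i s)
    (hQ : ∀ z ∈ Q, ∃ z' ∈ Q', ∀ x s, bind x = some s → z s = z' s)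
    (hQ' : ∀ z' ∈ Q', ∃ z ∈ Q, ∀ x s, bind x = some s → z s = z' s) (ψ : QF) {i : ℕ}
    (hi : i + ψ.depth < n) : ψ.FSat bind P Q i ↔ ψ.FSat bind P' Q' i := by
  induction ψ generalizing i with
  | atom a x =>
    exact exists_congr fun s => and_congr_right fun hs => by rw [hP i (by simpa [depth] using hi) x s hs]
  | neg ψ ih => exact not_congr (ih hi)
  | or ψ₁ ψ₂ ih1 ih2 =>
    simp only [depth] at hi
    exact or_congr (ih1 (by omega)) (ih2 (by omega))
  | and ψ₁ ψ₂ ih1 ih2 =>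
    simp only [depth] at hi
    exact and_congr (ih1 (by omega)) (ih2 (by omega))
  | next ψ ih =>
    simp only [depth] at hi
    exact ih (by omega)
  | ev ψ =>
    constructor
    · rintro ⟨z, hz, h⟩
      obtain ⟨z', hz', e⟩ := hQ z hz
      exact ⟨z', hz', (bsat_congr e ψ).1 h⟩
    · rintro ⟨z', hz', h⟩
      obtain ⟨z, hz, e⟩ := hQ' z' hz'
      exact ⟨z, hz, (bsat_congr e ψ).2 h⟩
  | alw ψ =>
    constructor
    · intro h z' hz'
      obtain ⟨z, hz, e⟩ := hQ' z' hz'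
      exact (bsat_congr e ψ).1 (h z hz)
    · intro h z hz
      obtain ⟨z', hz', e⟩ := hQ z hz
      exact (bsat_congr e ψ).2 (h z' hz')
  | _ => rfl

theorem fsat_of_isBoolean {bind : ℕ → Option ℕ} {ψ : QF} (h : ψ.IsBoolean) (P : ℕ → Val)
    (Q : Set Val) (i : ℕ) : ψ.FSat bind P Q i ↔ ψ.BSat bind (P i) := by
  induction h with
  | atom => rfl
  | neg _ ih => exact not_congr ih
  | or _ _ ih1 ih2 => exact or_congr ih1 ih2
  | and _ _ ih1 ih2 => exact and_congr ih1 ih2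

/-- The assignment in which a variable denotes the trace of the slot that binds it. -/
def _root_.HyperLTL.assignment (bind : ℕ → Option ℕ) (τ : ℕ → Trace) : Assignment :=
  fun x => (bind x).map τ

theorem sat_of_isBoolean {bind : ℕ → Option ℕ} {ψ : QF} (h : ψ.IsBoolean) (τ : ℕ → Trace) (i : ℕ) :
    ψ.Sat ((assignment bind τ).suffix i) ↔ ψ.BSat bind fun s => τ s i := by
  induction h with
  | atom a x =>
    simp only [Sat, BSat, assignment, Assignment.suffix]
    cases hx : bind x <;> simp
  | neg _ ih => exact not_congr ih
  | or _ _ ih1 ih2 => exact or_congr ih1 ih2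
  | and _ _ ih1 ih2 => exact and_congr ih1 ih2

theorem _root_.HyperLTL.Assignment.suffix_suffix (ρ : Assignment) (i j : ℕ) :
    (ρ.suffix i).suffix j = ρ.suffix (i + j) := by
  funext x
  simp only [Assignment.suffix, Option.map_map]
  congr 1
  funext t k
  simp only [Function.comp]
  congr 1
  omega

theorem _root_.HyperLTL.Assignment.suffix_zero (ρ : Assignment) : ρ.suffix 0 = ρ := by
  funext x
  simp only [Assignment.suffix]
  exact Option.map_id'

theorem sat_next {bind : ℕ → Option ℕ} {ψ : QF} (h : ψ.IsBoolean) (τ : ℕ → Trace) (Q : Set Val)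
    (n i : ℕ) : (QF.next^[n] ψ).Sat ((assignment bind τ).suffix i) ↔
      (QF.next^[n] ψ).FSat bind (fun i s => τ s i) Q i := by
  induction n generalizing i with
  | zero => exact (sat_of_isBoolean h τ i).trans (fsat_of_isBoolean h (fun i s => τ s i) Q i).symm
  | succ n ih =>
    rw [Function.iterate_succ_apply']
    simp only [Sat, FSat, Assignment.suffix_suffix]
    exact ih (i + 1)

/-- A formula of the fragment only depends on the valuations at the first positions and on the set
of all valuations that occur. -/
theorem sat_iff_fsat {bind : ℕ → Option ℕ} {ψ : QF} (h : ψ.IsFGX) (τ : ℕ → Trace) :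
    ψ.Sat (assignment bind τ) ↔
      ψ.FSat bind (fun i s => τ s i) (Set.range fun i s => τ s i) 0 := by
  induction h with
  | neg _ ih => exact not_congr ih
  | or _ _ ih1 ih2 => exact or_congr ih1 ih2
  | and _ _ ih1 ih2 => exact and_congr ih1 ih2
  | next n h => rw [← sat_next h, Assignment.suffix_zero]
  | ev h =>
    simp only [Sat, FSat, Set.exists_range_iff]
    exact exists_congr fun i => sat_of_isBoolean h τ i
  | alw h =>
    simp only [Sat, FSat, Set.forall_mem_range]
    exact forall_congr' fun i => sat_of_isBoolean h τ i
  | bool h => rw [← Assignment.suffix_zero (assignment bind τ), sat_of_isBoolean h, fsat_of_isBoolean h]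

end QF

/-! ### Skolem form of the quantifier prefix -/

/-- Existential quantification over a list of pairs of a variable and a slot. -/
def exs (L : List (ℕ × ℕ)) (φ : Formula) : Formula := L.foldr (fun p φ => .ex p.1 φ) φ

/-- The slot that binds a variable: the innermost one. -/
def bindOf (L : List (ℕ × ℕ)) (x : ℕ) : Option ℕ :=
  L.foldl (fun b p => if p.1 = x then some p.2 else b) none

theorem bindOf_append_singleton (L : List (ℕ × ℕ)) (p : ℕ × ℕ) (x : ℕ) :
    bindOf (L ++ [p]) x = if p.1 = x then some p.2 else bindOf L x := by
  simp [bindOf, List.foldl_append]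

theorem mem_of_bindOf {L : List (ℕ × ℕ)} {x s : ℕ} (h : bindOf L x = some s) : (x, s) ∈ L := by
  induction L using List.reverseRecOn with
  | nil => simp [bindOf] at h
  | append_singleton L p ih =>
    rw [bindOf_append_singleton] at h
    split_ifs at h with hp
    · simp only [Option.some.injEq] at h
      simp [← hp, ← h]
    · simp [ih h]

theorem assignment_append_singleton (L : List (ℕ × ℕ)) (p : ℕ × ℕ) (τ : ℕ → Trace) :
    assignment (bindOf (L ++ [p])) τ = (assignment (bindOf L) τ).set p.1 (τ p.2) := by
  funext x
  simp only [assignment, bindOf_append_singleton, Assignment.set]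
  by_cases h : p.1 = x
  · subst h; simp
  · simp [h, Function.update_of_ne (Ne.symm h), assignment]

theorem assignment_congr {L : List (ℕ × ℕ)} {τ τ' : ℕ → Trace} (h : ∀ p ∈ L, τ p.2 = τ' p.2) :
    assignment (bindOf L) τ = assignment (bindOf L) τ' := by
  funext x
  simp only [assignment]
  cases hx : bindOf L x with
  | none => rfl
  | some s => simpa using h _ (mem_of_bindOf hx)

/-- Existential quantifiers choose traces for the slots in `L`; those in `L₀` are bound already. -/
theorem sat_exs {T : Set Trace} (L₀ L : List (ℕ × ℕ)) (φ : Formula) (τ : ℕ → Trace)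
    (hL : ((L₀ ++ L).map Prod.snd).Nodup) :
    (exs L φ).Sat T (assignment (bindOf L₀) τ) ↔ ∃ τ' : ℕ → Trace, (∀ p ∈ L₀, τ' p.2 = τ p.2) ∧
      (∀ p ∈ L, τ' p.2 ∈ T) ∧ φ.Sat T (assignment (bindOf (L₀ ++ L)) τ') := by
  induction L generalizing L₀ τ with
  | nil =>
    simp only [exs, List.foldr_nil, List.append_nil, List.not_mem_nil, false_imp_iff, implies_true,
      true_and]
    exact ⟨fun h => ⟨τ, fun _ _ => rfl, h⟩, fun ⟨τ', h, h'⟩ => by rwa [← assignment_congr h]⟩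
  | cons p L ih =>
    have hL' : (((L₀ ++ [p]) ++ L).map Prod.snd).Nodup := by simpa using hL
    have hp : ∀ p' ∈ L₀, p'.2 ≠ p.2 := by
      intro p' hp' e
      rw [List.map_append, List.nodup_append] at hL
      exact hL.2.2 p'.2 (List.mem_map_of_mem hp') p.2 (by simp) e
    have key : ∀ t, (assignment (bindOf L₀) τ).set p.1 t =
        assignment (bindOf (L₀ ++ [p])) (update τ p.2 t) := by
      intro t
      rw [assignment_append_singleton, Function.update_self]
      rw [assignment_congr (τ := τ) (τ' := update τ p.2 t)]
      intro p' hp'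
      rw [Function.update_of_ne (hp p' hp')]
    change (∃ t ∈ T, (exs L φ).Sat T ((assignment (bindOf L₀) τ).set p.1 t)) ↔ _
    simp only [key, ih _ _ hL', List.append_assoc, List.singleton_append]
    constructor
    · rintro ⟨t, ht, τ', h1, h2, h3⟩
      refine ⟨τ', fun p' hp' => ?_, ?_, h3⟩
      · rw [h1 p' (by simp [hp']), Function.update_of_ne (hp p' hp')]
      · intro p' hp'
        rcases List.mem_cons.1 hp' with rfl | hp'
        · rw [h1 p' (by simp)]; simpa using ht
        · exact h2 p' hp'
    · rintro ⟨τ', h1, h2, h3⟩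
      refine ⟨τ' p.2, h2 p (by simp), τ', fun p' hp' => ?_, fun p' hp' => h2 p' (by simp [hp']), h3⟩
      rcases List.mem_append.1 hp' with hp' | hp'
      · rw [h1 p' hp', Function.update_of_ne (hp p' hp')]
      · obtain rfl := List.mem_singleton.1 hp'
        simp

/-- The traces of the slots: `τ` above the slot `y`, `t` at `y`, and `τ'` below `y`. -/
def comb (y : ℕ) (τ : ℕ → Trace) (t : Trace) (τ' : ℕ → Trace) : ℕ → Trace :=
  fun s => if s < y then τ' s else if s = y then t else τ s

/-- A prefix `∃*∀∃*` in Skolem form. -/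
theorem sat_prefix {T : Set Trace} {E W : List (ℕ × ℕ)} {p : ℕ × ℕ} {ψ : QF}
    (hE : ∀ q ∈ E, p.2 < q.2) (hW : ∀ q ∈ W, q.2 < p.2)
    (hL : ((E ++ p :: W).map Prod.snd).Nodup) :
    (exs E (.all p.1 (exs W (.qf ψ)))).Sat T Assignment.empty ↔
      ∃ τ : ℕ → Trace, (∀ q ∈ E, τ q.2 ∈ T) ∧ ∀ t ∈ T, ∃ τ' : ℕ → Trace, (∀ q ∈ W, τ' q.2 ∈ T) ∧
        ψ.Sat (assignment (bindOf (E ++ p :: W)) (comb p.2 τ t τ')) := by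
  have hL1 : (([] ++ E).map Prod.snd).Nodup := by
    rw [List.map_append, List.nodup_append] at hL
    simpa using hL.1
  have hL2 : (((E ++ [p]) ++ W).map Prod.snd).Nodup := by simpa using hL
  have e0 : Assignment.empty = assignment (bindOf []) fun _ _ => ∅ := rfl
  rw [e0, sat_exs [] E _ _ hL1]
  have hp : ∀ p' ∈ E, p'.2 ≠ p.2 := fun p' h => (hE p' h).ne'
  have key : ∀ (τ : ℕ → Trace) t, (assignment (bindOf E) τ).set p.1 t =
      assignment (bindOf (E ++ [p])) (update τ p.2 t) := by
    intro τ t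
    rw [assignment_append_singleton, Function.update_self]
    rw [assignment_congr (τ := τ) (τ' := update τ p.2 t)]
    intro p' hp'
    rw [Function.update_of_ne (hp p' hp')]
  simp only [List.not_mem_nil, false_imp_iff, implies_true, true_and, List.nil_append]
  refine exists_congr fun τ => and_congr_right fun hτ => forall_congr' fun t => forall_congr' fun ht => ?_
  rw [key, sat_exs _ _ _ _ hL2]
  simp only [List.append_assoc, List.singleton_append]
  constructor
  · rintro ⟨τ', h1, h2, h3⟩
    refine ⟨τ', h2, ?_⟩
    rwa [assignment_congr (τ' := τ')]
    intro q hq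
    rcases List.mem_append.1 hq with hq | hq
    · have := hE q hq
      rw [h1 q (by simp [hq]), Function.update_of_ne (hp q hq)]
      simp [comb, this.ne', this.le]
    · rcases List.mem_cons.1 hq with rfl | hq
      · rw [h1 q (by simp)]; simp [comb]
      · simp [comb, hW q hq]
  · rintro ⟨τ', h2, h3⟩
    refine ⟨comb p.2 τ t τ', fun q hq => ?_, fun q hq => ?_, h3⟩
    · rcases List.mem_append.1 hq with hq | hq
      · have := hE q hq
        rw [Function.update_of_ne (hp q hq)]
        simp [comb, this.ne', this.le]
      · obtain rfl := List.mem_singleton.1 hq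
        simp [comb]
    · simp only [comb, hW q hq, if_true]
      exact h2 q hq

end HyperLTL

/-! ### Certificates for satisfiability -/

namespace HyperLTL

open Function (update)

/-- The two valuations agree on the slots in `E`. -/
def Agree (E : Set ℕ) (z z' : Val) : Prop := ∀ s ∈ E, z s = z' s

theorem Agree.symm {E : Set ℕ} {z z' : Val} (h : Agree E z z') : Agree E z' z :=
  fun s hs => (h s hs).symm

theorem Agree.trans {E : Set ℕ} {z z' z'' : Val} (h : Agree E z z') (h' : Agree E z' z'') :
    Agree E z z'' := fun s hs => (h s hs).trans (h' s hs)

/-- A certificate for the satisfiability of a sentence with prefix `∃*∀∃*`, where `E` and `W` are the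
slots of the existential quantifiers before and after the universal quantifier with slot `y`. The
elements of `Θ` are types of traces `t`, considered together with witnesses for the existential
quantifiers. The type determines the valuations `P` at the first `n` positions, the set `Q` of all
valuations that occur at some position, and the types of the witnesses. -/
structure Cert (Θ : Type) (E W : Set ℕ) (y n : ℕ) where
  /-- The valuations at the first positions. -/
  P : Θ → ℕ → Val
  /-- The valuations that occur. -/
  Q : Θ → Set Val
  /-- The type of the witness for a slot in `W`. -/
  child : Θ → ℕ → Θ
  /-- The type of the witness for a slot in `E`. -/
  root : ℕ → Θ
  P_mem : ∀ θ, ∀ i < n, P θ i ∈ Q θ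
  P_agree : ∀ θ θ', ∀ i < n, Agree E (P θ i) (P θ' i)
  P_child : ∀ θ, ∀ s ∈ W, ∀ i < n, P θ i s = P (child θ s) i y
  Q_agree : ∀ θ θ', ∀ z ∈ Q θ, ∃ z' ∈ Q θ', Agree E z z'
  Q_down : ∀ θ, ∀ s ∈ W, ∀ z ∈ Q θ, ∃ z' ∈ Q (child θ s), Agree E z z' ∧ z s = z' y
  Q_up : ∀ θ, ∀ s ∈ W, ∀ z' ∈ Q (child θ s), ∃ z ∈ Q θ, Agree E z z' ∧ z s = z' y
  Q_root : ∀ s ∈ E, ∀ z ∈ Q (root s), z s = z y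

namespace Cert

variable {Θ : Type} {E W : Set ℕ} {y n : ℕ} (c : Cert Θ E W y n)

/-- The valuations of a node and of its child number `s` fit together. -/
def Step (_ : Cert Θ E W y n) (s : ℕ) (z z' : Val) : Prop := Agree E z z' ∧ (s ∈ W → z s = z' y)

/-- The type of a node of the tree with root type `θ`. A node is given by the path to it, the last
step first. -/
def type (c : Cert Θ E W y n) (θ : Θ) : List ℕ → Θ
  | [] => θ
  | s :: l => c.child (type c θ l) s

theorem exists_down (θ : Θ) (s : ℕ) {z : Val} (hz : z ∈ c.Q θ) :
    ∃ z' ∈ c.Q (c.child θ s), c.Step s z z' := by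
  by_cases hs : s ∈ W
  · obtain ⟨z', h, h1, h2⟩ := c.Q_down θ s hs z hz
    exact ⟨z', h, h1, fun _ => h2⟩
  · obtain ⟨z', h, h1⟩ := c.Q_agree θ (c.child θ s) z hz
    exact ⟨z', h, h1, fun h => absurd h hs⟩

theorem exists_up (θ : Θ) (s : ℕ) {z' : Val} (hz : z' ∈ c.Q (c.child θ s)) :
    ∃ z ∈ c.Q θ, c.Step s z z' := by
  by_cases hs : s ∈ W
  · obtain ⟨z', h, h1, h2⟩ := c.Q_up θ s hs _ hz
    exact ⟨z', h, h1, fun _ => h2⟩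
  · obtain ⟨z', h, h1⟩ := c.Q_agree (c.child θ s) θ _ hz
    exact ⟨z', h, h1.symm, fun h => absurd h hs⟩

/-- A valuation of one node extends to all ancestors of the node. -/
theorem exists_ancestors (θ : Θ) (l₀ : List ℕ) {z₀ : Val} (hz : z₀ ∈ c.Q (c.type θ l₀)) :
    ∃ u : List ℕ → Val, u l₀ = z₀ ∧ (∀ l, l <:+ l₀ → u l ∈ c.Q (c.type θ l)) ∧
      ∀ s l, (s :: l) <:+ l₀ → c.Step s (u l) (u (s :: l)) := by
  classical
  induction l₀ generalizing z₀ with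
  | nil =>
    refine ⟨fun _ => z₀, rfl, fun l hl => ?_, fun s l hl => by simp at hl⟩
    obtain rfl := List.suffix_nil.1 hl
    exact hz
  | cons s l₀ ih =>
    obtain ⟨z, hz', hst⟩ := c.exists_up _ s hz
    obtain ⟨u, h1, h2, h3⟩ := ih hz'
    have hne : ∀ l, l <:+ l₀ → l ≠ s :: l₀ := by
      rintro l hl rfl
      have := hl.length_le
      simp at this
    refine ⟨update u (s :: l₀) z₀, by simp, fun l hl => ?_, fun s' l hl => ?_⟩
    · rcases List.suffix_cons_iff.1 hl with rfl | hl
      · simpa using hz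
      · rw [Function.update_of_ne (hne l hl)]
        exact h2 l hl
    · rcases List.suffix_cons_iff.1 hl with h | hl
      · obtain ⟨rfl, rfl⟩ := List.cons.inj h
        rw [Function.update_self, Function.update_of_ne (hne _ (List.suffix_refl _)), h1]
        exact hst
      · rw [Function.update_of_ne (hne _ hl),
          Function.update_of_ne (hne _ ((List.suffix_cons _ _).trans hl))]
        exact h3 s' l hl

/-- A valuation of one node extends to the whole tree. -/
theorem exists_tree (θ : Θ) (l₀ : List ℕ) {z₀ : Val} (hz : z₀ ∈ c.Q (c.type θ l₀)) :
    ∃ v : List ℕ → Val, v l₀ = z₀ ∧ (∀ l, v l ∈ c.Q (c.type θ l)) ∧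
      ∀ s l, c.Step s (v l) (v (s :: l)) := by
  classical
  obtain ⟨u, h1, h2, h3⟩ := c.exists_ancestors θ l₀ hz
  have : ∀ θ s z, ∃ z', z ∈ c.Q θ → z' ∈ c.Q (c.child θ s) ∧ c.Step s z z' := by
    intro θ s z
    by_cases h : z ∈ c.Q θ
    · obtain ⟨z', h'⟩ := c.exists_down θ s h
      exact ⟨z', fun _ => h'⟩
    · exact ⟨z, fun h' => absurd h' h⟩
  choose d hd using this
  -- follow `u` on the path to `l₀`, and choose downwards elsewhere
  let v : List ℕ → Val := fun l => List.rec (u [])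
    (fun s l z => if (s :: l) <:+ l₀ then u (s :: l) else d (c.type θ l) s z) l
  have v_cons : ∀ s l, v (s :: l) = if (s :: l) <:+ l₀ then u (s :: l) else d (c.type θ l) s (v l) :=
    fun s l => rfl
  have hvu : ∀ l, l <:+ l₀ → v l = u l := by
    intro l hl
    cases l with
    | nil => rfl
    | cons s l => rw [v_cons, if_pos hl]
  have hv : ∀ l, v l ∈ c.Q (c.type θ l) := by
    intro l
    induction l with
    | nil => exact h2 [] List.nil_suffix
    | cons s l ih =>
      rw [v_cons]
      split_ifs with h
      · exact h2 _ h
      · exact (hd _ s _ ih).1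
  refine ⟨v, (hvu _ (List.suffix_refl _)).trans h1, hv, fun s l => ?_⟩
  by_cases h : (s :: l) <:+ l₀
  · rw [hvu _ h, hvu l ((List.suffix_cons _ _).trans h)]
    exact h3 s l h
  · rw [v_cons, if_neg h]
    exact (hd _ s _ (hv l)).2

theorem agree_root {v : List ℕ → Val} (h : ∀ s l, c.Step s (v l) (v (s :: l))) (l : List ℕ) :
    Agree E (v []) (v l) := by
  induction l with
  | nil => exact fun _ _ => rfl
  | cons s l ih => exact ih.trans (h s l).1

/-- A valuation of one node extends to all trees. -/
theorem exists_row (θ₀ : Θ) (l₀ : List ℕ) {z₀ : Val} (hz : z₀ ∈ c.Q (c.type θ₀ l₀)) :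
    ∃ v : Θ → List ℕ → Val, v θ₀ l₀ = z₀ ∧ (∀ θ l, v θ l ∈ c.Q (c.type θ l)) ∧
      (∀ θ s l, c.Step s (v θ l) (v θ (s :: l))) ∧ ∀ θ θ' l l', Agree E (v θ l) (v θ' l') := by
  classical
  obtain ⟨v₀, h1, h2, h3⟩ := c.exists_tree θ₀ l₀ hz
  have key : ∀ θ, ∃ v : List ℕ → Val, (θ = θ₀ → v = v₀) ∧ (∀ l, v l ∈ c.Q (c.type θ l)) ∧
      (∀ s l, c.Step s (v l) (v (s :: l))) ∧ Agree E (v₀ []) (v []) := by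
    intro θ
    by_cases h : θ = θ₀
    · subst h
      exact ⟨v₀, fun _ => rfl, h2, h3, fun _ _ => rfl⟩
    · obtain ⟨z', hz', ha⟩ := c.Q_agree θ₀ θ (v₀ []) (h2 [])
      obtain ⟨v, h1', h2', h3'⟩ := c.exists_tree θ [] (z₀ := z') hz'
      exact ⟨v, fun h' => absurd h' h, h2', h3', by rw [h1']; exact ha⟩
  choose v hv using key
  refine ⟨v, by rw [(hv θ₀).1 rfl, h1], fun θ => (hv θ).2.1, fun θ => (hv θ).2.2.1, fun θ θ' l l' => ?_⟩
  have a := c.agree_root (hv θ).2.2.1 l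
  have b := c.agree_root (hv θ').2.2.1 l'
  exact a.symm.trans ((hv θ).2.2.2.symm.trans ((hv θ').2.2.2.trans b))

/-- A certificate gives rise to a set of traces: one trace for every node of the unfoldings of the
types. Its first `n` positions come from `P`, and every other position comes from the extension of
one valuation of one node to all nodes. -/
theorem exists_model [Countable Θ] [Nonempty Θ] (hQ : ∀ θ, (c.Q θ).Countable) (hn : 0 < n)
    (hE : ∀ s ∈ E, y < s) (hW : ∀ s ∈ W, s < y) :
    ∃ T : Set Trace, T.Nonempty ∧ (∀ t ∈ T, ∀ i, ∃ θ, ∃ z ∈ c.Q θ, t i = z y) ∧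
      ∃ τ : ℕ → Trace, (∀ s ∈ E, τ s ∈ T) ∧ ∀ t ∈ T, ∃ τ' : ℕ → Trace, (∀ s ∈ W, τ' s ∈ T) ∧
        ∃ θ, ∃ R : ℕ → Val, (∀ i < n, R i = c.P θ i) ∧ Set.range R = c.Q θ ∧
          ∀ i, ∀ s, s ∈ E ∨ s = y ∨ s ∈ W → comb y τ t τ' s i = R i s := by
  classical
  -- every valuation that a node has to realize gets a position behind the first `n` ones
  let J : Type := Σ x : Θ × List ℕ, {z // z ∈ c.Q (c.type x.1 x.2)}
  have : ∀ θ, Countable {z // z ∈ c.Q θ} := fun θ => (hQ θ).to_subtype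
  obtain ⟨θ₁⟩ := ‹Nonempty Θ›
  have : Nonempty J := ⟨⟨(θ₁, []), _, c.P_mem θ₁ 0 hn⟩⟩
  obtain ⟨e, he⟩ := exists_surjective_nat J
  have := fun j : J => c.exists_row j.1.1 j.1.2 j.2.2
  choose V hV1 hV2 hV3 hV4 using this
  let R : ℕ → Θ → List ℕ → Val := fun i θ l => if i < n then c.P (c.type θ l) i else V (e (i - n)) θ l
  have hR1 : ∀ i θ l, R i θ l ∈ c.Q (c.type θ l) := by
    intro i θ l
    by_cases h : i < n
    · simpa [R, h] using c.P_mem _ i h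
    · simpa [R, h] using hV2 _ θ l
  have hR2 : ∀ i θ l, ∀ s ∈ W, R i θ l s = R i θ (s :: l) y := by
    intro i θ l s hs
    by_cases h : i < n
    · simp only [R, h, if_true]
      exact c.P_child _ s hs i h
    · simpa [R, h] using (hV3 _ θ s l).2 hs
  have hR3 : ∀ i θ θ' l l', Agree E (R i θ l) (R i θ' l') := by
    intro i θ θ' l l'
    by_cases h : i < n
    · simpa [R, h] using c.P_agree _ _ i h
    · simpa [R, h] using hV4 _ θ θ' l l'
  have hR4 : ∀ θ l, (Set.range fun i => R i θ l) = c.Q (c.type θ l) := by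
    intro θ l
    ext z
    constructor
    · rintro ⟨i, rfl⟩
      exact hR1 i θ l
    · intro hz
      obtain ⟨k, hk⟩ := he ⟨(θ, l), z, hz⟩
      refine ⟨k + n, ?_⟩
      have := hV1 (e k)
      rw [hk] at this
      simpa [R, hk] using this
  refine ⟨Set.range fun x : Θ × List ℕ => fun i => R i x.1 x.2 y, ⟨_, (θ₁, []), rfl⟩, ?_,
    fun s i => R i (c.root s) [] y, fun s _ => ⟨(c.root s, []), rfl⟩, ?_⟩
  · rintro _ ⟨⟨θ, l⟩, rfl⟩ i
    exact ⟨_, _, hR1 i θ l, rfl⟩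
  · rintro _ ⟨⟨θ, l⟩, rfl⟩
    refine ⟨fun s i => R i θ (s :: l) y, fun s _ => ⟨(θ, s :: l), rfl⟩, c.type θ l,
      fun i => R i θ l, fun i hi => by simp [R, hi], hR4 θ l, fun i s hs => ?_⟩
    rcases hs with hs | rfl | hs
    · have h1 := hE s hs
      have h2 : ¬ s < y := by omega
      simp only [comb, h2, h1.ne', if_false]
      rw [← c.Q_root s hs _ (hR1 i (c.root s) [])]
      exact hR3 _ _ _ _ _ s hs
    · simp [comb]
    · simp only [comb, hW s hs, if_true]
      exact (hR2 i θ l s hs).symm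

end Cert

/-- A set of traces with witnesses for all existential quantifiers is a certificate, in which every
trace has a type of its own. -/
theorem exists_cert {T : Set Trace} {E W : Set ℕ} {y : ℕ} (n : ℕ) (hT : T.Nonempty)
    (hE : ∀ s ∈ E, y < s) (hW : ∀ s ∈ W, s < y) {τ : ℕ → Trace} (hτ : ∀ s ∈ E, τ s ∈ T)
    {τ' : Trace → ℕ → Trace} (hτ' : ∀ t ∈ T, ∀ s ∈ W, τ' t s ∈ T) :
    ∃ c : Cert T E W y n, ∀ t : T, (c.P t = fun i s => comb y τ t (τ' t) s i) ∧
      c.Q t = Set.range fun i s => comb y τ t (τ' t) s i := by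
  classical
  obtain ⟨t₀, ht₀⟩ := hT
  have h1 : ∀ (t t' : T), ∀ s ∈ E, comb y τ t (τ' t) s = comb y τ t' (τ' t') s := by
    intro t t' s hs
    have h1 := hE s hs
    have h2 : ¬ s < y := by omega
    simp [comb, h2, h1.ne']
  have h2 : ∀ t : Trace, comb y τ t (τ' t) y = t := by intro t; simp [comb]
  have h3 : ∀ (t : T), ∀ s ∈ W, comb y τ t (τ' t) s = τ' t s := by
    intro t s hs; simp [comb, hW s hs]
  refine ⟨{
    P := fun t i s => comb y τ t (τ' t) s i
    Q := fun t => Set.range fun i s => comb y τ t (τ' t) s i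
    child := fun t s => if h : s ∈ W then ⟨τ' t s, hτ' t t.2 s h⟩ else t
    root := fun s => if h : s ∈ E then ⟨τ s, hτ s h⟩ else ⟨t₀, ht₀⟩
    P_mem := fun t i _ => ⟨i, rfl⟩
    P_agree := fun t t' i _ s hs => by simp only [h1 t t' s hs]
    P_child := fun t s hs i _ => by simp only [hs, dif_pos, h3 t s hs, h2]
    Q_agree := ?_
    Q_down := ?_
    Q_up := ?_
    Q_root := ?_ }, fun t => ⟨rfl, rfl⟩⟩
  · rintro t t' _ ⟨i, rfl⟩
    exact ⟨_, ⟨i, rfl⟩, fun s hs => by simp only [h1 t t' s hs]⟩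
  · rintro t s hs _ ⟨i, rfl⟩
    exact ⟨_, ⟨i, rfl⟩, fun s' hs' => congrFun (h1 t _ s' hs') i,
      by simp only [hs, dif_pos, h3 t s hs, h2]⟩
  · rintro t s hs _ ⟨i, rfl⟩
    exact ⟨_, ⟨i, rfl⟩, fun s' hs' => congrFun (h1 t _ s' hs') i,
      by simp only [hs, dif_pos, h3 t s hs, h2]⟩
  · rintro s hs _ ⟨i, rfl⟩
    have a := hE s hs
    have b : ¬ s < y := by omega
    simp only [hs, dif_pos, h2]
    simp [comb, b, a.ne']

end HyperLTL

/-! ### The formulas built by the lines of a presentation -/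

namespace HyperLTL

open Function (update)

/-- The letter that starts a right-hand side. -/
def Op.kind : Op → Letter
  | .atom _ _ => .atom
  | .neg _ => .neg
  | .or _ _ => .or
  | .and _ _ => .and
  | .next _ => .next
  | .until _ _ => .until
  | .ev _ => .ev
  | .alw _ => .alw
  | .ex _ _ => .ex
  | .all _ _ => .all

/-- The first number of a right-hand side. -/
def Op.fst : Op → ℕ
  | .atom a _ => a
  | .neg i => i
  | .or i _ => i
  | .and i _ => i
  | .next i => i
  | .until i _ => i
  | .ev i => i
  | .alw i => i
  | .ex x _ => x
  | .all x _ => x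

/-- The second number of a right-hand side, and `0` if there is none. -/
def Op.snd : Op → ℕ
  | .atom _ x => x
  | .or _ j => j
  | .and _ j => j
  | .until _ j => j
  | .ex _ i => i
  | .all _ i => i
  | _ => 0

namespace Letter

theorem ctorIdx_injective : Function.Injective Letter.ctorIdx := by
  intro a b h
  cases a <;> cases b <;> first | rfl | cases h

instance : DecidableEq Letter := fun a b =>
  decidable_of_iff (a.ctorIdx = b.ctorIdx) ctorIdx_injective.eq_iff

instance : Finite Letter :=
  .of_injective (β := Fin 13) (fun a => ⟨a.ctorIdx, by cases a <;> decide⟩) fun a b h =>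
    ctorIdx_injective (congrArg Fin.val h)

/-- The operators whose first number is a label. -/
def fsts : List Letter := [neg, or, and, next, .until, ev, alw]

/-- The operators whose second number is a label. -/
def snds : List Letter := [or, and, .until, ex, all]

/-- The operators that join two quantifier-free formulas. -/
def joins : List Letter := [or, and, .until]

/-- The quantifiers. -/
def quants : List Letter := [ex, all]

end Letter

variable (C : List (ℕ × Op))

/-- The label of line `k`. -/
def lab (k : ℕ) : ℕ := (C[k]?.getD (0, .neg 0)).1

/-- The right-hand side of line `k`. -/
def op (k : ℕ) : Op := (C[k]?.getD (0, .neg 0)).2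

/-- The meaning of the labels before line `k`. -/
def lineEnv : ℕ → ℕ → Option Formula
  | 0 => fun _ => none
  | k + 1 => update (lineEnv k) (lab C k) ((op C k).eval (lineEnv k))

/-- The formula built by line `k`. -/
def form (k : ℕ) : Option Formula := (op C k).eval (lineEnv C k)

/-- Before line `k`, the label `i` refers to line `k'`. -/
def Res (k i k' : ℕ) : Prop := k' < k ∧ lab C k' = i ∧ ∀ k'', k' < k'' → k'' < k → lab C k'' ≠ i

variable {C}

theorem Res.eq {k i k' k'' : ℕ} (h' : Res C k i k') (h'' : Res C k i k'') : k' = k'' := by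
  rcases lt_trichotomy k' k'' with h | h | h
  · exact absurd h''.2.1 (h'.2.2 _ h h''.1)
  · exact h
  · exact absurd h'.2.1 (h''.2.2 _ h h'.1)

theorem res_succ {k i k' : ℕ} :
    Res C (k + 1) i k' ↔ (lab C k = i ∧ k' = k) ∨ (lab C k ≠ i ∧ Res C k i k') := by
  constructor
  · rintro ⟨h1, h2, h3⟩
    rcases Nat.lt_succ_iff_lt_or_eq.1 h1 with h | rfl
    · exact .inr ⟨h3 k h (by omega), h, h2, fun k'' h4 h5 => h3 k'' h4 (by omega)⟩
    · exact .inl ⟨h2, rfl⟩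
  · rintro (⟨h, rfl⟩ | ⟨h, h1, h2, h3⟩)
    · exact ⟨by omega, h, fun _ _ _ => by omega⟩
    · refine ⟨by omega, h2, fun k'' h4 h5 => ?_⟩
      rcases Nat.lt_succ_iff_lt_or_eq.1 h5 with h' | rfl
      · exact h3 k'' h4 h'
      · exact h

theorem lineEnv_eq_some {k i : ℕ} {χ : Formula} :
    lineEnv C k i = some χ ↔ ∃ k', Res C k i k' ∧ form C k' = some χ := by
  induction k with
  | zero => simp [lineEnv, Res]
  | succ k ih =>
    simp only [res_succ]
    by_cases h : lab C k = i
    · subst h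
      simp [lineEnv, form]
    · simp [lineEnv, Function.update_of_ne (Ne.symm h), ih, h]

theorem denotes_drop {k : ℕ} (hk : k < C.length) {φ : Formula} :
    Denotes (lineEnv C k) (C.drop k) φ ↔
      (∀ j, k ≤ j → j < C.length → ∃ χ, form C j = some χ) ∧ form C (C.length - 1) = some φ := by
  have hCk : C[k] = (lab C k, op C k) := by simp [lab, op, hk]
  rw [List.drop_eq_getElem_cons hk, hCk]
  by_cases h : k + 1 < C.length
  · have ih := denotes_drop h (φ := φ)
    constructor
    · have hne : C.drop (k + 1) ≠ [] := by simpa using h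
      generalize C.drop (k + 1) = D at hne ih
      rintro (h' | ⟨h1, h2⟩)
      · exact absurd rfl hne
      · rename_i χ
        have hχ : (op C k).eval (lineEnv C k) = some χ := h1
        have : lineEnv C (k + 1) = update (lineEnv C k) (lab C k) (some χ) := by
          rw [lineEnv, hχ]
        rw [← this] at h2
        obtain ⟨h3, h4⟩ := ih.1 h2
        refine ⟨fun j hj hj' => ?_, h4⟩
        rcases hj.eq_or_lt with rfl | hj
        · exact ⟨χ, hχ⟩
        · exact h3 j hj hj'
    · rintro ⟨h1, h2⟩
      obtain ⟨χ, hχ⟩ := h1 k le_rfl hk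
      refine .cons hχ ?_
      have : lineEnv C (k + 1) = update (lineEnv C k) (lab C k) (some χ) := by
        rw [lineEnv]; exact congrArg _ hχ
      rw [← this]
      exact ih.2 ⟨fun j hj hj' => h1 j (by omega) hj', h2⟩
  · have hk' : k = C.length - 1 := by omega
    have hd : C.drop (k + 1) = [] := List.drop_eq_nil_of_le (by omega)
    rw [hd]
    constructor
    · rintro (h' | ⟨_, h2⟩)
      · refine ⟨fun j hj hj' => ?_, by rw [← hk']; exact h'⟩
        obtain rfl : j = k := by omega
        exact ⟨_, h'⟩
      · cases h2
    · rintro ⟨_, h2⟩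
      rw [← hk'] at h2
      exact .last h2
  termination_by C.length - k

theorem denotes_iff {φ : Formula} : Denotes (fun _ => none) C φ ↔
    C ≠ [] ∧ (∀ k < C.length, ∃ χ, form C k = some χ) ∧ form C (C.length - 1) = some φ := by
  rcases C.eq_nil_or_concat with rfl | ⟨C', c, rfl⟩
  · simp only [ne_eq, not_true_eq_false, false_and, iff_false]
    rintro ⟨⟩
  · have := denotes_drop (C := C' ++ [c]) (k := 0) (by simp) (φ := φ)
    simp only [List.drop_zero] at this
    rw [lineEnv] at this
    simpa using this

variable (C) in
/-- The quantifier-free line `k` builds the formula `ψ`. -/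
inductive Builds : ℕ → QF → Prop
  | atom {k : ℕ} : (op C k).kind = .atom → Builds k (.atom (op C k).fst (op C k).snd)
  | neg {k k' : ℕ} {ψ : QF} : (op C k).kind = .neg → Res C k (op C k).fst k' → Builds k' ψ →
      Builds k (.neg ψ)
  | or {k k' k'' : ℕ} {ψ ψ' : QF} : (op C k).kind = .or → Res C k (op C k).fst k' →
      Res C k (op C k).snd k'' → Builds k' ψ → Builds k'' ψ' → Builds k (.or ψ ψ')
  | and {k k' k'' : ℕ} {ψ ψ' : QF} : (op C k).kind = .and → Res C k (op C k).fst k' →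
      Res C k (op C k).snd k'' → Builds k' ψ → Builds k'' ψ' → Builds k (.and ψ ψ')
  | next {k k' : ℕ} {ψ : QF} : (op C k).kind = .next → Res C k (op C k).fst k' → Builds k' ψ →
      Builds k (.next ψ)
  | untl {k k' k'' : ℕ} {ψ ψ' : QF} : (op C k).kind = .until → Res C k (op C k).fst k' →
      Res C k (op C k).snd k'' → Builds k' ψ → Builds k'' ψ' → Builds k (.until ψ ψ')
  | ev {k k' : ℕ} {ψ : QF} : (op C k).kind = .ev → Res C k (op C k).fst k' → Builds k' ψ →
      Builds k (.ev ψ)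
  | alw {k k' : ℕ} {ψ : QF} : (op C k).kind = .alw → Res C k (op C k).fst k' → Builds k' ψ →
      Builds k (.alw ψ)

variable (C) in
/-- Line `k` builds the formula `φ`. -/
inductive BuildsFormula : ℕ → Formula → Prop
  | qf {k : ℕ} {ψ : QF} : Builds C k ψ → BuildsFormula k (.qf ψ)
  | ex {k k' : ℕ} {φ : Formula} : (op C k).kind = .ex → Res C k (op C k).snd k' →
      BuildsFormula k' φ → BuildsFormula k (.ex (op C k).fst φ)
  | all {k k' : ℕ} {φ : Formula} : (op C k).kind = .all → Res C k (op C k).snd k' →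
      BuildsFormula k' φ → BuildsFormula k (.all (op C k).fst φ)

theorem toQF_eq_some {φ : Formula} {ψ : QF} : φ.toQF = some ψ ↔ φ = .qf ψ := by
  cases φ <;> simp [Formula.toQF]

theorem lineEnv_bind {k i : ℕ} {ψ : QF} : (lineEnv C k i).bind Formula.toQF = some ψ ↔
    ∃ k', Res C k i k' ∧ form C k' = some (.qf ψ) := by
  simp only [Option.bind_eq_some_iff, toQF_eq_some, lineEnv_eq_some]
  simp

theorem form_of_builds {k : ℕ} {ψ : QF} (h : Builds C k ψ) : form C k = some (.qf ψ) := by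
  induction h with
  | @atom k h => unfold form; cases ho : op C k <;> simp_all [Op.kind, Op.eval, Op.fst, Op.snd]
  | @neg k k' ψ h hr _ ih =>
    have := lineEnv_bind.2 ⟨_, hr, ih⟩
    unfold form; cases ho : op C k <;> simp_all [Op.kind, Op.eval, Op.fst]
  | @next k k' ψ h hr _ ih =>
    have := lineEnv_bind.2 ⟨_, hr, ih⟩
    unfold form; cases ho : op C k <;> simp_all [Op.kind, Op.eval, Op.fst]
  | @ev k k' ψ h hr _ ih =>
    have := lineEnv_bind.2 ⟨_, hr, ih⟩
    unfold form; cases ho : op C k <;> simp_all [Op.kind, Op.eval, Op.fst]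
  | @alw k k' ψ h hr _ ih =>
    have := lineEnv_bind.2 ⟨_, hr, ih⟩
    unfold form; cases ho : op C k <;> simp_all [Op.kind, Op.eval, Op.fst]
  | @or k k' k'' ψ ψ' h hr hr' _ _ ih ih' =>
    have := lineEnv_bind.2 ⟨_, hr, ih⟩
    have := lineEnv_bind.2 ⟨_, hr', ih'⟩
    unfold form; cases ho : op C k <;> simp_all [Op.kind, Op.eval, Op.fst, Op.snd]
  | @and k k' k'' ψ ψ' h hr hr' _ _ ih ih' =>
    have := lineEnv_bind.2 ⟨_, hr, ih⟩
    have := lineEnv_bind.2 ⟨_, hr', ih'⟩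
    unfold form; cases ho : op C k <;> simp_all [Op.kind, Op.eval, Op.fst, Op.snd]
  | @untl k k' k'' ψ ψ' h hr hr' _ _ ih ih' =>
    have := lineEnv_bind.2 ⟨_, hr, ih⟩
    have := lineEnv_bind.2 ⟨_, hr', ih'⟩
    unfold form; cases ho : op C k <;> simp_all [Op.kind, Op.eval, Op.fst, Op.snd]

theorem form_of_buildsFormula {k : ℕ} {φ : Formula} (h : BuildsFormula C k φ) :
    form C k = some φ := by
  induction h with
  | qf h => exact form_of_builds h
  | @ex k k' φ h hr _ ih =>
    have := lineEnv_eq_some.2 ⟨_, hr, ih⟩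
    unfold form; cases ho : op C k <;> simp_all [Op.kind, Op.eval, Op.fst, Op.snd]
  | @all k k' φ h hr _ ih =>
    have := lineEnv_eq_some.2 ⟨_, hr, ih⟩
    unfold form; cases ho : op C k <;> simp_all [Op.kind, Op.eval, Op.fst, Op.snd]

theorem buildsFormula_of_form {k : ℕ} {φ : Formula} (h : form C k = some φ) :
    BuildsFormula C k φ := by
  induction k using Nat.strong_induction_on generalizing φ with
  | _ k ih =>
  have ih1 : ∀ {i φ}, lineEnv C k i = some φ → ∃ k', Res C k i k' ∧ BuildsFormula C k' φ := by
    intro i φ h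
    obtain ⟨k', h1, h2⟩ := lineEnv_eq_some.1 h
    exact ⟨k', h1, ih k' h1.1 h2⟩
  have ih2 : ∀ {i ψ}, (∃ φ, lineEnv C k i = some φ ∧ φ.toQF = some ψ) →
      ∃ k', Res C k i k' ∧ Builds C k' ψ := by
    intro i ψ h
    obtain ⟨k', h1, h2⟩ := lineEnv_bind.1 (Option.bind_eq_some_iff.2 h)
    cases ih k' h1.1 h2 with
    | qf h3 => exact ⟨k', h1, h3⟩
  unfold form at h
  cases ho : op C k with
  | atom a x =>
    rw [ho] at h
    obtain rfl : Formula.qf (.atom a x) = φ := by simpa [Op.eval] using h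
    simpa [ho, Op.fst, Op.snd] using BuildsFormula.qf (.atom (C := C) (k := k) (by rw [ho]; rfl))
  | ex x i =>
    simp only [ho, Op.eval, Option.bind_eq_bind, Option.bind_eq_some_iff, Option.pure_def,
      Option.some.injEq] at h
    obtain ⟨φ', h1, rfl⟩ := h
    obtain ⟨k', h2, h3⟩ := ih1 h1
    have := BuildsFormula.ex (C := C) (k := k) (by rw [ho]; rfl) (by rw [ho]; exact h2) h3
    rwa [show (op C k).fst = x by rw [ho]; rfl] at this
  | all x i =>
    simp only [ho, Op.eval, Option.bind_eq_bind, Option.bind_eq_some_iff, Option.pure_def,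
      Option.some.injEq] at h
    obtain ⟨φ', h1, rfl⟩ := h
    obtain ⟨k', h2, h3⟩ := ih1 h1
    have := BuildsFormula.all (C := C) (k := k) (by rw [ho]; rfl) (by rw [ho]; exact h2) h3
    rwa [show (op C k).fst = x by rw [ho]; rfl] at this
  | _ =>
    simp only [ho, Op.eval, Option.bind_eq_bind, Option.bind_eq_some_iff, Option.pure_def,
      Option.some.injEq] at h
    first
    | obtain ⟨ψ₁, h1, ψ₂, h2, rfl⟩ := h
      obtain ⟨k', h3, h4⟩ := ih2 h1
      obtain ⟨k'', h5, h6⟩ := ih2 h2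
      first
      | exact .qf (.or (by rw [ho]; rfl) (by rw [ho]; exact h3) (by rw [ho]; exact h5) h4 h6)
      | exact .qf (.and (by rw [ho]; rfl) (by rw [ho]; exact h3) (by rw [ho]; exact h5) h4 h6)
      | exact .qf (.untl (by rw [ho]; rfl) (by rw [ho]; exact h3) (by rw [ho]; exact h5) h4 h6)
    | obtain ⟨ψ₁, h1, rfl⟩ := h
      obtain ⟨k', h3, h4⟩ := ih2 h1
      first
      | exact .qf (.neg (by rw [ho]; rfl) (by rw [ho]; exact h3) h4)
      | exact .qf (.next (by rw [ho]; rfl) (by rw [ho]; exact h3) h4)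
      | exact .qf (.ev (by rw [ho]; rfl) (by rw [ho]; exact h3) h4)
      | exact .qf (.alw (by rw [ho]; rfl) (by rw [ho]; exact h3) h4)

theorem denotes_iff_buildsFormula {φ : Formula} : Denotes (fun _ => none) C φ ↔
    C ≠ [] ∧ (∀ k < C.length, ∃ χ, BuildsFormula C k χ) ∧ BuildsFormula C (C.length - 1) φ := by
  have : ∀ k χ, form C k = some χ ↔ BuildsFormula C k χ :=
    fun k χ => ⟨buildsFormula_of_form, form_of_buildsFormula⟩
  simp only [denotes_iff, this]

end HyperLTL

/-! ### The operand graph and the quantifier prefix of a presentation -/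

namespace HyperLTL

open Function (update)
open Relation (ReflTransGen)

variable {C : List (ℕ × Op)}

variable (C) in
/-- Line `k` refers to line `k'`. -/
def Opd (k k' : ℕ) : Prop :=
  ((op C k).kind ∈ Letter.fsts ∧ Res C k (op C k).fst k') ∨
    ((op C k).kind ∈ Letter.snds ∧ Res C k (op C k).snd k')

theorem Opd.lt {k k' : ℕ} (h : Opd C k k') : k' < k := by
  rcases h with h | h <;> exact h.2.1

theorem le_of_reflTransGen {k k' : ℕ} (h : ReflTransGen (Opd C) k k') : k' ≤ k := by
  induction h with
  | refl => exact le_rfl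
  | tail _ h ih => exact h.lt.le.trans ih

theorem Builds.unique {k : ℕ} {ψ ψ' : QF} (h : Builds C k ψ) (h' : Builds C k ψ') : ψ = ψ' := by
  have := (form_of_builds h).symm.trans (form_of_builds h')
  simpa using this

theorem Builds.kind_notMem {k : ℕ} {ψ : QF} (h : Builds C k ψ) :
    (op C k).kind ∉ Letter.quants := by
  cases h <;> simp_all [Letter.quants]

theorem reach_atom {k x : ℕ} (h : (op C k).kind = .atom) : ReflTransGen (Opd C) k x ↔ x = k := by
  rw [ReflTransGen.cases_head_iff]
  simp [Opd, h, Letter.fsts, Letter.snds, eq_comm]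

theorem reach_unary {k k' x : ℕ} (h : (op C k).kind ∈ Letter.fsts)
    (h' : (op C k).kind ∉ Letter.snds) (hr : Res C k (op C k).fst k') :
    ReflTransGen (Opd C) k x ↔ x = k ∨ ReflTransGen (Opd C) k' x := by
  rw [ReflTransGen.cases_head_iff]
  have : ∀ c, Opd C k c ↔ c = k' := fun c => by
    simp only [Opd, h, h', true_and, false_and, or_false]
    exact ⟨fun h => h.eq hr, fun h => h ▸ hr⟩
  simp [this, eq_comm]

theorem reach_binary {k k' k'' x : ℕ} (h : (op C k).kind ∈ Letter.joins)
    (hr : Res C k (op C k).fst k') (hr' : Res C k (op C k).snd k'') : ReflTransGen (Opd C) k x ↔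
      x = k ∨ ReflTransGen (Opd C) k' x ∨ ReflTransGen (Opd C) k'' x := by
  rw [ReflTransGen.cases_head_iff]
  have : ∀ c, Opd C k c ↔ c = k' ∨ c = k'' := fun c => by
    have h1 : (op C k).kind ∈ Letter.fsts := by
      simp only [Letter.joins, Letter.fsts, List.mem_cons] at h ⊢; tauto
    have h2 : (op C k).kind ∈ Letter.snds := by
      simp only [Letter.joins, Letter.snds, List.mem_cons] at h ⊢; tauto
    simp only [Opd, h1, h2, true_and]
    refine ⟨fun h => h.imp (·.eq hr) (·.eq hr'), ?_⟩
    rintro (rfl | rfl)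
    exacts [.inl hr, .inr hr']
  simp [this, eq_comm, or_and_right, exists_or]

/-- A property of formulas that holds if and only if it holds for some atom can be read off from
the lines that are reached. -/
theorem Builds.leaf_iff {S : QF → Prop} {g : ℕ → Prop}
    (hatom : ∀ k, S (.atom (op C k).fst (op C k).snd) ↔ g k) (hneg : ∀ ψ, S (.neg ψ) ↔ S ψ)
    (hnext : ∀ ψ, S (.next ψ) ↔ S ψ) (hev : ∀ ψ, S (.ev ψ) ↔ S ψ) (halw : ∀ ψ, S (.alw ψ) ↔ S ψ)
    (hor : ∀ ψ ψ', S (.or ψ ψ') ↔ S ψ ∨ S ψ') (hand : ∀ ψ ψ', S (.and ψ ψ') ↔ S ψ ∨ S ψ')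
    (huntil : ∀ ψ ψ', S (.until ψ ψ') ↔ S ψ ∨ S ψ') {k : ℕ} {ψ : QF} (h : Builds C k ψ) :
    S ψ ↔ ∃ x, ReflTransGen (Opd C) k x ∧ (op C x).kind = .atom ∧ g x := by
  induction h with
  | atom h => simp [reach_atom h, h, hatom]
  | neg h hr _ ih =>
    simp [reach_unary (h ▸ by decide) (h ▸ by decide) hr, hneg, ih, or_and_right, exists_or, h]
  | next h hr _ ih =>
    simp [reach_unary (h ▸ by decide) (h ▸ by decide) hr, hnext, ih, or_and_right, exists_or, h]
  | ev h hr _ ih =>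
    simp [reach_unary (h ▸ by decide) (h ▸ by decide) hr, hev, ih, or_and_right, exists_or, h]
  | alw h hr _ ih =>
    simp [reach_unary (h ▸ by decide) (h ▸ by decide) hr, halw, ih, or_and_right, exists_or, h]
  | or h hr hr' _ _ ih ih' =>
    simp [reach_binary (h ▸ by decide) hr hr', hor, ih, ih', or_and_right, exists_or, h]
  | and h hr hr' _ _ ih ih' =>
    simp [reach_binary (h ▸ by decide) hr hr', hand, ih, ih', or_and_right, exists_or, h]
  | untl h hr hr' _ _ ih ih' =>
    simp [reach_binary (h ▸ by decide) hr hr', huntil, ih, ih', or_and_right, exists_or, h]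

theorem Builds.mem_props {k : ℕ} {ψ : QF} (h : Builds C k ψ) (a : ℕ) : a ∈ ψ.props ↔
    ∃ x, ReflTransGen (Opd C) k x ∧ (op C x).kind = .atom ∧ a = (op C x).fst :=
  h.leaf_iff (S := fun ψ => a ∈ ψ.props) (by simp [QF.props]) (by simp [QF.props])
    (by simp [QF.props]) (by simp [QF.props]) (by simp [QF.props]) (by simp [QF.props])
    (by simp [QF.props]) (by simp [QF.props])

theorem Builds.mem_vars {k : ℕ} {ψ : QF} (h : Builds C k ψ) (x : ℕ) : x ∈ ψ.vars ↔
    ∃ l, ReflTransGen (Opd C) k l ∧ (op C l).kind = .atom ∧ x = (op C l).snd :=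
  h.leaf_iff (S := fun ψ => x ∈ ψ.vars) (by simp [QF.vars]) (by simp [QF.vars])
    (by simp [QF.vars]) (by simp [QF.vars]) (by simp [QF.vars]) (by simp [QF.vars])
    (by simp [QF.vars]) (by simp [QF.vars])

theorem Builds.kind_notMem_of_reach {k x : ℕ} {ψ : QF} (h : Builds C k ψ)
    (hx : ReflTransGen (Opd C) k x) : (op C x).kind ∉ Letter.quants := by
  induction h with
  | atom h =>
    rw [reach_atom h] at hx
    rw [hx, h]; decide
  | neg h hr _ ih | next h hr _ ih | ev h hr _ ih | alw h hr _ ih =>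
    rcases (reach_unary (h ▸ by decide) (h ▸ by decide) hr).1 hx with rfl | hx
    · rw [h]; decide
    · exact ih hx
  | or h hr hr' _ _ ih ih' | and h hr hr' _ _ ih ih' | untl h hr hr' _ _ ih ih' =>
    rcases (reach_binary (h ▸ by decide) hr hr').1 hx with rfl | hx | hx
    · rw [h]; decide
    · exact ih hx
    · exact ih' hx

theorem Builds.depth_le {k : ℕ} {ψ : QF} (h : Builds C k ψ) : ψ.depth ≤ k := by
  induction h with
  | neg _ hr _ ih | next _ hr _ ih =>
    have := hr.1
    simp only [QF.depth]; omega
  | or _ hr hr' _ _ ih ih' | and _ hr hr' _ _ ih ih' =>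
    have := hr.1
    have := hr'.1
    simp only [QF.depth]; omega
  | _ => simp [QF.depth]

variable (C) in
/-- From line `k`, the quantifier lines `L` lead to the quantifier-free line `m`. -/
inductive Chain : ℕ → List ℕ → ℕ → Prop
  | nil {m : ℕ} : (op C m).kind ∉ Letter.quants → Chain m [] m
  | cons {k k' m : ℕ} {L : List ℕ} : (op C k).kind ∈ Letter.quants → Res C k (op C k).snd k' →
      Chain k' L m → Chain k (k :: L) m

open scoped Classical in
variable (C) in
/-- The quantifiers of the lines `L` put in front of a formula. -/
noncomputable def quantify (L : List ℕ) (φ : Formula) : Formula :=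
  L.foldr (fun s φ => if (op C s).kind = .all then .all (op C s).fst φ else .ex (op C s).fst φ) φ

theorem BuildsFormula.exists_chain {k : ℕ} {φ : Formula} (h : BuildsFormula C k φ) :
    ∃ L m ψ, Chain C k L m ∧ Builds C m ψ ∧ φ = quantify C L (.qf ψ) := by
  induction h with
  | qf h => exact ⟨[], _, _, .nil h.kind_notMem, h, rfl⟩
  | ex h hr _ ih =>
    obtain ⟨L, m, ψ, h1, h2, rfl⟩ := ih
    exact ⟨_, m, ψ, .cons (h ▸ by decide) hr h1, h2, by simp [quantify, h]⟩
  | all h hr _ ih =>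
    obtain ⟨L, m, ψ, h1, h2, rfl⟩ := ih
    exact ⟨_, m, ψ, .cons (h ▸ by decide) hr h1, h2, by simp [quantify, h]⟩

theorem opd_of_quant {k k' x : ℕ} (h : (op C k).kind ∈ Letter.quants)
    (hr : Res C k (op C k).snd k') : Opd C k x ↔ x = k' := by
  have h1 : (op C k).kind ∉ Letter.fsts := by
    simp only [Letter.quants, List.mem_cons, List.not_mem_nil, or_false] at h
    rcases h with h | h <;> rw [h] <;> decide
  have h2 : (op C k).kind ∈ Letter.snds := by
    simp only [Letter.quants, Letter.snds, List.mem_cons] at h ⊢; tauto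
  simp only [Opd, h1, h2, true_and, false_and, false_or]
  exact ⟨fun h => h.eq hr, fun h => h ▸ hr⟩

namespace Chain

variable {k m : ℕ} {L : List ℕ}

theorem mem (h : Chain C k L m) : ∀ s ∈ L, (op C s).kind ∈ Letter.quants ∧ s ≤ k := by
  induction h with
  | nil => simp
  | cons h hr _ ih =>
    intro s hs
    rcases List.mem_cons.1 hs with rfl | hs
    · exact ⟨h, le_rfl⟩
    · exact ⟨(ih s hs).1, (ih s hs).2.trans hr.1.le⟩

theorem pairwise (h : Chain C k L m) : L.Pairwise (· > ·) := by
  induction h with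
  | nil => exact .nil
  | cons _ hr h ih => exact .cons (fun s hs => (h.mem s hs).2.trans_lt hr.1) ih

theorem reach_iff (h : Chain C k L m) {x : ℕ} :
    ReflTransGen (Opd C) k x ↔ x ∈ L ∨ ReflTransGen (Opd C) m x := by
  induction h with
  | nil => simp
  | cons h hr _ ih =>
    rw [ReflTransGen.cases_head_iff]
    simp [opd_of_quant h hr, ih, or_assoc, eq_comm]

theorem opd_iff (h : Chain C k L m) {x : ℕ} :
    ((op C x).kind ∉ Letter.quants ∧ ∃ s ∈ L, Opd C s x) ↔ L ≠ [] ∧ x = m := by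
  induction h with
  | nil => simp
  | @cons k k' m L h hr hc ih =>
    simp only [List.mem_cons, exists_eq_or_imp, opd_of_quant h hr, ne_eq, reduceCtorEq,
      not_false_eq_true, true_and]
    cases hc with
    | nil h' =>
      simp only [List.not_mem_nil, false_and, exists_false, or_false]
      exact ⟨fun h => h.2, fun h => ⟨h ▸ h', h⟩⟩
    | cons h' hr' hc' =>
      simp only [ne_eq, reduceCtorEq, not_false_eq_true, true_and] at ih
      rw [← ih]
      constructor
      · rintro ⟨h1, rfl | h2⟩
        · exact absurd h' h1
        · exact ⟨h1, h2⟩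
      · exact fun ⟨h1, h2⟩ => ⟨h1, .inr h2⟩

end Chain

theorem matrix_quantify (L : List ℕ) (ψ : QF) : (quantify C L (.qf ψ)).matrix = ψ := by
  induction L with
  | nil => rfl
  | cons s L ih =>
    simp only [quantify, List.foldr_cons] at ih ⊢
    split_ifs <;> exact ih

theorem mem_freeVars_quantify (L : List ℕ) (ψ : QF) (x : ℕ) :
    x ∈ (quantify C L (.qf ψ)).freeVars ↔ x ∈ ψ.vars ∧ ∀ s ∈ L, x ≠ (op C s).fst := by
  induction L with
  | nil => simp [quantify, Formula.freeVars]
  | cons s L ih =>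
    simp only [quantify, List.foldr_cons] at ih ⊢
    split_ifs <;> simp [Formula.freeVars, ih] <;> tauto

theorem quantify_eq_exs {L : List ℕ} (h : ∀ s ∈ L, (op C s).kind ≠ .all) (φ : Formula) :
    quantify C L φ = exs (L.map fun s => ((op C s).fst, s)) φ := by
  induction L with
  | nil => rfl
  | cons s L ih =>
    have := ih fun s hs => h s (List.mem_cons_of_mem _ hs)
    simp only [quantify, exs, List.foldr_cons, List.map_cons] at this ⊢
    rw [if_neg (h s List.mem_cons_self), this]

theorem isE_quantify {L : List ℕ} {ψ : QF} :
    (quantify C L (.qf ψ)).IsE ↔ ∀ s ∈ L, (op C s).kind ≠ .all := by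
  induction L with
  | nil => simp [quantify, Formula.IsE.qf]
  | cons s L ih =>
    simp only [quantify, List.foldr_cons, List.mem_cons, forall_eq_or_imp] at ih ⊢
    split_ifs with h
    · simp only [h, ne_eq, not_true_eq_false, false_and, iff_false]
      rintro ⟨⟩
    · simp only [ne_eq, h, not_false_eq_true, true_and]
      refine Iff.trans ⟨?_, fun h => .ex _ h⟩ ih
      rintro ⟨⟩
      assumption

theorem isEAE_quantify {L : List ℕ} {ψ : QF} : (quantify C L (.qf ψ)).IsEAE ↔
    ∃ E y W, L = E ++ y :: W ∧ (op C y).kind = .all ∧ (∀ s ∈ E, (op C s).kind ≠ .all) ∧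
      ∀ s ∈ W, (op C s).kind ≠ .all := by
  induction L with
  | nil =>
    simp only [quantify, List.foldr_nil, List.nil_eq, List.append_eq_nil_iff, reduceCtorEq,
      and_false, false_and, exists_false, iff_false]
    rintro ⟨⟩
  | cons s L ih =>
    by_cases h : (op C s).kind = .all
    · have e : quantify C (s :: L) (.qf ψ) = .all (op C s).fst (quantify C L (.qf ψ)) := by
        simp [quantify, h]
      rw [e]
      constructor
      · rintro ⟨⟩
        rename_i h'
        exact ⟨[], s, L, rfl, h, by simp, isE_quantify.1 h'⟩
      · rintro ⟨E, y, W, h1, h2, h3, h4⟩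
        cases E with
        | nil =>
          obtain ⟨rfl, rfl⟩ := List.cons.inj h1
          exact .all _ (isE_quantify.2 h4)
        | cons s' E =>
          obtain ⟨rfl, rfl⟩ := List.cons.inj h1
          exact absurd h (h3 _ List.mem_cons_self)
    · have e : quantify C (s :: L) (.qf ψ) = .ex (op C s).fst (quantify C L (.qf ψ)) := by
        simp [quantify, h]
      rw [e]
      constructor
      · rintro ⟨⟩
        rename_i h'
        obtain ⟨E, y, W, rfl, h2, h3, h4⟩ := ih.1 h'
        exact ⟨s :: E, y, W, rfl, h2, by simpa [h] using h3, h4⟩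
      · rintro ⟨E, y, W, h1, h2, h3, h4⟩
        cases E with
        | nil =>
          obtain ⟨rfl, rfl⟩ := List.cons.inj h1
          exact absurd h2 h
        | cons s' E =>
          obtain ⟨rfl, rfl⟩ := List.cons.inj h1
          exact .ex _ (ih.2 ⟨E, y, W, rfl, h2, fun s hs => h3 s (List.mem_cons_of_mem _ hs), h4⟩)

theorem bindOf_eq_some {L : List ℕ} (hL : L.Pairwise (· > ·)) {x s : ℕ} :
    bindOf (L.map fun s => ((op C s).fst, s)) x = some s ↔
      s ∈ L ∧ (op C s).fst = x ∧ ∀ s' ∈ L, s' < s → (op C s').fst ≠ x := by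
  induction L using List.reverseRecOn with
  | nil => simp [bindOf]
  | append_singleton L p ih =>
    rw [List.pairwise_append] at hL
    have hp : ∀ s ∈ L, p < s := fun s hs => hL.2.2 s hs p (by simp)
    rw [List.map_append, List.map_singleton, bindOf_append_singleton]
    split_ifs with h
    · simp only [Option.some.injEq]
      constructor
      · rintro rfl
        refine ⟨by simp, h, fun s' hs' hlt => ?_⟩
        rcases List.mem_append.1 hs' with hs' | hs'
        · have := hp s' hs'; omega
        · have := List.mem_singleton.1 hs'; omega
      · rintro ⟨h1, h2, h3⟩
        by_contra hne
        rcases List.mem_append.1 h1 with h1 | h1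
        · exact h3 p (by simp) (hp s h1) h
        · exact hne (List.mem_singleton.1 h1).symm
    · rw [ih hL.1]
      constructor
      · rintro ⟨h1, h2, h3⟩
        refine ⟨by simp [h1], h2, fun s' hs' hlt => ?_⟩
        rcases List.mem_append.1 hs' with hs' | hs'
        · exact h3 s' hs' hlt
        · rw [List.mem_singleton.1 hs']; exact h
      · rintro ⟨h1, h2, h3⟩
        rcases List.mem_append.1 h1 with h1 | h1
        · exact ⟨h1, h2, fun s' hs' => h3 s' (by simp [hs'])⟩
        · rw [List.mem_singleton.1 h1] at h2
          exact absurd h2 h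

/-! ### Satisfiability in terms of the lines of a presentation -/

variable (C) in
/-- The last line refers to line `k`, possibly in several steps. -/
def Reach (k : ℕ) : Prop := ReflTransGen (Opd C) (C.length - 1) k

variable (C) in
/-- Line `s` is a quantifier of the formula that the last line builds. -/
def Slot (s : ℕ) : Prop := Reach C s ∧ (op C s).kind ∈ Letter.quants

variable (C) in
/-- Line `y` is the only universal quantifier. -/
def OnlyAll (y : ℕ) : Prop :=
  (Slot C y ∧ (op C y).kind = .all) ∧ ∀ s, Slot C s → (op C s).kind = .all → s = y

variable (C) in
/-- Line `m` is the first line below the quantifiers. -/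
def Matrix (m : ℕ) : Prop := (op C m).kind ∉ Letter.quants ∧ ∃ s, Slot C s ∧ Opd C s m

variable (C) in
/-- The atoms with variable `x` are bound by the quantifier of line `s`. -/
def Binds (x s : ℕ) : Prop :=
  Slot C s ∧ (op C s).fst = x ∧ ∀ s', Slot C s' → s' < s → (op C s').fst ≠ x

variable (C) in
/-- The propositions of the formula that the last line builds. -/
def lineProps : Set ℕ := {a | ∃ k, Reach C k ∧ (op C k).kind = .atom ∧ a = (op C k).fst}

theorem exists_binds {x s : ℕ} (h : Slot C s) (hx : (op C s).fst = x) : ∃ s', Binds C x s' := by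
  classical
  have hex : ∃ s, Slot C s ∧ (op C s).fst = x := ⟨s, h, hx⟩
  exact ⟨Nat.find hex, (Nat.find_spec hex).1, (Nat.find_spec hex).2,
    fun s' h' hlt e => Nat.find_min hex hlt ⟨h', e⟩⟩

/-- The question whether the last line builds a satisfiable sentence of the fragment, in terms of
single lines. The existential quantifiers are replaced by witnesses: `τ` for those in front of the
universal quantifier, which have larger line numbers, and `τ'` for those behind it. -/
theorem satisfiable_iff {φ : Formula} (h : BuildsFormula C (C.length - 1) φ) :
    (φ.IsSentence ∧ φ.IsEAE ∧ φ.IsFGX ∧ φ.Satisfiable) ↔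
      ∃ y m ψ bind, OnlyAll C y ∧ (∀ m', Matrix C m' ↔ m' = m) ∧ Builds C m ψ ∧
        (∀ x s, bind x = some s ↔ Binds C x s) ∧
        (∀ k, Reach C k → (op C k).kind = .atom → ∃ s, Binds C (op C k).snd s) ∧ ψ.IsFGX ∧
        ∃ T : Set Trace, T.Nonempty ∧ (∀ t ∈ T, ∀ i, t i ⊆ lineProps C) ∧ ∃ τ : ℕ → Trace,
          (∀ s, Slot C s → y < s → τ s ∈ T) ∧ ∀ t ∈ T, ∃ τ' : ℕ → Trace,
            (∀ s, Slot C s → s < y → τ' s ∈ T) ∧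
              ψ.FSat bind (fun i s => comb y τ t τ' s i)
                (Set.range fun i s => comb y τ t τ' s i) 0 := by
  obtain ⟨L, m, ψ, hc, hb, rfl⟩ := h.exists_chain
  have hslot : ∀ s, Slot C s ↔ s ∈ L := fun s => by
    simp only [Slot, Reach, hc.reach_iff]
    exact ⟨fun ⟨h1, h2⟩ => h1.resolve_right fun h => hb.kind_notMem_of_reach h h2,
      fun h => ⟨.inl h, (hc.mem s h).1⟩⟩
  have hatom : ∀ k, (op C k).kind = .atom → (Reach C k ↔ ReflTransGen (Opd C) m k) := fun k hk => by
    simp only [Reach, hc.reach_iff, or_iff_right_iff_imp]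
    intro h
    have := (hc.mem k h).1
    rw [hk] at this
    exact absurd this (by decide)
  have hprops : lineProps C = (quantify C L (.qf ψ)).props := by
    ext a
    simp only [lineProps, Set.mem_ofPred_eq, Formula.props, matrix_quantify, Finset.mem_coe,
      hb.mem_props]
    exact exists_congr fun k => ⟨fun ⟨h1, h2, h3⟩ => ⟨(hatom k h2).1 h1, h2, h3⟩,
      fun ⟨h1, h2, h3⟩ => ⟨(hatom k h2).2 h1, h2, h3⟩⟩
  have hmat : L ≠ [] → ∀ m', Matrix C m' ↔ m' = m := fun hL m' => by
    have := hc.opd_iff (x := m')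
    simpa [Matrix, hslot, hL] using this
  have hsent : (quantify C L (.qf ψ)).IsSentence ↔
      ∀ k, Reach C k → (op C k).kind = .atom → ∃ s, Binds C (op C k).snd s := by
    simp only [Formula.IsSentence, Finset.eq_empty_iff_forall_notMem, mem_freeVars_quantify]
    constructor
    · intro h k h1 h2
      have := h (op C k).snd
      simp only [hb.mem_vars, not_and, not_forall, not_not] at this
      obtain ⟨s, hs, e⟩ := this ⟨k, (hatom k h2).1 h1, h2, rfl⟩
      exact exists_binds ((hslot s).2 hs) e.symm
    · rintro h x ⟨hx, h'⟩
      obtain ⟨k, h1, h2, rfl⟩ := (hb.mem_vars x).1 hx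
      obtain ⟨s, hs⟩ := h k ((hatom k h2).2 h1) h2
      exact h' s ((hslot s).1 hs.1) hs.2.1.symm
  have hbind : ∀ x s, bindOf (L.map fun s => ((op C s).fst, s)) x = some s ↔ Binds C x s := by
    intro x s
    simp only [bindOf_eq_some hc.pairwise, Binds, hslot]
  have hnd : L.Nodup := hc.pairwise.imp fun h => h.ne'
  have key : ∀ E y W, L = E ++ y :: W → (op C y).kind = .all → (∀ s ∈ E, (op C s).kind ≠ .all) →
      (∀ s ∈ W, (op C s).kind ≠ .all) → OnlyAll C y ∧ (ψ.IsFGX →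
        ((quantify C L (.qf ψ)).Satisfiable ↔ ∃ T : Set Trace, T.Nonempty ∧
          (∀ t ∈ T, ∀ i, t i ⊆ lineProps C) ∧ ∃ τ : ℕ → Trace,
          (∀ s, Slot C s → y < s → τ s ∈ T) ∧ ∀ t ∈ T, ∃ τ' : ℕ → Trace,
            (∀ s, Slot C s → s < y → τ' s ∈ T) ∧
              ψ.FSat (bindOf (L.map fun s => ((op C s).fst, s))) (fun i s => comb y τ t τ' s i)
                (Set.range fun i s => comb y τ t τ' s i) 0)) := by
    intro E y W hL hy hE hW
    have hp := hc.pairwise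
    rw [hL, List.pairwise_append, List.pairwise_cons] at hp
    have hE' : ∀ s ∈ E, y < s := fun s hs => hp.2.2 s hs y (by simp)
    have hW' : ∀ s ∈ W, s < y := fun s hs => hp.2.1.1 s hs
    have hsE : ∀ s, (Slot C s ∧ y < s) ↔ s ∈ E := fun s => by
      rw [hslot, hL, List.mem_append, List.mem_cons]
      refine ⟨?_, fun h => ⟨.inl h, hE' s h⟩⟩
      rintro ⟨h | rfl | h, h'⟩
      · exact h
      · exact absurd h' (lt_irrefl _)
      · exact absurd (hW' s h) h'.not_gt
    have hsW : ∀ s, (Slot C s ∧ s < y) ↔ s ∈ W := fun s => by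
      rw [hslot, hL, List.mem_append, List.mem_cons]
      refine ⟨?_, fun h => ⟨.inr (.inr h), hW' s h⟩⟩
      rintro ⟨h | rfl | h, h'⟩
      · exact absurd (hE' s h) h'.not_gt
      · exact absurd h' (lt_irrefl _)
      · exact h
    refine ⟨⟨⟨(hslot y).2 (by simp [hL]), hy⟩, fun s hs hk => ?_⟩, fun hψ => ?_⟩
    · rw [hslot, hL, List.mem_append, List.mem_cons] at hs
      rcases hs with h | h | h
      · exact absurd hk (hE s h)
      · exact h
      · exact absurd hk (hW s h)
    · have e : quantify C L (.qf ψ) = exs (E.map fun s => ((op C s).fst, s))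
          (.all (op C y).fst (exs (W.map fun s => ((op C s).fst, s)) (.qf ψ))) := by
        rw [← quantify_eq_exs hE, ← quantify_eq_exs hW, hL]
        simp [quantify, List.foldr_append, hy]
      have eL : (L.map fun s => ((op C s).fst, s)) = (E.map fun s => ((op C s).fst, s)) ++
          ((op C y).fst, y) :: (W.map fun s => ((op C s).fst, s)) := by
        simp [hL]
      have hnd' : (((E.map fun s => ((op C s).fst, s)) ++
          ((op C y).fst, y) :: (W.map fun s => ((op C s).fst, s))).map Prod.snd).Nodup := by
        rw [← eL]
        simpa [Function.comp_def] using hnd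
      simp only [Formula.Satisfiable, ← hprops]
      refine exists_congr fun T => and_congr_right fun _ => and_congr_right fun _ => ?_
      rw [e, sat_prefix (p := ((op C y).fst, y)) (by simpa using hE') (by simpa using hW') hnd', ← eL]
      simp only [List.forall_mem_map, QF.sat_iff_fsat hψ]
      simp only [← and_imp, hsE, hsW]
  constructor
  · rintro ⟨h1, h2, h3, h4⟩
    obtain ⟨E, y, W, hL, hy, hE, hW⟩ := isEAE_quantify.1 h2
    have h3' : ψ.IsFGX := by rwa [Formula.IsFGX, matrix_quantify] at h3
    obtain ⟨k1, k2⟩ := key E y W hL hy hE hW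
    exact ⟨y, m, ψ, _, k1, hmat (by simp [hL]), hb, hbind, hsent.1 h1, h3', (k2 h3').1 h4⟩
  · rintro ⟨y, m', ψ', bind, h1, h2, h3, h4, h5, h6, h7⟩
    have hyL : y ∈ L := (hslot y).1 h1.1.1
    obtain ⟨E, W, hL⟩ := List.append_of_mem hyL
    obtain rfl : m = m' := (h2 m).1 ((hmat (by simp [hL]) m).2 rfl)
    obtain rfl := hb.unique h3
    obtain rfl : bind = bindOf (L.map fun s => ((op C s).fst, s)) := by
      funext x
      apply Option.ext
      intro s
      rw [h4, hbind]
    have hnd' := hnd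
    rw [hL, List.nodup_append, List.nodup_cons] at hnd'
    have hE : ∀ s ∈ E, (op C s).kind ≠ .all := fun s hs hk =>
      hnd'.2.2 s hs y (by simp) (h1.2 s ((hslot s).2 (by simp [hL, hs])) hk)
    have hW : ∀ s ∈ W, (op C s).kind ≠ .all := fun s hs hk => by
      obtain rfl := h1.2 s ((hslot s).2 (by simp [hL, hs])) hk
      exact hnd'.2.1.1 hs
    obtain ⟨k1, k2⟩ := key E y W hL h1.1.2 hE hW
    exact ⟨hsent.2 h5, isEAE_quantify.2 ⟨E, y, W, hL, h1.1.2, hE, hW⟩,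
      by rwa [Formula.IsFGX, matrix_quantify], (k2 h6).2 h7⟩

end HyperLTL

/-! ### Small certificates -/

namespace HyperLTL

section

variable {n : ℕ} (A : Fin n → ℕ)

/-- The valuation that is given by a table of bits; `A` names the propositions. -/
def ofTable (S : Set (Fin n × Fin n)) : Val :=
  fun s => {a | ∃ k, ∃ hs : s < n, A k = a ∧ (⟨s, hs⟩, k) ∈ S}

/-- The table of bits of a valuation. -/
def toTable (v : Val) : Set (Fin n × Fin n) := {p | A p.2 ∈ v p.1}

theorem mem_ofTable_toTable {v : Val} {s a : ℕ} :
    a ∈ ofTable A (toTable A v) s ↔ s < n ∧ a ∈ v s ∧ a ∈ Set.range A := by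
  simp only [ofTable, toTable, Set.mem_ofPred_eq, Set.mem_range]
  constructor
  · rintro ⟨k, hs, rfl, h⟩
    exact ⟨hs, h, k, rfl⟩
  · rintro ⟨hs, h, k, rfl⟩
    exact ⟨k, hs, rfl, h⟩

theorem ofTable_toTable {v : Val} {s : ℕ} (hs : s < n) (h : v s ⊆ Set.range A) :
    ofTable A (toTable A v) s = v s := by
  ext a
  rw [mem_ofTable_toTable]
  exact ⟨fun h => h.2.1, fun ha => ⟨hs, ha, h ha⟩⟩

theorem ofTable_toTable_congr {v v' : Val} {s s' : ℕ} (hs : s < n ↔ s' < n) (h : v s = v' s') :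
    ofTable A (toTable A v) s = ofTable A (toTable A v') s' := by
  ext a
  rw [mem_ofTable_toTable, mem_ofTable_toTable, hs, h]

/-- The types of the traces of a model can be identified if they give the same tables. This leaves
doubly exponentially many types. -/
theorem exists_small_cert {T : Set Trace} (hT : T.Nonempty)
    (hA : ∀ t ∈ T, ∀ i, t i ⊆ Set.range A) {E W : Set ℕ} {y : ℕ} (hy : y < n)
    (hE : ∀ s ∈ E, y < s) (hEn : ∀ s ∈ E, s < n) (hW : ∀ s ∈ W, s < y) {τ : ℕ → Trace}
    (hτ : ∀ s ∈ E, τ s ∈ T) {τ' : Trace → ℕ → Trace} (hτ' : ∀ t ∈ T, ∀ s ∈ W, τ' t s ∈ T) :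
    ∃ M, 0 < M ∧ M ≤ (2 ^ (n * n)) ^ n * 2 ^ 2 ^ (n * n) ∧ ∃ c : Cert (Fin M) E W y n,
      (∀ θ, ∀ z ∈ c.Q θ, ∃ S, ofTable A S = z) ∧ ∀ θ, ∃ t ∈ T,
        (∀ i, ∀ s, s ∈ E ∨ s = y ∨ s ∈ W → i < n → comb y τ t (τ' t) s i = c.P θ i s) ∧
        (∀ i, ∃ z ∈ c.Q θ, ∀ s, s ∈ E ∨ s = y ∨ s ∈ W → comb y τ t (τ' t) s i = z s) ∧
        ∀ z ∈ c.Q θ, ∃ i, ∀ s, s ∈ E ∨ s = y ∨ s ∈ W → comb y τ t (τ' t) s i = z s := by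
  classical
  obtain ⟨c, hc⟩ := exists_cert n hT hE hW hτ hτ'
  -- two types are identified if they have the same element of `K`
  let K : Type := (Fin n → Set (Fin n × Fin n)) × Set (Set (Fin n × Fin n))
  let F : T → K := fun t => (fun i => toTable A (c.P t i), toTable A '' c.Q t)
  let e : K ≃ Fin (Fintype.card K) := Fintype.equivFin K
  have : ∀ x : Fin (Fintype.card K), ∃ t : T, (∃ t', F t' = e.symm x) → F t = e.symm x := by
    intro x
    by_cases h : ∃ t', F t' = e.symm x
    · exact ⟨h.choose, fun _ => h.choose_spec⟩
    · exact ⟨⟨_, hT.some_mem⟩, fun h' => absurd h' h⟩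
  -- `σ` picks a representative of every class
  choose σ hσ using this
  have hκ : ∀ t, F (σ (e (F t))) = F t := by
    intro t
    have := hσ (e (F t)) ⟨t, by simp⟩
    simpa using this
  have hP : ∀ t, ∀ i < n, toTable A (c.P (σ (e (F t))) i) = toTable A (c.P t i) := fun t i hi =>
    congrFun (congrArg Prod.fst (hκ t)) ⟨i, hi⟩
  have hQ : ∀ t, (fun z => ofTable A (toTable A z)) '' c.Q (σ (e (F t))) =
      (fun z => ofTable A (toTable A z)) '' c.Q t := fun t => by
    have := congrArg (fun S => ofTable A '' S) (congrArg Prod.snd (hκ t))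
    simpa only [F, Set.image_image] using this
  have agree : ∀ {z z' : Val}, Agree E z z' →
      Agree E (ofTable A (toTable A z)) (ofTable A (toTable A z')) :=
    fun h s hs => ofTable_toTable_congr A Iff.rfl (h s hs)
  have hWn : ∀ s ∈ W, (s < n ↔ y < n) := fun s hs => by have := hW s hs; omega
  have hEy : ∀ s ∈ E, (s < n ↔ y < n) := fun s hs => by have := hEn s hs; omega
  let c' : Cert (Fin (Fintype.card K)) E W y n :=
    { P := fun θ i => ofTable A (toTable A (c.P (σ θ) i))
      Q := fun θ => (fun z => ofTable A (toTable A z)) '' c.Q (σ θ)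
      child := fun θ s => e (F (c.child (σ θ) s))
      root := fun s => e (F (c.root s))
      P_mem := fun θ i hi => ⟨_, c.P_mem _ i hi, rfl⟩
      P_agree := fun θ θ' i hi => agree (c.P_agree _ _ i hi)
      P_child := fun θ s hs i hi => by
        simp only [hP _ i hi]
        exact ofTable_toTable_congr A (hWn s hs) (c.P_child _ s hs i hi)
      Q_agree := by
        rintro θ θ' _ ⟨z, hz, rfl⟩
        obtain ⟨z', hz', h⟩ := c.Q_agree (σ θ) (σ θ') z hz
        exact ⟨_, ⟨z', hz', rfl⟩, agree h⟩
      Q_down := by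
        rintro θ s hs _ ⟨z, hz, rfl⟩
        obtain ⟨z', hz', h, h'⟩ := c.Q_down (σ θ) s hs z hz
        rw [hQ]
        exact ⟨_, ⟨z', hz', rfl⟩, agree h, ofTable_toTable_congr A (hWn s hs) h'⟩
      Q_up := by
        intro θ s hs z hz
        rw [hQ] at hz
        obtain ⟨z', hz', rfl⟩ := hz
        obtain ⟨z, hz, h, h'⟩ := c.Q_up (σ θ) s hs z' hz'
        exact ⟨_, ⟨z, hz, rfl⟩, agree h, ofTable_toTable_congr A (hWn s hs) h'⟩
      Q_root := by
        intro s hs z hz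
        rw [hQ] at hz
        obtain ⟨z', hz', rfl⟩ := hz
        exact ofTable_toTable_congr A (hEy s hs) (c.Q_root s hs z' hz') }
  have key : ∀ (t : T) (i s : ℕ), s ∈ E ∨ s = y ∨ s ∈ W →
      comb y τ t (τ' t) s i = ofTable A (toTable A fun s => comb y τ t (τ' t) s i) s := by
    intro t i s hs
    refine (ofTable_toTable A (v := fun s => comb y τ t (τ' t) s i) ?_ ?_).symm
    · rcases hs with h | rfl | h
      exacts [hEn s h, hy, (hW s h).trans hy]
    · refine hA (comb y τ t (τ' t) s) ?_ i
      unfold comb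
      rcases hs with h | rfl | h
      · have := hE s h
        simpa [this.not_gt, this.ne'] using hτ s h
      · simp
      · simpa [hW s h] using hτ' t t.2 s h
  refine ⟨_, Fintype.card_pos_iff.2 ⟨F ⟨_, hT.some_mem⟩⟩, by simp [K], c', ?_, fun θ =>
    ⟨σ θ, (σ θ).2, fun i s hs _ => ?_, fun i => ?_, ?_⟩⟩
  · rintro θ _ ⟨z, _, rfl⟩
    exact ⟨_, rfl⟩
  · simp only [c', (hc (σ θ)).1]
    exact key _ _ _ hs
  · refine ⟨_, ⟨fun s => comb y τ (σ θ) (τ' (σ θ)) s i, ?_, rfl⟩, fun s hs => key _ _ _ hs⟩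
    rw [(hc (σ θ)).2]
    exact ⟨i, rfl⟩
  · rintro _ ⟨z, hz, rfl⟩
    rw [(hc (σ θ)).2] at hz
    obtain ⟨i, rfl⟩ := hz
    exact ⟨i, fun s hs => key _ _ _ hs⟩

end

/-- The number of types is below the bound up to which the machine counts. -/
theorem card_bound {n l : ℕ} (h : n ≤ l) :
    (2 ^ (n * n)) ^ n * 2 ^ 2 ^ (n * n) ≤ 2 ^ 2 ^ (l + 2) ^ 2 := by
  rw [← pow_mul, ← pow_add]
  refine Nat.pow_le_pow_right (by norm_num) ?_
  have h1 : n * n * n ≤ 2 ^ (n * n + 3 * n) := by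
    have := (Nat.lt_two_pow_self (n := n)).le
    calc n * n * n ≤ 2 ^ n * 2 ^ n * 2 ^ n := by gcongr
      _ = 2 ^ (3 * n) := by rw [← pow_add, ← pow_add]; congr 1; ring
      _ ≤ _ := Nat.pow_le_pow_right (by norm_num) (by omega)
  have h2 : 2 ^ (n * n) ≤ 2 ^ (n * n + 3 * n) := Nat.pow_le_pow_right (by norm_num) (by omega)
  calc n * n * n + 2 ^ (n * n) ≤ 2 ^ (n * n + 3 * n) + 2 ^ (n * n + 3 * n) := by omega
    _ = 2 ^ (n * n + 3 * n + 1) := by ring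
    _ ≤ 2 ^ (l + 2) ^ 2 := Nat.pow_le_pow_right (by norm_num) (by nlinarith)

/-- The number of tables is below the bound up to which the machine counts. -/
theorem table_bound {n l : ℕ} (h : n ≤ l) : 2 ^ (n * n) ≤ 2 ^ 2 ^ (l + 2) ^ 2 := by
  refine Nat.pow_le_pow_right (by norm_num) ((Nat.lt_two_pow_self).le.trans ?_)
  exact Nat.pow_le_pow_right (by norm_num) (by nlinarith)

end HyperLTL

/-! ### Satisfiability as a system of conditions on relations between numbers -/

namespace HyperLTL

open Function (update)
open Relation (ReflTransGen)

/-- Relations that describe how a word is divided into lines. Lines are counted from `0`, and all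
arguments called `p` or `r` are positions of the word. -/
structure ParseRel where
  /-- A number that ends at the separator `r` starts at `p`. -/
  num : ℕ → ℕ → Prop
  /-- The numbers that start at the two positions are equal. -/
  eqn : ℕ → ℕ → Prop
  /-- Line `k` starts at `p`. -/
  start : ℕ → ℕ → Prop
  /-- The right-hand side of line `k` starts at `p`. -/
  opp : ℕ → ℕ → Prop
  /-- The first number of the right-hand side of line `k` starts at `p`. -/
  a1 : ℕ → ℕ → Prop
  /-- The second number of the right-hand side of line `k` starts at `p`. -/
  a2 : ℕ → ℕ → Prop
  /-- There is a line `k`. -/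
  line : ℕ → Prop
  /-- The first number of line `k` is the label of line `k'`. -/
  lab1 : ℕ → ℕ → Prop
  /-- The second number of line `k` is the label of line `k'`. -/
  lab2 : ℕ → ℕ → Prop
  /-- The first number of line `k` is the first number of line `k'`. -/
  same1 : ℕ → ℕ → Prop
  /-- The second number of line `k` is the first number of line `k'`. -/
  same2 : ℕ → ℕ → Prop

/-- Relations that describe a formula and a certificate for its satisfiability. Numbers `k`, `s`, `i`
stand for lines, numbers `θ` for types and numbers `z` for valuations. -/
structure Rel extends ParseRel where
  /-- The first number of line `k`, read as a label, refers to line `k'`. -/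
  res1 : ℕ → ℕ → Prop
  /-- The second number of line `k`, read as a label, refers to line `k'`. -/
  res2 : ℕ → ℕ → Prop
  /-- Line `k'` is an operand of line `k`. -/
  opd : ℕ → ℕ → Prop
  /-- Line `k` belongs to the formula of the last line. -/
  reach : ℕ → Prop
  /-- Line `s` is a quantifier of the formula of the last line; it is called a slot. -/
  slot : ℕ → Prop
  /-- Line `m` builds the quantifier-free part of the formula. -/
  mat : ℕ → Prop
  /-- The slot of the universal quantifier. -/
  yy : ℕ → Prop
  /-- The slots of the existential quantifiers in front of the universal one. -/
  es : ℕ → Prop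
  /-- The slots of the existential quantifiers behind the universal one. -/
  ws : ℕ → Prop
  /-- The variable of the atom in line `k` is bound by the quantifier in line `s`. -/
  bind : ℕ → ℕ → Prop
  /-- Line `k` builds a Boolean combination of atoms. -/
  bool : ℕ → Prop
  /-- Line `k` builds a Boolean combination of atoms under a number of operators `X`. -/
  xb : ℕ → Prop
  /-- Line `k` builds a formula of the fragment. -/
  fgx : ℕ → Prop
  /-- The proposition of line `k` belongs to the valuation `z` of slot `s`. -/
  zb : ℕ → ℕ → ℕ → Prop
  /-- The Boolean formula of line `k` is true under the valuation `z`. -/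
  tb : ℕ → ℕ → Prop
  /-- The number `θ` is a type. -/
  th : ℕ → Prop
  /-- The valuation `z` occurs in the type `θ`. -/
  q : ℕ → ℕ → Prop
  /-- The type `θ` has the valuation `z` at position `i`. -/
  pr : ℕ → ℕ → ℕ → Prop
  /-- The witness for the slot `s` behind the universal quantifier has, for traces of type `θ`, the
  type `θ'`. -/
  child : ℕ → ℕ → ℕ → Prop
  /-- The witness for the slot `s` in front of the universal quantifier has the type `θ`. -/
  root : ℕ → ℕ → Prop
  /-- The formula of line `k` is true for the type `θ` at position `i`. -/
  t : ℕ → ℕ → ℕ → Prop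
  /-- The valuation of slot `s` in `z` is the valuation of the universal slot in `z'`. -/
  sync : ℕ → ℕ → ℕ → Prop
  /-- The valuations agree on the slots of the outer existential quantifiers. -/
  same : ℕ → ℕ → Prop

/-- The operators that take two numbers. -/
def Letter.twos : List Letter := [atom, or, and, .until, ex, all]

/-- The relations describe the lines of `C`, where `K S k` says that line `k` has an operator
in `S`. -/
structure ParseRel.Fits (C : List (ℕ × Op)) (K : List Letter → ℕ → Prop) (r : ParseRel) : Prop where
  line : ∀ k, r.line k ↔ k < C.length
  kind : ∀ S k, K S k ↔ k < C.length ∧ (op C k).kind ∈ S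
  lab1 : ∀ k k', r.lab1 k k' ↔ k < C.length ∧ k' < C.length ∧ lab C k' = (op C k).fst
  lab2 : ∀ k k', r.lab2 k k' ↔ k < C.length ∧ k' < C.length ∧ (op C k).kind ∈ Letter.twos ∧
    lab C k' = (op C k).snd
  same1 : ∀ k k', r.same1 k k' ↔ k < C.length ∧ k' < C.length ∧ (op C k).fst = (op C k').fst
  same2 : ∀ k k', r.same2 k k' ↔ k < C.length ∧ k' < C.length ∧ (op C k).kind ∈ Letter.twos ∧
    (op C k).snd = (op C k').fst

/-- The conditions that make the relations describe the formula of the last line, and that put this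
formula into the fragment. Most relations are determined by recursion on the lines; `bool`, `xb` and
`fgx` need only be sound, since they are used positively. -/
structure Rel.IsWellFormed (N : ℕ) (K : List Letter → ℕ → Prop) (r : Rel) : Prop where
  res1 : ∀ k < N, ∀ k' < N, (r.res1 k k' ↔
    r.lab1 k k' ∧ k' < k ∧ ∀ l < N, k' < l → l < k → ¬ r.lab1 k l)
  res2 : ∀ k < N, ∀ k' < N, (r.res2 k k' ↔
    r.lab2 k k' ∧ k' < k ∧ ∀ l < N, k' < l → l < k → ¬ r.lab2 k l)
  opd : ∀ k < N, ∀ k' < N, (r.opd k k' ↔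
    (K Letter.fsts k ∧ r.res1 k k') ∨ (K Letter.snds k ∧ r.res2 k k'))
  wf1 : ∀ k < N, K Letter.fsts k → ∃ k' < N, r.res1 k k' ∧ ¬ K Letter.quants k'
  wf2 : ∀ k < N, K Letter.joins k → ∃ k' < N, r.res2 k k' ∧ ¬ K Letter.quants k'
  wf3 : ∀ k < N, K Letter.quants k → ∃ k' < N, r.res2 k k'
  reach : ∀ k < N, (r.reach k ↔
    (r.line k ∧ ∀ l < N, k < l → ¬ r.line l) ∨ ∃ l < N, r.reach l ∧ r.opd l k)
  slot : ∀ s < N, (r.slot s ↔ r.reach s ∧ K Letter.quants s)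
  mat : ∀ m < N, (r.mat m ↔ r.line m ∧ ¬ K Letter.quants m ∧ ∃ s < N, r.slot s ∧ r.opd s m)
  yy : ∀ y < N, (r.yy y ↔ r.slot y ∧ K [.all] y)
  exists_yy : ∃ y < N, r.yy y
  yy_unique : ∀ y < N, ∀ y' < N, r.yy y → r.yy y' → ¬ y < y'
  es : ∀ s < N, (r.es s ↔ r.slot s ∧ ∃ y < N, r.yy y ∧ y < s)
  ws : ∀ s < N, (r.ws s ↔ r.slot s ∧ ∃ y < N, r.yy y ∧ s < y)
  bind : ∀ k < N, ∀ s < N, (r.bind k s ↔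
    r.slot s ∧ r.same2 k s ∧ ∀ l < N, r.slot l → l < s → ¬ r.same2 k l)
  bound : ∀ k < N, r.reach k → K [.atom] k → ∃ s < N, r.bind k s
  bool : ∀ k < N, r.bool k → K [.atom] k ∨
    (K [.neg, .or, .and] k ∧ ∀ l < N, r.opd k l → r.bool l)
  xb : ∀ k < N, r.xb k → r.bool k ∨ (K [.next] k ∧ ∀ l < N, r.opd k l → r.xb l)
  fgx : ∀ k < N, r.fgx k → r.xb k ∨ (K [.neg, .or, .and] k ∧ ∀ l < N, r.opd k l → r.fgx l) ∨
    (K [.ev, .alw] k ∧ ∀ l < N, r.opd k l → r.bool l)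
  mat_fgx : ∀ m < N, r.mat m → r.fgx m

/-- The conditions that make the relations describe a certificate in the sense of `Cert`. The lines
also serve as the positions at which the types record their valuations: the relevant positions are
bounded by the nesting depth of `X`, and this is less than the number of lines. -/
structure Rel.IsCertificate (N : ℕ) (K : List Letter → ℕ → Prop) (r : Rel) : Prop where
  zb_congr : ∀ z < N, ∀ s < N, ∀ k < N, ∀ k' < N, r.same1 k k' → r.zb z s k → r.zb z s k'
  tb_atom : ∀ z < N, ∀ k < N, K [.atom] k → (r.tb z k ↔ ∃ s < N, r.bind k s ∧ r.zb z s k)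
  tb_neg : ∀ z < N, ∀ k < N, ∀ k' < N, K [.neg] k → r.res1 k k' → (r.tb z k ↔ ¬ r.tb z k')
  tb_or : ∀ z < N, ∀ k < N, ∀ k' < N, ∀ l < N, K [.or] k → r.res1 k k' → r.res2 k l →
    (r.tb z k ↔ r.tb z k' ∨ r.tb z l)
  tb_and : ∀ z < N, ∀ k < N, ∀ k' < N, ∀ l < N, K [.and] k → r.res1 k k' → r.res2 k l →
    (r.tb z k ↔ r.tb z k' ∧ r.tb z l)
  tb_none : ∀ z < N, ∀ k < N, K [.next, .until, .ev, .alw] k → ¬ r.tb z k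
  t_atom : ∀ θ < N, ∀ i < N, ∀ k < N, r.th θ → r.line i → K [.atom] k →
    (r.t θ i k ↔ ∃ z < N, r.pr θ i z ∧ r.tb z k)
  t_neg : ∀ θ < N, ∀ i < N, ∀ k < N, ∀ k' < N, r.th θ → r.line i → K [.neg] k → r.res1 k k' →
    (r.t θ i k ↔ ¬ r.t θ i k')
  t_or : ∀ θ < N, ∀ i < N, ∀ k < N, ∀ k' < N, ∀ l < N, r.th θ → r.line i → K [.or] k →
    r.res1 k k' → r.res2 k l → (r.t θ i k ↔ r.t θ i k' ∨ r.t θ i l)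
  t_and : ∀ θ < N, ∀ i < N, ∀ k < N, ∀ k' < N, ∀ l < N, r.th θ → r.line i → K [.and] k →
    r.res1 k k' → r.res2 k l → (r.t θ i k ↔ r.t θ i k' ∧ r.t θ i l)
  t_next : ∀ θ < N, ∀ i < N, ∀ k < N, ∀ k' < N, ∀ j < N, r.th θ → r.line i → r.line j →
    j = i + 1 → K [.next] k → r.res1 k k' → (r.t θ i k ↔ r.t θ j k')
  t_until : ∀ θ < N, ∀ i < N, ∀ k < N, r.th θ → r.line i → K [.until] k → ¬ r.t θ i k
  t_ev : ∀ θ < N, ∀ i < N, ∀ k < N, ∀ k' < N, r.th θ → r.line i → K [.ev] k → r.res1 k k' →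
    (r.t θ i k ↔ ∃ z < N, r.q θ z ∧ r.tb z k')
  t_alw : ∀ θ < N, ∀ i < N, ∀ k < N, ∀ k' < N, r.th θ → r.line i → K [.alw] k → r.res1 k k' →
    (r.t θ i k ↔ ∀ z < N, r.q θ z → r.tb z k')
  t_mat : ∀ θ < N, ∀ m < N, ∀ i < N, r.th θ → r.mat m → (∀ j < N, ¬ j < i) → r.t θ i m
  exists_th : ∃ θ < N, r.th θ
  exists_pr : ∀ θ < N, ∀ i < N, r.th θ → r.line i → ∃ z < N, r.pr θ i z
  pr_unique : ∀ θ < N, ∀ i < N, ∀ z < N, ∀ z' < N, r.th θ → r.line i → r.pr θ i z → r.pr θ i z' →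
    ¬ z < z'
  pr_q : ∀ θ < N, ∀ i < N, ∀ z < N, r.th θ → r.line i → r.pr θ i z → r.q θ z
  sync : ∀ s < N, ∀ z < N, ∀ z' < N, (r.sync s z z' ↔
    ∀ y < N, ∀ k < N, r.yy y → K [.atom] k → (r.zb z s k ↔ r.zb z' y k))
  same : ∀ z < N, ∀ z' < N, (r.same z z' ↔
    ∀ s < N, ∀ k < N, r.es s → K [.atom] k → (r.zb z s k ↔ r.zb z' s k))
  pr_same : ∀ θ < N, ∀ θ' < N, ∀ i < N, ∀ z < N, ∀ z' < N, r.th θ → r.th θ' → r.line i →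
    r.pr θ i z → r.pr θ' i z' → r.same z z'
  exists_child : ∀ θ < N, ∀ s < N, r.th θ → r.ws s → ∃ θ' < N, r.th θ' ∧ r.child θ s θ'
  pr_child : ∀ θ < N, ∀ s < N, ∀ θ' < N, ∀ i < N, ∀ z < N, ∀ z' < N, r.th θ → r.ws s → r.th θ' →
    r.child θ s θ' → r.line i → r.pr θ i z → r.pr θ' i z' → r.sync s z z'
  q_same : ∀ θ < N, ∀ θ' < N, ∀ z < N, r.th θ → r.th θ' → r.q θ z →
    ∃ z' < N, r.q θ' z' ∧ r.same z z'
  q_down : ∀ θ < N, ∀ s < N, ∀ θ' < N, ∀ z < N, r.th θ → r.ws s → r.th θ' → r.child θ s θ' →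
    r.q θ z → ∃ z' < N, r.q θ' z' ∧ r.same z z' ∧ r.sync s z z'
  q_up : ∀ θ < N, ∀ s < N, ∀ θ' < N, ∀ z' < N, r.th θ → r.ws s → r.th θ' → r.child θ s θ' →
    r.q θ' z' → ∃ z < N, r.q θ z ∧ r.same z z' ∧ r.sync s z z'
  exists_root : ∀ s < N, r.es s → ∃ θ < N, r.th θ ∧ r.root s θ
  q_root : ∀ s < N, ∀ θ < N, ∀ z < N, r.es s → r.th θ → r.root s θ → r.q θ z → r.sync s z z

/-! ### The meaning of the syntactic relations -/

section

variable {C : List (ℕ × Op)} {N : ℕ} {K : List Letter → ℕ → Prop} {r : Rel}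

theorem Reach.lt (hC : C ≠ []) {k : ℕ} (h : Reach C k) : k < C.length := by
  have := le_of_reflTransGen h
  have := List.length_pos_iff.2 hC
  omega

theorem Letter.mem_twos_of_mem_snds {o : Letter} (h : o ∈ snds) : o ∈ twos := by
  cases o <;> first | decide | exact absurd h (by decide)

theorem reach_iff_exists (hC : C ≠ []) (hN : C.length ≤ N) (k : ℕ) : Reach C k ↔
    (k < C.length ∧ ∀ l < N, k < l → ¬ l < C.length) ∨
      ∃ l < N, Reach C l ∧ l < C.length ∧ Opd C l k := by
  have hpos := List.length_pos_iff.2 hC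
  rw [Reach, ReflTransGen.cases_tail_iff]
  refine or_congr ⟨?_, ?_⟩ (exists_congr fun l => ⟨fun h => ?_, fun h => ⟨h.2.1, h.2.2.2⟩⟩)
  · rintro rfl
    exact ⟨by omega, fun l _ h => by omega⟩
  · rintro ⟨h, h'⟩
    by_contra hne
    exact h' (C.length - 1) (by omega) (by omega) (by omega)
  · have := Reach.lt hC h.1
    exact ⟨by omega, h.1, this, h.2⟩

/-- The syntactic relations have the intended meaning. -/
structure Rel.Describes (C : List (ℕ × Op)) (N : ℕ) (r : Rel) : Prop where
  res1 : ∀ k < N, ∀ k' < N, (r.res1 k k' ↔ k < C.length ∧ Res C k (op C k).fst k')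
  res2 : ∀ k < N, ∀ k' < N, (r.res2 k k' ↔
    k < C.length ∧ (op C k).kind ∈ Letter.twos ∧ Res C k (op C k).snd k')
  opd : ∀ k < N, ∀ k' < N, (r.opd k k' ↔ k < C.length ∧ Opd C k k')
  reach : ∀ k < N, (r.reach k ↔ Reach C k)
  slot : ∀ s < N, (r.slot s ↔ Slot C s)
  mat : ∀ m < N, (r.mat m ↔ Matrix C m)
  yy : ∀ y < N, (r.yy y ↔ Slot C y ∧ (op C y).kind = .all)
  bind : ∀ k < N, ∀ s < N, (r.bind k s ↔
    k < C.length ∧ (op C k).kind ∈ Letter.twos ∧ Binds C (op C k).snd s)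

theorem ParseRel.Fits.res1_iff (hN : C.length ≤ N) {r : ParseRel} (hf : r.Fits C K) (k k' : ℕ) :
    k < C.length ∧ Res C k (op C k).fst k' ↔
      r.lab1 k k' ∧ k' < k ∧ ∀ l < N, k' < l → l < k → ¬ r.lab1 k l := by
  simp only [hf.lab1, Res]
  constructor
  · rintro ⟨h, h1, h2, h3⟩
    exact ⟨⟨h, h1.trans h, h2⟩, h1, fun l _ h4 h5 h6 => h3 l h4 h5 h6.2.2⟩
  · rintro ⟨⟨h, h0, h2⟩, h1, h3⟩
    exact ⟨h, h1, h2, fun l h4 h5 h6 => h3 l (by omega) h4 h5 ⟨h, by omega, h6⟩⟩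

theorem ParseRel.Fits.res2_iff (hN : C.length ≤ N) {r : ParseRel} (hf : r.Fits C K) (k k' : ℕ) :
    k < C.length ∧ (op C k).kind ∈ Letter.twos ∧ Res C k (op C k).snd k' ↔
      r.lab2 k k' ∧ k' < k ∧ ∀ l < N, k' < l → l < k → ¬ r.lab2 k l := by
  simp only [hf.lab2, Res]
  constructor
  · rintro ⟨h, h0, h1, h2, h3⟩
    exact ⟨⟨h, h1.trans h, h0, h2⟩, h1, fun l _ h4 h5 h6 => h3 l h4 h5 h6.2.2.2⟩
  · rintro ⟨⟨h, h', h0, h2⟩, h1, h3⟩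
    exact ⟨h, h0, h1, h2, fun l h4 h5 h6 => h3 l (by omega) h4 h5 ⟨h, by omega, h0, h6⟩⟩

theorem ParseRel.Fits.opd_iff {r : ParseRel} (hf : r.Fits C K) (k k' : ℕ) :
    k < C.length ∧ Opd C k k' ↔ (K Letter.fsts k ∧ k < C.length ∧ Res C k (op C k).fst k') ∨
      (K Letter.snds k ∧ k < C.length ∧ (op C k).kind ∈ Letter.twos ∧
        Res C k (op C k).snd k') := by
  simp only [hf.kind, Opd]
  constructor
  · rintro ⟨h, h' | h'⟩
    · exact .inl ⟨⟨h, h'.1⟩, h, h'.2⟩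
    · exact .inr ⟨⟨h, h'.1⟩, h, Letter.mem_twos_of_mem_snds h'.1, h'.2⟩
  · rintro (⟨⟨h, h1⟩, _, h2⟩ | ⟨⟨h, h1⟩, _, _, h2⟩)
    · exact ⟨h, .inl ⟨h1, h2⟩⟩
    · exact ⟨h, .inr ⟨h1, h2⟩⟩

theorem ParseRel.Fits.matrix_iff (hC : C ≠ []) (hN : C.length ≤ N) {r : ParseRel} (hf : r.Fits C K)
    (m : ℕ) : Matrix C m ↔
      r.line m ∧ ¬ K Letter.quants m ∧ ∃ s < N, Slot C s ∧ s < C.length ∧ Opd C s m := by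
  simp only [hf.kind, hf.line, Matrix]
  constructor
  · rintro ⟨h, s, hs, ho⟩
    have := hs.1.lt hC
    have := ho.lt
    exact ⟨by omega, fun h' => h h'.2, s, by omega, hs, by omega, ho⟩
  · rintro ⟨h, h', s, _, hs, _, ho⟩
    exact ⟨fun h'' => h' ⟨h, h''⟩, s, hs, ho⟩

theorem ParseRel.Fits.binds_iff (hC : C ≠ []) (hN : C.length ≤ N) {r : ParseRel} (hf : r.Fits C K)
    (k s : ℕ) : k < C.length ∧ (op C k).kind ∈ Letter.twos ∧ Binds C (op C k).snd s ↔
      Slot C s ∧ r.same2 k s ∧ ∀ l < N, Slot C l → l < s → ¬ r.same2 k l := by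
  simp only [hf.same2, Binds]
  constructor
  · rintro ⟨h, h1, h2, h3, h4⟩
    exact ⟨h2, ⟨h, h2.1.lt hC, h1, h3.symm⟩, fun l _ h5 h6 h7 => h4 l h5 h6 h7.2.2.2.symm⟩
  · rintro ⟨h2, ⟨h, _, h1, h3⟩, h4⟩
    exact ⟨h, h1, h2, h3.symm, fun l h5 h6 h7 =>
      h4 l ((h5.1.lt hC).trans_le hN) h5 h6 ⟨h, h5.1.lt hC, h1, h7.symm⟩⟩

theorem Rel.IsWellFormed.describes (hC : C ≠ []) (hN : C.length ≤ N) (hf : r.Fits C K)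
    (hs : r.IsWellFormed N K) : r.Describes C N := by
  have res1 : ∀ k < N, ∀ k' < N, (r.res1 k k' ↔ k < C.length ∧ Res C k (op C k).fst k') :=
    fun k hk k' hk' => by rw [hs.res1 k hk k' hk', hf.res1_iff hN]
  have res2 : ∀ k < N, ∀ k' < N, (r.res2 k k' ↔
      k < C.length ∧ (op C k).kind ∈ Letter.twos ∧ Res C k (op C k).snd k') :=
    fun k hk k' hk' => by rw [hs.res2 k hk k' hk', hf.res2_iff hN]
  have opd : ∀ k < N, ∀ k' < N, (r.opd k k' ↔ k < C.length ∧ Opd C k k') :=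
    fun k hk k' hk' => by rw [hs.opd k hk k' hk', hf.opd_iff, res1 k hk k' hk', res2 k hk k' hk']
  have reach : ∀ d, ∀ k < N, N - k = d → (r.reach k ↔ Reach C k) := by
    intro d
    induction d using Nat.strong_induction_on with
    | _ d ih =>
    intro k hk hd
    rw [hs.reach k hk, reach_iff_exists hC hN]
    simp only [hf.line]
    refine or_congr_right (exists_congr fun l => and_congr_right fun hl => ?_)
    rw [opd l hl k hk]
    constructor
    · rintro ⟨h1, h2, h3⟩
      have := h3.lt
      exact ⟨(ih _ (by omega) l hl rfl).1 h1, h2, h3⟩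
    · rintro ⟨h1, h2, h3⟩
      have := h3.lt
      exact ⟨(ih _ (by omega) l hl rfl).2 h1, h2, h3⟩
  have slot : ∀ s < N, (r.slot s ↔ Slot C s) := fun s h => by
    rw [hs.slot s h, reach _ s h rfl, hf.kind, Slot]
    exact ⟨fun h => ⟨h.1, h.2.2⟩, fun h => ⟨h.1, h.1.lt hC, h.2⟩⟩
  refine ⟨res1, res2, opd, fun k hk => reach _ k hk rfl, slot, fun m hm => ?_, fun y hy => ?_,
    fun k hk s h => ?_⟩
  · rw [hs.mat m hm, hf.matrix_iff hC hN]
    refine and_congr_right fun _ => and_congr_right fun _ => exists_congr fun s =>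
      and_congr_right fun h => ?_
    rw [slot s h, opd s h m hm]
  · rw [hs.yy y hy, slot y hy, hf.kind]
    exact ⟨fun h => ⟨h.1, by simpa using h.2.2⟩, fun h => ⟨h.1, h.1.1.lt hC, by simpa using h.2⟩⟩
  · rw [hs.bind k hk s h, hf.binds_iff hC hN, slot s h]
    refine and_congr_right fun _ => and_congr_right fun _ => forall_congr' fun l =>
      forall_congr' fun hl => ?_
    rw [slot l hl]

/-! ### The conditions imply satisfiability -/

theorem Rel.IsWellFormed.exists_buildsFormula (hN : C.length ≤ N) (hf : r.Fits C K)
    (hs : r.IsWellFormed N K) (hd : r.Describes C N) {k : ℕ} (hk : k < C.length) :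
    ((op C k).kind ∈ Letter.quants ∧ ∃ φ, BuildsFormula C k φ) ∨ ∃ ψ, Builds C k ψ := by
  induction k using Nat.strong_induction_on with
  | _ k ih =>
  have hkN := hk.trans_le hN
  have h1 : (op C k).kind ∈ Letter.fsts → ∃ k' ψ, Res C k (op C k).fst k' ∧ Builds C k' ψ := by
    intro h
    obtain ⟨k', hk', hr, hq⟩ := hs.wf1 k hkN ((hf.kind _ _).2 ⟨hk, h⟩)
    rw [hd.res1 k hkN k' hk'] at hr
    have hlt := hr.2.1
    rw [hf.kind] at hq
    rcases ih k' hlt (by omega) with h | ⟨ψ, h⟩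
    · exact absurd ⟨by omega, h.1⟩ hq
    · exact ⟨k', ψ, hr.2, h⟩
  have h2 : (op C k).kind ∈ Letter.joins → ∃ k' ψ, Res C k (op C k).snd k' ∧ Builds C k' ψ := by
    intro h
    obtain ⟨k', hk', hr, hq⟩ := hs.wf2 k hkN ((hf.kind _ _).2 ⟨hk, h⟩)
    rw [hd.res2 k hkN k' hk'] at hr
    have hlt := hr.2.2.1
    rw [hf.kind] at hq
    rcases ih k' hlt (by omega) with h | ⟨ψ, h⟩
    · exact absurd ⟨by omega, h.1⟩ hq
    · exact ⟨k', ψ, hr.2.2, h⟩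
  have h3 : (op C k).kind ∈ Letter.quants →
      ∃ k' φ, Res C k (op C k).snd k' ∧ BuildsFormula C k' φ := by
    intro h
    obtain ⟨k', hk', hr⟩ := hs.wf3 k hkN ((hf.kind _ _).2 ⟨hk, h⟩)
    rw [hd.res2 k hkN k' hk'] at hr
    have hlt := hr.2.2.1
    rcases ih k' hlt (by omega) with ⟨_, φ, h⟩ | ⟨ψ, h⟩
    · exact ⟨k', φ, hr.2.2, h⟩
    · exact ⟨k', _, hr.2.2, .qf h⟩
  cases ho : (op C k).kind with
  | atom => exact .inr ⟨_, .atom ho⟩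
  | neg =>
    obtain ⟨_, _, h, h'⟩ := h1 (ho ▸ by decide)
    exact .inr ⟨_, .neg ho h h'⟩
  | next =>
    obtain ⟨_, _, h, h'⟩ := h1 (ho ▸ by decide)
    exact .inr ⟨_, .next ho h h'⟩
  | ev =>
    obtain ⟨_, _, h, h'⟩ := h1 (ho ▸ by decide)
    exact .inr ⟨_, .ev ho h h'⟩
  | alw =>
    obtain ⟨_, _, h, h'⟩ := h1 (ho ▸ by decide)
    exact .inr ⟨_, .alw ho h h'⟩
  | or =>
    obtain ⟨_, _, h, h'⟩ := h1 (ho ▸ by decide)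
    obtain ⟨_, _, g, g'⟩ := h2 (ho ▸ by decide)
    exact .inr ⟨_, .or ho h g h' g'⟩
  | and =>
    obtain ⟨_, _, h, h'⟩ := h1 (ho ▸ by decide)
    obtain ⟨_, _, g, g'⟩ := h2 (ho ▸ by decide)
    exact .inr ⟨_, .and ho h g h' g'⟩
  | ex =>
    obtain ⟨_, _, h, h'⟩ := h3 (ho ▸ by decide)
    exact .inl ⟨by decide, _, .ex ho h h'⟩
  | all =>
    obtain ⟨_, _, h, h'⟩ := h3 (ho ▸ by decide)
    exact .inl ⟨by decide, _, .all ho h h'⟩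
  | zero => cases h : op C k <;> simp [h, Op.kind] at ho
  | one => cases h : op C k <;> simp [h, Op.kind] at ho
  | sep => cases h : op C k <;> simp [h, Op.kind] at ho
  | _ =>
    obtain ⟨_, _, h, h'⟩ := h1 (ho ▸ by decide)
    obtain ⟨_, _, g, g'⟩ := h2 (ho ▸ by decide)
    exact .inr ⟨_, .untl ho h g h' g'⟩

/-- A Boolean formula under a number of operators `X`. -/
def QF.IsNextBoolean (ψ : QF) : Prop := ∃ n ψ', ψ'.IsBoolean ∧ ψ = QF.next^[n] ψ'

theorem QF.IsNextBoolean.isFGX {ψ : QF} (h : ψ.IsNextBoolean) : ψ.IsFGX := by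
  obtain ⟨n, ψ', h, rfl⟩ := h
  exact .next n h

theorem Rel.IsWellFormed.isBoolean (hN : C.length ≤ N) (hf : r.Fits C K) (hs : r.IsWellFormed N K)
    (hd : r.Describes C N) {k : ℕ} {ψ : QF} (h : Builds C k ψ) (hk : k < C.length)
    (hb : r.bool k) : ψ.IsBoolean := by
  have key : ∀ {k k'}, k < C.length → (op C k).kind ∈ Letter.fsts → Res C k (op C k).fst k' →
      k' < C.length ∧ k' < N ∧ k < N ∧ r.opd k k' := fun {k k'} hk h hr => by
    have := hr.1
    exact ⟨by omega, by omega, by omega,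
      (hd.opd k (by omega) k' (by omega)).2 ⟨hk, .inl ⟨h, hr⟩⟩⟩
  have key' : ∀ {k k'}, k < C.length → (op C k).kind ∈ Letter.snds → Res C k (op C k).snd k' →
      k' < C.length ∧ k' < N ∧ r.opd k k' := fun {k k'} hk h hr => by
    have := hr.1
    exact ⟨by omega, by omega, (hd.opd k (by omega) k' (by omega)).2 ⟨hk, .inr ⟨h, hr⟩⟩⟩
  induction h with
  | atom => exact .atom _ _
  | neg h hr _ ih =>
    obtain ⟨h1, h2, h3, h4⟩ := key hk (h ▸ by decide) hr
    have := hs.bool _ h3 hb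
    simp only [hf.kind, h] at this
    simp at this
    exact .neg (ih h1 (this.2 _ h2 h4))
  | or h hr hr' _ _ ih ih' =>
    obtain ⟨h1, h2, h3, h4⟩ := key hk (h ▸ by decide) hr
    obtain ⟨h5, h6, h7⟩ := key' hk (h ▸ by decide) hr'
    have := hs.bool _ h3 hb
    simp only [hf.kind, h] at this
    simp at this
    exact .or (ih h1 (this.2 _ h2 h4)) (ih' h5 (this.2 _ h6 h7))
  | and h hr hr' _ _ ih ih' =>
    obtain ⟨h1, h2, h3, h4⟩ := key hk (h ▸ by decide) hr
    obtain ⟨h5, h6, h7⟩ := key' hk (h ▸ by decide) hr'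
    have := hs.bool _ h3 hb
    simp only [hf.kind, h] at this
    simp at this
    exact .and (ih h1 (this.2 _ h2 h4)) (ih' h5 (this.2 _ h6 h7))
  | next h _ _ _ | ev h _ _ _ | alw h _ _ _ | untl h _ _ _ _ _ _ =>
    have := hs.bool _ (hk.trans_le hN) hb
    simp [hf.kind, h] at this

theorem Rel.IsWellFormed.isNextBoolean (hN : C.length ≤ N) (hf : r.Fits C K) (hs : r.IsWellFormed N K)
    (hd : r.Describes C N) {k : ℕ} {ψ : QF} (h : Builds C k ψ) (hk : k < C.length)
    (hb : r.xb k) : ψ.IsNextBoolean := by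
  rcases hs.xb _ (hk.trans_le hN) hb with hb | ⟨hx, hb⟩
  · exact ⟨0, ψ, hs.isBoolean hN hf hd h hk hb, rfl⟩
  · induction h with
    | @next k k' ψ h hr hψ ih =>
      have := hr.1
      have hx' := hb k' (by omega)
        ((hd.opd k (by omega) k' (by omega)).2 ⟨hk, .inl ⟨h ▸ by decide, hr⟩⟩)
      have : ψ.IsNextBoolean := by
        rcases hs.xb _ (by omega) hx' with hb | ⟨hx, hb⟩
        · exact ⟨0, ψ, hs.isBoolean hN hf hd hψ (by omega) hb, rfl⟩
        · exact ih (by omega) hx' hx hb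
      obtain ⟨n, ψ', h1, rfl⟩ := this
      exact ⟨n + 1, ψ', h1, (Function.iterate_succ_apply' _ _ _).symm⟩
    | atom h => simp [hf.kind, h] at hx
    | neg h _ _ _ | ev h _ _ _ | alw h _ _ _ => simp [hf.kind, h] at hx
    | or h _ _ _ _ _ _ | and h _ _ _ _ _ _ | untl h _ _ _ _ _ _ => simp [hf.kind, h] at hx

theorem Rel.IsWellFormed.isFGX (hN : C.length ≤ N) (hf : r.Fits C K) (hs : r.IsWellFormed N K)
    (hd : r.Describes C N) {k : ℕ} {ψ : QF} (h : Builds C k ψ) (hk : k < C.length)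
    (hb : r.fgx k) : ψ.IsFGX := by
  have key : ∀ {k k'}, k < C.length → (op C k).kind ∈ Letter.fsts → Res C k (op C k).fst k' →
      k' < C.length ∧ k' < N ∧ r.opd k k' := fun {k k'} hk h hr => by
    have := hr.1
    exact ⟨by omega, by omega, (hd.opd k (by omega) k' (by omega)).2 ⟨hk, .inl ⟨h, hr⟩⟩⟩
  have key' : ∀ {k k'}, k < C.length → (op C k).kind ∈ Letter.snds → Res C k (op C k).snd k' →
      k' < C.length ∧ k' < N ∧ r.opd k k' := fun {k k'} hk h hr => by
    have := hr.1
    exact ⟨by omega, by omega, (hd.opd k (by omega) k' (by omega)).2 ⟨hk, .inr ⟨h, hr⟩⟩⟩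
  induction h with
  | atom => exact .bool (.atom _ _)
  | neg h hr hψ ih =>
    obtain ⟨h1, h2, h4⟩ := key hk (h ▸ by decide) hr
    rcases hs.fgx _ (hk.trans_le hN) hb with hb | hb | hb
    · exact (hs.isNextBoolean hN hf hd (.neg h hr hψ) hk hb).isFGX
    · exact .neg (ih h1 (hb.2 _ h2 h4))
    · simp [hf.kind, h] at hb
  | or h hr hr' hψ hψ' ih ih' =>
    obtain ⟨h1, h2, h4⟩ := key hk (h ▸ by decide) hr
    obtain ⟨h5, h6, h7⟩ := key' hk (h ▸ by decide) hr'
    rcases hs.fgx _ (hk.trans_le hN) hb with hb | hb | hb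
    · exact (hs.isNextBoolean hN hf hd (.or h hr hr' hψ hψ') hk hb).isFGX
    · exact .or (ih h1 (hb.2 _ h2 h4)) (ih' h5 (hb.2 _ h6 h7))
    · simp [hf.kind, h] at hb
  | and h hr hr' hψ hψ' ih ih' =>
    obtain ⟨h1, h2, h4⟩ := key hk (h ▸ by decide) hr
    obtain ⟨h5, h6, h7⟩ := key' hk (h ▸ by decide) hr'
    rcases hs.fgx _ (hk.trans_le hN) hb with hb | hb | hb
    · exact (hs.isNextBoolean hN hf hd (.and h hr hr' hψ hψ') hk hb).isFGX
    · exact .and (ih h1 (hb.2 _ h2 h4)) (ih' h5 (hb.2 _ h6 h7))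
    · simp [hf.kind, h] at hb
  | next h hr hψ ih =>
    rcases hs.fgx _ (hk.trans_le hN) hb with hb | hb | hb
    · exact (hs.isNextBoolean hN hf hd (.next h hr hψ) hk hb).isFGX
    · simp [hf.kind, h] at hb
    · simp [hf.kind, h] at hb
  | untl h hr hr' hψ hψ' ih ih' =>
    rcases hs.fgx _ (hk.trans_le hN) hb with hb | hb | hb
    · exact (hs.isNextBoolean hN hf hd (.untl h hr hr' hψ hψ') hk hb).isFGX
    · simp [hf.kind, h] at hb
    · simp [hf.kind, h] at hb
  | ev h hr hψ ih =>
    obtain ⟨h1, h2, h4⟩ := key hk (h ▸ by decide) hr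
    rcases hs.fgx _ (hk.trans_le hN) hb with hb | hb | hb
    · exact (hs.isNextBoolean hN hf hd (.ev h hr hψ) hk hb).isFGX
    · simp [hf.kind, h] at hb
    · exact .ev (hs.isBoolean hN hf hd hψ h1 (hb.2 _ h2 h4))
  | alw h hr hψ ih =>
    obtain ⟨h1, h2, h4⟩ := key hk (h ▸ by decide) hr
    rcases hs.fgx _ (hk.trans_le hN) hb with hb | hb | hb
    · exact (hs.isNextBoolean hN hf hd (.alw h hr hψ) hk hb).isFGX
    · simp [hf.kind, h] at hb
    · exact .alw (hs.isBoolean hN hf hd hψ h1 (hb.2 _ h2 h4))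

end

end HyperLTL

namespace HyperLTL

open Function (update)
open Relation (ReflTransGen)

variable {C : List (ℕ × Op)} {N : ℕ} {K : List Letter → ℕ → Prop} {r : Rel}

theorem Reach.tail {k k' : ℕ} (h : Reach C k) (h' : Opd C k k') : Reach C k' :=
  ReflTransGen.tail h h'

/-- The valuation with number `z`. -/
def Rel.val (C : List (ℕ × Op)) (r : Rel) (z : ℕ) : Val :=
  fun s => {a | ∃ k, Reach C k ∧ (op C k).kind = .atom ∧ a = (op C k).fst ∧ r.zb z s k}

/-- The conditions for the truth of Boolean formulas are correct. -/
theorem Rel.IsCertificate.tb_iff (hC : C ≠ []) (hN : C.length ≤ N) (hf : r.Fits C K)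
    (hd : r.Describes C N) (hm : r.IsCertificate N K) {bind : ℕ → Option ℕ}
    (hbind : ∀ x s, bind x = some s ↔ Binds C x s) {k : ℕ} {ψ : QF} (h : Builds C k ψ)
    (hk : Reach C k) {z : ℕ} (hz : z < N) : r.tb z k ↔ ψ.BSat bind (r.val C z) := by
  have res1 : ∀ {k k'}, Reach C k → (op C k).kind ∈ Letter.fsts → Res C k (op C k).fst k' →
      Reach C k' ∧ k < N ∧ k' < N ∧ r.res1 k k' := fun {k k'} hk h hr => by
    have := hr.1
    have := hk.lt hC
    exact ⟨hk.tail (.inl ⟨h, hr⟩), by omega, by omega,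
      (hd.res1 _ (by omega) _ (by omega)).2 ⟨this, hr⟩⟩
  have res2 : ∀ {k k'}, Reach C k → (op C k).kind ∈ Letter.snds → Res C k (op C k).snd k' →
      Reach C k' ∧ k' < N ∧ r.res2 k k' := fun {k k'} hk h hr => by
    have := hr.1
    have := hk.lt hC
    exact ⟨hk.tail (.inr ⟨h, hr⟩), by omega,
      (hd.res2 _ (by omega) _ (by omega)).2 ⟨this, Letter.mem_twos_of_mem_snds h, hr⟩⟩
  have kind : ∀ {k} (S : List Letter), Reach C k → (op C k).kind ∈ S → K S k :=
    fun S hk h => (hf.kind _ _).2 ⟨hk.lt hC, h⟩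
  induction h with
  | @atom k h =>
    have hkl := hk.lt hC
    rw [hm.tb_atom z hz k (hkl.trans_le hN) (kind _ hk (by simp [h]))]
    simp only [QF.BSat, hbind]
    refine exists_congr fun s => ⟨fun ⟨h1, h2, h3⟩ => ?_, fun ⟨h2, h3⟩ => ?_⟩
    · rw [hd.bind k (by omega) s h1] at h2
      exact ⟨h2.2.2, k, hk, h, rfl, h3⟩
    · have hs := h2.1.1.lt hC
      obtain ⟨k', h4, h5, h6, h7⟩ := h3
      have h8 := h4.lt hC
      refine ⟨by omega, (hd.bind k (by omega) s (by omega)).2 ⟨hkl, h ▸ by decide, h2⟩, ?_⟩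
      exact hm.zb_congr z hz s (by omega) k' (by omega) k (by omega)
        ((hf.same1 _ _).2 ⟨h8, hkl, h6.symm⟩) h7
  | neg h hr _ ih =>
    obtain ⟨h1, h2, h3, h4⟩ := res1 hk (h ▸ by decide) hr
    rw [hm.tb_neg z hz _ h2 _ h3 (kind _ hk (by simp [h])) h4]
    exact not_congr (ih h1)
  | or h hr hr' _ _ ih ih' =>
    obtain ⟨h1, h2, h3, h4⟩ := res1 hk (h ▸ by decide) hr
    obtain ⟨h5, h6, h7⟩ := res2 hk (h ▸ by decide) hr'
    rw [hm.tb_or z hz _ h2 _ h3 _ h6 (kind _ hk (by simp [h])) h4 h7]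
    exact or_congr (ih h1) (ih' h5)
  | and h hr hr' _ _ ih ih' =>
    obtain ⟨h1, h2, h3, h4⟩ := res1 hk (h ▸ by decide) hr
    obtain ⟨h5, h6, h7⟩ := res2 hk (h ▸ by decide) hr'
    rw [hm.tb_and z hz _ h2 _ h3 _ h6 (kind _ hk (by simp [h])) h4 h7]
    exact and_congr (ih h1) (ih' h5)
  | next h _ _ _ | ev h _ _ _ | alw h _ _ _ | untl h _ _ _ _ _ _ =>
    have := hm.tb_none z hz _ ((hk.lt hC).trans_le hN) (kind _ hk (by simp [h]))
    simpa [QF.BSat] using this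

/-- The conditions for the truth of formulas are correct at the positions that are recorded. -/
theorem Rel.IsCertificate.t_iff (hC : C ≠ []) (hN : C.length ≤ N) (hf : r.Fits C K)
    (hd : r.Describes C N) (hm : r.IsCertificate N K) {bind : ℕ → Option ℕ}
    (hbind : ∀ x s, bind x = some s ↔ Binds C x s) {θ : ℕ} (hθ : θ < N) (hθ' : r.th θ)
    {P : ℕ → ℕ} (hP : ∀ i < C.length, P i < N ∧ r.pr θ i (P i)) {k : ℕ} {ψ : QF}
    (h : Builds C k ψ) (hk : Reach C k) {i : ℕ} (hi : i + k < C.length) :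
    r.t θ i k ↔ ψ.FSat bind (fun i => r.val C (P i)) (r.val C '' {z | z < N ∧ r.q θ z}) i := by
  have res1 : ∀ {k k'}, Reach C k → (op C k).kind ∈ Letter.fsts → Res C k (op C k).fst k' →
      Reach C k' ∧ k < N ∧ k' < N ∧ r.res1 k k' ∧ k' < k := fun {k k'} hk h hr => by
    have := hr.1
    have := hk.lt hC
    exact ⟨hk.tail (.inl ⟨h, hr⟩), by omega, by omega,
      (hd.res1 _ (by omega) _ (by omega)).2 ⟨this, hr⟩, hr.1⟩
  have res2 : ∀ {k k'}, Reach C k → (op C k).kind ∈ Letter.snds → Res C k (op C k).snd k' →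
      Reach C k' ∧ k' < N ∧ r.res2 k k' ∧ k' < k := fun {k k'} hk h hr => by
    have := hr.1
    have := hk.lt hC
    exact ⟨hk.tail (.inr ⟨h, hr⟩), by omega,
      (hd.res2 _ (by omega) _ (by omega)).2 ⟨this, Letter.mem_twos_of_mem_snds h, hr⟩, hr.1⟩
  have kind : ∀ {k} (S : List Letter), Reach C k → (op C k).kind ∈ S → K S k :=
    fun S hk h => (hf.kind _ _).2 ⟨hk.lt hC, h⟩
  have line : ∀ {k i}, i + k < C.length → i < N ∧ r.line i :=
    fun {k i} hi => ⟨by omega, (hf.line i).2 (by omega)⟩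
  induction h generalizing i with
  | @atom k h =>
    obtain ⟨hi1, hi2⟩ := line hi
    have hkl := hk.lt hC
    rw [hm.t_atom θ hθ i hi1 k (by omega) hθ' hi2 (kind _ hk (by simp [h]))]
    have key : r.tb (P i) k ↔ _ := hm.tb_iff hC hN hf hd hbind (.atom h) hk (hP i (by omega)).1
    refine Iff.trans (b := r.tb (P i) k) ⟨?_, fun h' => ?_⟩ key
    · rintro ⟨z, h1, h2, h3⟩
      have hp := hP i (by omega)
      have e : z = P i := le_antisymm
        (not_lt.1 (hm.pr_unique θ hθ i hi1 _ hp.1 z h1 hθ' hi2 hp.2 h2))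
        (not_lt.1 (hm.pr_unique θ hθ i hi1 z h1 _ hp.1 hθ' hi2 h2 hp.2))
      rwa [← e]
    · exact ⟨P i, (hP i (by omega)).1, (hP i (by omega)).2, h'⟩
  | neg h hr _ ih =>
    obtain ⟨hi1, hi2⟩ := line hi
    obtain ⟨h1, h2, h3, h4, h5⟩ := res1 hk (h ▸ by decide) hr
    rw [hm.t_neg θ hθ i hi1 _ h2 _ h3 hθ' hi2 (kind _ hk (by simp [h])) h4]
    exact not_congr (ih h1 (by omega))
  | or h hr hr' _ _ ih ih' =>
    obtain ⟨hi1, hi2⟩ := line hi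
    obtain ⟨h1, h2, h3, h4, h5⟩ := res1 hk (h ▸ by decide) hr
    obtain ⟨g1, g3, g4, g5⟩ := res2 hk (h ▸ by decide) hr'
    rw [hm.t_or θ hθ i hi1 _ h2 _ h3 _ g3 hθ' hi2 (kind _ hk (by simp [h])) h4 g4]
    exact or_congr (ih h1 (by omega)) (ih' g1 (by omega))
  | and h hr hr' _ _ ih ih' =>
    obtain ⟨hi1, hi2⟩ := line hi
    obtain ⟨h1, h2, h3, h4, h5⟩ := res1 hk (h ▸ by decide) hr
    obtain ⟨g1, g3, g4, g5⟩ := res2 hk (h ▸ by decide) hr'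
    rw [hm.t_and θ hθ i hi1 _ h2 _ h3 _ g3 hθ' hi2 (kind _ hk (by simp [h])) h4 g4]
    exact and_congr (ih h1 (by omega)) (ih' g1 (by omega))
  | next h hr _ ih =>
    obtain ⟨hi1, hi2⟩ := line hi
    obtain ⟨h1, h2, h3, h4, h5⟩ := res1 hk (h ▸ by decide) hr
    obtain ⟨hj1, hj2⟩ := line (i := i + 1) (k := 0) (by omega)
    rw [hm.t_next θ hθ i hi1 _ h2 _ h3 (i + 1) hj1 hθ' hi2 hj2 rfl (kind _ hk (by simp [h])) h4]
    exact ih h1 (by omega)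
  | untl h _ _ _ _ _ _ =>
    obtain ⟨hi1, hi2⟩ := line hi
    have := hm.t_until θ hθ i hi1 _ ((hk.lt hC).trans_le hN) hθ' hi2 (kind _ hk (by simp [h]))
    simpa [QF.FSat] using this
  | ev h hr hψ _ =>
    obtain ⟨hi1, hi2⟩ := line hi
    obtain ⟨h1, h2, h3, h4, h5⟩ := res1 hk (h ▸ by decide) hr
    rw [hm.t_ev θ hθ i hi1 _ h2 _ h3 hθ' hi2 (kind _ hk (by simp [h])) h4]
    simp only [QF.FSat, Set.exists_mem_image, Set.mem_ofPred_eq, and_assoc]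
    exact exists_congr fun z => and_congr_right fun hz => and_congr_right fun _ =>
      hm.tb_iff hC hN hf hd hbind hψ h1 hz
  | alw h hr hψ _ =>
    obtain ⟨hi1, hi2⟩ := line hi
    obtain ⟨h1, h2, h3, h4, h5⟩ := res1 hk (h ▸ by decide) hr
    rw [hm.t_alw θ hθ i hi1 _ h2 _ h3 hθ' hi2 (kind _ hk (by simp [h])) h4]
    simp only [QF.FSat, Set.forall_mem_image, Set.mem_ofPred_eq, and_imp]
    exact forall_congr' fun z => forall_congr' fun hz => forall_congr' fun _ =>
      hm.tb_iff hC hN hf hd hbind hψ h1 hz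

/-- Relations that fulfil the conditions yield a certificate, and thus a model. -/
theorem satisfiable_of_rel (hC : C ≠ []) (hN : C.length ≤ N) (hf : r.Fits C K)
    (hs : r.IsWellFormed N K) (hm : r.IsCertificate N K) : ∃ φ, Denotes (fun _ => none) C φ ∧
      φ.IsSentence ∧ φ.IsEAE ∧ φ.IsFGX ∧ φ.Satisfiable := by
  classical
  have hd := hs.describes hC hN hf
  have hpos := List.length_pos_iff.2 hC
  have hall : ∀ k < C.length, ∃ χ, BuildsFormula C k χ := fun k hk => by
    rcases hs.exists_buildsFormula hN hf hd hk with h | ⟨ψ, h⟩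
    exacts [h.2, ⟨_, .qf h⟩]
  obtain ⟨φ, hφ⟩ := hall (C.length - 1) (by omega)
  refine ⟨φ, denotes_iff_buildsFormula.2 ⟨hC, hall, hφ⟩, (satisfiable_iff hφ).2 ?_⟩
  obtain ⟨y, hyN, hy⟩ := hs.exists_yy
  have hy' := (hd.yy y hyN).1 hy
  have hyu : ∀ y' < N, r.yy y' → y' = y := fun y' h h' => le_antisymm
    (not_lt.1 (hs.yy_unique y hyN y' h hy h')) (not_lt.1 (hs.yy_unique y' h y hyN h' hy))
  have hslotN : ∀ {s}, Slot C s → s < N := fun h => (h.1.lt hC).trans_le hN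
  have honly : OnlyAll C y := ⟨hy', fun s h h' => hyu s (hslotN h) ((hd.yy s (hslotN h)).2 ⟨h, h'⟩)⟩
  have hes : ∀ {s}, Slot C s → y < s → r.es s := fun {s} h h' =>
    (hs.es s (hslotN h)).2 ⟨(hd.slot s (hslotN h)).2 h, y, hyN, hy, h'⟩
  have hws : ∀ {s}, Slot C s → s < y → r.ws s := fun {s} h h' =>
    (hs.ws s (hslotN h)).2 ⟨(hd.slot s (hslotN h)).2 h, y, hyN, hy, h'⟩
  -- the quantifier-free part and the binding of the variables
  obtain ⟨L, m, ψ, hc, hb, rfl⟩ := hφ.exists_chain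
  have hslot : ∀ s, Slot C s ↔ s ∈ L := fun s => by
    simp only [Slot, Reach, hc.reach_iff]
    exact ⟨fun ⟨h1, h2⟩ => h1.resolve_right fun h => hb.kind_notMem_of_reach h h2,
      fun h => ⟨.inl h, (hc.mem s h).1⟩⟩
  obtain ⟨bind, hbind⟩ : ∃ bind : ℕ → Option ℕ, ∀ x s, bind x = some s ↔ Binds C x s :=
    ⟨bindOf (L.map fun s => ((op C s).fst, s)), fun x s => by
      simp only [bindOf_eq_some hc.pairwise, Binds, hslot]⟩
  have hL : L ≠ [] := List.ne_nil_of_mem ((hslot y).1 hy'.1)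
  have hmat : ∀ m', Matrix C m' ↔ m' = m := fun m' => by
    have := hc.opd_iff (x := m')
    simpa [Matrix, hslot, hL] using this
  have hm1 : Reach C m := hc.reach_iff.2 (.inr .refl)
  have hml := hm1.lt hC
  have hmr : r.mat m := (hd.mat m (by omega)).2 ((hmat m).2 rfl)
  -- the types are the numbers in `th`
  let Θ : Type := {θ : ℕ // θ < N ∧ r.th θ}
  have hline : ∀ i < C.length, i < N ∧ r.line i := fun i hi => ⟨by omega, (hf.line i).2 hi⟩
  have hP : ∀ (θ : Θ) i, ∃ z, i < C.length → z < N ∧ r.pr θ.1 i z := fun θ i => by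
    by_cases hi : i < C.length
    · obtain ⟨z, hz⟩ := hm.exists_pr θ.1 θ.2.1 i (hline i hi).1 θ.2.2 (hline i hi).2
      exact ⟨z, fun _ => hz⟩
    · exact ⟨0, fun h => absurd h hi⟩
  choose P hP using hP
  have hch : ∀ (θ : Θ) s, ∃ θ' : Θ, Slot C s ∧ s < y → r.child θ.1 s θ'.1 := fun θ s => by
    by_cases h : Slot C s ∧ s < y
    · obtain ⟨θ', h1, h2, h3⟩ := hm.exists_child θ.1 θ.2.1 s (hslotN h.1) θ.2.2 (hws h.1 h.2)
      exact ⟨⟨θ', h1, h2⟩, fun _ => h3⟩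
    · exact ⟨θ, fun h' => absurd h' h⟩
  choose child hch using hch
  obtain ⟨θ₀, hθ₀⟩ := hm.exists_th
  have hroot : ∀ s, ∃ θ' : Θ, Slot C s ∧ y < s → r.root s θ'.1 := fun s => by
    by_cases h : Slot C s ∧ y < s
    · obtain ⟨θ', h1, h2, h3⟩ := hm.exists_root s (hslotN h.1) (hes h.1 h.2)
      exact ⟨⟨θ', h1, h2⟩, fun _ => h3⟩
    · exact ⟨⟨θ₀, hθ₀⟩, fun h' => absurd h' h⟩
  choose root hroot using hroot
  have hkind : ∀ {k}, Reach C k → (op C k).kind = .atom → k < N ∧ K [.atom] k := fun hk h =>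
    ⟨(hk.lt hC).trans_le hN, (hf.kind _ _).2 ⟨hk.lt hC, by simp [h]⟩⟩
  have sync : ∀ {s z z'}, s < N → z < N → z' < N → r.sync s z z' → r.val C z s = r.val C z' y := by
    intro s z z' h1 h2 h3 h
    rw [hm.sync s h1 z h2 z' h3] at h
    ext a
    refine exists_congr fun k => and_congr_right fun h4 => and_congr_right fun h5 =>
      and_congr_right fun _ => ?_
    exact h y hyN k (hkind h4 h5).1 hy (hkind h4 h5).2
  have same : ∀ {z z'}, z < N → z' < N → r.same z z' →
      Agree {s | Slot C s ∧ y < s} (r.val C z) (r.val C z') := by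
    intro z z' h2 h3 h s hs'
    rw [hm.same z h2 z' h3] at h
    ext a
    refine exists_congr fun k => and_congr_right fun h4 => and_congr_right fun h5 =>
      and_congr_right fun _ => ?_
    exact h s (hslotN hs'.1) k (hkind h4 h5).1 (hes hs'.1 hs'.2) (hkind h4 h5).2
  let c : Cert Θ {s | Slot C s ∧ y < s} {s | Slot C s ∧ s < y} y C.length :=
    { P := fun θ i => r.val C (P θ i)
      Q := fun θ => r.val C '' {z | z < N ∧ r.q θ.1 z}
      child := child
      root := root
      P_mem := fun θ i hi => ⟨P θ i, ⟨(hP θ i hi).1, hm.pr_q θ.1 θ.2.1 i (hline i hi).1 _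
        (hP θ i hi).1 θ.2.2 (hline i hi).2 (hP θ i hi).2⟩, rfl⟩
      P_agree := fun θ θ' i hi => same (hP θ i hi).1 (hP θ' i hi).1
        (hm.pr_same θ.1 θ.2.1 θ'.1 θ'.2.1 i (hline i hi).1 _ (hP θ i hi).1 _ (hP θ' i hi).1
          θ.2.2 θ'.2.2 (hline i hi).2 (hP θ i hi).2 (hP θ' i hi).2)
      P_child := fun θ s hs' i hi => sync (hslotN hs'.1) (hP θ i hi).1 (hP _ i hi).1
        (hm.pr_child θ.1 θ.2.1 s (hslotN hs'.1) (child θ s).1 (child θ s).2.1 i (hline i hi).1 _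
          (hP θ i hi).1 _ (hP _ i hi).1 θ.2.2 (hws hs'.1 hs'.2) (child θ s).2.2 (hch θ s hs')
          (hline i hi).2 (hP θ i hi).2 (hP _ i hi).2)
      Q_agree := by
        rintro θ θ' _ ⟨z, ⟨hz, hq⟩, rfl⟩
        obtain ⟨z', h1, h2, h3⟩ := hm.q_same θ.1 θ.2.1 θ'.1 θ'.2.1 z hz θ.2.2 θ'.2.2 hq
        exact ⟨_, ⟨z', ⟨h1, h2⟩, rfl⟩, same hz h1 h3⟩
      Q_down := by
        rintro θ s hs' _ ⟨z, ⟨hz, hq⟩, rfl⟩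
        obtain ⟨z', h1, h2, h3, h4⟩ := hm.q_down θ.1 θ.2.1 s (hslotN hs'.1) (child θ s).1
          (child θ s).2.1 z hz θ.2.2 (hws hs'.1 hs'.2) (child θ s).2.2 (hch θ s hs') hq
        exact ⟨_, ⟨z', ⟨h1, h2⟩, rfl⟩, same hz h1 h3, sync (hslotN hs'.1) hz h1 h4⟩
      Q_up := by
        rintro θ s hs' _ ⟨z', ⟨hz, hq⟩, rfl⟩
        obtain ⟨z, h1, h2, h3, h4⟩ := hm.q_up θ.1 θ.2.1 s (hslotN hs'.1) (child θ s).1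
          (child θ s).2.1 z' hz θ.2.2 (hws hs'.1 hs'.2) (child θ s).2.2 (hch θ s hs') hq
        exact ⟨_, ⟨z, ⟨h1, h2⟩, rfl⟩, same h1 hz h3, sync (hslotN hs'.1) h1 hz h4⟩
      Q_root := by
        rintro s hs' _ ⟨z, ⟨hz, hq⟩, rfl⟩
        exact sync (hslotN hs'.1) hz hz (hm.q_root s (hslotN hs'.1) (root s).1 (root s).2.1 z hz
          (hes hs'.1 hs'.2) (root s).2.2 (hroot s hs') hq) }
  have : Nonempty Θ := ⟨⟨θ₀, hθ₀⟩⟩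
  obtain ⟨T, hT, hT', τ, hτ, hτ'⟩ := c.exists_model (fun θ => (Set.to_countable _).image _) hpos
    (fun s h => h.2) (fun s h => h.2)
  refine ⟨y, m, ψ, bind, honly, hmat, hb, hbind, fun k hk ha => ?_,
    hs.isFGX hN hf hd hb hml (hs.mat_fgx m (by omega) hmr), T, hT, fun t ht i => ?_, τ,
    fun s h h' => hτ s ⟨h, h'⟩, fun t ht => ?_⟩
  · obtain ⟨s, h1, h2⟩ := hs.bound k (hkind hk ha).1 ((hd.reach k (hkind hk ha).1).2 hk)
      (hkind hk ha).2
    exact ⟨s, ((hd.bind k (hkind hk ha).1 s h1).1 h2).2.2⟩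
  · obtain ⟨θ, _, ⟨z, _, rfl⟩, h⟩ := hT' t ht i
    rw [h]
    rintro a ⟨k, h1, h2, h3, _⟩
    exact ⟨k, h1, h2, h3⟩
  · obtain ⟨τ', h1, θ, R, hR, hR', h2⟩ := hτ' t ht
    refine ⟨τ', fun s h h' => h1 s ⟨h, h'⟩, ?_⟩
    have hsl : ∀ x s, bind x = some s → ∀ i, comb y τ t τ' s i = R i s := by
      intro x s hx i
      refine h2 i s ?_
      have := ((hbind x s).1 hx).1
      rcases lt_trichotomy y s with h | h | h
      · exact .inl ⟨this, h⟩
      · exact .inr (.inl h.symm)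
      · exact .inr (.inr ⟨this, h⟩)
    have ht := (hm.t_iff hC hN hf hd hbind θ.2.1 θ.2.2 (hP θ) hb hm1 (i := 0) (by omega)).1
      (hm.t_mat θ.1 θ.2.1 m (by omega) 0 (by omega) θ.2.2 hmr fun j _ => by omega)
    refine (QF.fsat_congr (n := C.length) ?_ ?_ ?_ ψ ?_).2 ht
    · intro i hi x s hx
      have : R i = r.val C (P θ i) := hR i hi
      rw [← this]
      exact hsl x s hx i
    · rintro _ ⟨i, rfl⟩
      refine ⟨R i, ?_, fun x s hx => hsl x s hx i⟩
      have : Set.range R = r.val C '' {z | z < N ∧ r.q θ.1 z} := hR'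
      rw [← this]
      exact ⟨i, rfl⟩
    · intro z hz
      have : Set.range R = r.val C '' {z | z < N ∧ r.q θ.1 z} := hR'
      rw [← this] at hz
      obtain ⟨i, rfl⟩ := hz
      exact ⟨_, ⟨i, rfl⟩, fun x s hx => hsl x s hx i⟩
    · have := hb.depth_le
      omega

end HyperLTL

/-! ### Satisfiability implies the conditions -/

namespace HyperLTL

open Function (update)
open Relation (ReflTransGen)

namespace QF

/-- The operator of a formula. -/
def kind : QF → Letter
  | atom _ _ => .atom
  | neg _ => .neg
  | or _ _ => .or
  | and _ _ => .and
  | next _ => .next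
  | .until _ _ => .until
  | ev _ => .ev
  | alw _ => .alw

/-- The first operand of a formula. -/
def left : QF → QF
  | atom a x => atom a x
  | neg ψ => ψ
  | or ψ _ => ψ
  | and ψ _ => ψ
  | next ψ => ψ
  | .until ψ _ => ψ
  | ev ψ => ψ
  | alw ψ => ψ

/-- The second operand of a formula. -/
def right : QF → QF
  | or _ ψ => ψ
  | and _ ψ => ψ
  | .until _ ψ => ψ
  | ψ => ψ

theorem IsBoolean.operands {ψ : QF} (h : ψ.IsBoolean) : ψ.kind = .atom ∨
    (ψ.kind ∈ [.neg, .or, .and] ∧ ψ.left.IsBoolean ∧ (ψ.kind ∈ Letter.joins → ψ.right.IsBoolean)) := by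
  cases h with
  | atom => exact .inl rfl
  | neg h => exact .inr ⟨by simp [kind], h, fun h => absurd h (by simp [kind, Letter.joins])⟩
  | or h h' => exact .inr ⟨by simp [kind], h, fun _ => h'⟩
  | and h h' => exact .inr ⟨by simp [kind], h, fun _ => h'⟩

theorem IsNextBoolean.operands {ψ : QF} (h : ψ.IsNextBoolean) : ψ.IsBoolean ∨
    (ψ.kind = .next ∧ ψ.left.IsNextBoolean) := by
  obtain ⟨n, ψ', h, rfl⟩ := h
  cases n with
  | zero => exact .inl h
  | succ n =>
    rw [Function.iterate_succ_apply']
    exact .inr ⟨rfl, n, ψ', h, rfl⟩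

theorem IsFGX.operands {ψ : QF} (h : ψ.IsFGX) : ψ.IsNextBoolean ∨
    (ψ.kind ∈ [.neg, .or, .and] ∧ ψ.left.IsFGX ∧ (ψ.kind ∈ Letter.joins → ψ.right.IsFGX)) ∨
    (ψ.kind ∈ [.ev, .alw] ∧ ψ.left.IsBoolean) := by
  cases h with
  | neg h => exact .inr (.inl ⟨by simp [kind], h, fun h => absurd h (by simp [kind, Letter.joins])⟩)
  | or h h' => exact .inr (.inl ⟨by simp [kind], h, fun _ => h'⟩)
  | and h h' => exact .inr (.inl ⟨by simp [kind], h, fun _ => h'⟩)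
  | next n h => exact .inl ⟨n, _, h, rfl⟩
  | ev h => exact .inr (.inr ⟨by simp [kind], h⟩)
  | alw h => exact .inr (.inr ⟨by simp [kind], h⟩)
  | bool h => exact .inl ⟨0, _, h, rfl⟩

theorem not_bsat {ψ : QF} (h : ψ.kind ∈ [.next, .until, .ev, .alw]) {bind : ℕ → Option ℕ}
    {z : Val} : ¬ ψ.BSat bind z := by
  cases ψ <;> first | exact id | simp [kind] at h

theorem not_fsat {ψ : QF} (h : ψ.kind = .until) {bind : ℕ → Option ℕ} {P : ℕ → Val} {Q : Set Val}
    {i : ℕ} : ¬ ψ.FSat bind P Q i := by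
  cases ψ <;> first | exact id | simp [kind] at h

end QF

variable {C : List (ℕ × Op)}

namespace Builds

variable {k k' : ℕ} {ψ : QF}

theorem kind_eq (h : Builds C k ψ) : ψ.kind = (op C k).kind := by
  cases h <;> exact Eq.symm ‹_›

theorem exists_fst (h : Builds C k ψ) (hk : (op C k).kind ∈ Letter.fsts) :
    ∃ k', Res C k (op C k).fst k' ∧ Builds C k' ψ.left := by
  cases h with
  | atom h => rw [h] at hk; exact absurd hk (by decide)
  | neg _ h h' | next _ h h' | ev _ h h' | alw _ h h' => exact ⟨_, h, h'⟩
  | or _ h _ h' _ | and _ h _ h' _ | untl _ h _ h' _ => exact ⟨_, h, h'⟩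

theorem exists_snd (h : Builds C k ψ) (hk : (op C k).kind ∈ Letter.joins) :
    ∃ k', Res C k (op C k).snd k' ∧ Builds C k' ψ.right := by
  cases h with
  | atom h | neg h _ _ | next h _ _ | ev h _ _ | alw h _ _ =>
    rw [h] at hk; exact absurd hk (by decide)
  | or _ _ h _ h' | and _ _ h _ h' | untl _ _ h _ h' => exact ⟨_, h, h'⟩

theorem left (h : Builds C k ψ) (hk : (op C k).kind ∈ Letter.fsts)
    (hr : Res C k (op C k).fst k') : Builds C k' ψ.left := by
  obtain ⟨k'', h1, h2⟩ := h.exists_fst hk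
  rwa [hr.eq h1]

theorem right (h : Builds C k ψ) (hk : (op C k).kind ∈ Letter.joins)
    (hr : Res C k (op C k).snd k') : Builds C k' ψ.right := by
  obtain ⟨k'', h1, h2⟩ := h.exists_snd hk
  rwa [hr.eq h1]

theorem opd (h : Builds C k ψ) (ho : Opd C k k') :
    Builds C k' ψ.left ∨ ψ.kind ∈ Letter.joins ∧ Builds C k' ψ.right := by
  rcases ho with ⟨h1, h2⟩ | ⟨h1, h2⟩
  · exact .inl (h.left h1 h2)
  · have h3 : (op C k).kind ∈ Letter.joins := by
      have := h.kind_notMem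
      simp only [Letter.snds, Letter.joins, Letter.quants, List.mem_cons, List.not_mem_nil] at *
      tauto
    exact .inr ⟨by rwa [h.kind_eq], h.right h3 h2⟩

theorem exists_neg (h : Builds C k ψ) (hk : (op C k).kind = .neg)
    (hr : Res C k (op C k).fst k') : ∃ ψ', Builds C k (.neg ψ') ∧ Builds C k' ψ' := by
  have hl := h.left (by rw [hk]; decide) hr
  rw [← h.kind_eq] at hk
  cases ψ <;> first | exact ⟨_, h, hl⟩ | simp [QF.kind] at hk

theorem exists_next (h : Builds C k ψ) (hk : (op C k).kind = .next)
    (hr : Res C k (op C k).fst k') : ∃ ψ', Builds C k (.next ψ') ∧ Builds C k' ψ' := by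
  have hl := h.left (by rw [hk]; decide) hr
  rw [← h.kind_eq] at hk
  cases ψ <;> first | exact ⟨_, h, hl⟩ | simp [QF.kind] at hk

theorem exists_ev (h : Builds C k ψ) (hk : (op C k).kind = .ev)
    (hr : Res C k (op C k).fst k') : ∃ ψ', Builds C k (.ev ψ') ∧ Builds C k' ψ' := by
  have hl := h.left (by rw [hk]; decide) hr
  rw [← h.kind_eq] at hk
  cases ψ <;> first | exact ⟨_, h, hl⟩ | simp [QF.kind] at hk

theorem exists_alw (h : Builds C k ψ) (hk : (op C k).kind = .alw)
    (hr : Res C k (op C k).fst k') : ∃ ψ', Builds C k (.alw ψ') ∧ Builds C k' ψ' := by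
  have hl := h.left (by rw [hk]; decide) hr
  rw [← h.kind_eq] at hk
  cases ψ <;> first | exact ⟨_, h, hl⟩ | simp [QF.kind] at hk

theorem exists_or {l : ℕ} (h : Builds C k ψ) (hk : (op C k).kind = .or)
    (hr : Res C k (op C k).fst k') (hr' : Res C k (op C k).snd l) :
    ∃ ψ₁ ψ₂, Builds C k (.or ψ₁ ψ₂) ∧ Builds C k' ψ₁ ∧ Builds C l ψ₂ := by
  have hl := h.left (by rw [hk]; decide) hr
  have hl' := h.right (by rw [hk]; decide) hr'
  rw [← h.kind_eq] at hk
  cases ψ <;> first | exact ⟨_, _, h, hl, hl'⟩ | simp [QF.kind] at hk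

theorem exists_and {l : ℕ} (h : Builds C k ψ) (hk : (op C k).kind = .and)
    (hr : Res C k (op C k).fst k') (hr' : Res C k (op C k).snd l) :
    ∃ ψ₁ ψ₂, Builds C k (.and ψ₁ ψ₂) ∧ Builds C k' ψ₁ ∧ Builds C l ψ₂ := by
  have hl := h.left (by rw [hk]; decide) hr
  have hl' := h.right (by rw [hk]; decide) hr'
  rw [← h.kind_eq] at hk
  cases ψ <;> first | exact ⟨_, _, h, hl, hl'⟩ | simp [QF.kind] at hk

end Builds

theorem BuildsFormula.exists_snd {k : ℕ} {φ : Formula} (h : BuildsFormula C k φ)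
    (hk : (op C k).kind ∈ Letter.quants) : ∃ k', Res C k (op C k).snd k' := by
  cases h with
  | qf h => exact absurd hk h.kind_notMem
  | ex _ h _ | all _ h _ => exact ⟨_, h⟩

theorem BuildsFormula.exists_builds {k : ℕ} {φ : Formula} (h : BuildsFormula C k φ)
    (hk : (op C k).kind ∉ Letter.quants) : ∃ ψ, Builds C k ψ := by
  cases h with
  | qf h => exact ⟨_, h⟩
  | ex h | all h => exact absurd (h ▸ by decide) hk

variable {N : ℕ} {K : List Letter → ℕ → Prop} {y M : ℕ}

/-- The relations given by a certificate. Valuations are numbered by `code`, with inverse `dec`. -/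
def witness (C : List (ℕ × Op)) (N : ℕ) (K : List Letter → ℕ → Prop) (p : ParseRel)
    (bind : ℕ → Option ℕ)
    (c : Cert (Fin M) {s | Slot C s ∧ y < s} {s | Slot C s ∧ s < y} y C.length)
    (dec : ℕ → Val) (code : Val → ℕ) : Rel where
  toParseRel := p
  res1 k k' := k < C.length ∧ Res C k (op C k).fst k'
  res2 k k' := k < C.length ∧ (op C k).kind ∈ Letter.twos ∧ Res C k (op C k).snd k'
  opd k k' := k < C.length ∧ Opd C k k'
  reach k := Reach C k
  slot s := Slot C s
  mat m := Matrix C m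
  yy s := Slot C s ∧ (op C s).kind = .all
  es s := Slot C s ∧ y < s
  ws s := Slot C s ∧ s < y
  bind k s := k < C.length ∧ (op C k).kind ∈ Letter.twos ∧ Binds C (op C k).snd s
  bool k := k < C.length ∧ ∃ ψ, Builds C k ψ ∧ ψ.IsBoolean
  xb k := k < C.length ∧ ∃ ψ, Builds C k ψ ∧ ψ.IsNextBoolean
  fgx k := k < C.length ∧ ∃ ψ, Builds C k ψ ∧ ψ.IsFGX
  zb z s k := (op C k).fst ∈ dec z s
  tb z k := ∃ ψ, Builds C k ψ ∧ ψ.BSat bind (dec z)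
  th θ := θ < M
  q θ z := ∃ h : θ < M, dec z ∈ c.Q ⟨θ, h⟩
  pr θ i z := ∃ h : θ < M, z = code (c.P ⟨θ, h⟩ i)
  child θ s θ' := ∃ h : θ < M, θ' = c.child ⟨θ, h⟩ s
  root s θ := θ = c.root s
  t θ i k := ∃ h : θ < M, ∃ ψ, Builds C k ψ ∧ ψ.FSat bind (c.P ⟨θ, h⟩) (c.Q ⟨θ, h⟩) i
  sync s z z' := ∀ y < N, ∀ k < N, Slot C y ∧ (op C y).kind = .all → K [.atom] k →
    ((op C k).fst ∈ dec z s ↔ (op C k).fst ∈ dec z' y)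
  same z z' := ∀ s < N, ∀ k < N, Slot C s ∧ y < s → K [.atom] k →
    ((op C k).fst ∈ dec z s ↔ (op C k).fst ∈ dec z' s)

variable {p : ParseRel} {bind : ℕ → Option ℕ}
  {c : Cert (Fin M) {s | Slot C s ∧ y < s} {s | Slot C s ∧ s < y} y C.length}
  {dec : ℕ → Val} {code : Val → ℕ}

theorem witness_isWellFormed (hC : C ≠ []) (hN : C.length ≤ N) (hf : p.Fits C K)
    (hall : ∀ k < C.length, ∃ χ, BuildsFormula C k χ) (hy : OnlyAll C y)
    (hbound : ∀ k, Reach C k → (op C k).kind = .atom → ∃ s, Binds C (op C k).snd s)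
    {m : ℕ} {ψ : QF} (hm : ∀ m', Matrix C m' ↔ m' = m) (hb : Builds C m ψ) (hψ : ψ.IsFGX) :
    (witness C N K p bind c dec code).IsWellFormed N K := by
  have hyl := hy.1.1.1.lt hC
  have hb' : ∀ {k}, k < C.length → (op C k).kind ∉ Letter.quants → ∃ ψ, Builds C k ψ :=
    fun hk h => (hall _ hk).choose_spec.exists_builds h
  have hfst : ∀ {k}, (op C k).kind ∈ Letter.fsts → (op C k).kind ∉ Letter.quants := by
    intro k h
    simp only [Letter.fsts, Letter.quants, List.mem_cons, List.not_mem_nil] at h ⊢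
    rcases h with h | h | h | h | h | h | h | h <;> simp [h] at h ⊢
  have hjoin : ∀ {k}, (op C k).kind ∈ Letter.joins → (op C k).kind ∉ Letter.quants := by
    intro k h
    simp only [Letter.joins, Letter.quants, List.mem_cons, List.not_mem_nil] at h ⊢
    rcases h with h | h | h | h <;> simp [h] at h ⊢
  have atom : ∀ {k}, (op C k).kind = .atom → k < C.length → K [.atom] k := fun h hk =>
    (hf.kind _ _).2 ⟨hk, by simp [h]⟩
  have hon : ∀ {s}, Slot C s → (op C s).kind = .all → s = y := fun h h' => hy.2 _ h h'
  exact {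
    res1 := fun k _ k' _ => hf.res1_iff hN k k'
    res2 := fun k _ k' _ => hf.res2_iff hN k k'
    opd := fun k _ k' _ => hf.opd_iff k k'
    wf1 := fun k hk h => by
      obtain ⟨hk, h⟩ := (hf.kind _ _).1 h
      obtain ⟨ψ, hψ⟩ := hb' hk (hfst h)
      obtain ⟨k', h1, h2⟩ := hψ.exists_fst h
      have := h1.1
      exact ⟨k', by omega, ⟨hk, h1⟩, fun h' => h2.kind_notMem ((hf.kind _ _).1 h').2⟩
    wf2 := fun k hk h => by
      obtain ⟨hk, h⟩ := (hf.kind _ _).1 h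
      obtain ⟨ψ, hψ⟩ := hb' hk (hjoin h)
      obtain ⟨k', h1, h2⟩ := hψ.exists_snd h
      have := h1.1
      refine ⟨k', by omega, ⟨hk, ?_, h1⟩, fun h' => h2.kind_notMem ((hf.kind _ _).1 h').2⟩
      simp only [Letter.joins, Letter.twos, List.mem_cons] at h ⊢
      tauto
    wf3 := fun k hk h => by
      obtain ⟨hk, h⟩ := (hf.kind _ _).1 h
      obtain ⟨k', h1⟩ := (hall k hk).choose_spec.exists_snd h
      have := h1.1
      refine ⟨k', by omega, hk, ?_, h1⟩
      simp only [Letter.quants, Letter.twos, List.mem_cons] at h ⊢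
      tauto
    reach := fun k _ => by
      refine (reach_iff_exists hC hN k).trans (or_congr ?_ Iff.rfl)
      simp only [← hf.line]
      exact Iff.rfl
    slot := fun s _ => ⟨fun h => ⟨h.1, (hf.kind _ _).2 ⟨h.1.lt hC, h.2⟩⟩,
      fun h => ⟨h.1, ((hf.kind _ _).1 h.2).2⟩⟩
    mat := fun m _ => hf.matrix_iff hC hN m
    yy := fun s _ => ⟨fun h => ⟨h.1, (hf.kind _ _).2 ⟨h.1.1.lt hC, by simp [h.2]⟩⟩,
      fun h => ⟨h.1, by simpa using ((hf.kind _ _).1 h.2).2⟩⟩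
    exists_yy := ⟨y, by omega, hy.1⟩
    yy_unique := fun s _ s' _ h h' => by
      rw [hon h.1 h.2, hon h'.1 h'.2]
      exact lt_irrefl _
    es := fun s _ => ⟨fun h => ⟨h.1, y, by omega, hy.1, h.2⟩,
      fun ⟨h, y', _, h', hlt⟩ => ⟨h, by rwa [← hon h'.1 h'.2]⟩⟩
    ws := fun s _ => ⟨fun h => ⟨h.1, y, by omega, hy.1, h.2⟩,
      fun ⟨h, y', _, h', hlt⟩ => ⟨h, by rwa [← hon h'.1 h'.2]⟩⟩
    bind := fun k _ s _ => hf.binds_iff hC hN k s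
    bound := fun k _ h h' => by
      obtain ⟨hk, h'⟩ := (hf.kind _ _).1 h'
      have h' : (op C k).kind = .atom := by simpa using h'
      obtain ⟨s, hs⟩ := hbound k h h'
      exact ⟨s, (hs.1.1.lt hC).trans_le hN, hk, h' ▸ by decide, hs⟩
    bool := by
      rintro k _ ⟨hk, ψ, h, h'⟩
      rcases h'.operands with h1 | ⟨h1, h2, h3⟩
      · rw [h.kind_eq] at h1
        exact .inl (atom h1 hk)
      · refine .inr ⟨(hf.kind _ _).2 ⟨hk, by rwa [← h.kind_eq]⟩, fun l hl hlo => ?_⟩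
        have := hlo.2.lt
        rcases h.opd hlo.2 with h4 | ⟨h4, h5⟩
        · exact ⟨by omega, _, h4, h2⟩
        · exact ⟨by omega, _, h5, h3 h4⟩
    xb := by
      rintro k _ ⟨hk, ψ, h, h'⟩
      rcases h'.operands with h1 | ⟨h1, h2⟩
      · exact .inl ⟨hk, ψ, h, h1⟩
      · refine .inr ⟨(hf.kind _ _).2 ⟨hk, by rw [← h.kind_eq, h1]; simp⟩, fun l hl hlo => ?_⟩
        have := hlo.2.lt
        rcases h.opd hlo.2 with h4 | ⟨h4, h5⟩
        · exact ⟨by omega, _, h4, h2⟩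
        · rw [h1] at h4
          exact absurd h4 (by decide)
    fgx := by
      rintro k _ ⟨hk, ψ, h, h'⟩
      rcases h'.operands with h1 | ⟨h1, h2, h3⟩ | ⟨h1, h2⟩
      · exact .inl ⟨hk, ψ, h, h1⟩
      · refine .inr (.inl ⟨(hf.kind _ _).2 ⟨hk, by rwa [← h.kind_eq]⟩, fun l hl hlo => ?_⟩)
        have := hlo.2.lt
        rcases h.opd hlo.2 with h4 | ⟨h4, h5⟩
        · exact ⟨by omega, _, h4, h2⟩
        · exact ⟨by omega, _, h5, h3 h4⟩
      · refine .inr (.inr ⟨(hf.kind _ _).2 ⟨hk, by rwa [← h.kind_eq]⟩, fun l hl hlo => ?_⟩)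
        have := hlo.2.lt
        rcases h.opd hlo.2 with h4 | ⟨h4, h5⟩
        · exact ⟨by omega, _, h4, h2⟩
        · simp only [List.mem_cons, List.not_mem_nil, or_false] at h1
          rcases h1 with h1 | h1 <;> rw [h1] at h4 <;> exact absurd h4 (by decide)
    mat_fgx := fun m' _ h => by
      have h' : Matrix C m' := h
      obtain ⟨s, hs, ho⟩ := h'.2
      have := ho.lt
      have := hs.1.lt hC
      obtain rfl := (hm m').1 h'
      exact ⟨by omega, ψ, hb, hψ⟩ }

theorem witness_isCertificate (hC : C ≠ []) (hN : C.length ≤ N) (hM : 0 < M) (hMN : M ≤ N)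
    (hf : p.Fits C K) (hall : ∀ k < C.length, ∃ χ, BuildsFormula C k χ) (hy : OnlyAll C y)
    (hbind : ∀ x s, bind x = some s ↔ Binds C x s) {m : ℕ} {ψ : QF}
    (hm : ∀ m', Matrix C m' ↔ m' = m) (hb : Builds C m ψ)
    (hc : ∀ θ, ψ.FSat bind (c.P θ) (c.Q θ) 0)
    (hdec : ∀ θ, ∀ v ∈ c.Q θ, code v < N ∧ dec (code v) = v) :
    (witness C N K p bind c dec code).IsCertificate N K := by
  have hyl := hy.1.1.1.lt hC
  have hon : ∀ {s}, Slot C s → (op C s).kind = .all → s = y := fun h h' => hy.2 _ h h'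
  have hb' : ∀ {S : List Letter} {k}, K S k → (∀ o ∈ S, o ∉ Letter.quants) →
      k < C.length ∧ (op C k).kind ∈ S ∧ ∃ ψ, Builds C k ψ := fun {S k} h h' => by
    obtain ⟨hk, h⟩ := (hf.kind _ _).1 h
    exact ⟨hk, h, (hall _ hk).choose_spec.exists_builds (h' _ h)⟩
  have ex : ∀ {k ψ} {P : QF → Prop}, Builds C k ψ → ((∃ ψ', Builds C k ψ' ∧ P ψ') ↔ P ψ) :=
    fun {k ψ P} h => ⟨fun ⟨ψ', h', h''⟩ => by rwa [h.unique h'], fun h' => ⟨ψ, h, h'⟩⟩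
  have ht : ∀ {θ i k ψ} (hθ : θ < M), Builds C k ψ →
      ((witness C N K p bind c dec code).t θ i k ↔ ψ.FSat bind (c.P ⟨θ, hθ⟩) (c.Q ⟨θ, hθ⟩) i) :=
    fun {θ i k ψ} hθ h => ⟨fun ⟨_, h'⟩ => (ex h).1 h', fun h' => ⟨hθ, (ex h).2 h'⟩⟩
  have htb : ∀ {z k ψ}, Builds C k ψ →
      ((witness C N K p bind c dec code).tb z k ↔ ψ.BSat bind (dec z)) := fun h => ex h
  have hPd : ∀ (θ : Fin M) i, i < C.length → code (c.P θ i) < N ∧ dec (code (c.P θ i)) = c.P θ i :=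
    fun θ i hi => hdec θ _ (c.P_mem θ i hi)
  have hi' : ∀ {i}, p.line i → i < C.length := fun h => (hf.line _).1 h
  have sync : ∀ {s z z'}, dec z s = dec z' y →
      (witness C N K p bind c dec code).sync s z z' := by
    intro s z z' h s' _ k _ h1 _
    rw [hon h1.1 h1.2, h]
  have same : ∀ {z z'}, Agree {s | Slot C s ∧ y < s} (dec z) (dec z') →
      (witness C N K p bind c dec code).same z z' := by
    intro z z' h s _ k _ h1 _
    rw [h s h1]
  have hq : ∀ {θ z}, (witness C N K p bind c dec code).q θ z → ∃ h : θ < M, dec z ∈ c.Q ⟨θ, h⟩ :=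
    fun h => h
  -- the operands of a line with a given operator
  have neg' : ∀ {k k'}, K [.neg] k → k < C.length ∧ Res C k (op C k).fst k' →
      ∃ ψ, Builds C k (.neg ψ) ∧ Builds C k' ψ := fun {k k'} h hr => by
    obtain ⟨_, h1, ψ, h2⟩ := hb' h (by decide)
    exact h2.exists_neg (List.mem_singleton.1 h1) hr.2
  have next' : ∀ {k k'}, K [.next] k → k < C.length ∧ Res C k (op C k).fst k' →
      ∃ ψ, Builds C k (.next ψ) ∧ Builds C k' ψ := fun {k k'} h hr => by
    obtain ⟨_, h1, ψ, h2⟩ := hb' h (by decide)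
    exact h2.exists_next (List.mem_singleton.1 h1) hr.2
  have ev' : ∀ {k k'}, K [.ev] k → k < C.length ∧ Res C k (op C k).fst k' →
      ∃ ψ, Builds C k (.ev ψ) ∧ Builds C k' ψ := fun {k k'} h hr => by
    obtain ⟨_, h1, ψ, h2⟩ := hb' h (by decide)
    exact h2.exists_ev (List.mem_singleton.1 h1) hr.2
  have alw' : ∀ {k k'}, K [.alw] k → k < C.length ∧ Res C k (op C k).fst k' →
      ∃ ψ, Builds C k (.alw ψ) ∧ Builds C k' ψ := fun {k k'} h hr => by
    obtain ⟨_, h1, ψ, h2⟩ := hb' h (by decide)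
    exact h2.exists_alw (List.mem_singleton.1 h1) hr.2
  have or' : ∀ {k k' l}, K [.or] k → k < C.length ∧ Res C k (op C k).fst k' →
      k < C.length ∧ (op C k).kind ∈ Letter.twos ∧ Res C k (op C k).snd l →
      ∃ ψ ψ', Builds C k (.or ψ ψ') ∧ Builds C k' ψ ∧ Builds C l ψ' := fun {k k' l} h hr hr' => by
    obtain ⟨_, h1, ψ, h2⟩ := hb' h (by decide)
    exact h2.exists_or (List.mem_singleton.1 h1) hr.2 hr'.2.2
  have and' : ∀ {k k' l}, K [.and] k → k < C.length ∧ Res C k (op C k).fst k' →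
      k < C.length ∧ (op C k).kind ∈ Letter.twos ∧ Res C k (op C k).snd l →
      ∃ ψ ψ', Builds C k (.and ψ ψ') ∧ Builds C k' ψ ∧ Builds C l ψ' := fun {k k' l} h hr hr' => by
    obtain ⟨_, h1, ψ, h2⟩ := hb' h (by decide)
    exact h2.exists_and (List.mem_singleton.1 h1) hr.2 hr'.2.2
  have atom' : ∀ {k}, K [.atom] k → k < C.length ∧ (op C k).kind ∈ Letter.twos ∧
      Builds C k (.atom (op C k).fst (op C k).snd) := fun {k} h => by
    obtain ⟨h0, h1, ψ, h2⟩ := hb' h (by decide)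
    have h1 := List.mem_singleton.1 h1
    exact ⟨h0, h1 ▸ by decide, .atom h1⟩
  exact {
    zb_congr := fun z _ s _ k _ k' _ h h' => by
      have h'' : (op C k).fst ∈ dec z s := h'
      rw [((hf.same1 _ _).1 h).2.2] at h''
      exact h''
    tb_atom := fun z _ k _ h => by
      obtain ⟨h1, h2, h3⟩ := atom' h
      rw [htb h3]
      simp only [QF.BSat, hbind]
      exact exists_congr fun s => ⟨fun ⟨h4, h5⟩ => ⟨(h4.1.1.lt hC).trans_le hN, ⟨h1, h2, h4⟩, h5⟩,
        fun ⟨_, h4, h5⟩ => ⟨h4.2.2, h5⟩⟩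
    tb_neg := fun z _ k _ k' _ h hr => by
      obtain ⟨ψ, h1, h2⟩ := neg' h hr
      rw [htb h1, htb h2]
      exact Iff.rfl
    tb_or := fun z _ k _ k' _ l _ h hr hr' => by
      obtain ⟨ψ, ψ', h1, h2, h3⟩ := or' h hr hr'
      rw [htb h1, htb h2, htb h3]
      exact Iff.rfl
    tb_and := fun z _ k _ k' _ l _ h hr hr' => by
      obtain ⟨ψ, ψ', h1, h2, h3⟩ := and' h hr hr'
      rw [htb h1, htb h2, htb h3]
      exact Iff.rfl
    tb_none := fun z _ k _ h => by
      obtain ⟨_, h1, ψ, h2⟩ := hb' h (by decide)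
      rw [htb h2]
      rw [← h2.kind_eq] at h1
      exact QF.not_bsat h1
    t_atom := fun θ _ i _ k _ hθ hi h => by
      obtain ⟨h1, h2, h3⟩ := atom' h
      rw [ht hθ h3]
      have := hPd ⟨θ, hθ⟩ i (hi' hi)
      constructor
      · refine fun h' => ⟨_, this.1, ⟨hθ, rfl⟩, (htb h3).2 ?_⟩
        rw [this.2]
        exact h'
      · rintro ⟨z, _, ⟨_, rfl⟩, h'⟩
        have h' := (htb h3).1 h'
        rw [this.2] at h'
        exact h'
    t_neg := fun θ _ i _ k _ k' _ hθ hi h hr => by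
      obtain ⟨ψ, h1, h2⟩ := neg' h hr
      rw [ht hθ h1, ht hθ h2]
      exact Iff.rfl
    t_or := fun θ _ i _ k _ k' _ l _ hθ hi h hr hr' => by
      obtain ⟨ψ, ψ', h1, h2, h3⟩ := or' h hr hr'
      rw [ht hθ h1, ht hθ h2, ht hθ h3]
      exact Iff.rfl
    t_and := fun θ _ i _ k _ k' _ l _ hθ hi h hr hr' => by
      obtain ⟨ψ, ψ', h1, h2, h3⟩ := and' h hr hr'
      rw [ht hθ h1, ht hθ h2, ht hθ h3]
      exact Iff.rfl
    t_next := fun θ _ i _ k _ k' _ j _ hθ hi hj e h hr => by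
      obtain ⟨ψ, h1, h2⟩ := next' h hr
      rw [ht hθ h1, ht hθ h2, e]
      exact Iff.rfl
    t_until := fun θ _ i _ k _ hθ hi h => by
      obtain ⟨_, h1, ψ, h2⟩ := hb' h (by decide)
      rw [ht hθ h2]
      rw [← h2.kind_eq] at h1
      exact QF.not_fsat (List.mem_singleton.1 h1)
    t_ev := fun θ _ i _ k _ k' _ hθ hi h hr => by
      obtain ⟨ψ, h1, h2⟩ := ev' h hr
      rw [ht hθ h1]
      constructor
      · rintro ⟨v, hv, h⟩
        have := hdec _ v hv
        refine ⟨code v, this.1, ⟨hθ, ?_⟩, (htb h2).2 ?_⟩ <;> rwa [this.2]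
      · rintro ⟨z, _, ⟨_, hz⟩, h⟩
        exact ⟨_, hz, (htb h2).1 h⟩
    t_alw := fun θ _ i _ k _ k' _ hθ hi h hr => by
      obtain ⟨ψ, h1, h2⟩ := alw' h hr
      rw [ht hθ h1]
      constructor
      · rintro h z _ ⟨_, hz⟩
        exact (htb h2).2 (h _ hz)
      · rintro h v hv
        have := hdec _ v hv
        have h' := (htb h2).1 (h (code v) this.1 ⟨hθ, by rwa [this.2]⟩)
        rwa [this.2] at h'
    t_mat := fun θ _ m' _ i _ hθ h hi => by
      obtain rfl := (hm m').1 h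
      obtain rfl : i = 0 := by
        by_contra hne
        exact hi 0 (by omega) (by omega)
      exact (ht hθ hb).2 (hc _)
    exists_th := ⟨0, by omega, hM⟩
    exists_pr := fun θ _ i _ hθ hi => ⟨_, (hPd ⟨θ, hθ⟩ i (hi' hi)).1, hθ, rfl⟩
    pr_unique := by
      rintro θ _ i _ z _ z' _ hθ hi ⟨_, rfl⟩ ⟨_, rfl⟩
      exact lt_irrefl _
    pr_q := by
      rintro θ _ i _ z _ hθ hi ⟨_, rfl⟩
      refine ⟨hθ, ?_⟩
      rw [(hPd ⟨θ, hθ⟩ i (hi' hi)).2]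
      exact c.P_mem _ i (hi' hi)
    sync := fun s _ z _ z' _ => Iff.rfl
    same := fun z _ z' _ => Iff.rfl
    pr_same := by
      rintro θ _ θ' _ i _ z _ z' _ hθ hθ' hi ⟨_, rfl⟩ ⟨_, rfl⟩
      apply same
      rw [(hPd ⟨θ, hθ⟩ i (hi' hi)).2, (hPd ⟨θ', hθ'⟩ i (hi' hi)).2]
      exact c.P_agree _ _ i (hi' hi)
    exists_child := fun θ _ s _ hθ hs =>
      ⟨c.child ⟨θ, hθ⟩ s, (c.child ⟨θ, hθ⟩ s).2.trans_le hMN, (c.child ⟨θ, hθ⟩ s).2, hθ, rfl⟩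
    pr_child := by
      rintro θ _ s _ θ' _ i _ z _ z' _ hθ hs hθ' ⟨_, rfl⟩ hi ⟨_, rfl⟩ ⟨_, rfl⟩
      apply sync
      rw [(hPd ⟨θ, hθ⟩ i (hi' hi)).2, (hPd _ i (hi' hi)).2]
      exact c.P_child _ s hs i (hi' hi)
    q_same := by
      rintro θ _ θ' _ z _ hθ hθ' ⟨_, hz⟩
      obtain ⟨v, hv, h⟩ := c.Q_agree ⟨θ, hθ⟩ ⟨θ', hθ'⟩ _ hz
      have := hdec _ v hv
      refine ⟨code v, this.1, ⟨hθ', by rwa [this.2]⟩, same ?_⟩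
      rwa [this.2]
    q_down := by
      rintro θ _ s _ θ' _ z _ hθ hs hθ' ⟨_, rfl⟩ ⟨_, hz⟩
      obtain ⟨v, hv, h, h'⟩ := c.Q_down ⟨θ, hθ⟩ s hs _ hz
      have := hdec _ v hv
      exact ⟨code v, this.1, ⟨hθ', by rwa [this.2]⟩, same (by rwa [this.2]),
        sync (by rwa [this.2])⟩
    q_up := by
      rintro θ _ s _ θ' _ z _ hθ hs hθ' ⟨_, rfl⟩ ⟨_, hz⟩
      obtain ⟨v, hv, h, h'⟩ := c.Q_up ⟨θ, hθ⟩ s hs _ hz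
      have := hdec _ v hv
      exact ⟨code v, this.1, ⟨hθ, by rwa [this.2]⟩, same (by rwa [this.2]),
        sync (by rwa [this.2])⟩
    exists_root := fun s _ hs => ⟨c.root s, (c.root s).2.trans_le hMN, (c.root s).2, rfl⟩
    q_root := by
      rintro s _ θ _ z _ hs hθ rfl ⟨_, hz⟩
      exact sync (c.Q_root s hs _ hz) }

/-- For a satisfiable formula the conditions can be fulfilled with numbers below `N`, provided that
`N` is at least the number of types and of valuations in a small certificate. -/
theorem exists_rel_of_satisfiable (hN : C.length ≤ N)
    (hN' : (2 ^ (C.length * C.length)) ^ C.length * 2 ^ 2 ^ (C.length * C.length) ≤ N)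
    (hN'' : 2 ^ (C.length * C.length) ≤ N) (hf : p.Fits C K) {φ : Formula}
    (hφ : Denotes (fun _ => none) C φ)
    (h : φ.IsSentence ∧ φ.IsEAE ∧ φ.IsFGX ∧ φ.Satisfiable) :
    ∃ r : Rel, r.toParseRel = p ∧ r.IsWellFormed N K ∧ r.IsCertificate N K := by
  classical
  obtain ⟨hC, hall, hφ⟩ := denotes_iff_buildsFormula.1 hφ
  obtain ⟨y, m, ψ, bind, hy, hm, hb, hbind, hbound, hψ, T, hT, hTp, τ, hτ, hτ'⟩ :=
    (satisfiable_iff hφ).1 h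
  have : ∀ t, ∃ τ' : ℕ → Trace, t ∈ T → (∀ s, Slot C s → s < y → τ' s ∈ T) ∧
      ψ.FSat bind (fun i s => comb y τ t τ' s i) (Set.range fun i s => comb y τ t τ' s i) 0 := by
    intro t
    by_cases ht : t ∈ T
    · obtain ⟨τ', h⟩ := hτ' t ht
      exact ⟨τ', fun _ => h⟩
    · exact ⟨τ, fun h => absurd h ht⟩
  choose τ' hτ' using this
  let A : Fin C.length → ℕ := fun k => (op C k).fst
  obtain ⟨M, hM, hMN, c, hQ, hc⟩ := exists_small_cert A hT (E := {s | Slot C s ∧ y < s})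
    (W := {s | Slot C s ∧ s < y}) (y := y) (τ := τ) (τ' := τ')
    (fun t ht i a ha => by
      obtain ⟨k, h1, _, h2⟩ := hTp t ht i ha
      exact ⟨⟨k, h1.lt hC⟩, h2.symm⟩)
    (hy.1.1.1.lt hC) (fun s h => h.2) (fun s h => h.1.1.lt hC) (fun s h => h.2)
    (fun s h => hτ s h.1 h.2) (fun t ht s h => (hτ' t ht).1 s h.1 h.2)
  let e : Set (Fin C.length × Fin C.length) ≃ Fin (2 ^ (C.length * C.length)) :=
    Fintype.equivFinOfCardEq (by simp)
  let dec : ℕ → Val := fun z => if h : z < 2 ^ (C.length * C.length) then ofTable A (e.symm ⟨z, h⟩)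
    else fun _ => ∅
  have : ∀ v : Val, ∃ z, (∃ S, ofTable A S = v) → z < N ∧ dec z = v := by
    intro v
    by_cases h : ∃ S, ofTable A S = v
    · obtain ⟨S, rfl⟩ := h
      exact ⟨e S, fun _ => ⟨(e S).2.trans_le hN'', by simp [dec]⟩⟩
    · exact ⟨0, fun h' => absurd h' h⟩
  choose code hcode using this
  refine ⟨witness C N K p bind c dec code, rfl,
    witness_isWellFormed hC hN hf hall hy hbound hm hb hψ,
    witness_isCertificate hC hN hM (hMN.trans hN') hf hall hy hbind hm hb (fun θ => ?_)
      fun θ v hv => hcode v (hQ θ v hv)⟩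
  obtain ⟨t, ht, h1, h2, h3⟩ := hc θ
  have hsl : ∀ x s, bind x = some s →
      s ∈ {s | Slot C s ∧ y < s} ∨ s = y ∨ s ∈ {s | Slot C s ∧ s < y} := by
    intro x s hx
    have := ((hbind x s).1 hx).1
    rcases lt_trichotomy y s with h | h | h
    · exact .inl ⟨this, h⟩
    · exact .inr (.inl h.symm)
    · exact .inr (.inr ⟨this, h⟩)
  refine (QF.fsat_congr (n := C.length) ?_ ?_ ?_ ψ ?_).1 (hτ' t ht).2
  · exact fun i hi x s hx => h1 i s (hsl x s hx) hi
  · rintro _ ⟨i, rfl⟩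
    obtain ⟨z, hz, h⟩ := h2 i
    exact ⟨z, hz, fun x s hx => h s (hsl x s hx)⟩
  · intro z hz
    obtain ⟨i, h⟩ := h3 z hz
    exact ⟨_, ⟨i, rfl⟩, fun x s hx => h s (hsl x s hx)⟩
  · obtain ⟨s, hs, ho⟩ := ((hm m).2 rfl).2
    have := hs.1.lt hC
    have := ho.lt
    have := hb.depth_le
    omega

end HyperLTL

/-! ### Numbers and lines in a word -/

namespace HyperLTL

/-- A binary digit. -/
def digit (b : Bool) : Letter := if b then .one else .zero

theorem digit_ne_sep (b : Bool) : digit b ≠ .sep := by cases b <;> decide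

theorem digit_injective : Function.Injective digit := by
  intro a b; cases a <;> cases b <;> decide

/-- The number `m` is written from position `p` to the separator at position `r`. -/
inductive NumAt (w : List Letter) : ℕ → ℕ → ℕ → Prop
  | sep {p : ℕ} : w[p]? = some .sep → NumAt w p 0 p
  | bit {p m r : ℕ} (b : Bool) : w[p]? = some (digit b) → NumAt w (p + 1) m r →
      (m = 0 → b = true) → NumAt w p (Nat.bit b m) r

theorem bit_inj {b b' : Bool} {m m' : ℕ} : Nat.bit b m = Nat.bit b' m' ↔ b = b' ∧ m = m' := by
  cases b <;> cases b' <;> simp [Nat.bit] <;> omega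

theorem encNat_zero : encNat 0 = [.sep] := by simp [encNat]

theorem encNat_bit {b : Bool} {m : ℕ} (h : m = 0 → b = true) :
    encNat (Nat.bit b m) = digit b :: encNat m := by
  simp [encNat, Nat.bits_append_bit m b h, digit]

theorem getElem?_lt {α : Type*} {l : List α} {i : ℕ} {a : α} (h : l[i]? = some a) : i < l.length := by
  by_contra h'
  rw [List.getElem?_eq_none (not_lt.1 h')] at h
  cases h

theorem drop_eq_cons {α : Type*} {l : List α} {i : ℕ} {a : α} (h : l[i]? = some a) :
    l.drop i = a :: l.drop (i + 1) := by
  have hi := getElem?_lt h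
  rw [List.drop_eq_getElem_cons hi]
  rw [List.getElem?_eq_getElem hi] at h
  rw [Option.some.inj h]

namespace NumAt

variable {w : List Letter} {p m r p' m' r' : ℕ}

theorem le (h : NumAt w p m r) : p ≤ r := by
  induction h with
  | sep => exact le_rfl
  | bit _ _ _ _ ih => omega

theorem lt (h : NumAt w p m r) : r < w.length := by
  induction h with
  | sep h => exact getElem?_lt h
  | bit _ _ _ _ ih => exact ih

theorem drop (h : NumAt w p m r) : w.drop p = encNat m ++ w.drop (r + 1) := by
  induction h with
  | sep h => rw [drop_eq_cons h, encNat_zero]; rfl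
  | bit b h _ h' ih => rw [drop_eq_cons h, ih, encNat_bit h']; rfl

theorem unique (h : NumAt w p m r) (h' : NumAt w p m' r') : m = m' ∧ r = r' := by
  induction h generalizing m' with
  | sep h =>
    cases h' with
    | sep => exact ⟨rfl, rfl⟩
    | bit b h' =>
      rw [h] at h'
      exact absurd (Option.some.inj h').symm (digit_ne_sep b)
  | bit b h _ _ ih =>
    cases h' with
    | sep h' =>
      rw [h] at h'
      exact absurd (Option.some.inj h') (digit_ne_sep b)
    | bit b' h' h'' =>
      obtain ⟨rfl, rfl⟩ := ih h''
      rw [h] at h'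
      obtain rfl := digit_injective (Option.some.inj h')
      exact ⟨rfl, rfl⟩

theorem eq_of_zero (h : NumAt w p m r) (hm : m = 0) : p = r := by
  cases h with
  | sep => rfl
  | bit b _ _ h' =>
    rw [Nat.bit_eq_zero_iff] at hm
    rw [h' hm.1] at hm
    exact absurd hm.2 (by decide)

end NumAt

theorem numAt_append (u v : List Letter) (m : ℕ) :
    NumAt (u ++ encNat m ++ v) u.length m (u.length + m.bits.length) := by
  induction m using Nat.binaryRec' generalizing u with
  | zero => exact .sep (by simp [encNat_zero])
  | bit b m h ih =>
    rw [encNat_bit h, Nat.bits_append_bit m b h]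
    refine .bit b (by simp) ?_ h
    have := ih (u ++ [digit b])
    simp only [List.append_assoc, List.cons_append, List.nil_append, List.length_append,
      List.length_nil, List.length_cons] at this ⊢
    convert this using 1
    omega

namespace Letter

/-- All letters. -/
def univ : List Letter :=
  [zero, one, sep, atom, neg, or, and, next, .until, ev, alw, ex, all]

/-- The operators that take one number. -/
def ones : List Letter := [neg, next, ev, alw]

theorem notMem_twos_of_mem_ones {o : Letter} (h : o ∈ ones) : o ∉ twos := by
  cases o <;> first | decide | exact absurd h (by decide)

theorem mem_univ (o : Letter) : o ∈ univ := by cases o <;> decide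

end Letter

theorem exists_op_of_mem_ones {o : Letter} (h : o ∈ Letter.ones) (i : ℕ) :
    ∃ f : Op, f.kind = o ∧ f.fst = i ∧ f.enc = o :: encNat i := by
  simp only [Letter.ones, List.mem_cons, List.not_mem_nil, or_false] at h
  rcases h with rfl | rfl | rfl | rfl
  exacts [⟨.neg i, rfl, rfl, rfl⟩, ⟨.next i, rfl, rfl, rfl⟩, ⟨.ev i, rfl, rfl, rfl⟩,
    ⟨.alw i, rfl, rfl, rfl⟩]

theorem exists_op_of_mem_twos {o : Letter} (h : o ∈ Letter.twos) (i j : ℕ) :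
    ∃ f : Op, f.kind = o ∧ f.fst = i ∧ f.snd = j ∧ f.enc = o :: (encNat i ++ encNat j) := by
  simp only [Letter.twos, List.mem_cons, List.not_mem_nil, or_false] at h
  rcases h with rfl | rfl | rfl | rfl | rfl | rfl
  exacts [⟨.atom i j, rfl, rfl, rfl, rfl⟩, ⟨.or i j, rfl, rfl, rfl, rfl⟩,
    ⟨.and i j, rfl, rfl, rfl, rfl⟩, ⟨.until i j, rfl, rfl, rfl, rfl⟩,
    ⟨.ex i j, rfl, rfl, rfl, rfl⟩, ⟨.all i j, rfl, rfl, rfl, rfl⟩]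

theorem Op.enc_eq (f : Op) : (f.kind ∈ Letter.ones ∧ f.kind ∉ Letter.twos ∧
    f.enc = f.kind :: encNat f.fst) ∨ (f.kind ∈ Letter.twos ∧
      f.enc = f.kind :: (encNat f.fst ++ encNat f.snd)) := by
  cases f <;> simp [Op.kind, Op.enc, Op.fst, Op.snd, Letter.ones, Letter.twos]

/-- The letter at position `p` of the word is in `S`. -/
def At (w : List Letter) (S : List Letter) (p : ℕ) : Prop := ∃ o ∈ S, w[p]? = some o

/-- Line `k` has an operator in `S`. -/
def ParseRel.KindIn (N : ℕ) (w : List Letter) (d : ParseRel) (S : List Letter) (k : ℕ) : Prop :=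
  d.line k ∧ ∃ q < N, d.opp k q ∧ At w S q

/-- The conditions that make the relations describe the lines of the word `w`. The relation `num` need
only be sound: `step` asserts it wherever a number must be found. A line is started by every position
that is not the end of the word, and `Letter.univ` tells these positions. The condition `¬ q = r`
excludes numbers whose most significant digit is `0`, which `encNat` does not produce. -/
structure ParseRel.IsParse (N : ℕ) (w : List Letter) (d : ParseRel) : Prop where
  num : ∀ p < N, ∀ r < N, d.num p r → (At w [.sep] p ∧ p = r) ∨ ∃ q < N, q = p + 1 ∧ d.num q r ∧
    (At w [.one] p ∨ (At w [.zero] p ∧ ¬ q = r))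
  eqn : ∀ p < N, ∀ r < N, ∀ p' < N, ∀ r' < N, d.num p r → d.num p' r' → (d.eqn p p' ↔
    (At w [.sep] p ∧ At w [.sep] p') ∨ ∃ q < N, ∃ q' < N, q = p + 1 ∧ q' = p' + 1 ∧
      ((At w [.zero] p ∧ At w [.zero] p') ∨ (At w [.one] p ∧ At w [.one] p')) ∧ d.eqn q q')
  start_zero : ∃ p < N, (∀ j < N, ¬ j < p) ∧ d.start p p ∧ At w Letter.univ p
  start_fun : ∀ k < N, ∀ p < N, ∀ q < N, d.start k p → d.start k q → p = q
  opp_fun : ∀ k < N, ∀ p < N, ∀ q < N, d.opp k p → d.opp k q → p = q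
  a1_fun : ∀ k < N, ∀ p < N, ∀ q < N, d.a1 k p → d.a1 k q → p = q
  a2_fun : ∀ k < N, ∀ p < N, ∀ q < N, d.a2 k p → d.a2 k q → p = q
  start_pred : ∀ k < N, ∀ k' < N, ∀ q < N, k' = k + 1 → d.start k' q →
    ∃ p < N, d.start k p ∧ At w Letter.univ p
  step : ∀ k < N, ∀ p < N, d.start k p → At w Letter.univ p →
    ∃ s < N, ∃ q < N, ∃ a < N, ∃ s' < N, ∃ e < N, ∃ k' < N, q = s + 1 ∧ a = q + 1 ∧ e = s' + 1 ∧
      k' = k + 1 ∧ d.num p s ∧ d.opp k q ∧ d.a1 k a ∧ d.num a s' ∧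
        ((At w Letter.ones q ∧ d.start k' e) ∨ (At w Letter.twos q ∧ d.a2 k e ∧
          ∃ t < N, ∃ f < N, f = t + 1 ∧ d.num e t ∧ d.start k' f))
  line : ∀ k < N, (d.line k ↔ ∃ p < N, d.start k p ∧ At w Letter.univ p)
  lab1 : ∀ k < N, ∀ k' < N, (d.lab1 k k' ↔ d.line k ∧ d.line k' ∧
    ∃ p < N, ∃ p' < N, d.a1 k p ∧ d.start k' p' ∧ d.eqn p p')
  lab2 : ∀ k < N, ∀ k' < N, (d.lab2 k k' ↔ d.line k ∧ d.line k' ∧ d.KindIn N w Letter.twos k ∧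
    ∃ p < N, ∃ p' < N, d.a2 k p ∧ d.start k' p' ∧ d.eqn p p')
  same1 : ∀ k < N, ∀ k' < N, (d.same1 k k' ↔ d.line k ∧ d.line k' ∧
    ∃ p < N, ∃ p' < N, d.a1 k p ∧ d.a1 k' p' ∧ d.eqn p p')
  same2 : ∀ k < N, ∀ k' < N, (d.same2 k k' ↔ d.line k ∧ d.line k' ∧ d.KindIn N w Letter.twos k ∧
    ∃ p < N, ∃ p' < N, d.a2 k p ∧ d.a1 k' p' ∧ d.eqn p p')

/-- The relations only hold of numbers below `N`. -/
structure ParseRel.BelowN (N : ℕ) (d : ParseRel) : Prop where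
  line : ∀ k, d.line k → k < N
  lab1 : ∀ k k', d.lab1 k k' → k < N ∧ k' < N
  lab2 : ∀ k k', d.lab2 k k' → k < N ∧ k' < N
  same1 : ∀ k k', d.same1 k k' → k < N ∧ k' < N
  same2 : ∀ k k', d.same2 k k' → k < N ∧ k' < N

theorem at_singleton {w : List Letter} {o : Letter} {p : ℕ} : At w [o] p ↔ w[p]? = some o := by
  simp [At]

section

variable {N : ℕ} {w : List Letter} {d : ParseRel}

namespace ParseRel.IsParse

theorem exists_numAt (h : d.IsParse N w) {p r : ℕ} (hp : p < N) (hr : r < N) (hn : d.num p r) :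
    ∃ m, NumAt w p m r := by
  rcases h.num p hp r hr hn with ⟨h1, rfl⟩ | ⟨q, hq, rfl, h1, h2⟩
  · exact ⟨0, .sep (at_singleton.1 h1)⟩
  · have hlt : p < w.length := by
      rcases h2 with ⟨_, _, h2⟩ | ⟨⟨_, _, h2⟩, _⟩ <;> exact getElem?_lt h2
    obtain ⟨m, hm⟩ := exists_numAt h hq hr h1
    rcases h2 with h2 | ⟨h2, h3⟩
    · exact ⟨_, .bit true (at_singleton.1 h2) hm fun _ => rfl⟩
    · exact ⟨_, .bit false (at_singleton.1 h2) hm fun h0 => absurd (hm.eq_of_zero h0) h3⟩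
  termination_by w.length - p

theorem num_succ (h : d.IsParse N w) {p r : ℕ} (hp : p < N) (hr : r < N) (hn : d.num p r) {b : Bool}
    (hb : w[p]? = some (digit b)) : p + 1 < N ∧ d.num (p + 1) r := by
  rcases h.num p hp r hr hn with ⟨h1, rfl⟩ | ⟨q, hq, rfl, h1, h2⟩
  · rw [at_singleton, hb] at h1
    exact absurd (Option.some.inj h1) (digit_ne_sep b)
  · exact ⟨hq, h1⟩

/-- The relation `eqn` is determined by recursion on the digits. -/
theorem eqn_iff (h : d.IsParse N w) {p m r p' m' r' : ℕ} (hm : NumAt w p m r)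
    (hm' : NumAt w p' m' r') (hp : p < N) (hr : r < N) (hp' : p' < N) (hr' : r' < N)
    (hn : d.num p r) (hn' : d.num p' r') : d.eqn p p' ↔ m = m' := by
  rw [h.eqn p hp r hr p' hp' r' hr' hn hn']
  simp only [at_singleton]
  induction hm generalizing p' m' with
  | sep h0 =>
    cases hm' with
    | sep h1 => simp [h0, h1]
    | bit b h1 h2 h3 =>
      have : digit b ≠ .sep := digit_ne_sep b
      simp only [h0, h1, Option.some.injEq, this, and_false, reduceCtorEq, false_and, or_self,
        exists_false, false_iff]
      intro e
      rw [eq_comm, Nat.bit_eq_zero_iff] at e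
      rw [h3 e.1] at e
      exact absurd e.2 (by decide)
  | bit b h0 h2 h3 ih =>
    obtain ⟨k1, k2⟩ := h.num_succ hp hr hn h0
    have hb : digit b ≠ .sep := digit_ne_sep b
    cases hm' with
    | sep h1 =>
      simp only [h0, h1, Option.some.injEq, hb, and_false, false_and, reduceCtorEq, or_self,
        exists_false, false_iff]
      intro e
      rw [Nat.bit_eq_zero_iff] at e
      rw [h3 e.1] at e
      exact absurd e.2 (by decide)
    | @bit _ m' _ b' h1 h4 h5 =>
      obtain ⟨k3, k4⟩ := h.num_succ hp' hr' hn' h1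
      have ih' := ih h4 k1 hr k3 k2 k4
      rw [← at_singleton, ← at_singleton] at ih'
      have e := h.eqn _ k1 _ hr _ k3 _ hr' k2 k4
      simp only [at_singleton] at e ih'
      rw [← e] at ih'
      simp only [h0, h1, Option.some.injEq, hb, false_and, false_or, bit_inj]
      constructor
      · rintro ⟨q, _, q', _, rfl, rfl, h6, h7⟩
        refine ⟨?_, ih'.1 h7⟩
        cases b <;> cases b' <;> simp [digit] at h6 ⊢
      · rintro ⟨rfl, h6⟩
        refine ⟨_, k1, _, k3, rfl, rfl, ?_, ih'.2 h6⟩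
        cases b <;> simp [digit]

variable (N w d) in
/-- The relations give the positions of the parts of line `k`, which is `l`. -/
structure _root_.HyperLTL.ParseRel.Line (k : ℕ) (l : ℕ × Op) (p s s' : ℕ) : Prop where
  lt : s' + 1 < N
  start : d.start k p
  num : d.num p s
  numAt : NumAt w p l.1 s
  opp : d.opp k (s + 1)
  kind : w[s + 1]? = some l.2.kind
  a1 : d.a1 k (s + 2)
  num1 : d.num (s + 2) s'
  numAt1 : NumAt w (s + 2) l.2.fst s'
  snd : l.2.kind ∈ Letter.twos →
    ∃ t < N, d.a2 k (s' + 1) ∧ d.num (s' + 1) t ∧ NumAt w (s' + 1) l.2.snd t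

/-- The word from the beginning of a line on is a list of lines. -/
theorem exists_lines (h : d.IsParse N w) (hN : w.length < N) {k p : ℕ} (hk : k ≤ p)
    (hp : p ≤ w.length) (hst : d.start k p) : ∃ C : List (ℕ × Op), w.drop p = encLines C ∧
      k + C.length ≤ w.length ∧ d.start (k + C.length) w.length ∧
        ∀ j l, C[j]? = some l → ∃ p s s', d.Line N w (k + j) l p s s' := by
  rcases hp.eq_or_lt with rfl | hlt
  · exact ⟨[], by simp [encLines], by simpa using hk, by simpa using hst, by simp⟩
  have hat : At w Letter.univ p := ⟨w[p], Letter.mem_univ _, List.getElem?_eq_getElem hlt⟩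
  obtain ⟨s, hs, q, hq, a, ha, s', hs', e, he, k', hk', rfl, rfl, rfl, rfl, h1, h2, h3, h4, h5⟩ :=
    h.step k (by omega) p (by omega) hst hat
  obtain ⟨m, hm⟩ := h.exists_numAt (by omega) hs h1
  obtain ⟨i, hi⟩ := h.exists_numAt ha hs' h4
  have l1 := hm.le
  have l2 := hi.le
  have l3 := hi.lt
  rcases h5 with ⟨⟨o, ho, ho'⟩, h5⟩ | ⟨⟨o, ho, ho'⟩, h5, t, ht, f, hf, rfl, h6, h7⟩
  · obtain ⟨g, rfl, rfl, hg⟩ := exists_op_of_mem_ones ho i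
    obtain ⟨C, e1, e2, e3, e4⟩ := exists_lines h hN (k := k + 1) (p := s' + 1) (by omega) l3 h5
    refine ⟨(m, g) :: C, ?_, ?_, ?_, ?_⟩
    · rw [hm.drop, drop_eq_cons ho', hi.drop, e1]
      simp [encLines, hg]
    · simp only [List.length_cons]; omega
    · rw [List.length_cons, ← add_assoc, add_right_comm]; exact e3
    · intro j l hj
      cases j with
      | zero =>
        obtain rfl := Option.some.inj hj
        refine ⟨p, s, s', he, hst, h1, hm, h2, ho', h3, h4, hi, fun h' => ?_⟩
        exact absurd h' (Letter.notMem_twos_of_mem_ones ho)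
      | succ j =>
        obtain ⟨p, s, s', hl⟩ := e4 j l hj
        exact ⟨p, s, s', by rwa [← add_assoc, add_right_comm]⟩
  · obtain ⟨n, hn⟩ := h.exists_numAt he ht h6
    have l4 := hn.le
    have l5 := hn.lt
    obtain ⟨g, rfl, rfl, rfl, hg⟩ := exists_op_of_mem_twos ho i n
    obtain ⟨C, e1, e2, e3, e4⟩ := exists_lines h hN (k := k + 1) (p := t + 1) (by omega) l5 h7
    refine ⟨(m, g) :: C, ?_, ?_, ?_, ?_⟩
    · rw [hm.drop, drop_eq_cons ho', hi.drop, hn.drop, e1]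
      simp [encLines, hg]
    · simp only [List.length_cons]; omega
    · rw [List.length_cons, ← add_assoc, add_right_comm]; exact e3
    · intro j l hj
      cases j with
      | zero =>
        obtain rfl := Option.some.inj hj
        exact ⟨p, s, s', he, hst, h1, hm, h2, ho', h3, h4, hi, fun _ => ⟨t, ht, h5, h6, hn⟩⟩
      | succ j =>
        obtain ⟨p, s, s', hl⟩ := e4 j l hj
        exact ⟨p, s, s', by rwa [← add_assoc, add_right_comm]⟩
  termination_by w.length - p

/-- A word that can be divided into lines is a list of lines, and the relations describe it. -/
theorem exists_fits (h : d.IsParse N w) (hb : d.BelowN N) (hN : w.length < N) :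
    ∃ C : List (ℕ × Op), C ≠ [] ∧ C.length ≤ w.length ∧ w = encLines C ∧
      d.Fits C (d.KindIn N w) := by
  obtain ⟨p, hp, hp0, hst, _, _, hp1⟩ := h.start_zero
  obtain rfl : p = 0 := by
    by_contra hne
    exact hp0 0 (by omega) (by omega)
  have hpos := getElem?_lt hp1
  obtain ⟨C, hC1, hC2, hC3, hC4⟩ := h.exists_lines hN le_rfl (Nat.zero_le _) hst
  simp only [zero_add, List.drop_zero] at hC1 hC2 hC3 hC4
  have hC : C ≠ [] := by
    rintro rfl
    rw [hC1] at hpos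
    simp [encLines] at hpos
  have hend : ¬ At w Letter.univ w.length := by
    rintro ⟨_, _, h⟩
    exact absurd (getElem?_lt h) (lt_irrefl _)
  have hline' : ∀ k p, C.length ≤ k → k < N → p < N → d.start k p → At w Letter.univ p → False := by
    intro k
    induction k using Nat.strong_induction_on with
    | _ k ih =>
    intro p h1 h2 h3 h4 h5
    rcases h1.eq_or_lt with rfl | h1
    · rw [h.start_fun _ h2 _ h3 _ hN h4 hC3] at h5
      exact hend h5
    · obtain ⟨p', h6, h7, h8⟩ := h.start_pred (k - 1) (by omega) k h2 p h3 (by omega) h4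
      exact ih (k - 1) (by omega) p' (by omega) (by omega) h6 h7 h8
  have info : ∀ k < C.length, ∃ p s s', d.Line N w k (lab C k, op C k) p s s' := by
    intro k hk
    refine hC4 k _ ?_
    simp [lab, op, hk]
  have hline : ∀ k, d.line k ↔ k < C.length := by
    intro k
    constructor
    · intro hk
      have hkN := hb.line k hk
      obtain ⟨p, h1, h2, h3⟩ := (h.line k hkN).1 hk
      by_contra h4
      exact hline' k p (not_lt.1 h4) hkN h1 h2 h3
    · intro hk
      obtain ⟨p, s, s', hl⟩ := info k hk
      have := hl.numAt.le
      have := hl.numAt.lt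
      refine (h.line k (by omega)).2 ⟨p, by omega, hl.start, w[p], Letter.mem_univ _, ?_⟩
      exact List.getElem?_eq_getElem (by omega)
  have hlt : ∀ {k}, k < C.length → k < N := fun h => by omega
  have hkind : ∀ S k, d.KindIn N w S k ↔ k < C.length ∧ (op C k).kind ∈ S := by
    intro S k
    rw [ParseRel.KindIn, hline]
    refine and_congr_right fun hk => ?_
    obtain ⟨p, s, s', hl⟩ := info k hk
    have h1 := getElem?_lt hl.kind
    constructor
    · rintro ⟨q, hq, h2, o, ho, h3⟩
      rw [h.opp_fun k (hlt hk) q hq (s + 1) (by omega) h2 hl.opp, hl.kind] at h3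
      rwa [Option.some.inj h3]
    · exact fun h2 => ⟨s + 1, by omega, hl.opp, _, h2, hl.kind⟩
  have hkind' : ∀ S k, k < C.length → (d.KindIn N w S k ↔ (op C k).kind ∈ S) := fun S k hk => by
    rw [hkind]; exact and_iff_right hk
  refine ⟨C, hC, hC2, hC1, hline, hkind, fun k k' => ?_, fun k k' => ?_, fun k k' => ?_,
    fun k k' => ?_⟩
  · constructor
    · intro h'
      obtain ⟨h1, h2⟩ := hb.lab1 k k' h'
      obtain ⟨h3, h4, p, hp, p', hp', h5, h6, h7⟩ := (h.lab1 k h1 k' h2).1 h'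
      rw [hline] at h3 h4
      refine ⟨h3, h4, ?_⟩
      obtain ⟨p₁, s₁, s₁', l₁⟩ := info k h3
      obtain ⟨p₂, s₂, s₂', l₂⟩ := info k' h4
      have a₁ := l₁.numAt1.le
      have b₁ := l₁.numAt1.lt
      have a₂ := l₂.numAt.le
      have b₂ := l₂.numAt.lt
      rw [h.a1_fun k h1 p hp _ (by omega) h5 l₁.a1,
        h.start_fun k' h2 p' hp' _ (by omega) h6 l₂.start,
        h.eqn_iff l₁.numAt1 l₂.numAt (by omega) (by omega) (by omega) (by omega) l₁.num1 l₂.num] at h7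
      exact h7.symm
    · rintro ⟨h3, h4, h5⟩
      obtain ⟨p₁, s₁, s₁', l₁⟩ := info k h3
      obtain ⟨p₂, s₂, s₂', l₂⟩ := info k' h4
      have a₁ := l₁.numAt1.le
      have b₁ := l₁.numAt1.lt
      have a₂ := l₂.numAt.le
      have b₂ := l₂.numAt.lt
      refine (h.lab1 k (hlt h3) k' (hlt h4)).2 ⟨(hline k).2 h3, (hline k').2 h4, _, ?_, _, ?_, l₁.a1,
        l₂.start, (h.eqn_iff l₁.numAt1 l₂.numAt (by omega) (by omega) (by omega) (by omega) l₁.num1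
          l₂.num).2 h5.symm⟩ <;> omega
  · constructor
    · intro h'
      obtain ⟨h1, h2⟩ := hb.lab2 k k' h'
      obtain ⟨h3, h4, h8, p, hp, p', hp', h5, h6, h7⟩ := (h.lab2 k h1 k' h2).1 h'
      rw [hline] at h3 h4
      rw [hkind' _ _ h3] at h8
      refine ⟨h3, h4, h8, ?_⟩
      obtain ⟨p₁, s₁, s₁', l₁⟩ := info k h3
      obtain ⟨p₂, s₂, s₂', l₂⟩ := info k' h4
      obtain ⟨t, ht, g1, g2, g3⟩ := l₁.snd h8
      have a₁ := g3.le
      have b₁ := g3.lt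
      have a₂ := l₂.numAt.le
      have b₂ := l₂.numAt.lt
      rw [h.a2_fun k h1 p hp _ (by omega) h5 g1,
        h.start_fun k' h2 p' hp' _ (by omega) h6 l₂.start,
        h.eqn_iff g3 l₂.numAt (by omega) (by omega) (by omega) (by omega) g2 l₂.num] at h7
      exact h7.symm
    · rintro ⟨h3, h4, h8, h5⟩
      obtain ⟨p₁, s₁, s₁', l₁⟩ := info k h3
      obtain ⟨p₂, s₂, s₂', l₂⟩ := info k' h4
      obtain ⟨t, ht, g1, g2, g3⟩ := l₁.snd h8
      have a₁ := g3.le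
      have b₁ := g3.lt
      have a₂ := l₂.numAt.le
      have b₂ := l₂.numAt.lt
      refine (h.lab2 k (hlt h3) k' (hlt h4)).2 ⟨(hline k).2 h3, (hline k').2 h4,
        (hkind' _ _ h3).2 h8, _, ?_, _, ?_, g1, l₂.start, (h.eqn_iff g3 l₂.numAt (by omega)
          (by omega) (by omega) (by omega) g2 l₂.num).2 h5.symm⟩ <;> omega
  · constructor
    · intro h'
      obtain ⟨h1, h2⟩ := hb.same1 k k' h'
      obtain ⟨h3, h4, p, hp, p', hp', h5, h6, h7⟩ := (h.same1 k h1 k' h2).1 h'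
      rw [hline] at h3 h4
      refine ⟨h3, h4, ?_⟩
      obtain ⟨p₁, s₁, s₁', l₁⟩ := info k h3
      obtain ⟨p₂, s₂, s₂', l₂⟩ := info k' h4
      have a₁ := l₁.numAt1.le
      have b₁ := l₁.numAt1.lt
      have a₂ := l₂.numAt1.le
      have b₂ := l₂.numAt1.lt
      rwa [h.a1_fun k h1 p hp _ (by omega) h5 l₁.a1,
        h.a1_fun k' h2 p' hp' _ (by omega) h6 l₂.a1,
        h.eqn_iff l₁.numAt1 l₂.numAt1 (by omega) (by omega) (by omega) (by omega) l₁.num1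
          l₂.num1] at h7
    · rintro ⟨h3, h4, h5⟩
      obtain ⟨p₁, s₁, s₁', l₁⟩ := info k h3
      obtain ⟨p₂, s₂, s₂', l₂⟩ := info k' h4
      have a₁ := l₁.numAt1.le
      have b₁ := l₁.numAt1.lt
      have a₂ := l₂.numAt1.le
      have b₂ := l₂.numAt1.lt
      refine (h.same1 k (hlt h3) k' (hlt h4)).2 ⟨(hline k).2 h3, (hline k').2 h4, _, ?_, _, ?_,
        l₁.a1, l₂.a1, (h.eqn_iff l₁.numAt1 l₂.numAt1 (by omega) (by omega) (by omega) (by omega)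
          l₁.num1 l₂.num1).2 h5⟩ <;> omega
  · constructor
    · intro h'
      obtain ⟨h1, h2⟩ := hb.same2 k k' h'
      obtain ⟨h3, h4, h8, p, hp, p', hp', h5, h6, h7⟩ := (h.same2 k h1 k' h2).1 h'
      rw [hline] at h3 h4
      rw [hkind' _ _ h3] at h8
      refine ⟨h3, h4, h8, ?_⟩
      obtain ⟨p₁, s₁, s₁', l₁⟩ := info k h3
      obtain ⟨p₂, s₂, s₂', l₂⟩ := info k' h4
      obtain ⟨t, ht, g1, g2, g3⟩ := l₁.snd h8
      have a₁ := g3.le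
      have b₁ := g3.lt
      have a₂ := l₂.numAt1.le
      have b₂ := l₂.numAt1.lt
      rwa [h.a2_fun k h1 p hp _ (by omega) h5 g1,
        h.a1_fun k' h2 p' hp' _ (by omega) h6 l₂.a1,
        h.eqn_iff g3 l₂.numAt1 (by omega) (by omega) (by omega) (by omega) g2 l₂.num1] at h7
    · rintro ⟨h3, h4, h8, h5⟩
      obtain ⟨p₁, s₁, s₁', l₁⟩ := info k h3
      obtain ⟨p₂, s₂, s₂', l₂⟩ := info k' h4
      obtain ⟨t, ht, g1, g2, g3⟩ := l₁.snd h8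
      have a₁ := g3.le
      have b₁ := g3.lt
      have a₂ := l₂.numAt1.le
      have b₂ := l₂.numAt1.lt
      refine (h.same2 k (hlt h3) k' (hlt h4)).2 ⟨(hline k).2 h3, (hline k').2 h4,
        (hkind' _ _ h3).2 h8, _, ?_, _, ?_, g1, l₂.a1, (h.eqn_iff g3 l₂.numAt1 (by omega)
          (by omega) (by omega) (by omega) g2 l₂.num1).2 h5⟩ <;> omega

end ParseRel.IsParse

end

end HyperLTL

/-! ### The relations that describe a list of lines -/

namespace HyperLTL

section

variable {C : List (ℕ × Op)} {k : ℕ}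

/-- The position at which line `k` starts. -/
def startPos (C : List (ℕ × Op)) (k : ℕ) : ℕ := (encLines (C.take k)).length

/-- The position of the operator of line `k`. -/
def opPos (C : List (ℕ × Op)) (k : ℕ) : ℕ := startPos C k + (lab C k).bits.length + 1

/-- The position behind the first number of the right-hand side of line `k`. -/
def sndPos (C : List (ℕ × Op)) (k : ℕ) : ℕ := opPos C k + 1 + (op C k).fst.bits.length + 1

theorem startPos_zero : startPos C 0 = 0 := by simp [startPos, encLines]

theorem startPos_length : startPos C C.length = (encLines C).length := by simp [startPos]

theorem length_encNat (m : ℕ) : (encNat m).length = m.bits.length + 1 := by simp [encNat]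

theorem encLines_eq (hk : k < C.length) : encLines C = encLines (C.take k) ++ encNat (lab C k) ++
    ((op C k).enc ++ encLines (C.drop (k + 1))) := by
  conv_lhs => rw [← List.take_append_drop k C, List.drop_eq_getElem_cons hk]
  simp only [encLines, lab, op, hk, List.flatMap_append, List.flatMap_cons,
    List.getElem?_eq_getElem, Option.getD_some, List.append_assoc]

theorem startPos_succ (hk : k < C.length) :
    startPos C (k + 1) = opPos C k + (op C k).enc.length := by
  rw [startPos, List.take_add_one, List.getElem?_eq_getElem hk]
  simp only [encLines, opPos, startPos, lab, op, hk, List.flatMap_append, List.length_append,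
    Option.toList_some, List.flatMap_cons, List.flatMap_nil, List.append_nil, length_encNat,
    List.getElem?_eq_getElem, Option.getD_some]
  omega

theorem numAt_startPos (hk : k < C.length) :
    NumAt (encLines C) (startPos C k) (lab C k) (startPos C k + (lab C k).bits.length) := by
  rw [encLines_eq hk]
  exact numAt_append _ _ _

theorem getElem?_opPos (hk : k < C.length) : (encLines C)[opPos C k]? = some (op C k).kind := by
  have h : opPos C k = (encLines (C.take k) ++ encNat (lab C k)).length := by
    simp [opPos, startPos, length_encNat, add_assoc]
  rw [encLines_eq hk, h, List.getElem?_append_right le_rfl, Nat.sub_self]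
  rcases (op C k).enc_eq with ⟨-, -, h⟩ | ⟨-, h⟩ <;> rw [h] <;> rfl

theorem numAt_fst (hk : k < C.length) : NumAt (encLines C) (opPos C k + 1) (op C k).fst
    (opPos C k + 1 + (op C k).fst.bits.length) := by
  have h : opPos C k + 1 =
      (encLines (C.take k) ++ encNat (lab C k) ++ [(op C k).kind]).length := by
    simp [opPos, startPos, length_encNat, add_assoc]
  rw [encLines_eq hk, h]
  rcases (op C k).enc_eq with ⟨-, -, h⟩ | ⟨-, h⟩ <;> rw [h]
  · convert numAt_append (encLines (C.take k) ++ encNat (lab C k) ++ [(op C k).kind])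
      (encLines (C.drop (k + 1))) (op C k).fst using 1
    simp
  · convert numAt_append (encLines (C.take k) ++ encNat (lab C k) ++ [(op C k).kind])
      (encNat (op C k).snd ++ encLines (C.drop (k + 1))) (op C k).fst using 1
    simp

theorem numAt_snd (hk : k < C.length) (h : (op C k).kind ∈ Letter.twos) :
    NumAt (encLines C) (sndPos C k) (op C k).snd (sndPos C k + (op C k).snd.bits.length) := by
  have h' : sndPos C k = (encLines (C.take k) ++ encNat (lab C k) ++ [(op C k).kind] ++
      encNat (op C k).fst).length := by
    simp only [sndPos, opPos, startPos, length_encNat, List.length_append, List.length_singleton]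
    omega
  rw [encLines_eq hk, h']
  rcases (op C k).enc_eq with ⟨-, h'', -⟩ | ⟨-, h⟩
  · exact absurd h h''
  · rw [h]
    convert numAt_append (encLines (C.take k) ++ encNat (lab C k) ++ [(op C k).kind] ++
      encNat (op C k).fst) (encLines (C.drop (k + 1))) (op C k).snd using 1
    simp

theorem startPos_succ_cases (hk : k < C.length) :
    ((op C k).kind ∈ Letter.ones ∧ startPos C (k + 1) = sndPos C k) ∨
      ((op C k).kind ∈ Letter.twos ∧
        startPos C (k + 1) = sndPos C k + (op C k).snd.bits.length + 1) := by
  rw [startPos_succ hk]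
  rcases (op C k).enc_eq with ⟨h1, -, h⟩ | ⟨h1, h⟩ <;> rw [h]
  · refine .inl ⟨h1, ?_⟩
    simp only [List.length_cons, length_encNat, sndPos]
    omega
  · refine .inr ⟨h1, ?_⟩
    simp only [List.length_cons, List.length_append, length_encNat, sndPos]
    omega

theorem le_startPos (hk : k ≤ C.length) : k ≤ startPos C k := by
  induction k with
  | zero => exact Nat.zero_le _
  | succ k ih =>
    have := ih (by omega)
    rcases startPos_succ_cases (show k < C.length by omega) with ⟨-, h⟩ | ⟨-, h⟩ <;>
      rw [h, sndPos, opPos] <;> omega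

theorem startPos_le (hk : k ≤ C.length) : startPos C k ≤ (encLines C).length := by
  rcases hk.eq_or_lt with rfl | hk
  · exact startPos_length.le
  · have := (numAt_startPos hk).le
    have := (numAt_startPos hk).lt
    omega

theorem length_le_length_encLines : C.length ≤ (encLines C).length :=
  (le_startPos le_rfl).trans startPos_length.le

/-- The numbers at the two positions are equal. -/
def EqNumAt (w : List Letter) (p p' : ℕ) : Prop := ∃ m r r', NumAt w p m r ∧ NumAt w p' m r'

theorem NumAt.eqNumAt_iff {w : List Letter} {p m r p' m' r' : ℕ} (h : NumAt w p m r)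
    (h' : NumAt w p' m' r') : EqNumAt w p p' ↔ m = m' := by
  constructor
  · rintro ⟨n, _, _, h1, h2⟩
    rw [(h.unique h1).1, (h'.unique h2).1]
  · rintro rfl
    exact ⟨_, _, _, h, h'⟩

/-- The relations that describe the lines of `C`. -/
def parseRel (C : List (ℕ × Op)) : ParseRel where
  num p r := ∃ m, NumAt (encLines C) p m r
  eqn := EqNumAt (encLines C)
  start k p := k ≤ C.length ∧ p = startPos C k
  opp k p := k < C.length ∧ p = opPos C k
  a1 k p := k < C.length ∧ p = opPos C k + 1
  a2 k p := k < C.length ∧ p = sndPos C k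
  line k := k < C.length
  lab1 k k' := k < C.length ∧ k' < C.length ∧ lab C k' = (op C k).fst
  lab2 k k' := k < C.length ∧ k' < C.length ∧ (op C k).kind ∈ Letter.twos ∧ lab C k' = (op C k).snd
  same1 k k' := k < C.length ∧ k' < C.length ∧ (op C k).fst = (op C k').fst
  same2 k k' := k < C.length ∧ k' < C.length ∧ (op C k).kind ∈ Letter.twos ∧
    (op C k).snd = (op C k').fst

theorem at_univ_iff {w : List Letter} {p : ℕ} : At w Letter.univ p ↔ p < w.length :=
  ⟨fun ⟨_, _, h⟩ => getElem?_lt h, fun h => ⟨w[p], Letter.mem_univ _, List.getElem?_eq_getElem h⟩⟩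

theorem kindIn_parseRel {N : ℕ} (hN : (encLines C).length < N) (S : List Letter) (k : ℕ) :
    (parseRel C).KindIn N (encLines C) S k ↔ k < C.length ∧ (op C k).kind ∈ S := by
  refine and_congr_right fun hk => ?_
  have h := getElem?_opPos hk
  constructor
  · rintro ⟨_, _, ⟨_, rfl⟩, o, ho, h'⟩
    rw [h] at h'
    rwa [Option.some.inj h']
  · exact fun h' => ⟨_, (getElem?_lt h).trans hN, ⟨hk, rfl⟩, _, h', h⟩

theorem parseRel_fits {N : ℕ} (hN : (encLines C).length < N) :
    (parseRel C).Fits C ((parseRel C).KindIn N (encLines C)) where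
  line _ := Iff.rfl
  kind := kindIn_parseRel hN
  lab1 _ _ := Iff.rfl
  lab2 _ _ := Iff.rfl
  same1 _ _ := Iff.rfl
  same2 _ _ := Iff.rfl

theorem isParse_parseRel {N : ℕ} (hC : C ≠ []) (hN : (encLines C).length < N) :
    (parseRel C).IsParse N (encLines C) where
  num := by
    rintro p - r hr ⟨m, h⟩
    cases h with
    | sep h => exact .inl ⟨at_singleton.2 h, rfl⟩
    | @bit _ m _ b h h1 h2 =>
      have := h1.le
      refine .inr ⟨p + 1, by omega, rfl, ⟨_, h1⟩, ?_⟩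
      cases b with
      | true => exact .inl (at_singleton.2 h)
      | false =>
        refine .inr ⟨at_singleton.2 h, ?_⟩
        rintro rfl
        cases h1 with
        | sep => exact absurd (h2 rfl) (by decide)
        | bit _ _ h3 _ => exact absurd h3.le (by omega)
  eqn := by
    rintro p - r hr p' - r' hr' ⟨m, h⟩ ⟨m', h'⟩
    change EqNumAt _ _ _ ↔ _
    rw [h.eqNumAt_iff h']
    simp only [at_singleton]
    cases h with
    | sep h0 =>
      cases h' with
      | sep h1 => simp [h0, h1]
      | bit b h1 h2 h3 =>
        have hb : digit b ≠ .sep := digit_ne_sep b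
        simp only [h0, h1, Option.some.injEq, hb, and_false, reduceCtorEq, false_and, or_self,
          exists_false, iff_false]
        intro e
        rw [eq_comm, Nat.bit_eq_zero_iff] at e
        rw [h3 e.1] at e
        exact absurd e.2 (by decide)
    | bit b h0 h2 h3 =>
      have hb : digit b ≠ .sep := digit_ne_sep b
      cases h' with
      | sep h1 =>
        simp only [h0, h1, Option.some.injEq, hb, and_false, false_and, reduceCtorEq, or_self,
          exists_false, iff_false]
        intro e
        rw [Nat.bit_eq_zero_iff] at e
        rw [h3 e.1] at e
        exact absurd e.2 (by decide)
      | bit b' h1 h4 h5 =>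
        have l1 := h2.le
        have l2 := h4.le
        simp only [h0, h1, Option.some.injEq, hb, false_and, false_or, bit_inj]
        constructor
        · rintro ⟨rfl, rfl⟩
          refine ⟨p + 1, by omega, p' + 1, by omega, rfl, rfl, ?_, _, _, _, h2, h4⟩
          cases b <;> simp [digit]
        · rintro ⟨q, _, q', _, rfl, rfl, h6, h7⟩
          refine ⟨?_, (h2.eqNumAt_iff h4).1 h7⟩
          cases b <;> cases b' <;> simp [digit] at h6 ⊢
  start_zero := by
    have h := length_le_length_encLines (C := C)
    have h' := List.length_pos_iff.2 hC
    exact ⟨0, by omega, fun j _ => by omega, ⟨Nat.zero_le _, startPos_zero.symm⟩,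
      at_univ_iff.2 (by omega)⟩
  start_fun := by
    rintro k - _ - _ - ⟨-, rfl⟩ ⟨-, rfl⟩
    rfl
  opp_fun := by
    rintro k - _ - _ - ⟨-, rfl⟩ ⟨-, rfl⟩
    rfl
  a1_fun := by
    rintro k - _ - _ - ⟨-, rfl⟩ ⟨-, rfl⟩
    rfl
  a2_fun := by
    rintro k - _ - _ - ⟨-, rfl⟩ ⟨-, rfl⟩
    rfl
  start_pred := by
    rintro k - _ - _ - rfl ⟨hk, rfl⟩
    have h1 := (numAt_startPos hk).le
    have h2 := (numAt_startPos hk).lt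
    exact ⟨startPos C k, by omega, ⟨by omega, rfl⟩, at_univ_iff.2 (by omega)⟩
  step := by
    rintro k - _ - ⟨hk, rfl⟩ h
    rw [at_univ_iff, ← startPos_length] at h
    have hk : k < C.length := by
      rcases hk.eq_or_lt with rfl | hk
      · exact absurd h (lt_irrefl _)
      · exact hk
    have h1 := getElem?_opPos hk
    have h2 := numAt_fst hk
    have h3 := h2.lt
    have h4 := startPos_le (show k + 1 ≤ C.length from hk)
    have h5 := length_le_length_encLines (C := C)
    have h6 : opPos C k = startPos C k + (lab C k).bits.length + 1 := rfl
    have h7 : sndPos C k = opPos C k + 1 + (op C k).fst.bits.length + 1 := rfl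
    refine ⟨startPos C k + (lab C k).bits.length, by omega, opPos C k, by omega, opPos C k + 1,
      by omega, opPos C k + 1 + (op C k).fst.bits.length, by omega, sndPos C k, by omega, k + 1,
      by omega, rfl, rfl, rfl, rfl, ⟨_, numAt_startPos hk⟩, ⟨hk, rfl⟩, ⟨hk, rfl⟩, ⟨_, h2⟩, ?_⟩
    rcases startPos_succ_cases hk with ⟨h8, h9⟩ | ⟨h8, h9⟩
    · exact .inl ⟨⟨_, h8, h1⟩, hk, h9.symm⟩
    · exact .inr ⟨⟨_, h8, h1⟩, ⟨hk, rfl⟩, sndPos C k + (op C k).snd.bits.length, by omega,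
        startPos C (k + 1), by omega, h9, ⟨_, numAt_snd hk h8⟩, hk, rfl⟩
  line := by
    intro k _
    constructor
    · intro hk
      have h1 := (numAt_startPos hk).le
      have h2 := (numAt_startPos hk).lt
      exact ⟨startPos C k, by omega, ⟨le_of_lt hk, rfl⟩, at_univ_iff.2 (by omega)⟩
    · rintro ⟨_, _, ⟨hk, rfl⟩, h⟩
      rw [at_univ_iff, ← startPos_length] at h
      rcases hk.eq_or_lt with rfl | hk
      · exact absurd h (lt_irrefl _)
      · exact hk
  lab1 := by
    intro k _ k' _
    refine and_congr_right fun hk => and_congr_right fun hk' => ?_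
    have h1 := numAt_fst hk
    have h2 := numAt_startPos hk'
    rw [eq_comm, ← h1.eqNumAt_iff h2]
    constructor
    · intro h
      have := h1.le; have := h1.lt; have := h2.le; have := h2.lt
      exact ⟨_, by omega, _, by omega, ⟨hk, rfl⟩, ⟨le_of_lt hk', rfl⟩, h⟩
    · rintro ⟨_, _, _, _, ⟨_, rfl⟩, ⟨_, rfl⟩, h⟩
      exact h
  lab2 := by
    intro k _ k' _
    refine and_congr_right fun hk => and_congr_right fun hk' => ?_
    rw [kindIn_parseRel hN, and_iff_right (show k < C.length from hk)]
    refine and_congr_right fun h0 => ?_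
    have h1 := numAt_snd hk h0
    have h2 := numAt_startPos hk'
    rw [eq_comm, ← h1.eqNumAt_iff h2]
    constructor
    · intro h
      have := h1.le; have := h1.lt; have := h2.le; have := h2.lt
      exact ⟨_, by omega, _, by omega, ⟨hk, rfl⟩, ⟨le_of_lt hk', rfl⟩, h⟩
    · rintro ⟨_, _, _, _, ⟨_, rfl⟩, ⟨_, rfl⟩, h⟩
      exact h
  same1 := by
    intro k _ k' _
    refine and_congr_right fun hk => and_congr_right fun hk' => ?_
    have h1 := numAt_fst hk
    have h2 := numAt_fst hk'
    rw [← h1.eqNumAt_iff h2]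
    constructor
    · intro h
      have := h1.le; have := h1.lt; have := h2.le; have := h2.lt
      exact ⟨_, by omega, _, by omega, ⟨hk, rfl⟩, ⟨hk', rfl⟩, h⟩
    · rintro ⟨_, _, _, _, ⟨_, rfl⟩, ⟨_, rfl⟩, h⟩
      exact h
  same2 := by
    intro k _ k' _
    refine and_congr_right fun hk => and_congr_right fun hk' => ?_
    rw [kindIn_parseRel hN, and_iff_right (show k < C.length from hk)]
    refine and_congr_right fun h0 => ?_
    have h1 := numAt_snd hk h0
    have h2 := numAt_fst hk'
    rw [← h1.eqNumAt_iff h2]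
    constructor
    · intro h
      have := h1.le; have := h1.lt; have := h2.le; have := h2.lt
      exact ⟨_, by omega, _, by omega, ⟨hk, rfl⟩, ⟨hk', rfl⟩, h⟩
    · rintro ⟨_, _, _, _, ⟨_, rfl⟩, ⟨_, rfl⟩, h⟩
      exact h

end

end HyperLTL

/-! ### Derived connectives of bounded first-order formulas -/

namespace TapeProgram.Fml

open Function (update)

variable {A : Type} {D R : ℕ} {N : ℕ} {w : List A} {G : Fin R → ℕ → ℕ → ℕ → Prop} {v : Fin D → ℕ}
  {φ ψ : Fml A D R} {x y : Fin D}

/-- Disjunction. -/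
def or (φ ψ : Fml A D R) : Fml A D R := neg (and (neg φ) (neg ψ))

/-- Implication. -/
def imp (φ ψ : Fml A D R) : Fml A D R := neg (and φ (neg ψ))

/-- Equivalence. -/
def iff (φ ψ : Fml A D R) : Fml A D R := and (imp φ ψ) (imp ψ φ)

/-- Universal quantification. -/
def all (x : Fin D) (φ : Fml A D R) : Fml A D R := neg (ex x (neg φ))

/-- Equality. -/
def eq (x y : Fin D) : Fml A D R := and (neg (lt x y)) (neg (lt y x))

/-- The letter at position `x` is in the list. -/
def letterIn (x : Fin D) : List A → Fml A D R
  | [] => lt x x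
  | a :: S => or (letter a x) (letterIn x S)

/-- The conjunction of a nonempty list of formulas. -/
def conj (φ : Fml A D R) : List (Fml A D R) → Fml A D R
  | [] => φ
  | ψ :: l => and φ (conj ψ l)

theorem sat_and : (and φ ψ).Sat N w G v ↔ φ.Sat N w G v ∧ ψ.Sat N w G v := Iff.rfl

theorem sat_or : (or φ ψ).Sat N w G v ↔ φ.Sat N w G v ∨ ψ.Sat N w G v := by
  simp only [or, Sat]; tauto

theorem sat_imp : (imp φ ψ).Sat N w G v ↔ (φ.Sat N w G v → ψ.Sat N w G v) := by
  simp only [imp, Sat]; tauto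

theorem sat_iff : (iff φ ψ).Sat N w G v ↔ (φ.Sat N w G v ↔ ψ.Sat N w G v) := by
  simp only [iff, sat_and, sat_imp]; tauto

theorem sat_all : (all x φ).Sat N w G v ↔ ∀ i < N, φ.Sat N w G (update v x i) := by
  simp only [all, Sat]; push Not; rfl

theorem sat_eq : (eq x y : Fml A D R).Sat N w G v ↔ v x = v y := by
  simp only [eq, Sat]; omega

theorem sat_letterIn {S : List A} :
    (letterIn x S : Fml A D R).Sat N w G v ↔ ∃ o ∈ S, w[v x]? = some o := by
  induction S with
  | nil => simp [letterIn, Sat]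
  | cons a S ih => simp [letterIn, sat_or, ih, Sat]

end TapeProgram.Fml

/-! ### The conditions as a first-order formula -/

namespace HyperLTL

open Function (update)
open TapeProgram (Fml)

/-- The relations of a structure for the relation symbols `0, …, 33`. Relations of smaller arity are
obtained by repeating the last argument. -/
def Rel.ofFun (G : Fin 34 → ℕ → ℕ → ℕ → Prop) : Rel where
  num x y := G 0 x y y
  eqn x y := G 1 x y y
  start x y := G 2 x y y
  opp x y := G 3 x y y
  a1 x y := G 4 x y y
  a2 x y := G 5 x y y
  line x := G 6 x x x
  lab1 x y := G 7 x y y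
  lab2 x y := G 8 x y y
  same1 x y := G 9 x y y
  same2 x y := G 10 x y y
  res1 x y := G 11 x y y
  res2 x y := G 12 x y y
  opd x y := G 13 x y y
  reach x := G 14 x x x
  slot x := G 15 x x x
  mat x := G 16 x x x
  yy x := G 17 x x x
  es x := G 18 x x x
  ws x := G 19 x x x
  bind x y := G 20 x y y
  bool x := G 21 x x x
  xb x := G 22 x x x
  fgx x := G 23 x x x
  zb x y z := G 24 x y z
  tb x y := G 25 x y y
  th x := G 26 x x x
  q x y := G 27 x y y
  pr x y z := G 28 x y z
  child x y z := G 29 x y z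
  root x y := G 30 x y y
  t x y z := G 31 x y z
  sync x y z := G 32 x y z
  same x y := G 33 x y y

theorem Rel.exists_ofFun_eq (r : Rel) : ∃ G, Rel.ofFun G = r := by
  obtain ⟨⟨num, eqn, start, opp, a1, a2, line, lab1, lab2, same1, same2⟩, res1, res2, opd, reach,
    slot, mat, yy, es, ws, bind, bool, xb, fgx, zb, tb, th, q, pr, child, root, t, sync, same⟩ := r
  let U (f : ℕ → Prop) (x _ _ : ℕ) : Prop := f x
  let B (f : ℕ → ℕ → Prop) (x y _ : ℕ) : Prop := f x y
  exact ⟨![B num, B eqn, B start, B opp, B a1, B a2, U line, B lab1, B lab2, B same1, B same2,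
    B res1, B res2, B opd, U reach, U slot, U mat, U yy, U es, U ws, B bind, U bool, U xb, U fgx,
    zb, B tb, U th, B q, pr, child, B root, t, sync, B same], rfl⟩

theorem Rel.belowN_ofFun (N : ℕ) (G : Fin 34 → ℕ → ℕ → ℕ → Prop) :
    (Rel.ofFun fun r x y z => x < N ∧ y < N ∧ z < N ∧ G r x y z).BelowN N where
  line _ h := h.1
  lab1 _ _ h := ⟨h.1, h.2.1⟩
  lab2 _ _ h := ⟨h.1, h.2.1⟩
  same1 _ _ h := ⟨h.1, h.2.1⟩
  same2 _ _ h := ⟨h.1, h.2.1⟩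

/-- Formulas in the variables `0, …, 10`. A quantifier in the scope of `d` quantifiers binds the
variable `d`, except that `kind` binds the variable `10`. -/
abbrev Cond : Type := Fml Letter 11 34

namespace Cond

open TapeProgram.Fml (all ex imp iff neg letterIn lt succ)

local infixr:35 " ⋏ " => Fml.and
local infixr:30 " ⋎ " => Fml.or
local infixr:25 " ⇒ " => Fml.imp
local infix:20 " ⇔ " => Fml.iff

/-! The atomic formulas; `Rel` explains the relation symbols. -/

def num (x y : Fin 11) : Cond := .rel 0 x y y
def eqn (x y : Fin 11) : Cond := .rel 1 x y y
def start (x y : Fin 11) : Cond := .rel 2 x y y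
def opp (x y : Fin 11) : Cond := .rel 3 x y y
def a1 (x y : Fin 11) : Cond := .rel 4 x y y
def a2 (x y : Fin 11) : Cond := .rel 5 x y y
def line (x : Fin 11) : Cond := .rel 6 x x x
def lab1 (x y : Fin 11) : Cond := .rel 7 x y y
def lab2 (x y : Fin 11) : Cond := .rel 8 x y y
def same1 (x y : Fin 11) : Cond := .rel 9 x y y
def same2 (x y : Fin 11) : Cond := .rel 10 x y y
def res1 (x y : Fin 11) : Cond := .rel 11 x y y
def res2 (x y : Fin 11) : Cond := .rel 12 x y y
def opd (x y : Fin 11) : Cond := .rel 13 x y y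
def reach (x : Fin 11) : Cond := .rel 14 x x x
def slot (x : Fin 11) : Cond := .rel 15 x x x
def mat (x : Fin 11) : Cond := .rel 16 x x x
def yy (x : Fin 11) : Cond := .rel 17 x x x
def es (x : Fin 11) : Cond := .rel 18 x x x
def ws (x : Fin 11) : Cond := .rel 19 x x x
def bind (x y : Fin 11) : Cond := .rel 20 x y y
def bool (x : Fin 11) : Cond := .rel 21 x x x
def xb (x : Fin 11) : Cond := .rel 22 x x x
def fgx (x : Fin 11) : Cond := .rel 23 x x x
def zb (x y z : Fin 11) : Cond := .rel 24 x y z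
def tb (x y : Fin 11) : Cond := .rel 25 x y y
def th (x : Fin 11) : Cond := .rel 26 x x x
def q (x y : Fin 11) : Cond := .rel 27 x y y
def pr (x y z : Fin 11) : Cond := .rel 28 x y z
def child (x y z : Fin 11) : Cond := .rel 29 x y z
def root (x y : Fin 11) : Cond := .rel 30 x y y
def t (x y z : Fin 11) : Cond := .rel 31 x y z
def sync (x y z : Fin 11) : Cond := .rel 32 x y z
def same (x y : Fin 11) : Cond := .rel 33 x y y

/-- Line `x` has an operator in `S`. -/
def kind (S : List Letter) (x : Fin 11) : Cond := line x ⋏ ex 10 (opp x 10 ⋏ letterIn 10 S)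

/-- The condition `ParseRel.IsParse`, field by field. -/
def parse : Cond := Fml.conj
  (all 0 <| all 1 <| num 0 1 ⇒ (letterIn 0 [.sep] ⋏ .eq 0 1) ⋎ ex 2 (succ 0 2 ⋏ num 2 1 ⋏
    (letterIn 0 [.one] ⋎ (letterIn 0 [.zero] ⋏ neg (.eq 2 1)))))
  [all 0 <| all 1 <| all 2 <| all 3 <| num 0 1 ⇒ num 2 3 ⇒ (eqn 0 2 ⇔
    (letterIn 0 [.sep] ⋏ letterIn 2 [.sep]) ⋎ ex 4 (ex 5 (succ 0 4 ⋏ succ 2 5 ⋏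
      ((letterIn 0 [.zero] ⋏ letterIn 2 [.zero]) ⋎ (letterIn 0 [.one] ⋏ letterIn 2 [.one])) ⋏
        eqn 4 5))),
  ex 0 ((all 1 <| neg (lt 1 0)) ⋏ start 0 0 ⋏ letterIn 0 Letter.univ),
  all 0 <| all 1 <| all 2 <| start 0 1 ⇒ start 0 2 ⇒ .eq 1 2,
  all 0 <| all 1 <| all 2 <| opp 0 1 ⇒ opp 0 2 ⇒ .eq 1 2,
  all 0 <| all 1 <| all 2 <| a1 0 1 ⇒ a1 0 2 ⇒ .eq 1 2,
  all 0 <| all 1 <| all 2 <| a2 0 1 ⇒ a2 0 2 ⇒ .eq 1 2,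
  all 0 <| all 1 <| all 2 <| succ 0 1 ⇒ start 1 2 ⇒ ex 3 (start 0 3 ⋏ letterIn 3 Letter.univ),
  all 0 <| all 1 <| start 0 1 ⇒ letterIn 1 Letter.univ ⇒
    ex 2 (ex 3 (ex 4 (ex 5 (ex 6 (ex 7 (succ 2 3 ⋏ succ 3 4 ⋏ succ 5 6 ⋏ succ 0 7 ⋏ num 1 2 ⋏
      opp 0 3 ⋏ a1 0 4 ⋏ num 4 5 ⋏ ((letterIn 3 Letter.ones ⋏ start 7 6) ⋎
        (letterIn 3 Letter.twos ⋏ a2 0 6 ⋏ ex 8 (ex 9 (succ 8 9 ⋏ num 6 8 ⋏ start 7 9)))))))))),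
  all 0 <| line 0 ⇔ ex 1 (start 0 1 ⋏ letterIn 1 Letter.univ),
  all 0 <| all 1 <| lab1 0 1 ⇔ line 0 ⋏ line 1 ⋏ ex 2 (ex 3 (a1 0 2 ⋏ start 1 3 ⋏ eqn 2 3)),
  all 0 <| all 1 <| lab2 0 1 ⇔ line 0 ⋏ line 1 ⋏ kind Letter.twos 0 ⋏
    ex 2 (ex 3 (a2 0 2 ⋏ start 1 3 ⋏ eqn 2 3)),
  all 0 <| all 1 <| same1 0 1 ⇔ line 0 ⋏ line 1 ⋏ ex 2 (ex 3 (a1 0 2 ⋏ a1 1 3 ⋏ eqn 2 3)),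
  all 0 <| all 1 <| same2 0 1 ⇔ line 0 ⋏ line 1 ⋏ kind Letter.twos 0 ⋏
    ex 2 (ex 3 (a2 0 2 ⋏ a1 1 3 ⋏ eqn 2 3))]

/-- The condition `Rel.IsWellFormed`, field by field. -/
def wellFormed : Cond := Fml.conj
  (all 0 <| all 1 <| res1 0 1 ⇔ lab1 0 1 ⋏ lt 1 0 ⋏ all 2 (lt 1 2 ⇒ lt 2 0 ⇒ neg (lab1 0 2)))
  [all 0 <| all 1 <| res2 0 1 ⇔ lab2 0 1 ⋏ lt 1 0 ⋏ all 2 (lt 1 2 ⇒ lt 2 0 ⇒ neg (lab2 0 2)),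
  all 0 <| all 1 <| opd 0 1 ⇔ (kind Letter.fsts 0 ⋏ res1 0 1) ⋎ (kind Letter.snds 0 ⋏ res2 0 1),
  all 0 <| kind Letter.fsts 0 ⇒ ex 1 (res1 0 1 ⋏ neg (kind Letter.quants 1)),
  all 0 <| kind Letter.joins 0 ⇒ ex 1 (res2 0 1 ⋏ neg (kind Letter.quants 1)),
  all 0 <| kind Letter.quants 0 ⇒ ex 1 (res2 0 1),
  all 0 <| reach 0 ⇔ (line 0 ⋏ all 1 (lt 0 1 ⇒ neg (line 1))) ⋎ ex 1 (reach 1 ⋏ opd 1 0),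
  all 0 <| slot 0 ⇔ reach 0 ⋏ kind Letter.quants 0,
  all 0 <| mat 0 ⇔ line 0 ⋏ neg (kind Letter.quants 0) ⋏ ex 1 (slot 1 ⋏ opd 1 0),
  all 0 <| yy 0 ⇔ slot 0 ⋏ kind [.all] 0,
  ex 0 (yy 0),
  all 0 <| all 1 <| yy 0 ⇒ yy 1 ⇒ neg (lt 0 1),
  all 0 <| es 0 ⇔ slot 0 ⋏ ex 1 (yy 1 ⋏ lt 1 0),
  all 0 <| ws 0 ⇔ slot 0 ⋏ ex 1 (yy 1 ⋏ lt 0 1),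
  all 0 <| all 1 <| bind 0 1 ⇔ slot 1 ⋏ same2 0 1 ⋏ all 2 (slot 2 ⇒ lt 2 1 ⇒ neg (same2 0 2)),
  all 0 <| reach 0 ⇒ kind [.atom] 0 ⇒ ex 1 (bind 0 1),
  all 0 <| bool 0 ⇒ kind [.atom] 0 ⋎ (kind [.neg, .or, .and] 0 ⋏ all 1 (opd 0 1 ⇒ bool 1)),
  all 0 <| xb 0 ⇒ bool 0 ⋎ (kind [.next] 0 ⋏ all 1 (opd 0 1 ⇒ xb 1)),
  all 0 <| fgx 0 ⇒ xb 0 ⋎ (kind [.neg, .or, .and] 0 ⋏ all 1 (opd 0 1 ⇒ fgx 1)) ⋎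
    (kind [.ev, .alw] 0 ⋏ all 1 (opd 0 1 ⇒ bool 1)),
  all 0 <| mat 0 ⇒ fgx 0]

/-- The condition `Rel.IsCertificate`, field by field. -/
def certificate : Cond := Fml.conj
  (all 0 <| all 1 <| all 2 <| all 3 <| same1 2 3 ⇒ zb 0 1 2 ⇒ zb 0 1 3)
  [all 0 <| all 1 <| kind [.atom] 1 ⇒ (tb 0 1 ⇔ ex 2 (bind 1 2 ⋏ zb 0 2 1)),
  all 0 <| all 1 <| all 2 <| kind [.neg] 1 ⇒ res1 1 2 ⇒ (tb 0 1 ⇔ neg (tb 0 2)),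
  all 0 <| all 1 <| all 2 <| all 3 <| kind [.or] 1 ⇒ res1 1 2 ⇒ res2 1 3 ⇒
    (tb 0 1 ⇔ tb 0 2 ⋎ tb 0 3),
  all 0 <| all 1 <| all 2 <| all 3 <| kind [.and] 1 ⇒ res1 1 2 ⇒ res2 1 3 ⇒
    (tb 0 1 ⇔ tb 0 2 ⋏ tb 0 3),
  all 0 <| all 1 <| kind [.next, .until, .ev, .alw] 1 ⇒ neg (tb 0 1),
  all 0 <| all 1 <| all 2 <| th 0 ⇒ line 1 ⇒ kind [.atom] 2 ⇒
    (t 0 1 2 ⇔ ex 3 (pr 0 1 3 ⋏ tb 3 2)),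
  all 0 <| all 1 <| all 2 <| all 3 <| th 0 ⇒ line 1 ⇒ kind [.neg] 2 ⇒ res1 2 3 ⇒
    (t 0 1 2 ⇔ neg (t 0 1 3)),
  all 0 <| all 1 <| all 2 <| all 3 <| all 4 <| th 0 ⇒ line 1 ⇒ kind [.or] 2 ⇒ res1 2 3 ⇒
    res2 2 4 ⇒ (t 0 1 2 ⇔ t 0 1 3 ⋎ t 0 1 4),
  all 0 <| all 1 <| all 2 <| all 3 <| all 4 <| th 0 ⇒ line 1 ⇒ kind [.and] 2 ⇒ res1 2 3 ⇒
    res2 2 4 ⇒ (t 0 1 2 ⇔ t 0 1 3 ⋏ t 0 1 4),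
  all 0 <| all 1 <| all 2 <| all 3 <| all 4 <| th 0 ⇒ line 1 ⇒ line 4 ⇒ succ 1 4 ⇒
    kind [.next] 2 ⇒ res1 2 3 ⇒ (t 0 1 2 ⇔ t 0 4 3),
  all 0 <| all 1 <| all 2 <| th 0 ⇒ line 1 ⇒ kind [.until] 2 ⇒ neg (t 0 1 2),
  all 0 <| all 1 <| all 2 <| all 3 <| th 0 ⇒ line 1 ⇒ kind [.ev] 2 ⇒ res1 2 3 ⇒
    (t 0 1 2 ⇔ ex 4 (q 0 4 ⋏ tb 4 3)),
  all 0 <| all 1 <| all 2 <| all 3 <| th 0 ⇒ line 1 ⇒ kind [.alw] 2 ⇒ res1 2 3 ⇒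
    (t 0 1 2 ⇔ all 4 (q 0 4 ⇒ tb 4 3)),
  all 0 <| all 1 <| all 2 <| th 0 ⇒ mat 1 ⇒ all 3 (neg (lt 3 2)) ⇒ t 0 2 1,
  ex 0 (th 0),
  all 0 <| all 1 <| th 0 ⇒ line 1 ⇒ ex 2 (pr 0 1 2),
  all 0 <| all 1 <| all 2 <| all 3 <| th 0 ⇒ line 1 ⇒ pr 0 1 2 ⇒ pr 0 1 3 ⇒ neg (lt 2 3),
  all 0 <| all 1 <| all 2 <| th 0 ⇒ line 1 ⇒ pr 0 1 2 ⇒ q 0 2,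
  all 0 <| all 1 <| all 2 <| sync 0 1 2 ⇔
    all 3 (all 4 (yy 3 ⇒ kind [.atom] 4 ⇒ (zb 1 0 4 ⇔ zb 2 3 4))),
  all 0 <| all 1 <| same 0 1 ⇔ all 2 (all 3 (es 2 ⇒ kind [.atom] 3 ⇒ (zb 0 2 3 ⇔ zb 1 2 3))),
  all 0 <| all 1 <| all 2 <| all 3 <| all 4 <| th 0 ⇒ th 1 ⇒ line 2 ⇒ pr 0 2 3 ⇒ pr 1 2 4 ⇒
    same 3 4,
  all 0 <| all 1 <| th 0 ⇒ ws 1 ⇒ ex 2 (th 2 ⋏ child 0 1 2),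
  all 0 <| all 1 <| all 2 <| all 3 <| all 4 <| all 5 <| th 0 ⇒ ws 1 ⇒ th 2 ⇒ child 0 1 2 ⇒
    line 3 ⇒ pr 0 3 4 ⇒ pr 2 3 5 ⇒ sync 1 4 5,
  all 0 <| all 1 <| all 2 <| th 0 ⇒ th 1 ⇒ q 0 2 ⇒ ex 3 (q 1 3 ⋏ same 2 3),
  all 0 <| all 1 <| all 2 <| all 3 <| th 0 ⇒ ws 1 ⇒ th 2 ⇒ child 0 1 2 ⇒ q 0 3 ⇒
    ex 4 (q 2 4 ⋏ same 3 4 ⋏ sync 1 3 4),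
  all 0 <| all 1 <| all 2 <| all 3 <| th 0 ⇒ ws 1 ⇒ th 2 ⇒ child 0 1 2 ⇒ q 2 3 ⇒
    ex 4 (q 0 4 ⋏ same 4 3 ⋏ sync 1 4 3),
  all 0 <| es 0 ⇒ ex 1 (th 1 ⋏ root 0 1),
  all 0 <| all 1 <| all 2 <| es 0 ⇒ th 1 ⇒ root 0 1 ⇒ q 1 2 ⇒ sync 0 2 2]

variable {N : ℕ} {w : List Letter} {G : Fin 34 → ℕ → ℕ → ℕ → Prop} {v : Fin 11 → ℕ}

theorem sat_kind {S : List Letter} {x : Fin 11} (hx : x ≠ 10) :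
    (kind S x).Sat N w G v ↔ (Rel.ofFun G).KindIn N w S (v x) := by
  simp only [kind, line, opp, Fml.sat_and, Fml.sat_letterIn, Fml.Sat,
    Function.update_self, Function.update_of_ne hx]
  rfl

theorem sat_parse : parse.Sat N w G v ↔ (Rel.ofFun G).IsParse N w := by
  simp only [parse, Fml.conj, Fml.sat_and, Fml.sat_or, Fml.sat_imp, Fml.sat_iff, Fml.sat_all, Fml.sat_eq, Fml.sat_letterIn, ne_eq,
    Fin.reduceEq, not_false_eq_true, sat_kind, num, eqn, start, opp, a1, a2, line, lab1, lab2,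
    same1, same2, Fml.Sat, Function.update_self, Function.update_of_ne]
  exact ⟨fun ⟨h1, h2, h3, h4, h5, h6, h7, h8, h9, h10, h11, h12, h13, h14⟩ =>
    ⟨h1, h2, h3, h4, h5, h6, h7, h8, h9, h10, h11, h12, h13, h14⟩,
    fun ⟨h1, h2, h3, h4, h5, h6, h7, h8, h9, h10, h11, h12, h13, h14⟩ =>
      ⟨h1, h2, h3, h4, h5, h6, h7, h8, h9, h10, h11, h12, h13, h14⟩⟩

theorem sat_wellFormed : wellFormed.Sat N w G v ↔
    (Rel.ofFun G).IsWellFormed N ((Rel.ofFun G).KindIn N w) := by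
  simp only [wellFormed, Fml.conj, Fml.sat_and, Fml.sat_or, Fml.sat_imp, Fml.sat_iff, Fml.sat_all, ne_eq, Fin.reduceEq, not_false_eq_true, sat_kind, line,
    lab1, lab2, same2, res1, res2, opd, reach, slot, mat, yy, es, ws, bind, bool, xb, fgx,
    Fml.Sat, Function.update_self, Function.update_of_ne]
  exact ⟨fun ⟨h1, h2, h3, h4, h5, h6, h7, h8, h9, h10, h11, h12, h13, h14, h15, h16, h17, h18, h19,
    h20⟩ => ⟨h1, h2, h3, h4, h5, h6, h7, h8, h9, h10, h11, h12, h13, h14, h15, h16, h17, h18, h19,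
    h20⟩, fun ⟨h1, h2, h3, h4, h5, h6, h7, h8, h9, h10, h11, h12, h13, h14, h15, h16, h17, h18, h19,
    h20⟩ => ⟨h1, h2, h3, h4, h5, h6, h7, h8, h9, h10, h11, h12, h13, h14, h15, h16, h17, h18, h19,
    h20⟩⟩

theorem sat_certificate : certificate.Sat N w G v ↔
    (Rel.ofFun G).IsCertificate N ((Rel.ofFun G).KindIn N w) := by
  simp only [certificate, Fml.conj, Fml.sat_and, Fml.sat_or, Fml.sat_imp, Fml.sat_iff, Fml.sat_all, ne_eq, Fin.reduceEq, not_false_eq_true,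
    sat_kind, line, same1, res1, res2, mat, yy, es, ws, bind, zb, tb, th, q, pr, child, root, t,
    sync, same, Fml.Sat, Function.update_self, Function.update_of_ne]
  exact ⟨fun ⟨h1, h2, h3, h4, h5, h6, h7, h8, h9, h10, h11, h12, h13, h14, h15, h16, h17, h18, h19,
    h20, h21, h22, h23, h24, h25, h26, h27, h28, h29⟩ => ⟨h1, h2, h3, h4, h5, h6, h7, h8, h9, h10,
    h11, h12, h13, h14, h15, h16, h17, h18, h19, h20, h21, h22, h23, h24, h25, h26, h27, h28, h29⟩,
    fun ⟨h1, h2, h3, h4, h5, h6, h7, h8, h9, h10, h11, h12, h13, h14, h15, h16, h17, h18, h19,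
    h20, h21, h22, h23, h24, h25, h26, h27, h28, h29⟩ => ⟨h1, h2, h3, h4, h5, h6, h7, h8, h9, h10,
    h11, h12, h13, h14, h15, h16, h17, h18, h19, h20, h21, h22, h23, h24, h25, h26, h27, h28, h29⟩⟩

/-- The conditions on relations that together express membership in `satEAE`. -/
def total : Cond := parse ⋏ wellFormed ⋏ certificate

theorem ok_total : total.ok [] = true := by decide +kernel

end Cond

/-- Membership in the decision problem is expressed by a fixed formula over a structure of doubly
exponential size with arbitrary relations. -/
theorem mem_satEAE_iff (w : List Letter) : w ∈ satEAE ↔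
    ∃ G, Cond.total.Sat (2 ^ 2 ^ (w.length + 2) ^ 2) w G fun _ => 0 := by
  set N := 2 ^ 2 ^ (w.length + 2) ^ 2 with hN
  have hpos : 0 < N := by positivity
  have hlt : w.length < N := by
    have h1 : w.length < 2 ^ w.length := Nat.lt_two_pow_self
    have h2 : w.length ≤ (w.length + 2) ^ 2 := by nlinarith
    have h3 : (w.length + 2) ^ 2 < 2 ^ (w.length + 2) ^ 2 := Nat.lt_two_pow_self
    exact h1.trans_le (Nat.pow_le_pow_right (by norm_num) (by omega))
  constructor
  · rintro ⟨φ, ⟨C, rfl, hC⟩, h⟩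
    have hne : C ≠ [] := by rintro rfl; cases hC
    have hle := length_le_length_encLines (C := C)
    obtain ⟨r, h1, h2, h3⟩ := exists_rel_of_satisfiable (by omega) (card_bound hle)
      (table_bound hle) (parseRel_fits hlt) hC h
    obtain ⟨G, rfl⟩ := r.exists_ofFun_eq
    refine ⟨G, Cond.sat_parse.2 ?_, Cond.sat_wellFormed.2 ?_, Cond.sat_certificate.2 ?_⟩
    · rw [h1]; exact isParse_parseRel hne hlt
    · rw [h1]; exact h2
    · rw [h1]; exact h3
  · rintro ⟨G, h⟩
    -- `Fits` speaks about all numbers, so the relations are cut down to the numbers below `N`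
    rw [Fml.sat_congr (G' := fun r x y z => x < N ∧ y < N ∧ z < N ∧ G r x y z)
      (fun r i hi j hj k hk => by simp [hi, hj, hk]) _ fun _ => hpos] at h
    obtain ⟨h1, h2, h3⟩ := h
    rw [Cond.sat_parse] at h1
    rw [Cond.sat_wellFormed] at h2
    rw [Cond.sat_certificate] at h3
    obtain ⟨C, hne, hle, hw, hf⟩ := h1.exists_fits (Rel.belowN_ofFun N G) hlt
    obtain ⟨φ, hφ, h4⟩ := satisfiable_of_rel hne (by omega) hf h2 h3
    exact ⟨φ, ⟨C, hw, hφ⟩, h4⟩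

end HyperLTL

theorem theorem6 : HyperLTL.satEAE ∈ Complexity.N2ExpTime HyperLTL.Letter :=
  TapeProgram.mem_N2ExpTime HyperLTL.Cond.total HyperLTL.Cond.ok_total HyperLTL.mem_satEAE_iff
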